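/- Let $X\subset\mathbb P^N$ be a smooth complex projective variety of pure dimension $n\ge 1$ with Hilbert polynomial $\chi$, and let $G=SL(N+1,\mathbb C)$. Let $\omega=\omega_{FS}|_X$, where $\omega_{FS}=\frac{\sqrt{-1}}{2\pi}\partial\bar\partial\log|z|^2$ is the Fubini–Study form, and for $\sigma\in G$ put $\varphi_\sigma(z)=\log\frac{|\sigma z|^2}{|z|^2}$. Let $c_{2,k}$ ($n-1\le k\le n+1$) be the rational numbers for which the coefficient of $m^{-2}$ in the expansion of $\frac{a_{n+1}m^{n+1}+a_nm^n+\cdots}{m\chi(m)}$ in powers of $1/m$ is $\sum_k c_{2,k}a_k$. Put $P_{k,r}(m)=\sum_{j=0}^{k}(-1)^j\binom kj(m+j)^r$, let $(q_{n+1}(m),q_n(m),q_{n-1}(m))$ be the solution of $\sum_{j=0}^{2}P_{n+1-j,k}(m)\,q_{n+1-j}(m)=c_{2,k}$ ($n-1\le k\le n+1$), and let $$\mathcal E_2(m)=\sum_{j=0}^{2}\ \sum_{i=0}^{n+1-j}q_{n+1-j}(m)(-1)^i\binom{n+1-j}{i}\,\mathcal O_X(1)^{\otimes(m+i)}.$$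 For a function $\varphi$ on $X$ with $\omega+\frac{\sqrt{-1}}{2\pi}\partial\bar\partial\varphi>0$ let $$F_{2,\omega}(\varphi)=\Big(\tfrac{\sqrt{-1}}{2\pi}\Big)^{n}\int_X\int_0^1\frac{\partial}{\partial b}\Big(\mathrm{Td}\big(R_{g_t}+b\,\dot g_tg_t^{-1}\big)\,\mathrm{Ch}\big(F^{\mathcal E_2(m)}_{H_t}+b\,\dot H_tH_t^{-1}\big)\Big)\Big|_{b=0}\,dt,$$ where $\varphi_t$ ($0\le t\le1$) is any smooth path of such functions from $0$ to $\varphi$, $g_t=\omega+\frac{\sqrt{-1}}{2\pi}\partial\bar\partial\varphi_t$, $R_g=\bar\partial(\partial g\,g^{-1})$, $H_t=e^{-\varphi_t}h$ with $h$ the Fubini–Study metric on $\mathcal O_X(1)$ (inducing metrics on all its powers), $F_{H_t}=\bar\partial\partial\log H_t$ is its curvature, and $\mathrm{Ch}$ is extended linearly to $\mathcal E_2(m)$. Let $\pi_1,\pi_2$ be the projections of $G\times X$, let $h_G$ be the Hermitian metric on $\pi_2^*T^{1,0}X$ given on $\{\sigma\}\times X$ by $\omega+\frac{\sqrt{-1}}{2\pi}\partial\bar\partial\varphi_\sigma$,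 let $c_1(h_G)$ and $\mathrm{Ch}_2(h_G)=\frac12\mathrm{Tr}\big(\frac{\sqrt{-1}}{2\pi}R_{h_G}\big)^2$ be its Chern–Weil forms, and let $\Omega$ be the pull-back of $\omega_{FS}$ under the evaluation map $G\times X\to\mathbb P^N$, $(\sigma,x)\mapsto\sigma x$. Then for every $m\in\mathbb N$ and every smooth compactly supported form $\psi$ on $G$ $$-\frac{\sqrt{-1}}{2\pi}\int_G F_{2,\omega}(\varphi_\sigma)\,\partial\bar\partial\psi=\int_{G\times X}\Big\{\frac{c_{2,n-1}}{(n-1)!}\Big(\frac18c_1(h_G)^2-\frac1{12}\mathrm{Ch}_2(h_G)\Big)\Omega^{n-1}+\frac{c_{2,n}}{n!}\cdot\frac12\,c_1(h_G)\,\Omega^{n}+\frac{c_{2,n+1}}{(n+1)!}\Omega^{n+1}\Big\}\wedge\pi_1^*\psi .$$ -/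

import Mathlib

open scoped ContDiff ComplexOrder LinearAlgebra.Projectivization

noncomputable section

namespace HigherEnergy

/-! ### Complex-valued differential forms on open subsets of a coordinate space `ι → ℂ` -/

/-- Complex-valued real-linear covectors on `ℂ^ι`. -/
abbrev Cov (ι : Type) : Type := (ι → ℂ) →ₗ[ℝ] ℂ

/-- The exterior algebra `Λ^•(T^*ℂ^ι) ⊗ ℂ`: values of differential forms of mixed degree. The
product is the wedge product. -/
abbrev Frm (ι : Type) : Type := ExteriorAlgebra ℂ (Cov ι)

/-- The centre of the exterior algebra. It contains all forms of even degree, and it is a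
commutative ring, so that characteristic forms can be computed in it. -/
abbrev CFrm (ι : Type) : Type := Subalgebra.center ℂ (Frm ι)

theorem finite_frm (ι : Type) [Fintype ι] : Module.Finite ℂ (Frm ι) := by
  have hbot : ∀ i, Module.finrank ℂ (Cov ι) < i → (⋀[ℂ]^i (Cov ι)) = ⊥ := by
    intro i hi
    have h := exteriorPower.finrank_eq ℂ (M := Cov ι) i
    rw [Nat.choose_eq_zero_of_lt hi] at h
    exact Submodule.finrank_eq_zero.mp h
  have htop : (⨆ i, (⋀[ℂ]^i (Cov ι) : Submodule ℂ (Frm ι))) = ⊤ :=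
    (DirectSum.Decomposition.isInternal
      (fun i : ℕ => (⋀[ℂ]^i (Cov ι) : Submodule ℂ (Frm ι)))).submodule_iSup_eq_top
  have hle : (⊤ : Submodule ℂ (Frm ι)) =
      ⨆ i ∈ Finset.range (Module.finrank ℂ (Cov ι) + 1),
        (⋀[ℂ]^i (Cov ι) : Submodule ℂ (Frm ι)) := by
    apply le_antisymm _ le_top
    rw [← htop]
    refine iSup_le fun i => ?_
    by_cases hi : Module.finrank ℂ (Cov ι) < i
    · rw [hbot i hi]; exact bot_le
    · exact le_biSup (fun i => (⋀[ℂ]^i (Cov ι) : Submodule ℂ (Frm ι)))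
        (Finset.mem_range.mpr (by omega))
  refine ⟨?_⟩
  rw [hle]
  exact Submodule.fg_biSup _ _ fun i _ =>
    (Module.Finite.iff_fg (N := (⋀[ℂ]^i (Cov ι) : Submodule ℂ (Frm ι)))).mp inferInstance

instance instFiniteFrm (ι : Type) [Fintype ι] : Module.Finite ℂ (Frm ι) := finite_frm ι

/-- The covector `dz_a`. -/
def dz {ι : Type} (a : ι) : Cov ι where
  toFun v := v a
  map_add' _ _ := rfl
  map_smul' _ _ := rfl

/-- The covector `d\bar z_a`. -/
def dzbar {ι : Type} (a : ι) : Cov ι where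
  toFun v := (starRingEnd ℂ) (v a)
  map_add' v w := by simp
  map_smul' c v := by simp

theorem ι_mul_ι_mem_center {ι : Type} (α β : Cov ι) :
    ExteriorAlgebra.ι ℂ α * ExteriorAlgebra.ι ℂ β ∈ Subalgebra.center ℂ (Frm ι) := by
  rw [Subalgebra.mem_center_iff]
  intro c
  have anti : ∀ x y : Cov ι, ExteriorAlgebra.ι ℂ x * ExteriorAlgebra.ι ℂ y =
      -(ExteriorAlgebra.ι ℂ y * ExteriorAlgebra.ι ℂ x) := fun x y =>
    eq_neg_of_add_eq_zero_left (ExteriorAlgebra.ι_add_mul_swap x y)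
  induction c using ExteriorAlgebra.induction with
  | algebraMap r => exact Algebra.commutes r _
  | ι x =>
    rw [← mul_assoc, anti x α, neg_mul, mul_assoc, anti x β, mul_neg, neg_neg, ← mul_assoc]
  | mul a b ha hb => rw [mul_assoc, hb, ← mul_assoc, ha, mul_assoc]
  | add a b ha hb => rw [add_mul, mul_add, ha, hb]

/-- The form `dz_a ∧ d\bar z_b`. -/
def dzdzbar {ι : Type} (a b : ι) : CFrm ι :=
  ⟨ExteriorAlgebra.ι ℂ (dz a) * ExteriorAlgebra.ι ℂ (dzbar b), ι_mul_ι_mem_center _ _⟩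

/-- The Wirtinger derivative `∂f/∂z_a`. -/
def pd {ι : Type} [Fintype ι] [DecidableEq ι] (a : ι) (f : (ι → ℂ) → ℂ) (x : ι → ℂ) : ℂ :=
  (1 / 2) * (fderiv ℝ f x (Pi.single a 1) - Complex.I * fderiv ℝ f x (Pi.single a Complex.I))

/-- The Wirtinger derivative `∂f/∂\bar z_a`. -/
def pdbar {ι : Type} [Fintype ι] [DecidableEq ι] (a : ι) (f : (ι → ℂ) → ℂ) (x : ι → ℂ) : ℂ :=
  (1 / 2) * (fderiv ℝ f x (Pi.single a 1) + Complex.I * fderiv ℝ f x (Pi.single a Complex.I))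

/-- The form `∂\bar∂ f` of a function `f`. -/
def ddbarFun {ι : Type} [Fintype ι] [DecidableEq ι] (f : (ι → ℂ) → ℝ) (x : ι → ℂ) : CFrm ι :=
  ∑ a, ∑ b, pd a (pdbar b (fun y => (f y : ℂ))) x • dzdzbar a b

/-- The form `∂\bar∂ ψ = ∑ dz_a ∧ d\bar z_b ∧ ∂_a \bar∂_b ψ` of a form `ψ` of arbitrary degree,
the derivatives being taken coefficientwise in a basis of the exterior algebra. -/
def ddbarForm {ι : Type} [Fintype ι] [DecidableEq ι] (ψ : (ι → ℂ) → Frm ι) (x : ι → ℂ) : Frm ι :=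
  ∑ a, ∑ b, (dzdzbar a b : Frm ι) *
    ∑ k, pd a (pdbar b (fun y => (Module.finBasis ℂ (Frm ι)).repr (ψ y) k)) x •
      Module.finBasis ℂ (Frm ι) k

/-- A form is smooth on a set if all its coefficients are. -/
def SmoothFormOn {ι : Type} [Fintype ι] (ψ : (ι → ℂ) → Frm ι) (U : Set (ι → ℂ)) : Prop :=
  ∀ ℓ : Frm ι →ₗ[ℂ] ℂ, ContDiffOn ℝ ∞ (fun x => ℓ (ψ x)) U

/-- Pull-back of covectors by the differential of `f` at `x`. -/
def covPullback {ι κ : Type} [Fintype ι] [Fintype κ] (f : (ι → ℂ) → (κ → ℂ)) (x : ι → ℂ) :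
    Cov κ →ₗ[ℂ] Cov ι where
  toFun α := α.comp (fderiv ℝ f x : (ι → ℂ) →ₗ[ℝ] (κ → ℂ))
  map_add' _ _ := rfl
  map_smul' _ _ := rfl

/-- The pull-back `f^* ψ` of a form. -/
def pullback {ι κ : Type} [Fintype ι] [Fintype κ] (f : (ι → ℂ) → (κ → ℂ))
    (ψ : (κ → ℂ) → Frm κ) (x : ι → ℂ) : Frm ι :=
  ExteriorAlgebra.map (covPullback f x) (ψ (f x))

/-- The real basis `e_1, i e_1, e_2, i e_2, …` of `ℂ^ι`; it is positively oriented for the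
complex orientation, whatever the enumeration of `ι`. -/
def realBasis (ι : Type) [Fintype ι] [DecidableEq ι] (k : Fin (Fintype.card ι * 2)) : ι → ℂ :=
  Pi.single ((Fintype.equivFin ι).symm k.divNat) (if k.modNat = 0 then 1 else Complex.I)

/-- Evaluation of a covector on the real basis. -/
def covCoords (ι : Type) [Fintype ι] [DecidableEq ι] :
    Cov ι →ₗ[ℂ] (Fin (Fintype.card ι * 2) → ℂ) where
  toFun α k := α (realBasis ι k)
  map_add' _ _ := rfl
  map_smul' _ _ := rfl

/-- The coefficient of a form at `dx_1 ∧ dy_1 ∧ dx_2 ∧ dy_2 ∧ ⋯` (zero on the components of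
degree below the top one). The integral of a form over a region of `ℂ^ι` is the Lebesgue integral
of this coefficient. -/
def topCoeff (ι : Type) [Fintype ι] [DecidableEq ι] : Frm ι →ₗ[ℂ] ℂ :=
  ExteriorAlgebra.liftAlternating
    (Pi.single (M := fun i => Cov ι [⋀^Fin i]→ₗ[ℂ] ℂ) (Fintype.card ι * 2)
      (Matrix.detRowAlternating.compLinearMap (covCoords ι)))

/-! ### Chern-Weil forms -/

/-- The curvature `\bar∂(∂g g⁻¹)` of the Chern connection of the Hermitian metric with matrix
`g_{ij} = ⟨e_i, e_j⟩` in a holomorphic frame. -/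
def curvature {ι : Type} [Fintype ι] [DecidableEq ι] {r : ℕ}
    (g : (ι → ℂ) → Matrix (Fin r) (Fin r) ℂ) (x : ι → ℂ) : Matrix (Fin r) (Fin r) (CFrm ι) :=
  Matrix.of fun i j => ∑ a, ∑ b,
    (-(pdbar b (fun y => ((Matrix.of fun k l => pd a (fun w => g w k l) y) * (g y)⁻¹) i j) x)) •
      dzdzbar a b

/-- `√-1 / 2π`. -/
def ci : ℂ := Complex.I / (2 * Real.pi)

/-- The first Chern form. -/
def chernOne {ι : Type} {r : ℕ} (R : Matrix (Fin r) (Fin r) (CFrm ι)) : CFrm ι :=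
  ((ci : ℂ) • R).trace

/-- The degree two component `½ Tr((√-1/2π R)²)` of the Chern character form. -/
def chTwo {ι : Type} {r : ℕ} (R : Matrix (Fin r) (Fin r) (CFrm ι)) : CFrm ι :=
  (1 / 2 : ℂ) • (((ci : ℂ) • R) ^ 2).trace

/-- The Todd form `det(A / (1 - e^{-A}))`, truncated above degree `K` in each entry. Here
`x / (1 - e^{-x}) = ∑ bernoulli' k / k! x^k`. -/
def todd {A : Type} [CommRing A] [Algebra ℂ A] {r : ℕ} (K : ℕ) (R : Matrix (Fin r) (Fin r) A) : A :=
  (∑ k ∈ Finset.range (K + 1), (((bernoulli' k : ℚ) : ℂ) / (k.factorial : ℂ)) • R ^ k).det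

/-- The Chern character form `e^x` of a line bundle, truncated above degree `K`. -/
def chLine {A : Type} [CommRing A] [Algebra ℂ A] (K : ℕ) (x : A) : A :=
  ∑ k ∈ Finset.range (K + 1), (1 / (k.factorial : ℂ)) • x ^ k

/-! ### Charts, atlases and integration -/

/-- A map from a region of `ℂ^ι` to `ℂ^κ`, used as a local parametrization. -/
structure Param (ι κ : Type) where
  /-- the region -/
  dom : Set (ι → ℂ)
  /-- the map -/
  map : (ι → ℂ) → (κ → ℂ)

/-- `p` is a holomorphic parametrization of an open subset of `S ⊆ ℂ^κ`. -/
structure IsChart {ι κ : Type} [Fintype ι] [Fintype κ] (S : Set (κ → ℂ)) (p : Param ι κ) :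
    Prop where
  isOpen_dom : IsOpen p.dom
  holomorphic : DifferentiableOn ℂ p.map p.dom
  mapsTo : Set.MapsTo p.map p.dom S
  injOn : Set.InjOn p.map p.dom
  immersion : ∀ u ∈ p.dom, Function.Injective (fderiv ℂ p.map u)
  openMap : ∀ V ⊆ p.dom, IsOpen V → ∃ O : Set (κ → ℂ), IsOpen O ∧ p.map '' V = O ∩ S

/-- A countable atlas of a complex submanifold `S` of `ℂ^κ`. -/
structure IsAtlas {ι κ : Type} [Fintype ι] [Fintype κ] (S : Set (κ → ℂ)) (B : ℕ → Param ι κ) :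
    Prop where
  chart : ∀ i, IsChart S (B i)
  cover : ∀ s ∈ S, ∃ i, s ∈ (B i).map '' (B i).dom

/-- Points of projective space. -/
abbrev PSpace (N : ℕ) : Type := ℙ ℂ (Fin (N + 1) → ℂ)

/-- `X ⊆ ℙ^N` is a closed algebraic set. -/
def IsProjAlgebraic {N : ℕ} (X : Set (PSpace N)) : Prop :=
  ∃ 𝓕 : Set (MvPolynomial (Fin (N + 1)) ℂ), (∀ f ∈ 𝓕, ∃ d, f.IsHomogeneous d) ∧
    X = {x | ∀ f ∈ 𝓕, MvPolynomial.eval x.rep f = 0}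

/-- The punctured affine cone over `X`. -/
def cone {N : ℕ} (X : Set (PSpace N)) : Set (Fin (N + 1) → ℂ) :=
  {z | ∃ h : z ≠ 0, Projectivization.mk ℂ z h ∈ X}

/-- The nonzero multiples of the elements of `T`. -/
def multiples {N : ℕ} (T : Set (Fin (N + 1) → ℂ)) : Set (Fin (N + 1) → ℂ) :=
  {z | ∃ c : ℂ, c ≠ 0 ∧ ∃ w ∈ T, z = c • w}

/-- `u ↦ [p u]` is a holomorphic parametrization of an open subset of `X ⊆ ℙ^N`. -/
structure IsProjChart {n N : ℕ} (X : Set (PSpace N)) (p : Param (Fin n) (Fin (N + 1))) :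
    Prop where
  isOpen_dom : IsOpen p.dom
  holomorphic : DifferentiableOn ℂ p.map p.dom
  mapsTo : Set.MapsTo p.map p.dom (cone X)
  inj : ∀ u ∈ p.dom, ∀ v ∈ p.dom, ∀ c : ℂ, p.map u = c • p.map v → u = v
  immersion : ∀ u ∈ p.dom, ∀ v : Fin n → ℂ, ∀ c : ℂ, fderiv ℂ p.map u v = c • p.map u → v = 0
  openMap : ∀ V ⊆ p.dom, IsOpen V →
    ∃ O : Set (Fin (N + 1) → ℂ), IsOpen O ∧ multiples (p.map '' V) = O ∩ cone X

/-- A countable atlas of an `n`-dimensional complex submanifold `X` of `ℙ^N`. -/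
structure IsProjAtlas {n N : ℕ} (X : Set (PSpace N)) (A : ℕ → Param (Fin n) (Fin (N + 1))) :
    Prop where
  chart : ∀ i, IsProjChart X (A i)
  cover : ∀ z ∈ cone X, ∃ i, z ∈ multiples ((A i).map '' (A i).dom)

/-- The part of the `i`-th chart of an atlas not covered by the previous charts. The manifold is
the disjoint union of the images of these sets, so that an integral over the manifold is the sum
of the integrals over these sets. -/
def piece {ι κ : Type} (B : ℕ → Param ι κ) (i : ℕ) : Set (ι → ℂ) :=
  {u | u ∈ (B i).dom ∧ ∀ j < i, (B i).map u ∉ (B j).map '' (B j).dom}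

/-- The same for an atlas of a submanifold of projective space. -/
def projPiece {n N : ℕ} (A : ℕ → Param (Fin n) (Fin (N + 1))) (i : ℕ) : Set (Fin n → ℂ) :=
  {u | u ∈ (A i).dom ∧ ∀ j < i, (A i).map u ∉ multiples ((A j).map '' (A j).dom)}

/-- The integral over `S` of the form that is `α i` in the `i`-th chart. -/
def integral {ι κ : Type} [Fintype ι] [DecidableEq ι] (B : ℕ → Param ι κ)
    (α : ℕ → (ι → ℂ) → Frm ι) : ℂ :=
  ∑' i, ∫ u in piece B i, topCoeff ι (α i u)

/-- The integral over `S × X` of the form that is `α i j` in the product of the `i`-th and the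
`j`-th chart. -/
def integralProd {ι κ : Type} [Fintype ι] [DecidableEq ι] {n N : ℕ} (B : ℕ → Param ι κ)
    (A : ℕ → Param (Fin n) (Fin (N + 1))) (α : ℕ → ℕ → (ι ⊕ Fin n → ℂ) → Frm (ι ⊕ Fin n)) : ℂ :=
  ∑' ij : ℕ × ℕ, ∫ z in {z : ι ⊕ Fin n → ℂ | (fun a => z (Sum.inl a)) ∈ piece B ij.1 ∧
    (fun a => z (Sum.inr a)) ∈ projPiece A ij.2}, topCoeff (ι ⊕ Fin n) (α ij.1 ij.2 z)

/-! ### Hilbert polynomial and the virtual bundle `𝓔_l(m)` -/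

/-- Restriction of polynomials to the cone over `X`. -/
def restrictToCone {N : ℕ} (X : Set (PSpace N)) :
    MvPolynomial (Fin (N + 1)) ℂ →ₗ[ℂ] (cone X → ℂ) where
  toFun f z := MvPolynomial.eval (z : Fin (N + 1) → ℂ) f
  map_add' f g := by ext z; simp
  map_smul' c f := by ext z; simp

/-- The dimension of the `m`-th graded piece of the homogeneous coordinate ring of `X`. -/
def hilbertFunction {N : ℕ} (X : Set (PSpace N)) (m : ℕ) : ℕ :=
  Module.finrank ℂ
    ((MvPolynomial.homogeneousSubmodule (Fin (N + 1)) ℂ m).map (restrictToCone X))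

/-- `χ` is the Hilbert polynomial of `X`. -/
def IsHilbertPolynomial {N : ℕ} (X : Set (PSpace N)) (χ : Polynomial ℚ) : Prop :=
  ∀ᶠ m : ℕ in Filter.atTop, χ.eval (m : ℚ) = hilbertFunction X m

/-- The numbers `c_{l,k}`: the coefficient of `m^{-l}` in the expansion in powers of `1/m` of
`(a_{n+1} m^{n+1} + a_n m^n + ⋯) / (m χ(m))` is `∑ k, c_{l,k} a_k`. With `x = 1/m` one has
`m χ(m) = m^{n+1} (b_n + b_{n-1} x + ⋯)`. -/
def hilbCoeff (χ : Polynomial ℚ) (n l k : ℕ) : ℚ :=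
  if n + 1 ≤ l + k then
    PowerSeries.coeff (l + k - (n + 1)) ((Polynomial.reflect n χ : PowerSeries ℚ)⁻¹)
  else 0

/-- `P_{k,l}(m) = ∑_{j ≤ k} (-1)^j (k choose j) (m + j)^l`, which is `(-1)^k k!` for `l = k` and
`0` for `l < k`. -/
def diffPoly (k l m : ℕ) : ℚ :=
  ∑ j ∈ Finset.range (k + 1), (-1) ^ j * (k.choose j : ℚ) * ((m : ℚ) + j) ^ l

/-- The upper triangular matrix with entries `P_{n+1-j, n+1-i}(m)`, `0 ≤ i, j ≤ l`. -/
def diffMatrix (n l m : ℕ) : Matrix (Fin (l + 1)) (Fin (l + 1)) ℚ :=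
  Matrix.of fun i j => diffPoly (n + 1 - (j : ℕ)) (n + 1 - (i : ℕ)) m

/-- The unique solution `(q_{n+1}(m), …, q_{n+1-l}(m))` of
`∑ j, P_{n+1-j, k}(m) q_{n+1-j}(m) = c_{l,k}`, `n + 1 - l ≤ k ≤ n + 1`; the value at `j` is
`q_{n+1-j}(m)`. -/
def qCoeff (χ : Polynomial ℚ) (n l m : ℕ) : Fin (l + 1) → ℚ :=
  (diffMatrix n l m)⁻¹.mulVec fun i => hilbCoeff χ n l (n + 1 - (i : ℕ))

/-- The Chern character form of the virtual bundle
`𝓔_l(m) = ∑_{j ≤ l} ∑_{i ≤ n+1-j} q_{n+1-j}(m) (-1)^i (n+1-j choose i) L^{m+i}`, where `x` is the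
curvature of `L`, so that `(m + i) x` is the curvature of `L^{m+i}`. -/
def chVirtual {A : Type} [CommRing A] [Algebra ℂ A] (χ : Polynomial ℚ) (n l m : ℕ) (x : A) : A :=
  ∑ j : Fin (l + 1), ∑ i ∈ Finset.range (n + 1 - (j : ℕ) + 1),
    (((qCoeff χ n l m j * (-1) ^ i * ((n + 1 - (j : ℕ)).choose i : ℚ) : ℚ)) : ℂ) •
      chLine (n + 1) (((m + i : ℕ) : ℂ) • x)

/-! ### The energy functionals -/

/-- `log |z|²`. -/
def logNormSq {N : ℕ} (z : Fin (N + 1) → ℂ) : ℝ := Real.log (∑ i, Complex.normSq (z i))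

/-- The matrix `∂_a \bar∂_b f`, i.e. the coefficients of `√-1/2π ∂\bar∂ f` with respect to
`√-1/2π dz_a ∧ d\bar z_b`. -/
def hessMatrix {n : ℕ} (f : (Fin n → ℂ) → ℝ) (u : Fin n → ℂ) : Matrix (Fin n) (Fin n) ℂ :=
  Matrix.of fun a b => pd a (pdbar b (fun y => (f y : ℂ))) u

/-- The local potential of `ω + √-1/2π ∂\bar∂ φ` in the chart `p`, where
`ω = √-1/2π ∂\bar∂ log |z|²` is the Fubini-Study form and `φ` is a function on `X`, written as a
function on the cone. It is also `-log` of the metric `e^{-φ} h` on `𝓞(1)`. -/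
def localPotential {n N : ℕ} (p : Param (Fin n) (Fin (N + 1))) (φ : (Fin (N + 1) → ℂ) → ℝ)
    (u : Fin n → ℂ) : ℝ :=
  logNormSq (p.map u) + φ (p.map u)

/-- The matrix of the metric `ω + √-1/2π ∂\bar∂ φ` in the chart `p`. -/
def metric {n N : ℕ} (p : Param (Fin n) (Fin (N + 1))) (φ : (Fin (N + 1) → ℂ) → ℝ)
    (u : Fin n → ℂ) : Matrix (Fin n) (Fin n) ℂ :=
  hessMatrix (localPotential p φ) u

/-- `φ_t`, `0 ≤ t ≤ 1`, is a smooth path of Kähler potentials on `X` that joins `0` to `φ'`.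
Functions on `X` are written as functions on the cone that are homogeneous of degree `0`. -/
structure IsPath {n N : ℕ} (X : Set (PSpace N)) (A : ℕ → Param (Fin n) (Fin (N + 1)))
    (φ : ℝ → (Fin (N + 1) → ℂ) → ℝ) (φ' : (Fin (N + 1) → ℂ) → ℝ) : Prop where
  homogeneous : ∀ t ∈ Set.Icc (0 : ℝ) 1, ∀ z ∈ cone X, ∀ c : ℂ, c ≠ 0 → φ t (c • z) = φ t z
  smooth : ∀ i, ContDiffOn ℝ ∞ (fun q : ℝ × (Fin n → ℂ) => φ q.1 ((A i).map q.2))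
    (Set.Icc (0 : ℝ) 1 ×ˢ (A i).dom)
  positive : ∀ t ∈ Set.Icc (0 : ℝ) 1, ∀ i, ∀ u ∈ (A i).dom, (metric (A i) (φ t) u).PosDef
  start : ∀ z ∈ cone X, φ 0 z = 0
  finish : ∀ z ∈ cone X, φ 1 z = φ' z

/-- The form `∂/∂b (Td(R_{g_t} + b ġ_t g_t⁻¹) Ch(F + b Ḣ_t H_t⁻¹))` at `b = 0` in the chart `p`, as
the coefficient of the first power of the variable `b = Polynomial.X`. Here `F = ∂\bar∂ f_t` is the
curvature of `H_t = e^{-φ_t} h` and `Ḣ_t H_t⁻¹ = -∂φ_t/∂t`. -/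
def transgression {n N : ℕ} (χ : Polynomial ℚ) (l m : ℕ) (p : Param (Fin n) (Fin (N + 1)))
    (φ : ℝ → (Fin (N + 1) → ℂ) → ℝ) (t : ℝ) (u : Fin n → ℂ) : CFrm (Fin n) :=
  let g : Matrix (Fin n) (Fin n) ℂ := metric p (φ t) u
  let g' : Matrix (Fin n) (Fin n) ℂ :=
    Matrix.of fun a b => deriv (fun s => metric p (φ s) u a b) t
  let R : Matrix (Fin n) (Fin n) (CFrm (Fin n)) := curvature (metric p (φ t)) u
  let E : Matrix (Fin n) (Fin n) (CFrm (Fin n)) :=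
    (g' * g⁻¹).map (algebraMap ℂ (CFrm (Fin n)))
  let F : CFrm (Fin n) := ddbarFun (localPotential p (φ t)) u
  let e : ℂ := -((deriv (fun s => φ s (p.map u)) t : ℝ) : ℂ)
  (todd (n + 1) (R.map Polynomial.C + (Polynomial.X : Polynomial (CFrm (Fin n))) •
      E.map Polynomial.C) *
    chVirtual χ n l m (Polynomial.C F +
      Polynomial.X * Polynomial.C (algebraMap ℂ (CFrm (Fin n)) e))).coeff 1

/-- The integral `(√-1/2π)^n ∫_X ∫_0^1 ∂/∂b (Td Ch)|_{b = 0} dt` along the path `φ_t`. -/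
def energyAlong {n N : ℕ} (A : ℕ → Param (Fin n) (Fin (N + 1))) (χ : Polynomial ℚ) (l m : ℕ)
    (φ : ℝ → (Fin (N + 1) → ℂ) → ℝ) : ℂ :=
  ci ^ n * ∑' i, ∫ u in projPiece A i, ∫ t in (0 : ℝ)..1,
    topCoeff (Fin n) (transgression χ l m (A i) φ t u)

/-- `v` is the value at `φ'` of the higher energy `F_{l,ω}`: the integral of the transgression form
of `𝓔_l(m)` along a smooth path of Kähler potentials from `0` to `φ'`. -/
def IsHigherEnergy {n N : ℕ} (X : Set (PSpace N)) (A : ℕ → Param (Fin n) (Fin (N + 1)))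
    (χ : Polynomial ℚ) (l m : ℕ) (φ' : (Fin (N + 1) → ℂ) → ℝ) (v : ℂ) : Prop :=
  ∃ φ : ℝ → (Fin (N + 1) → ℂ) → ℝ, IsPath X A φ φ' ∧ v = energyAlong A χ l m φ

/-! ### The group `SL(N+1, ℂ)` -/

/-- Index set of the entries of a square matrix. -/
abbrev MatIdx (N : ℕ) : Type := Fin (N + 1) × Fin (N + 1)

/-- The action of a matrix on `ℂ^{N+1}`. -/
def act {N : ℕ} (σ : MatIdx N → ℂ) (z : Fin (N + 1) → ℂ) : Fin (N + 1) → ℂ :=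
  (Matrix.of fun i j => σ (i, j)).mulVec z

/-- `SL(N+1, ℂ)` as a subset of the space of matrices. -/
def SL (N : ℕ) : Set (MatIdx N → ℂ) :=
  {σ | (Matrix.of fun i j => σ (i, j)).det = 1}

/-- The potential `φ_σ(z) = log (|σ z|² / |z|²)`. -/
def bergman {N : ℕ} (σ : MatIdx N → ℂ) (z : Fin (N + 1) → ℂ) : ℝ :=
  logNormSq (act σ z) - logNormSq z

/-- A smooth compactly supported form on `SL(N+1, ℂ)`. A (not necessarily continuous) form on a
submanifold is given by an element of the exterior algebra of the ambient space at every point,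
only its restriction to the tangent space of the submanifold being relevant. -/
structure IsTestForm {N M : ℕ} (B : ℕ → Param (Fin M) (MatIdx N))
    (ψ : (MatIdx N → ℂ) → Frm (MatIdx N)) : Prop where
  smooth : ∀ i, SmoothFormOn (pullback (B i).map ψ) (B i).dom
  compactSupport : ∃ K : Set (MatIdx N → ℂ), IsCompact K ∧ K ⊆ SL N ∧
    ∀ i, ∀ v ∈ (B i).dom, (B i).map v ∉ K → pullback (B i).map ψ v = 0

/-- The curvature form, in the product of the chart `s` of `SL(N+1, ℂ)` and the chart `p` of `X`,
of the bundle `π_2^* T^{1,0} X` over `SL(N+1, ℂ) × X` with the metric `h_G` that is given by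
`ω + √-1/2π ∂\bar∂ φ_σ` on `{σ} × X`. -/
def curvatureG {M n N : ℕ} (s : Param (Fin M) (MatIdx N)) (p : Param (Fin n) (Fin (N + 1))) :
    (Fin M ⊕ Fin n → ℂ) → Matrix (Fin n) (Fin n) (CFrm (Fin M ⊕ Fin n)) :=
  curvature fun z =>
    metric p (bergman (s.map fun a => z (Sum.inl a))) (fun a => z (Sum.inr a))

/-- The pull-back of the Fubini-Study form `√-1/2π ∂\bar∂ log |·|²` by the evaluation map
`(σ, x) ↦ σ x` from `SL(N+1, ℂ) × X` to `ℙ^N`. -/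
def omegaG {M n N : ℕ} (s : Param (Fin M) (MatIdx N)) (p : Param (Fin n) (Fin (N + 1)))
    (z : Fin M ⊕ Fin n → ℂ) : CFrm (Fin M ⊕ Fin n) :=
  ci • ddbarFun (fun y => logNormSq
    (act (s.map fun a => y (Sum.inl a)) (p.map fun a => y (Sum.inr a)))) z

/-- The Chern-Weil form of degree `2n + 2` on `SL(N+1, ℂ) × X`. -/
def chernWeil {M n N : ℕ} (χ : Polynomial ℚ) (s : Param (Fin M) (MatIdx N))
    (p : Param (Fin n) (Fin (N + 1))) (z : Fin M ⊕ Fin n → ℂ) : CFrm (Fin M ⊕ Fin n) :=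
  let c : ℕ → ℂ := fun k => ((hilbCoeff χ n 2 k : ℚ) : ℂ) / (k.factorial : ℂ)
  let c₁ := chernOne (curvatureG s p z)
  let ch₂ := chTwo (curvatureG s p z)
  let η := omegaG s p z
  c (n - 1) • (((1 / 8 : ℂ) • c₁ ^ 2 - (1 / 12 : ℂ) • ch₂) * η ^ (n - 1)) +
    c n • ((1 / 2 : ℂ) • c₁ * η ^ n) + c (n + 1) • η ^ (n + 1)

end HigherEnergy

end

open scoped ContDiff ComplexOrder LinearAlgebra.Projectivization

noncomputable section

set_option linter.unusedSectionVars false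

namespace HigherEnergy

open MeasureTheory ComplexConjugate
open Finset (sum_congr mul_sum sum_mul sum_comm sum_eq_zero smul_sum sum_neg_distrib univ
  sum_add_distrib sum_smul prod_const_one)
open ExteriorAlgebra hiding ι
open ExteriorAlgebra renaming ι → ιF

/-- Complex coordinate spaces. -/
local notation:max "ℂ^" ι:max => ι → ℂ

/-- Smoothness on a set. -/
local notation "SmoothOn" => ContDiffOn ℝ ∞

/-! ### Linear algebra of covectors -/

section Covectors

variable {ι : Type} [Fintype ι] [DecidableEq ι]

/-- The `dz_a`-component of a covector. -/
def czCoord (a : ι) : Cov ι →ₗ[ℂ] ℂ where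
  toFun α := (α (Pi.single a 1) - Complex.I * α (Pi.single a Complex.I)) / 2
  map_add' α β := by simp; ring
  map_smul' c α := by simp; ring

/-- The `d\bar z_a`-component of a covector. -/
def czbarCoord (a : ι) : Cov ι →ₗ[ℂ] ℂ where
  toFun α := (α (Pi.single a 1) + Complex.I * α (Pi.single a Complex.I)) / 2
  map_add' α β := by simp; ring
  map_smul' c α := by simp; ring

theorem single_eq_re_im (a : ι) (c : ℂ) :
    (Pi.single a c : ℂ^ι) = c.re • (Pi.single a (1 : ℂ) : ℂ^ι) + c.im • (Pi.single a Complex.I : ℂ^ι) := by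
  rw [← Pi.single_smul, ← Pi.single_smul, ← Pi.single_add]
  congr 1
  apply Complex.ext <;> simp

theorem cov_eq_sum (α : Cov ι) :
    α = ∑ a, (czCoord a α • dz a + czbarCoord a α • dzbar a) := by
  refine LinearMap.ext fun v => ?_
  have hv : v = ∑ a, Pi.single a (v a) := by
    ext b; simp [Finset.sum_apply, Pi.single_apply]
  conv_lhs => rw [hv, map_sum]
  rw [LinearMap.sum_apply]
  refine sum_congr rfl fun a _ => ?_
  rw [single_eq_re_im, map_add, map_smul, map_smul]
  simp only [czCoord, czbarCoord, dz, dzbar, LinearMap.add_apply, LinearMap.smul_apply,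
    LinearMap.coe_mk, AddHom.coe_mk, smul_eq_mul, Complex.real_smul]
  have h1 : v a = (v a).re + (v a).im * Complex.I := (Complex.re_add_im _).symm
  have h2 : conj (v a) = (v a).re - (v a).im * Complex.I := by
    apply Complex.ext <;> simp
  rw [h2]
  conv_rhs => rw [h1]
  simp only [Complex.add_re, Complex.add_im, Complex.ofReal_re, Complex.ofReal_im, Complex.mul_re,
    Complex.mul_im, Complex.I_re, Complex.I_im]
  push_cast
  ring_nf
  simp only [Complex.I_sq]
  ring

theorem czCoord_dz (a b : ι) : czCoord a (dz b : Cov ι) = if a = b then 1 else 0 := by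
  by_cases h : a = b
  · subst h; simp [czCoord, dz]
  · simp [czCoord, dz, h]

theorem czCoord_dzbar (a b : ι) : czCoord a (dzbar b : Cov ι) = 0 := by
  by_cases h : a = b
  · subst h; simp [czCoord, dzbar]
  · simp [czCoord, dzbar, h]

theorem czbarCoord_dz (a b : ι) : czbarCoord a (dz b : Cov ι) = 0 := by
  by_cases h : a = b
  · subst h; simp [czbarCoord, dz]
  · simp [czbarCoord, dz, h]

theorem czbarCoord_dzbar (a b : ι) :
    czbarCoord a (dzbar b : Cov ι) = if a = b then 1 else 0 := by
  by_cases h : a = b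
  · subst h; simp [czbarCoord, dzbar]
  · simp [czbarCoord, dzbar, h]

/-- Coordinates of covectors with respect to the `dz_a` and the `d\bar z_a`. -/
def covEquiv (ι : Type) [Fintype ι] [DecidableEq ι] : Cov ι ≃ₗ[ℂ] (ι ⊕ ι → ℂ) where
  toFun α := Sum.elim (fun a => czCoord a α) (fun a => czbarCoord a α)
  map_add' α β := by ext (a | a) <;> simp
  map_smul' c α := by ext (a | a) <;> simp
  invFun c := ∑ a, (c (Sum.inl a) • dz a + c (Sum.inr a) • dzbar a)
  left_inv α := (cov_eq_sum α).symm
  right_inv c := by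
    ext (a | a)
    · simp [czCoord_dz, czCoord_dzbar]
    · simp [czbarCoord_dz, czbarCoord_dzbar]

/-- The basis of the `dz_a` and the `d\bar z_a`. -/
def covBasis (ι : Type) [Fintype ι] [DecidableEq ι] : Module.Basis (ι ⊕ ι) ℂ (Cov ι) :=
  Module.Basis.ofEquivFun (covEquiv ι)

theorem covBasis_inl (a : ι) : covBasis ι (Sum.inl a) = dz a := by
  rw [covBasis, Module.Basis.coe_ofEquivFun]
  change ∑ b, _ = _
  simp [Pi.single_apply]

theorem covBasis_inr (a : ι) : covBasis ι (Sum.inr a) = dzbar a := by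
  rw [covBasis, Module.Basis.coe_ofEquivFun]
  change ∑ b, _ = _
  simp [Pi.single_apply]

theorem cov_hom_ext {V : Type*} [AddCommGroup V] [Module ℂ V] {f g : Cov ι →ₗ[ℂ] V}
    (h : ∀ a, f (dz a) = g (dz a)) (h' : ∀ a, f (dzbar a) = g (dzbar a)) : f = g := by
  refine (covBasis ι).ext ?_
  rintro (a | a)
  · rw [covBasis_inl, h]
  · rw [covBasis_inr, h']

theorem finrank_cov : Module.finrank ℂ (Cov ι) = Fintype.card ι * 2 := by
  rw [Module.finrank_eq_card_basis (covBasis ι), Fintype.card_sum, mul_two]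

/-- The linear map that multiplies `dz_a` by `s a` and `d\bar z_a` by `t a`. -/
def covScale (s t : ℂ^ι) : Cov ι →ₗ[ℂ] Cov ι :=
  (covBasis ι).constr ℂ (Sum.elim (fun a => s a • dz a) (fun a => t a • dzbar a))

theorem covScale_dz (s t : ℂ^ι) (a : ι) : covScale s t (dz a) = s a • dz a := by
  have := (covBasis ι).constr_basis ℂ
    (Sum.elim (fun a => s a • dz a) (fun a => t a • dzbar a)) (Sum.inl a)
  rwa [covBasis_inl] at this

theorem covScale_dzbar (s t : ℂ^ι) (a : ι) : covScale s t (dzbar a) = t a • dzbar a := by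
  have := (covBasis ι).constr_basis ℂ
    (Sum.elim (fun a => s a • dz a) (fun a => t a • dzbar a)) (Sum.inr a)
  rwa [covBasis_inr] at this

theorem det_covScale (s t : ℂ^ι) :
    LinearMap.det (covScale s t) = (∏ a, s a) * ∏ a, t a := by
  rw [← LinearMap.det_toMatrix (covBasis ι)]
  have : LinearMap.toMatrix (covBasis ι) (covBasis ι) (covScale s t) =
      Matrix.diagonal (Sum.elim s t) := by
    ext i j
    rw [LinearMap.toMatrix_apply]
    rcases j with j | j
    · rw [covBasis_inl, covScale_dz, ← covBasis_inl, map_smul, Module.Basis.repr_self]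
      by_cases h : i = Sum.inl j
      · subst h; simp
      · simp [h]
    · rw [covBasis_inr, covScale_dzbar, ← covBasis_inr, map_smul, Module.Basis.repr_self]
      by_cases h : i = Sum.inr j
      · subst h; simp
      · simp [h]
  rw [this, Matrix.det_diagonal, Fintype.prod_sum_type]
  simp

theorem covScale_surjective {s t : ℂ^ι} (hs : ∀ a, s a ≠ 0) (ht : ∀ a, t a ≠ 0) :
    Function.Surjective (covScale s t) := by
  have h : LinearMap.det (covScale s t) ≠ 0 := by
    rw [det_covScale]
    exact mul_ne_zero (Finset.prod_ne_zero_iff.mpr fun a _ => hs a)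
      (Finset.prod_ne_zero_iff.mpr fun a _ => ht a)
  exact ((LinearMap.equivOfDetNeZero _ h).surjective)

end Covectors

/-! ### The top coefficient -/

section TopCoeff

variable {ι : Type} [Fintype ι] [DecidableEq ι]

theorem topCoeff_ιMulti (v : Fin (Fintype.card ι * 2) → Cov ι) :
    topCoeff ι (ιMulti ℂ _ v) =
      (Matrix.of fun i j => v i (realBasis ι j)).det := by
  rw [topCoeff, liftAlternating_apply_ιMulti, Pi.single_eq_same]
  rfl

theorem topCoeff_ιMulti_of_ne {p : ℕ} (hp : p ≠ Fintype.card ι * 2) (v : Fin p → Cov ι) :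
    topCoeff ι (ιMulti ℂ _ v) = 0 := by
  rw [topCoeff, liftAlternating_apply_ιMulti, Pi.single_eq_of_ne hp]
  rfl

theorem frm_hom_ext {V : Type*} [AddCommGroup V] [Module ℂ V] {f g : Frm ι →ₗ[ℂ] V}
    (h : ∀ p (v : Fin p → Cov ι), f (ιMulti ℂ p v) =
      g (ιMulti ℂ p v)) : f = g := by
  apply lhom_ext
  intro p
  ext v
  exact h p v

theorem topCoeff_map (L : Cov ι →ₗ[ℂ] Cov ι) (θ : Frm ι) :
    topCoeff ι (map L θ) = LinearMap.det L * topCoeff ι θ := by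
  suffices h : (topCoeff ι).comp (map L).toLinearMap =
      (LinearMap.det L) • topCoeff ι from LinearMap.congr_fun h θ
  apply frm_hom_ext
  intro p v
  simp only [LinearMap.comp_apply, AlgHom.toLinearMap_apply, LinearMap.smul_apply,
    map_apply_ιMulti, smul_eq_mul]
  by_cases hp : p = Fintype.card ι * 2
  · subst hp
    let e : Module.Basis (Fin (Fintype.card ι * 2)) ℂ (Cov ι) :=
      Module.finBasisOfFinrankEq ℂ (Cov ι) finrank_cov
    let A : (Cov ι) [⋀^Fin (Fintype.card ι * 2)]→ₗ[ℂ] ℂ :=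
      (topCoeff ι).compAlternatingMap (ιMulti ℂ _)
    have hA : A = A e • e.det := AlternatingMap.eq_smul_basis_det e A
    change A (L ∘ v) = LinearMap.det L * A v
    rw [hA]
    simp only [AlternatingMap.smul_apply, smul_eq_mul, Module.Basis.det_comp]
    ring
  · rw [topCoeff_ιMulti_of_ne hp, topCoeff_ιMulti_of_ne hp, mul_zero]

/-- The form `∏_a dz_a ∧ d\bar z_a`. -/
def volForm (ι : Type) [Fintype ι] : CFrm ι := ∏ a, dzdzbar a a

/-- The factors of `volForm`. -/
def volCov (ι : Type) [Fintype ι] (k : Fin (Fintype.card ι * 2)) : Cov ι :=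
  if k.modNat = 0 then dz ((Fintype.equivFin ι).symm k.divNat)
    else dzbar ((Fintype.equivFin ι).symm k.divNat)

theorem volForm_eq : (volForm ι : Frm ι) = ιMulti ℂ _ (volCov ι) := by
  rw [ιMulti_apply, List.ofFn_mul, List.prod_flatten, volForm,
    ← (Fintype.equivFin ι).symm.prod_comp, ← List.prod_ofFn]
  change (Subalgebra.center ℂ (Frm ι)).val _ = _
  rw [map_list_prod, List.map_ofFn, List.map_ofFn]
  congr 2
  ext i
  simp only [Function.comp_apply, Subalgebra.coe_val, dzdzbar, List.ofFn_succ, List.ofFn_zero]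
  have h0 : ∀ h, (⟨(i : ℕ) * 2 + ((0 : Fin 2) : ℕ), h⟩ : Fin (Fintype.card ι * 2)).divNat = i := by
    intro h; ext; simp [Fin.divNat]
  have h1 : ∀ h, (⟨(i : ℕ) * 2 + ((Fin.succ 0 : Fin 2) : ℕ), h⟩ :
      Fin (Fintype.card ι * 2)).divNat = i := by
    intro h; ext; simp [Fin.divNat]; omega
  have h2 : ∀ h, (⟨(i : ℕ) * 2 + ((0 : Fin 2) : ℕ), h⟩ : Fin (Fintype.card ι * 2)).modNat = 0 := by
    intro h; ext; simp [Fin.modNat]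
  have h3 : ∀ h, (⟨(i : ℕ) * 2 + ((Fin.succ 0 : Fin 2) : ℕ), h⟩ :
      Fin (Fintype.card ι * 2)).modNat = 1 := by
    intro h; ext; simp [Fin.modNat]
  simp only [volCov, h0, h1, h2, h3]
  simp

theorem topCoeff_volForm : topCoeff ι (volForm ι) = (-2 * Complex.I) ^ Fintype.card ι := by
  rw [volForm_eq, topCoeff_ιMulti]
  have : (Matrix.of fun i j => volCov ι i (realBasis ι j)) =
      (Matrix.kronecker (1 : Matrix (Fin (Fintype.card ι)) (Fin (Fintype.card ι)) ℂ)
        !![1, Complex.I; 1, -Complex.I]).submatrix finProdFinEquiv.symm finProdFinEquiv.symm := by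
    ext i j
    obtain ⟨⟨a, m⟩, rfl⟩ := finProdFinEquiv.surjective i
    obtain ⟨⟨b, l⟩, rfl⟩ := finProdFinEquiv.surjective j
    have e1 : (finProdFinEquiv (a, m)).divNat = a :=
      congrArg Prod.fst (finProdFinEquiv.symm_apply_apply (a, m))
    have e2 : (finProdFinEquiv (a, m)).modNat = m :=
      congrArg Prod.snd (finProdFinEquiv.symm_apply_apply (a, m))
    have e3 : (finProdFinEquiv (b, l)).divNat = b :=
      congrArg Prod.fst (finProdFinEquiv.symm_apply_apply (b, l))
    have e4 : (finProdFinEquiv (b, l)).modNat = l :=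
      congrArg Prod.snd (finProdFinEquiv.symm_apply_apply (b, l))
    simp only [Matrix.of_apply, volCov, realBasis, e1, e2, e3, e4, Matrix.submatrix_apply,
      Equiv.symm_apply_apply, Matrix.kronecker, Matrix.kroneckerMap_apply, Matrix.one_apply]
    by_cases hab : a = b
    · subst hab
      fin_cases m <;> fin_cases l <;> simp [dz, dzbar]
    · have : (Fintype.equivFin ι).symm a ≠ (Fintype.equivFin ι).symm b := by simpa using hab
      fin_cases m <;> simp [dz, dzbar, hab, this]
  rw [this, Matrix.det_submatrix_equiv_self, Matrix.kronecker, Matrix.det_kronecker]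
  simp [Matrix.det_fin_two]
  ring

theorem ne_zero_aux (M : ℕ) : (-2 * Complex.I) ^ M ≠ 0 :=
  pow_ne_zero _ (by simp)

/-- A functional on forms that only sees the top degree is a multiple of the top coefficient. -/
theorem eq_topCoeff (G : Frm ι →ₗ[ℂ] ℂ)
    (hG : ∀ p (v : Fin p → Cov ι), p ≠ Fintype.card ι * 2 → G (ιMulti ℂ p v) = 0)
    (θ : Frm ι) :
    (-2 * Complex.I) ^ Fintype.card ι * G θ = G (volForm ι) * topCoeff ι θ := by
  suffices h : ((-2 * Complex.I) ^ Fintype.card ι) • G = (G (volForm ι)) • topCoeff ι from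
    LinearMap.congr_fun h θ
  apply frm_hom_ext
  intro p v
  simp only [LinearMap.smul_apply, smul_eq_mul]
  by_cases hp : p = Fintype.card ι * 2
  · subst hp
    let e : Module.Basis (Fin (Fintype.card ι * 2)) ℂ (Cov ι) :=
      Module.finBasisOfFinrankEq ℂ (Cov ι) finrank_cov
    let A : (Cov ι) [⋀^Fin (Fintype.card ι * 2)]→ₗ[ℂ] ℂ :=
      (topCoeff ι).compAlternatingMap (ιMulti ℂ _)
    let C : (Cov ι) [⋀^Fin (Fintype.card ι * 2)]→ₗ[ℂ] ℂ :=
      G.compAlternatingMap (ιMulti ℂ _)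
    have hA : A = A e • e.det := AlternatingMap.eq_smul_basis_det e A
    have hC : C = C e • e.det := AlternatingMap.eq_smul_basis_det e C
    rw [← topCoeff_volForm, volForm_eq]
    change A (volCov ι) * C v = C (volCov ι) * A v
    rw [hA, hC]
    simp only [AlternatingMap.smul_apply, smul_eq_mul]
    ring
  · rw [hG p v hp, topCoeff_ιMulti_of_ne hp, mul_zero, mul_zero]

end TopCoeff

/-! ### Forms on products -/

section Products

variable {ι κ : Type} [Fintype ι] [DecidableEq ι] [Fintype κ] [DecidableEq κ]

/-- Pull-back of covectors from the first factor. -/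
def covFst (ι κ : Type) : Cov ι →ₗ[ℂ] Cov (ι ⊕ κ) where
  toFun α := α.comp (LinearMap.funLeft ℝ ℂ Sum.inl)
  map_add' _ _ := rfl
  map_smul' _ _ := rfl

/-- Pull-back of covectors from the second factor. -/
def covSnd (ι κ : Type) : Cov κ →ₗ[ℂ] Cov (ι ⊕ κ) where
  toFun α := α.comp (LinearMap.funLeft ℝ ℂ Sum.inr)
  map_add' _ _ := rfl
  map_smul' _ _ := rfl

/-- Restriction of covectors to the second factor. -/
def covRes (ι κ : Type) : Cov (ι ⊕ κ) →ₗ[ℂ] Cov κ where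
  toFun α := α.comp
    ({ toFun := fun v => Sum.elim (0 : ℂ^ι) v
       map_add' := fun v w => by ext (a | a) <;> simp
       map_smul' := fun c v => by ext (a | a) <;> simp } : ℂ^κ →ₗ[ℝ] ℂ^(ι ⊕ κ))
  map_add' _ _ := rfl
  map_smul' _ _ := rfl

/-- Pull-back of forms from the first factor. -/
abbrev frmFst (ι κ : Type) : Frm ι →ₐ[ℂ] Frm (ι ⊕ κ) := map (covFst ι κ)

/-- Pull-back of forms from the second factor. -/
abbrev frmSnd (ι κ : Type) : Frm κ →ₐ[ℂ] Frm (ι ⊕ κ) := map (covSnd ι κ)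

theorem covFst_dz (a : ι) : covFst ι κ (dz a) = dz (Sum.inl a) := rfl
theorem covFst_dzbar (a : ι) : covFst ι κ (dzbar a) = dzbar (Sum.inl a) := rfl
theorem covSnd_dz (a : κ) : covSnd ι κ (dz a) = dz (Sum.inr a) := rfl
theorem covSnd_dzbar (a : κ) : covSnd ι κ (dzbar a) = dzbar (Sum.inr a) := rfl
theorem covRes_dz (a : κ) : covRes ι κ (dz (Sum.inr a)) = dz a := rfl
theorem covRes_dzbar (a : κ) : covRes ι κ (dzbar (Sum.inr a)) = dzbar a := rfl
theorem covRes_dz_inl (a : ι) : covRes ι κ (dz (Sum.inl a)) = 0 := by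
  refine LinearMap.ext fun v => ?_
  simp [covRes, dz]
theorem covRes_dzbar_inl (a : ι) : covRes ι κ (dzbar (Sum.inl a)) = 0 := by
  refine LinearMap.ext fun v => ?_
  simp [covRes, dzbar]

theorem covRes_surjective : Function.Surjective (covRes ι κ) := fun α => ⟨covSnd ι κ α, by
  ext v; rfl⟩

theorem covScale_comp_covFst (s t : ℂ^(ι ⊕ κ)) :
    (covScale s t).comp (covFst ι κ) =
      (covFst ι κ).comp (covScale (fun a => s (Sum.inl a)) (fun a => t (Sum.inl a))) := by
  apply cov_hom_ext <;> intro a <;>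
    simp [covFst_dz, covFst_dzbar, covScale_dz, covScale_dzbar]

theorem covScale_comp_covSnd (s t : ℂ^(ι ⊕ κ)) :
    (covScale s t).comp (covSnd ι κ) =
      (covSnd ι κ).comp (covScale (fun a => s (Sum.inr a)) (fun a => t (Sum.inr a))) := by
  apply cov_hom_ext <;> intro a <;>
    simp [covSnd_dz, covSnd_dzbar, covScale_dz, covScale_dzbar]

theorem covScale_const (c : ℂ) : covScale (fun _ : ι => c) (fun _ => c) = c • LinearMap.id := by
  apply cov_hom_ext <;> intro a <;> simp [covScale_dz, covScale_dzbar]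

theorem map_smul_id_ιMulti (c : ℂ) {p : ℕ} (v : Fin p → Cov ι) :
    map (c • LinearMap.id : Cov ι →ₗ[ℂ] Cov ι) (ιMulti ℂ p v) =
      c ^ p • ιMulti ℂ p v := by
  rw [map_apply_ιMulti]
  have : ((c • LinearMap.id : Cov ι →ₗ[ℂ] Cov ι) : Cov ι → Cov ι) ∘ v = fun i => c • v i := by
    ext i; simp
  rw [this, AlternatingMap.map_smul_univ]
  simp

theorem two_pow_inj {p q : ℕ} (h : p ≠ q) : (2 : ℂ) ^ p ≠ 2 ^ q := by
  intro h'
  apply h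
  have : (2 : ℕ) ^ p = 2 ^ q := by exact_mod_cast h'
  exact Nat.pow_right_injective le_rfl this

theorem scale_const {ι' : Type} [Fintype ι'] [DecidableEq ι'] (c : ℂ) :
    map (covScale (fun _ : ι' => c) (fun _ => c)) =
    map (c • LinearMap.id : Cov ι' →ₗ[ℂ] Cov ι') := by rw [covScale_const]

theorem map_covScale_frmFst (s t : ℂ^(ι ⊕ κ)) (θ : Frm ι) :
    map (covScale s t) (frmFst ι κ θ) =
      frmFst ι κ (map
        (covScale (fun a => s (Sum.inl a)) (fun a => t (Sum.inl a))) θ) := by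
  rw [← AlgHom.comp_apply, ← AlgHom.comp_apply, map_comp_map,
    map_comp_map, covScale_comp_covFst]

theorem map_covScale_frmSnd (s t : ℂ^(ι ⊕ κ)) (θ : Frm κ) :
    map (covScale s t) (frmSnd ι κ θ) =
      frmSnd ι κ (map
        (covScale (fun a => s (Sum.inr a)) (fun a => t (Sum.inr a))) θ) := by
  rw [← AlgHom.comp_apply, ← AlgHom.comp_apply, map_comp_map,
    map_comp_map, covScale_comp_covSnd]

theorem map_one_smul_id {ι' : Type} [Fintype ι'] [DecidableEq ι'] (θ : Frm ι') :
    map ((1 : ℂ) • LinearMap.id : Cov ι' →ₗ[ℂ] Cov ι') θ = θ := by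
  rw [one_smul, map_id]; rfl

theorem topCoeff_mul_ιMulti_left (θ : Frm ι) {p : ℕ} (v : Fin p → Cov κ)
    (hp : p ≠ Fintype.card κ * 2) :
    topCoeff (ι ⊕ κ) (frmSnd ι κ (ιMulti ℂ p v) * frmFst ι κ θ) = 0 := by
  have h := topCoeff_map (covScale (Sum.elim (fun _ : ι => (1 : ℂ)) (fun _ : κ => 2))
    (Sum.elim (fun _ => 1) (fun _ => 2)))
    (frmSnd ι κ (ιMulti ℂ p v) * frmFst ι κ θ)
  rw [map_mul, map_covScale_frmFst, map_covScale_frmSnd, det_covScale] at h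
  simp only [Sum.elim_inl, Sum.elim_inr, map_one_smul_id, scale_const, map_smul_id_ιMulti,
    map_smul, smul_mul_assoc, Fintype.prod_sum_type, Finset.prod_const, one_pow, one_mul,
    Finset.card_univ, smul_eq_mul] at h
  rw [← pow_add, ← mul_two, ← sub_eq_zero, ← sub_mul] at h
  exact (mul_eq_zero.mp h).resolve_left (sub_ne_zero.mpr (two_pow_inj hp))

theorem topCoeff_mul_ιMulti_right (Ω : Frm κ) {p : ℕ} (v : Fin p → Cov ι)
    (hp : p ≠ Fintype.card ι * 2) :
    topCoeff (ι ⊕ κ) (frmSnd ι κ Ω * frmFst ι κ (ιMulti ℂ p v)) = 0 := by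
  have h := topCoeff_map (covScale (Sum.elim (fun _ : ι => (2 : ℂ)) (fun _ : κ => 1))
    (Sum.elim (fun _ => 2) (fun _ => 1)))
    (frmSnd ι κ Ω * frmFst ι κ (ιMulti ℂ p v))
  rw [map_mul, map_covScale_frmFst, map_covScale_frmSnd, det_covScale] at h
  simp only [Sum.elim_inl, Sum.elim_inr, map_one_smul_id, scale_const, map_smul_id_ιMulti,
    map_smul, mul_smul_comm, Fintype.prod_sum_type, Finset.prod_const, one_pow, mul_one,
    Finset.card_univ, smul_eq_mul] at h
  rw [← pow_add, ← mul_two, ← sub_eq_zero, ← sub_mul] at h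
  exact (mul_eq_zero.mp h).resolve_left (sub_ne_zero.mpr (two_pow_inj hp))

theorem frmFst_dzdzbar (a b : ι) :
    frmFst ι κ (dzdzbar a b : CFrm ι) = (dzdzbar (Sum.inl a) (Sum.inl b) : CFrm (ι ⊕ κ)) := by
  simp [dzdzbar, map_apply_ι, covFst_dz, covFst_dzbar]

theorem frmSnd_dzdzbar (a b : κ) :
    frmSnd ι κ (dzdzbar a b : CFrm κ) = (dzdzbar (Sum.inr a) (Sum.inr b) : CFrm (ι ⊕ κ)) := by
  simp [dzdzbar, map_apply_ι, covSnd_dz, covSnd_dzbar]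

theorem coe_prod_dzdzbar {J K : Type} [Fintype J] (x : J → CFrm K) :
    ((∏ i, x i : CFrm K) : Frm K) =
      (List.ofFn fun k => (x ((Fintype.equivFin J).symm k) : Frm K)).prod := by
  rw [← (Fintype.equivFin J).symm.prod_comp, ← List.prod_ofFn]
  change (Subalgebra.center ℂ (Frm K)).val _ = _
  rw [map_list_prod, List.map_ofFn]
  rfl

theorem map_volForm {J K : Type} [Fintype J] (g : Frm J →ₐ[ℂ] Frm K) (j : J → K)
    (hg : ∀ a, g (dzdzbar a a : CFrm J) = (dzdzbar (j a) (j a) : CFrm K)) :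
    g (volForm J) = ((∏ a, dzdzbar (j a) (j a) : CFrm K) : Frm K) := by
  rw [volForm, coe_prod_dzdzbar, coe_prod_dzdzbar, map_list_prod, List.map_ofFn]
  congr 2
  ext i
  exact hg _

/-- Integration of a product form. -/
theorem topCoeff_frmSnd_mul_frmFst (Ω : Frm κ) (θ : Frm ι) :
    topCoeff (ι ⊕ κ) (frmSnd ι κ Ω * frmFst ι κ θ) = topCoeff κ Ω * topCoeff ι θ := by
  let G1 : Frm κ →ₗ[ℂ] ℂ := (topCoeff (ι ⊕ κ)).comp
    ((LinearMap.mulRight ℂ (frmFst ι κ θ)).comp (frmSnd ι κ).toLinearMap)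
  let G2 : Frm ι →ₗ[ℂ] ℂ := (topCoeff (ι ⊕ κ)).comp
    ((LinearMap.mulLeft ℂ (frmSnd ι κ (volForm κ : Frm κ))).comp (frmFst ι κ).toLinearMap)
  have hG1 : ∀ x, G1 x = topCoeff (ι ⊕ κ) (frmSnd ι κ x * frmFst ι κ θ) := fun x => rfl
  have hG2 : ∀ x, G2 x = topCoeff (ι ⊕ κ) (frmSnd ι κ (volForm κ : Frm κ) * frmFst ι κ x) :=
    fun x => rfl
  have h1 := eq_topCoeff G1 (fun p v hp => by
    rw [hG1]; exact topCoeff_mul_ιMulti_left θ v hp) Ω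
  have h2 := eq_topCoeff G2 (fun p v hp => by
    rw [hG2]; exact topCoeff_mul_ιMulti_right _ v hp) θ
  rw [hG1, hG1] at h1
  rw [hG2, hG2] at h2
  have h3 : frmSnd ι κ (volForm κ) * frmFst ι κ (volForm ι) = (volForm (ι ⊕ κ) : Frm (ι ⊕ κ)) := by
    rw [map_volForm _ Sum.inr fun a => frmSnd_dzdzbar a a,
      map_volForm _ Sum.inl fun a => frmFst_dzdzbar a a, volForm,
      Fintype.prod_sum_type, mul_comm (∏ a, dzdzbar (Sum.inl a) (Sum.inl a))]
    rfl
  rw [h3, topCoeff_volForm, Fintype.card_sum, pow_add] at h2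
  have e1 := ne_zero_aux (Fintype.card ι)
  have e2 := ne_zero_aux (Fintype.card κ)
  have h4 : topCoeff (ι ⊕ κ) (frmSnd ι κ (volForm κ) * frmFst ι κ θ) =
      (-2 * Complex.I) ^ Fintype.card κ * topCoeff ι θ := by
    apply mul_left_cancel₀ e1
    rw [h2]; ring
  rw [h4] at h1
  apply mul_left_cancel₀ e2
  rw [h1]; ring

end Products

/-! ### Forms of type `(p, p)` -/

section OneOne

variable {ι κ : Type} [Fintype ι] [DecidableEq ι] [Fintype κ] [DecidableEq κ]

/-- The algebra homomorphism between the centres induced by a surjection on covectors. -/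
def cmap (L : Cov ι →ₗ[ℂ] Cov κ) (hL : Function.Surjective L) : CFrm ι →ₐ[ℂ] CFrm κ :=
  AlgHom.codRestrict ((map L).comp (Subalgebra.center ℂ (Frm ι)).val)
    (Subalgebra.center ℂ (Frm κ)) (by
      intro x
      rw [Subalgebra.mem_center_iff]
      intro y
      obtain ⟨y', rfl⟩ := map_surjective_iff.mpr hL y
      have := Subalgebra.mem_center_iff.mp x.2 y'
      simp only [AlgHom.comp_apply, Subalgebra.coe_val]
      rw [← map_mul, this, map_mul])

theorem coe_cmap (L : Cov ι →ₗ[ℂ] Cov κ) (hL : Function.Surjective L) (x : CFrm ι) :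
    (cmap L hL x : Frm κ) = map L (x : Frm ι) := rfl

/-- The span of the forms `dz_a ∧ d\bar z_b`. -/
def oneOne (ι : Type) : Submodule ℂ (CFrm ι) :=
  Submodule.span ℂ (Set.range fun ab : ι × ι => dzdzbar ab.1 ab.2)

theorem dzdzbar_mem (a b : ι) : dzdzbar a b ∈ oneOne ι :=
  Submodule.subset_span ⟨(a, b), rfl⟩

theorem eqOn_oneOne_pow {V : Type*} [AddCommGroup V] [Module ℂ V] {p : ℕ}
    {f g : CFrm ι →ₗ[ℂ] V}
    (h : ∀ α β : Fin p → ι, f (∏ k, dzdzbar (α k) (β k)) = g (∏ k, dzdzbar (α k) (β k)))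
    {Ω : CFrm ι} (hΩ : Ω ∈ oneOne ι ^ p) : f Ω = g Ω := by
  rw [oneOne, Submodule.span_pow] at hΩ
  refine LinearMap.eqOn_span (f := f) (g := g) ?_ hΩ
  rintro x hx
  obtain ⟨y, rfl⟩ := Set.mem_pow.mp hx
  rw [List.prod_ofFn]
  choose ab hab using fun i => (y i).2
  simp only [← hab]
  exact h _ _

theorem coe_eqOn_oneOne_pow {V : Type*} [AddCommGroup V] [Module ℂ V] {p : ℕ}
    {f g : Frm ι →ₗ[ℂ] V}
    (h : ∀ α β : Fin p → ι, f ((∏ k, dzdzbar (α k) (β k) : CFrm ι) : Frm ι) =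
      g ((∏ k, dzdzbar (α k) (β k) : CFrm ι) : Frm ι))
    {Ω : CFrm ι} (hΩ : Ω ∈ oneOne ι ^ p) : f (Ω : Frm ι) = g (Ω : Frm ι) :=
  eqOn_oneOne_pow (f := f.comp (Subalgebra.center ℂ (Frm ι)).val.toLinearMap)
    (g := g.comp (Subalgebra.center ℂ (Frm ι)).val.toLinearMap) h hΩ

/-- Integrand of the integral of a form on a product against the pull-back of a form on the first
factor. -/
def wedgeTop (κ : Type) [Fintype κ] [DecidableEq κ] (ψ : Frm ι) : Frm (ι ⊕ κ) →ₗ[ℂ] ℂ where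
  toFun Ω := topCoeff (ι ⊕ κ) (Ω * frmFst ι κ ψ)
  map_add' x y := by rw [add_mul, map_add]
  map_smul' c x := by rw [smul_mul_assoc, map_smul]; rfl

theorem wedgeTop_apply (ψ : Frm ι) (Ω : Frm (ι ⊕ κ)) :
    wedgeTop κ ψ Ω = topCoeff (ι ⊕ κ) (Ω * frmFst ι κ ψ) := rfl

theorem map_dzdzbar (L : Cov ι →ₗ[ℂ] Cov κ) (a b : ι) :
    map L (dzdzbar a b : CFrm ι) =
      ιF ℂ (L (dz a)) * ιF ℂ (L (dzbar b)) := by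
  simp [dzdzbar, map_apply_ι]

theorem coe_prod_fin {J : Type} {p : ℕ} (x : Fin p → CFrm J) :
    ((∏ i, x i : CFrm J) : Frm J) = (List.ofFn fun k => (x k : Frm J)).prod := by
  rw [← List.prod_ofFn]
  change (Subalgebra.center ℂ (Frm J)).val _ = _
  rw [map_list_prod, List.map_ofFn]
  rfl

theorem prod_ofFn_smul {J : Type} {p : ℕ} (c : Fin p → ℂ) (x : Fin p → Frm J) :
    (List.ofFn fun k => c k • x k).prod = (∏ k, c k) • (List.ofFn x).prod := by
  induction p with
  | zero => simp
  | succ p ih =>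
    rw [List.ofFn_succ, List.ofFn_succ, List.prod_cons, List.prod_cons, ih, Fin.prod_univ_succ,
      smul_mul_smul_comm]

theorem map_covScale_prod (s t : ℂ^ι) {p : ℕ} (α β : Fin p → ι) :
    map (covScale s t) ((∏ k, dzdzbar (α k) (β k) : CFrm ι) : Frm ι) =
      ((∏ k, s (α k)) * ∏ k, t (β k)) •
        ((∏ k, dzdzbar (α k) (β k) : CFrm ι) : Frm ι) := by
  rw [coe_prod_fin, map_list_prod, List.map_ofFn, ← Finset.prod_mul_distrib, ← prod_ofFn_smul]
  congr 2
  ext k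
  simp only [Function.comp_apply, map_dzdzbar, covScale_dz, covScale_dzbar, map_smul,
    smul_mul_smul_comm]
  rfl

theorem prod_elim (s t : ℂ) {p : ℕ} (α : Fin p → ι ⊕ κ) :
    ∏ k, Sum.elim (fun _ : ι => s) (fun _ : κ => t) (α k) =
      t ^ (univ.filter fun k => (α k).isRight).card *
        s ^ (univ.filter fun k => ¬(α k).isRight).card := by
  have : ∀ k, Sum.elim (fun _ : ι => s) (fun _ : κ => t) (α k) =
      if (α k).isRight then t else s := by
    intro k; rcases α k with a | a <;> simp
  simp only [this]
  rw [Finset.prod_ite, Finset.prod_const, Finset.prod_const]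

/-- An `(n, n)`-form with a factor `dz_a` or `d\bar z_a` from the first factor does not contribute
to the integral over a product with `n`-dimensional second factor. -/
theorem topCoeff_prod_mul_eq_zero {p : ℕ} (α β : Fin p → ι ⊕ κ) (ψ : Frm ι)
    (h : ¬((univ.filter fun k => (α k).isRight).card = Fintype.card κ ∧
      (univ.filter fun k => (β k).isRight).card = Fintype.card κ)) :
    topCoeff (ι ⊕ κ) (((∏ k, dzdzbar (α k) (β k) : CFrm (ι ⊕ κ)) : Frm (ι ⊕ κ)) *
      frmFst ι κ ψ) = 0 := by
  have key : ∀ s t : ℂ, _ := fun s t => topCoeff_map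
    (covScale (Sum.elim (fun _ : ι => (1 : ℂ)) (fun _ : κ => s))
      (Sum.elim (fun _ : ι => (1 : ℂ)) (fun _ : κ => t)))
    (((∏ k, dzdzbar (α k) (β k) : CFrm (ι ⊕ κ)) : Frm (ι ⊕ κ)) * frmFst ι κ ψ)
  simp only [map_mul, map_covScale_frmFst, map_covScale_prod, det_covScale, prod_elim, Sum.elim_inl,
    Sum.elim_inr, scale_const, map_one_smul_id, prod_const_one, map_smul, smul_mul_assoc,
    Fintype.prod_sum_type, Finset.prod_const, one_mul, one_pow, mul_one, Finset.card_univ,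
    smul_eq_mul, ← sub_eq_zero (b := _ * topCoeff (ι ⊕ κ) _), ← sub_mul] at key
  rw [not_and_or] at h
  rcases h with h | h
  · exact (mul_eq_zero.mp (key 2 1)).resolve_left (by
      simpa only [one_pow, mul_one] using sub_ne_zero.mpr (two_pow_inj h))
  · exact (mul_eq_zero.mp (key 1 2)).resolve_left (by
      simpa only [one_pow, one_mul] using sub_ne_zero.mpr (two_pow_inj h))

/-- Exactly one factor `dz_a` and one factor `d\bar z_a` of an `(n+1, n+1)`-form that contributes to
the integral over a product with `n`-dimensional second factor come from the first factor. -/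
theorem topCoeff_scale_fst {Ω : CFrm (ι ⊕ κ)} (hΩ : Ω ∈ oneOne (ι ⊕ κ) ^ (Fintype.card κ + 1))
    (ψ : Frm ι) (s t : ℂ) :
    topCoeff (ι ⊕ κ) (map (covScale (Sum.elim (fun _ : ι => s) (fun _ : κ => 1))
      (Sum.elim (fun _ : ι => t) (fun _ : κ => 1))) (Ω : Frm (ι ⊕ κ)) * frmFst ι κ ψ) =
      s * t * topCoeff (ι ⊕ κ) ((Ω : Frm (ι ⊕ κ)) * frmFst ι κ ψ) := by
  refine coe_eqOn_oneOne_pow (f := (wedgeTop κ ψ).comp (map (covScale (Sum.elim (fun _ : ι => s)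
    (fun _ : κ => 1)) (Sum.elim (fun _ : ι => t) (fun _ : κ => 1)))).toLinearMap)
    (g := (s * t) • wedgeTop κ ψ) (fun α β => ?_) hΩ
  simp only [wedgeTop_apply, AlgHom.toLinearMap_apply, LinearMap.smul_apply, LinearMap.comp_apply,
    smul_eq_mul, map_covScale_prod, prod_elim, one_pow, one_mul, map_smul]
  have hcard : ∀ γ : Fin (Fintype.card κ + 1) → ι ⊕ κ,
      (univ.filter fun k => (γ k).isRight).card = Fintype.card κ →
      (univ.filter fun k => ¬(γ k).isRight).card = 1 := fun γ h => by
    have h2 := Finset.card_filter_add_card_filter_not (s := univ) (fun k => (γ k).isRight = true)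
    rw [h, Finset.card_univ, Fintype.card_fin] at h2
    exact Nat.add_left_cancel h2
  by_cases h : (univ.filter fun k => (α k).isRight).card = Fintype.card κ ∧
      (univ.filter fun k => (β k).isRight).card = Fintype.card κ
  · rw [hcard α h.1, hcard β h.2, pow_one, pow_one]
  · rw [topCoeff_prod_mul_eq_zero α β ψ h, mul_zero, mul_zero]

/-- Fibre integration of an `(n, n)`-form. -/
theorem topCoeff_mul_frmFst {Ω : CFrm (ι ⊕ κ)} (hΩ : Ω ∈ oneOne (ι ⊕ κ) ^ Fintype.card κ)
    (ψ : Frm ι) :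
    topCoeff (ι ⊕ κ) ((Ω : Frm (ι ⊕ κ)) * frmFst ι κ ψ) =
      topCoeff κ (map (covRes ι κ) (Ω : Frm (ι ⊕ κ))) * topCoeff ι ψ := by
  rw [mul_comm (topCoeff κ _)]
  refine coe_eqOn_oneOne_pow (f := wedgeTop κ ψ)
    (g := topCoeff ι ψ • (topCoeff κ).comp (map (covRes ι κ)).toLinearMap) (fun α β => ?_) hΩ
  simp only [wedgeTop_apply, AlgHom.toLinearMap_apply, LinearMap.smul_apply, LinearMap.comp_apply,
    smul_eq_mul]
  have hcard : ∀ γ : Fin (Fintype.card κ) → ι ⊕ κ,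
      (univ.filter fun k => (γ k).isRight).card = Fintype.card κ ↔ ∀ k, (γ k).isRight := fun γ => by
    simpa using Finset.card_filter_eq_iff (s := univ) (p := fun k => (γ k).isRight = true)
  by_cases h : (∀ k, (α k).isRight) ∧ ∀ k, (β k).isRight
  · choose α' hα' using fun k => Sum.isRight_iff.mp (h.1 k)
    choose β' hβ' using fun k => Sum.isRight_iff.mp (h.2 k)
    have e1 : ((∏ k, dzdzbar (α k) (β k) : CFrm (ι ⊕ κ)) : Frm (ι ⊕ κ)) =
        frmSnd ι κ ((∏ k, dzdzbar (α' k) (β' k) : CFrm κ) : Frm κ) := by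
      rw [coe_prod_fin, coe_prod_fin, map_list_prod, List.map_ofFn]
      congr 2
      ext k
      rw [Function.comp_apply, frmSnd_dzdzbar, hα', hβ']
    rw [e1, topCoeff_frmSnd_mul_frmFst, mul_comm]
    congr 2
    rw [← AlgHom.comp_apply, map_comp_map]
    have : (covRes ι κ).comp (covSnd ι κ) = LinearMap.id := by
      apply cov_hom_ext <;> intro a
      · rw [LinearMap.comp_apply, covSnd_dz, covRes_dz]; rfl
      · rw [LinearMap.comp_apply, covSnd_dzbar, covRes_dzbar]; rfl
    rw [this, map_id]
    rfl
  · rw [topCoeff_prod_mul_eq_zero α β ψ (by rwa [hcard, hcard])]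
    obtain ⟨k, hk⟩ : ∃ k, map (covRes ι κ) (dzdzbar (α k) (β k) : CFrm (ι ⊕ κ)) = 0 := by
      simp only [not_and_or, not_forall, Sum.not_isRight, Sum.isLeft_iff] at h
      rcases h with ⟨k, b, hb⟩ | ⟨k, b, hb⟩ <;> refine ⟨k, ?_⟩ <;> rw [map_dzdzbar, hb]
      · rw [covRes_dz_inl, map_zero, zero_mul]
      · rw [covRes_dzbar_inl, map_zero, mul_zero]
    rw [coe_prod_fin, map_list_prod, List.map_ofFn,
      List.prod_eq_zero (List.mem_ofFn.mpr ⟨k, hk⟩), map_zero, mul_zero]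

/-- Pull-back of covectors by a complex linear map. -/
def covComp (D : ℂ^ι →ₗ[ℂ] ℂ^κ) : Cov κ →ₗ[ℂ] Cov ι where
  toFun α := α.comp (D.restrictScalars ℝ)
  map_add' _ _ := rfl
  map_smul' _ _ := rfl

theorem apply_eq_sum (D : ℂ^ι →ₗ[ℂ] ℂ^κ) (v : ℂ^ι) (a : κ) :
    D v a = ∑ b, v b * D (Pi.single b 1) a := by
  have hv : v = ∑ b, v b • (Pi.single b (1 : ℂ) : ℂ^ι) := by
    ext c
    simp [Finset.sum_apply, Pi.single_apply]
  conv_lhs => rw [hv, map_sum]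
  simp [Finset.sum_apply]

theorem covComp_dz (D : ℂ^ι →ₗ[ℂ] ℂ^κ) (a : κ) :
    covComp D (dz a) = ∑ b, D (Pi.single b 1) a • dz b := by
  refine LinearMap.ext fun v => ?_
  rw [LinearMap.sum_apply]
  change D v a = ∑ b, D (Pi.single b 1) a * v b
  rw [apply_eq_sum]
  exact sum_congr rfl fun b _ => mul_comm _ _

theorem covComp_dzbar (D : ℂ^ι →ₗ[ℂ] ℂ^κ) (a : κ) :
    covComp D (dzbar a) = ∑ b, conj (D (Pi.single b 1) a) • dzbar b := by
  refine LinearMap.ext fun v => ?_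
  rw [LinearMap.sum_apply]
  change conj (D v a) = ∑ b, conj (D (Pi.single b 1) a) *
    conj (v b)
  rw [apply_eq_sum, map_sum]
  exact sum_congr rfl fun b _ => by rw [map_mul, mul_comm]

theorem det_covComp (D : ℂ^ι →ₗ[ℂ] ℂ^ι) :
    LinearMap.det (covComp D) = (Complex.normSq (LinearMap.det D) : ℂ) := by
  rw [← LinearMap.det_toMatrix (covBasis ι)]
  have hM : LinearMap.toMatrix (covBasis ι) (covBasis ι) (covComp D) =
      Matrix.fromBlocks (LinearMap.toMatrix' D).transpose 0 0
        ((LinearMap.toMatrix' D).transpose.map (starRingEnd ℂ)) := by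
    ext i j
    rw [LinearMap.toMatrix_apply]
    rcases j with j | j
    · rw [covBasis_inl, covComp_dz, map_sum]
      simp only [← covBasis_inl, map_smul, Module.Basis.repr_self, Finsupp.coe_finsetSum,
        Finset.sum_apply, Finsupp.smul_apply, Finsupp.single_apply]
      rcases i with i | i <;> simp [LinearMap.toMatrix'_apply, eq_comm]
    · rw [covBasis_inr, covComp_dzbar, map_sum]
      simp only [← covBasis_inr, map_smul, Module.Basis.repr_self, Finsupp.coe_finsetSum,
        Finset.sum_apply, Finsupp.smul_apply, Finsupp.single_apply]
      rcases i with i | i <;> simp [LinearMap.toMatrix'_apply, eq_comm]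
  rw [hM, Matrix.det_fromBlocks_zero₂₁, Matrix.det_transpose, LinearMap.det_toMatrix']
  have h2 : ((LinearMap.toMatrix' D).transpose.map (starRingEnd ℂ)).det =
      conj (LinearMap.det D) := by
    rw [← RingHom.mapMatrix_apply, ← RingHom.map_det, Matrix.det_transpose,
      LinearMap.det_toMatrix']
  rw [h2, Complex.mul_conj]

theorem covPullback_eq {f : ℂ^ι → ℂ^κ} {x : ℂ^ι} (hf : DifferentiableAt ℂ f x) :
    covPullback f x = covComp (fderiv ℂ f x : ℂ^ι →ₗ[ℂ] ℂ^κ) := by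
  refine LinearMap.ext fun α => LinearMap.ext fun v => ?_
  change α (fderiv ℝ f x v) = α (fderiv ℂ f x v)
  rw [hf.fderiv_restrictScalars ℝ]
  rfl

theorem det_restrictScalars_eq (D : ℂ^ι →L[ℂ] ℂ^ι) :
    (D.restrictScalars ℝ : ℂ^ι →L[ℝ] ℂ^ι).det =
      Complex.normSq (LinearMap.det (D : ℂ^ι →ₗ[ℂ] ℂ^ι)) := by
  have := LinearMap.det_restrictScalars (R := ℝ) (f := (D : ℂ^ι →ₗ[ℂ] ℂ^ι))
  rw [Algebra.norm_complex_eq] at this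
  exact this

/-- Transformation of the top coefficient under holomorphic maps. -/
theorem topCoeff_covPullback {f : ℂ^ι → ℂ^ι} {x : ℂ^ι} (hf : DifferentiableAt ℂ f x)
    (θ : Frm ι) :
    topCoeff ι (map (covPullback f x) θ) =
      |(fderiv ℝ f x).det| * topCoeff ι θ := by
  rw [topCoeff_map, covPullback_eq hf, det_covComp, hf.fderiv_restrictScalars ℝ,
    det_restrictScalars_eq, abs_of_nonneg (Complex.normSq_nonneg _)]

end OneOne

/-! ### Smoothness of holomorphic functions of several variables -/

section Holomorphic

variable {E F : Type*} [NormedAddCommGroup E] [NormedSpace ℂ E] [FiniteDimensional ℂ E]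
  [NormedAddCommGroup F] [NormedSpace ℂ F] [FiniteDimensional ℂ F]

theorem fderiv_apply_eq_circleIntegral [CompleteSpace F] {f : E → F} {U : Set E} (hU : IsOpen U)
    (hf : DifferentiableOn ℂ f U) {z w : E} {r : ℝ} (hr : 0 < r)
    (hz : ∀ ζ : ℂ, ‖ζ‖ ≤ r → z + ζ • w ∈ U) :
    fderiv ℂ f z w =
      (2 * ↑Real.pi * Complex.I)⁻¹ • ∮ ζ in C(0, r), (ζ ^ 2)⁻¹ • f (z + ζ • w) := by
  have hcont : Continuous fun ζ : ℂ => z + ζ • w := by fun_prop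
  have hV : IsOpen ((fun ζ : ℂ => z + ζ • w) ⁻¹' U) := hU.preimage hcont
  have hsub : Metric.closedBall (0 : ℂ) r ⊆ (fun ζ : ℂ => z + ζ • w) ⁻¹' U := by
    intro ζ hζ
    exact hz ζ (by simpa using hζ)
  have hd : DifferentiableOn ℂ (fun ζ : ℂ => f (z + ζ • w))
      ((fun ζ : ℂ => z + ζ • w) ⁻¹' U) :=
    hf.comp (by fun_prop) (fun ζ hζ => hζ)
  have h := Complex.two_pi_I_inv_smul_circleIntegral_sub_sq_inv_smul_of_differentiable hV hsub hd
    (Metric.mem_ball_self hr)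
  simp only [sub_zero] at h
  rw [h]
  have h0 : z ∈ U := by simpa using hz 0 (by simpa using hr.le)
  have h1 : HasDerivAt (fun ζ : ℂ => z + ζ • w) w 0 := by
    simpa using ((hasDerivAt_id (0 : ℂ)).smul_const w).const_add z
  have h2 : HasFDerivAt f (fderiv ℂ f z) ((fun ζ : ℂ => z + ζ • w) 0) := by
    simpa using (hf.differentiableAt (hU.mem_nhds h0)).hasFDerivAt
  exact (h2.comp_hasDerivAt 0 h1).deriv.symm

theorem differentiableAt_fderiv_apply {f : E → F} {U : Set E} (hU : IsOpen U)
    (hf : DifferentiableOn ℂ f U) {z₀ : E} (hz₀ : z₀ ∈ U) (w : E) :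
    DifferentiableAt ℂ (fun z => fderiv ℂ f z w) z₀ := by
  have : ProperSpace E := FiniteDimensional.proper ℂ E
  have : CompleteSpace F := FiniteDimensional.complete ℂ F
  have : ProperSpace (E →L[ℂ] F) := FiniteDimensional.proper ℂ (E →L[ℂ] F)
  borelize E
  obtain ⟨ε, hε, hεU⟩ := Metric.isOpen_iff.mp hU z₀ hz₀
  set ρ : ℝ := ε / 4 with hρ
  have hρ0 : 0 < ρ := by positivity
  have hball : Metric.closedBall z₀ (3 * ρ) ⊆ U := fun y hy => hεU (by
    rw [Metric.mem_ball]; rw [Metric.mem_closedBall] at hy; linarith)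
  obtain ⟨C, hC⟩ := (isCompact_closedBall z₀ (3 * ρ)).exists_bound_of_continuousOn
    (hf.continuousOn.mono hball)
  have hC0 : 0 ≤ C := (norm_nonneg _).trans (hC z₀ (Metric.mem_closedBall_self (by positivity)))
  have hbound : ∀ y ∈ Metric.ball z₀ (2 * ρ), ‖fderiv ℂ f y‖ ≤ (2 * C + 1) / ρ := by
    intro y hy
    have hsub : Metric.ball y ρ ⊆ Metric.closedBall z₀ (3 * ρ) := by
      intro x hx
      rw [Metric.mem_ball] at hx hy
      rw [Metric.mem_closedBall]
      linarith [dist_triangle x y z₀]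
    refine Complex.norm_fderiv_le_div_of_mapsTo_ball (hf.mono (hsub.trans hball)) ?_ hρ0
    intro x hx
    have h1 := hC x (hsub hx)
    have h2 := hC y (hsub (Metric.mem_ball_self hρ0))
    rw [Metric.mem_closedBall, dist_eq_norm]
    linarith [norm_sub_le (f x) (f y)]
  set r : ℝ := ρ / (‖w‖ + 1) with hr
  have hr0 : 0 < r := by positivity
  have hrw : r * ‖w‖ < ρ := by
    rw [hr, div_mul_eq_mul_div, div_lt_iff₀ (by positivity)]
    nlinarith [norm_nonneg w]
  have hmem : ∀ z ∈ Metric.ball z₀ ρ, ∀ ζ : ℂ, ‖ζ‖ ≤ r → z + ζ • w ∈ Metric.ball z₀ (2 * ρ) := by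
    intro z hz ζ hζ
    rw [Metric.mem_ball, dist_eq_norm] at hz ⊢
    have : z + ζ • w - z₀ = (z - z₀) + ζ • w := by abel
    rw [this]
    have h1 : ‖ζ • w‖ ≤ r * ‖w‖ := by
      rw [norm_smul]; exact mul_le_mul_of_nonneg_right hζ (norm_nonneg _)
    linarith [norm_add_le (z - z₀) (ζ • w)]
  have hballU : Metric.ball z₀ (2 * ρ) ⊆ U := fun y hy => hball (by
    rw [Metric.mem_closedBall]; rw [Metric.mem_ball] at hy; linarith)
  have hnhds : Metric.ball z₀ ρ ∈ nhds z₀ := Metric.ball_mem_nhds _ hρ0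
  have heq : (fun z => fderiv ℂ f z w) =ᶠ[nhds z₀] fun z =>
      (2 * ↑Real.pi * Complex.I)⁻¹ • ∮ ζ in C(0, r), (ζ ^ 2)⁻¹ • f (z + ζ • w) := by
    filter_upwards [hnhds] with z hz
    exact fderiv_apply_eq_circleIntegral hU hf hr0 fun ζ hζ => hballU (hmem z hz ζ hζ)
  refine DifferentiableAt.congr_of_eventuallyEq ?_ heq
  refine DifferentiableAt.const_smul ?_ _
  simp only [circleIntegral]
  have hcm : ∀ θ, ‖circleMap 0 r θ‖ = r := fun θ => by simp [abs_of_pos hr0]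
  have hcm0 : ∀ θ, circleMap 0 r θ ≠ 0 := fun θ h => by
    have := hcm θ; rw [h, norm_zero] at this; exact hr0.ne this
  have hcc : Continuous fun θ => deriv (circleMap 0 r) θ := by
    simp only [deriv_circleMap]; fun_prop
  let k : ℝ → ℂ := fun θ => deriv (circleMap 0 r) θ * ((circleMap 0 r θ) ^ 2)⁻¹
  have hk : Continuous k := hcc.mul
    (((continuous_circleMap 0 r).pow 2).inv₀ fun θ => pow_ne_zero _ (hcm0 θ))
  have hkn : ∀ θ, ‖k θ‖ = r⁻¹ := by
    intro θ
    simp only [k, norm_mul, norm_inv, norm_pow, hcm, deriv_circleMap, Complex.norm_I, mul_one]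
    field_simp
  have key : HasFDerivAt (fun z => ∫ θ in (0 : ℝ)..2 * Real.pi,
      deriv (circleMap 0 r) θ • ((circleMap 0 r θ) ^ 2)⁻¹ • f (z + circleMap 0 r θ • w))
      (∫ θ in (0 : ℝ)..2 * Real.pi, k θ • fderiv ℂ f (z₀ + circleMap 0 r θ • w)) z₀ := by
    have hFc : ∀ z ∈ Metric.ball z₀ ρ, Continuous fun θ =>
        deriv (circleMap 0 r) θ • ((circleMap 0 r θ) ^ 2)⁻¹ • f (z + circleMap 0 r θ • w) := by
      intro z hz
      simp only [smul_smul]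
      refine hk.smul ?_
      refine hf.continuousOn.comp_continuous (by fun_prop) fun θ => ?_
      exact hballU (hmem z hz _ (hcm θ).le)
    refine intervalIntegral.hasFDerivAt_integral_of_dominated_of_fderiv_le (𝕜 := ℂ)
      (bound := fun _ => r⁻¹ * ((2 * C + 1) / ρ)) (s := Metric.ball z₀ ρ)
      (F' := fun z θ => k θ • fderiv ℂ f (z + circleMap 0 r θ • w)) hnhds ?_ ?_ ?_ ?_ ?_ ?_
    · filter_upwards [hnhds] with z hz
      exact (hFc z hz).aestronglyMeasurable
    · exact (hFc z₀ (Metric.mem_ball_self hρ0)).intervalIntegrable _ _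
    · refine hk.aestronglyMeasurable.smul ?_
      have hm : Measurable fun θ : ℝ => fderiv ℂ f (z₀ + circleMap 0 r θ • w) :=
        (measurable_fderiv ℂ f).comp (by fun_prop : Continuous fun θ : ℝ =>
          z₀ + circleMap 0 r θ • w).measurable
      exact hm.stronglyMeasurable.aestronglyMeasurable
    · refine MeasureTheory.ae_of_all _ fun θ _ z hz => ?_
      rw [norm_smul, hkn]
      exact mul_le_mul_of_nonneg_left (hbound _ (hmem z hz _ (hcm θ).le)) (by positivity)
    · exact intervalIntegrable_const
    · refine MeasureTheory.ae_of_all _ fun θ _ z hz => ?_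
      simp only [smul_smul]
      have h1 : HasFDerivAt f (fderiv ℂ f (z + circleMap 0 r θ • w))
          (z + circleMap 0 r θ • w) :=
        (hf.differentiableAt (hU.mem_nhds (hballU (hmem z hz _ (hcm θ).le)))).hasFDerivAt
      have h2 : HasFDerivAt (fun z => z + circleMap 0 r θ • w) (ContinuousLinearMap.id ℂ E) z :=
        (hasFDerivAt_id z).add_const _
      have h3 := h1.comp z h2
      rw [ContinuousLinearMap.comp_id] at h3
      exact h3.const_smul _
  exact key.differentiableAt

theorem contDiffOn_of_differentiableOn_complex {f : E → F} {U : Set E} (hU : IsOpen U)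
    (hf : DifferentiableOn ℂ f U) : ContDiffOn ℂ ∞ f U := by
  rw [contDiffOn_infty]
  intro m
  induction m generalizing f with
  | zero => exact contDiffOn_zero.mpr hf.continuousOn
  | succ m ih =>
    have := contDiffOn_succ_iff_fderiv_of_isOpen (𝕜 := ℂ) (n := m) (f := f) hU
    push_cast
    refine this.mpr ⟨hf, by simp, contDiffOn_clm_apply.mpr fun w => ih ?_⟩
    exact fun z hz => (differentiableAt_fderiv_apply hU hf hz w).differentiableWithinAt

theorem contDiffOn_of_holomorphic {f : E → F} {U : Set E} (hU : IsOpen U)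
    (hf : DifferentiableOn ℂ f U) : SmoothOn f U :=
  (contDiffOn_of_differentiableOn_complex hU hf).restrict_scalars ℝ

end Holomorphic

/-! ### Wirtinger derivatives of vector-valued functions -/

section Wirtinger

variable {ι κ : Type} [Fintype ι] [DecidableEq ι] [Fintype κ] [DecidableEq κ]
variable {V W : Type*} [NormedAddCommGroup V] [NormedSpace ℂ V]
  [NormedAddCommGroup W] [NormedSpace ℂ W]

/-- `1` for antiholomorphic and `-1` for holomorphic derivatives. -/
def wsgn : Bool → ℂ
  | true => 1
  | false => -1

/-- Conjugation for antiholomorphic derivatives, the identity for holomorphic ones. -/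
def wconj : Bool → (ℂ →+* ℂ)
  | true => starRingEnd ℂ
  | false => RingHom.id ℂ

/-- The `ℂ`-linear (`b = false`) or `ℂ`-antilinear (`b = true`) part of the differential. -/
def wdir (b : Bool) (f : ℂ^ι → V) (x w : ℂ^ι) : V :=
  (1 / 2 : ℂ) • (fderiv ℝ f x w + (wsgn b * Complex.I) • fderiv ℝ f x (Complex.I • w))

/-- The Wirtinger derivatives `∂/∂\bar z_a` (`b = true`) and `∂/∂z_a` (`b = false`). -/
def wd (b : Bool) (a : ι) (f : ℂ^ι → V) (x : ℂ^ι) : V := wdir b f x (Pi.single a 1)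

theorem I_smul_single (a : ι) :
    Complex.I • (Pi.single a 1 : ℂ^ι) = Pi.single a Complex.I := by
  rw [← Pi.single_smul]; simp

theorem pd_eq (a : ι) (f : ℂ^ι → ℂ) : pd a f = wd false a f := by
  ext x
  simp only [pd, wd, wdir, wsgn, I_smul_single, smul_eq_mul]
  ring

theorem pdbar_eq (a : ι) (f : ℂ^ι → ℂ) : pdbar a f = wd true a f := by
  ext x
  simp only [pdbar, wd, wdir, wsgn, I_smul_single, smul_eq_mul]
  ring

theorem wdir_add_right (b : Bool) (f : ℂ^ι → V) (x w w' : ℂ^ι) :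
    wdir b f x (w + w') = wdir b f x w + wdir b f x w' := by
  simp only [wdir, smul_add, map_add]; module

theorem wdir_smul_right (b : Bool) (f : ℂ^ι → V) (x w : ℂ^ι) (c : ℂ) :
    wdir b f x (c • w) = wconj b c • wdir b f x w := by
  have h1 : c • w = c.re • w + c.im • (Complex.I • w) := by
    ext i
    simp only [Pi.smul_apply, Pi.add_apply, smul_eq_mul, Complex.real_smul]
    conv_lhs => rw [← Complex.re_add_im c]
    ring
  have h2 : Complex.I • c • w = (-c.im) • w + c.re • (Complex.I • w) := by
    rw [h1]
    ext i
    simp only [Pi.smul_apply, Pi.add_apply, smul_eq_mul, Complex.real_smul]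
    push_cast
    linear_combination (c.im : ℂ) * w i * Complex.I_sq
  simp only [wdir]
  rw [h2, h1, map_add, map_add, (fderiv ℝ f x).map_smul, (fderiv ℝ f x).map_smul,
    (fderiv ℝ f x).map_smul, (fderiv ℝ f x).map_smul]
  have h3 : wconj b c = c.re - wsgn b * c.im * Complex.I := by
    cases b
    · simp [wconj, wsgn]
    · simp only [wconj, wsgn]; apply Complex.ext <;> simp
  have hs : wsgn b * wsgn b = 1 := by cases b <;> simp [wsgn]
  rw [h3]
  set A := fderiv ℝ f x w
  set B := fderiv ℝ f x (Complex.I • w)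
  have hr : ∀ (r : ℝ) (v : V), r • v = (r : ℂ) • v := fun r v => (Complex.coe_smul r v).symm
  simp only [hr]
  push_cast
  have hI := Complex.I_sq
  match_scalars
  all_goals
    first
      | ring1
      | linear_combination (c.im * (wsgn b * wsgn b) / 2 : ℂ) * hI - (c.im / 2 : ℂ) * hs

theorem wdir_eq_sum (b : Bool) (f : ℂ^ι → V) (x w : ℂ^ι) :
    wdir b f x w = ∑ a, wconj b (w a) • wd b a f x := by
  have hw : w = ∑ a, w a • (Pi.single a (1 : ℂ) : ℂ^ι) := by
    ext c
    simp [Finset.sum_apply, Pi.single_apply]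
  have h0 : wdir b f x 0 = 0 := by simp [wdir]
  have hs : ∀ s : Finset ι, wdir b f x (∑ a ∈ s, w a • (Pi.single a (1 : ℂ) : ℂ^ι)) =
      ∑ a ∈ s, wdir b f x (w a • (Pi.single a (1 : ℂ) : ℂ^ι)) := by
    intro s
    induction s using Finset.induction_on with
    | empty => simpa using h0
    | insert i s hi ih => rw [Finset.sum_insert hi, Finset.sum_insert hi, wdir_add_right, ih]
  conv_lhs => rw [hw, hs]
  simp only [wdir_smul_right]
  rfl

theorem wd_congr {f g : ℂ^ι → V} {x : ℂ^ι} (h : f =ᶠ[nhds x] g) (b : Bool) (a : ι) :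
    wd b a f x = wd b a g x := by
  simp only [wd, wdir, h.fderiv_eq]

theorem wd_congr_on {f g : ℂ^ι → V} {U : Set ℂ^ι} (hU : IsOpen U)
    (h : Set.EqOn f g U) (b : Bool) (a : ι) : Set.EqOn (wd b a f) (wd b a g) U :=
  fun _ hx => wd_congr (h.eventuallyEq_of_mem (hU.mem_nhds hx)) b a

theorem wd_clm (L : V →L[ℂ] W) {f : ℂ^ι → V} {x : ℂ^ι} (hf : DifferentiableAt ℝ f x)
    (b : Bool) (a : ι) : wd b a (fun y => L (f y)) x = L (wd b a f x) := by
  have h : fderiv ℝ (fun y => L (f y)) x = (L.restrictScalars ℝ).comp (fderiv ℝ f x) :=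
    ((L.restrictScalars ℝ).hasFDerivAt.comp x hf.hasFDerivAt).fderiv
  simp only [wd, wdir, h, ContinuousLinearMap.comp_apply, ContinuousLinearMap.coe_restrictScalars',
    map_smul, map_add]

theorem wd_const (v : V) (b : Bool) (a : ι) (x : ℂ^ι) : wd b a (fun _ => v) x = 0 := by
  simp [wd, wdir]

theorem wd_add {f g : ℂ^ι → V} {x : ℂ^ι} (hf : DifferentiableAt ℝ f x)
    (hg : DifferentiableAt ℝ g x) (b : Bool) (a : ι) :
    wd b a (fun y => f y + g y) x = wd b a f x + wd b a g x := by
  simp only [wd, wdir, fderiv_fun_add hf hg, _root_.add_apply]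
  module

theorem wd_neg (f : ℂ^ι → V) (x : ℂ^ι) (b : Bool) (a : ι) :
    wd b a (fun y => - f y) x = - wd b a f x := by
  simp only [wd, wdir, fderiv_fun_neg, _root_.neg_apply]
  module

theorem wd_sub {f g : ℂ^ι → V} {x : ℂ^ι} (hf : DifferentiableAt ℝ f x)
    (hg : DifferentiableAt ℝ g x) (b : Bool) (a : ι) :
    wd b a (fun y => f y - g y) x = wd b a f x - wd b a g x := by
  simp only [wd, wdir, fderiv_fun_sub hf hg, _root_.sub_apply]
  module

theorem wd_sum {J : Type*} (s : Finset J) {f : J → ℂ^ι → V} {x : ℂ^ι}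
    (hf : ∀ j ∈ s, DifferentiableAt ℝ (f j) x) (b : Bool) (a : ι) :
    wd b a (fun y => ∑ j ∈ s, f j y) x = ∑ j ∈ s, wd b a (f j) x := by
  simp only [wd, wdir, fderiv_fun_sum hf, _root_.sum_apply]
  rw [← smul_sum, sum_add_distrib, smul_sum (s := s) (r := wsgn b * Complex.I)]

theorem wd_const_smul {f : ℂ^ι → V} {x : ℂ^ι} (hf : DifferentiableAt ℝ f x) (c : ℂ)
    (b : Bool) (a : ι) : wd b a (fun y => c • f y) x = c • wd b a f x :=
  wd_clm (c • ContinuousLinearMap.id ℂ V) hf b a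

theorem wd_smul {c : ℂ^ι → ℂ} {f : ℂ^ι → V} {x : ℂ^ι} (hc : DifferentiableAt ℝ c x)
    (hf : DifferentiableAt ℝ f x) (b : Bool) (a : ι) :
    wd b a (fun y => c y • f y) x = c x • wd b a f x + wd b a c x • f x := by
  simp only [wd, wdir, fderiv_fun_smul hc hf, _root_.add_apply,
    _root_.smul_apply, ContinuousLinearMap.smulRight_apply]
  module

theorem wd_mul {A : Type*} [NormedRing A] [NormedAlgebra ℂ A] {f g : ℂ^ι → A} {x : ℂ^ι}
    (hf : DifferentiableAt ℝ f x) (hg : DifferentiableAt ℝ g x) (b : Bool) (a : ι) :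
    wd b a (fun y => f y * g y) x = f x * wd b a g x + wd b a f x * g x := by
  have h : fderiv ℝ (fun y => f y * g y) x = f x • fderiv ℝ g x +
      MulOpposite.op (g x) • fderiv ℝ f x := (hf.hasFDerivAt.mul' hg.hasFDerivAt).fderiv
  simp only [wd, wdir, h, _root_.add_apply, _root_.smul_apply]
  simp only [smul_eq_mul, MulOpposite.smul_eq_mul_unop, MulOpposite.unop_op, mul_smul_comm,
    smul_mul_assoc, mul_add, add_mul, smul_add]
  abel

theorem contDiffOn_wd {f : ℂ^ι → V} {U : Set ℂ^ι} (hU : IsOpen U)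
    (hf : SmoothOn f U) (b : Bool) (a : ι) : SmoothOn (wd b a f) U := by
  have h : SmoothOn (fderiv ℝ f) U := hf.fderiv_of_isOpen hU (by simp)
  exact ((h.clm_apply contDiffOn_const).add
    ((h.clm_apply contDiffOn_const).const_smul _)).const_smul _

theorem diffAt_of_contDiffOn {E : Type*} [NormedAddCommGroup E] [NormedSpace ℝ E]
    {f : E → V} {U : Set E} (hU : IsOpen U)
    (hf : SmoothOn f U) {x : E} (hx : x ∈ U) : DifferentiableAt ℝ f x :=
  (hf.contDiffAt (hU.mem_nhds hx)).differentiableAt (by simp)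

theorem fderiv_wdir {f : ℂ^ι → V} {U : Set ℂ^ι} (hU : IsOpen U)
    (hf : SmoothOn f U) {x : ℂ^ι} (hx : x ∈ U) (b : Bool) (w v : ℂ^ι) :
    fderiv ℝ (fun y => wdir b f y w) x v =
      (1 / 2 : ℂ) • (fderiv ℝ (fderiv ℝ f) x v w +
        (wsgn b * Complex.I) • fderiv ℝ (fderiv ℝ f) x v (Complex.I • w)) := by
  have h : DifferentiableAt ℝ (fderiv ℝ f) x :=
    diffAt_of_contDiffOn hU (hf.fderiv_of_isOpen hU (m := ∞) (by simp)) hx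
  have h1 : ∀ w, HasFDerivAt (fun y => fderiv ℝ f y w)
      ((fderiv ℝ (fderiv ℝ f) x).flip w) x := fun w =>
    (h.hasFDerivAt.clm_apply (hasFDerivAt_const w x)).congr_fderiv (by ext; simp)
  have h2 := ((h1 w).add ((h1 (Complex.I • w)).const_smul (wsgn b * Complex.I))).const_smul
    (1 / 2 : ℂ)
  have h3 := h2.fderiv
  change fderiv ℝ (fun y => wdir b f y w) x = _ at h3
  rw [h3]
  simp

theorem wd_comm {f : ℂ^ι → V} {U : Set ℂ^ι} (hU : IsOpen U)
    (hf : SmoothOn f U) {x : ℂ^ι} (hx : x ∈ U) (b b' : Bool) (a a' : ι) :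
    wd b a (wd b' a' f) x = wd b' a' (wd b a f) x := by
  have hs : IsSymmSndFDerivAt ℝ f x :=
    (hf.contDiffAt (hU.mem_nhds hx)).isSymmSndFDerivAt (by
      simpa using (WithTop.coe_le_coe.mpr le_top : ((2 : ℕ∞) : WithTop ℕ∞) ≤ ((⊤ : ℕ∞) : WithTop ℕ∞)))
  have h1 : ∀ (b b' : Bool) (a a' : ι), wd b a (wd b' a' f) x = (1 / 2 : ℂ) •
      (fderiv ℝ (fun y => wdir b' f y (Pi.single a' 1)) x (Pi.single a 1) +
      (wsgn b * Complex.I) • fderiv ℝ (fun y => wdir b' f y (Pi.single a' 1)) x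
        (Complex.I • Pi.single a 1)) := fun _ _ _ _ => rfl
  rw [h1, h1]
  simp only [fderiv_wdir hU hf hx]
  have e := hs.eq
  rw [e (Pi.single a 1) (Pi.single a' 1), e (Pi.single a 1) (Complex.I • Pi.single a' 1),
    e (Complex.I • Pi.single a 1) (Pi.single a' 1),
    e (Complex.I • Pi.single a 1) (Complex.I • Pi.single a' 1)]
  module

theorem wd_comp {f : ℂ^κ → V} {T : ℂ^ι → ℂ^κ} {x : ℂ^ι}
    (hf : DifferentiableAt ℝ f (T x)) (hT : DifferentiableAt ℂ T x) (b : Bool) (a : ι) :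
    wd b a (fun y => f (T y)) x =
      ∑ c, wconj b (fderiv ℂ T x (Pi.single a 1) c) • wd b c f (T x) := by
  rw [← wdir_eq_sum]
  have h : fderiv ℝ (fun y => f (T y)) x = (fderiv ℝ f (T x)).comp (fderiv ℝ T x) :=
    (hf.hasFDerivAt.comp x (hT.restrictScalars ℝ).hasFDerivAt).fderiv
  simp only [wd, wdir, h, hT.fderiv_restrictScalars ℝ, ContinuousLinearMap.comp_apply,
    ContinuousLinearMap.coe_restrictScalars', map_smul]

theorem wd_true_holomorphic {f : ℂ^ι → V} {x : ℂ^ι} (hf : DifferentiableAt ℂ f x) (a : ι) :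
    wd true a f x = 0 := by
  simp only [wd, wdir, wsgn, hf.fderiv_restrictScalars ℝ,
    ContinuousLinearMap.coe_restrictScalars', map_smul, smul_smul, one_mul, Complex.I_mul_I]
  simp

theorem wd_false_holomorphic {f : ℂ^ι → V} {x : ℂ^ι} (hf : DifferentiableAt ℂ f x) (a : ι) :
    wd false a f x = fderiv ℂ f x (Pi.single a 1) := by
  simp only [wd, wdir, wsgn, hf.fderiv_restrictScalars ℝ,
    ContinuousLinearMap.coe_restrictScalars', map_smul, smul_smul, neg_mul, one_mul,
    Complex.I_mul_I]
  module

theorem wd_conj {f : ℂ^ι → ℂ} {x : ℂ^ι} (hf : DifferentiableAt ℝ f x) (b : Bool) (a : ι) :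
    wd b a (fun y => conj (f y)) x = conj (wd (!b) a f x) := by
  have h : fderiv ℝ (fun y => conj (f y)) x =
      (Complex.conjCLE : ℂ →L[ℝ] ℂ).comp (fderiv ℝ f x) :=
    ((Complex.conjCLE : ℂ →L[ℝ] ℂ).hasFDerivAt.comp x hf.hasFDerivAt).fderiv
  have h2 : conj (1 / 2 : ℂ) = 1 / 2 := by simp [map_ofNat]
  cases b <;> simp only [wd, wdir, wsgn, h, smul_eq_mul, map_mul, h2] <;> simp

end Wirtinger

/-! ### The Chern character of the virtual bundle -/

theorem diffPoly_eq (k l m : ℕ) :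
    diffPoly k l m = (-1) ^ k * ((fwdDiff (1 : ℚ))^[k] (fun x : ℚ => x ^ l)) m := by
  rw [fwdDiff_iter_eq_sum_shift, diffPoly, mul_sum]
  refine sum_congr rfl fun j hj => ?_
  have hj' : j ≤ k := Nat.lt_succ_iff.mp (Finset.mem_range.mp hj)
  obtain ⟨d, rfl⟩ := Nat.exists_eq_add_of_le hj'
  have h1 : ((-1 : ℚ)) ^ (j + d) * (-1) ^ d = (-1) ^ j := by
    rw [pow_add, mul_assoc, ← mul_pow]; simp
  simp only [Nat.add_sub_cancel_left, zsmul_eq_mul, nsmul_eq_mul, mul_one]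
  push_cast
  linear_combination (-(((j + d).choose j : ℚ) * ((m : ℚ) + j) ^ l)) * h1

theorem diffPoly_eq_zero {k l : ℕ} (h : l < k) (m : ℕ) : diffPoly k l m = 0 := by
  rw [diffPoly_eq, fwdDiff_iter_pow_eq_zero_of_lt h]; simp

theorem diffPoly_self (k m : ℕ) : diffPoly k k m = (-1) ^ k * k.factorial := by
  rw [diffPoly_eq, fwdDiff_iter_eq_factorial]; simp

theorem isUnit_det_diffMatrix {n l : ℕ} (h : l ≤ n + 1) (m : ℕ) :
    IsUnit (diffMatrix n l m).det := by
  rw [Matrix.det_of_isUpperTriangular]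
  · rw [isUnit_iff_ne_zero, Finset.prod_ne_zero_iff]
    intro i _
    simp only [diffMatrix, Matrix.of_apply, diffPoly_self]
    exact mul_ne_zero (pow_ne_zero _ (by norm_num)) (by exact_mod_cast Nat.factorial_ne_zero _)
  · intro i j hij
    simp only [diffMatrix, Matrix.of_apply]
    refine diffPoly_eq_zero ?_ m
    have h1 : (j : ℕ) < (i : ℕ) := hij
    have := i.2
    omega

theorem sum_diffPoly_qCoeff (χ : Polynomial ℚ) {n l : ℕ} (h : l ≤ n + 1) (m : ℕ)
    (i : Fin (l + 1)) :
    ∑ j : Fin (l + 1), qCoeff χ n l m j * diffPoly (n + 1 - (j : ℕ)) (n + 1 - (i : ℕ)) m =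
      hilbCoeff χ n l (n + 1 - (i : ℕ)) := by
  have h1 : (diffMatrix n l m).mulVec (qCoeff χ n l m) =
      fun i : Fin (l + 1) => hilbCoeff χ n l (n + 1 - (i : ℕ)) := by
    unfold qCoeff
    rw [ Matrix.mulVec_mulVec, Matrix.mul_nonsing_inv _ (isUnit_det_diffMatrix h m),
      Matrix.one_mulVec]
  rw [← congrFun h1 i, Matrix.mulVec, dotProduct]
  refine sum_congr rfl fun j _ => ?_
  rw [mul_comm]; rfl

theorem chVirtual_eq {A : Type} [CommRing A] [Algebra ℂ A] (χ : Polynomial ℚ) (n l m : ℕ) (x : A) :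
    chVirtual χ n l m x = ∑ k ∈ Finset.range (n + 1 + 1),
      (((∑ j : Fin (l + 1), qCoeff χ n l m j * diffPoly (n + 1 - (j : ℕ)) k m : ℚ) : ℂ) /
        (k.factorial : ℂ)) • x ^ k := by
  simp only [chVirtual, chLine, smul_sum]
  have h1 : ∀ j : Fin (l + 1), ∀ f : ℕ → ℕ → A,
      ∑ i ∈ Finset.range (n + 1 - (j : ℕ) + 1), ∑ k ∈ Finset.range (n + 1 + 1), f i k =
      ∑ k ∈ Finset.range (n + 1 + 1), ∑ i ∈ Finset.range (n + 1 - (j : ℕ) + 1), f i k :=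
    fun j f => sum_comm
  simp only [h1]
  rw [sum_comm]
  refine sum_congr rfl fun k _ => ?_
  simp only [smul_pow, smul_smul, ← sum_smul]
  congr 1
  simp only [diffPoly]
  push_cast
  rw [Finset.sum_div]
  refine sum_congr rfl fun j _ => ?_
  rw [mul_sum, Finset.sum_div]
  refine sum_congr rfl fun i _ => ?_
  ring

/-- The coefficients `c_{2,k} / k!`. -/
def hilbTerm (χ : Polynomial ℚ) (n k : ℕ) : ℂ :=
  ((hilbCoeff χ n 2 k : ℚ) : ℂ) / (k.factorial : ℂ)

theorem chVirtual_two {A : Type} [CommRing A] [Algebra ℂ A] (χ : Polynomial ℚ) {n : ℕ}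
    (hn : 1 ≤ n) (m : ℕ) (x : A) :
    chVirtual χ n 2 m x = hilbTerm χ n (n - 1) • x ^ (n - 1) + hilbTerm χ n n • x ^ n +
      hilbTerm χ n (n + 1) • x ^ (n + 1) := by
  obtain ⟨p, rfl⟩ := Nat.exists_eq_add_of_le hn
  rw [chVirtual_eq]
  have hk : ∀ i : Fin 3, ∑ j : Fin (2 + 1), qCoeff χ (1 + p) 2 m j *
      diffPoly (1 + p + 1 - (j : ℕ)) (1 + p + 1 - (i : ℕ)) m =
        hilbCoeff χ (1 + p) 2 (1 + p + 1 - (i : ℕ)) :=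
    fun i => sum_diffPoly_qCoeff χ (by omega) m i
  have e : 1 + p + 1 + 1 = p + 3 := by omega
  rw [e, Finset.sum_range_succ, Finset.sum_range_succ, Finset.sum_range_succ]
  have h0 := hk 0
  have h1 := hk 1
  have h2 := hk 2
  have e0 : 1 + p + 1 - ((0 : Fin 3) : ℕ) = p + 2 := by simp; omega
  have e1 : 1 + p + 1 - ((1 : Fin 3) : ℕ) = p + 1 := by simp; omega
  have e2 : 1 + p + 1 - ((2 : Fin 3) : ℕ) = p := by
    have : ((2 : Fin 3) : ℕ) = 2 := rfl
    omega
  rw [e0] at h0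
  rw [e1] at h1
  rw [e2] at h2
  rw [h0, h1, h2, sum_eq_zero]
  · rw [zero_add]
    have a1 : 1 + p - 1 = p := by omega
    have a2 : 1 + p + 1 = p + 2 := by omega
    rw [a1, a2]
    simp only [hilbTerm, Nat.add_comm 1 p]
  · intro k hk
    have hk' : k < p := Finset.mem_range.mp hk
    rw [sum_eq_zero]
    · simp
    · intro j _
      rw [diffPoly_eq_zero (by have := j.2; omega), mul_zero]

/-! ### The Todd polynomial up to order two -/

section Todd

open Polynomial

variable {A : Type} [CommRing A] {r : ℕ}

theorem coeff_two_det_one_add_X_smul [Algebra ℂ A] (M : Matrix (Fin r) (Fin r) A) :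
    (Matrix.det (1 + (X : A[X]) • M.map C)).coeff 2 =
      (1 / 2 : ℂ) • (M.trace ^ 2 - (M * M).trace) := by
  set f : A[X] := Matrix.det (1 + (X : A[X]) • M.map C) with hf
  set g : A[X] := Matrix.det (1 + (X : A[X]) • (-(M * M)).map C) with hg
  have hf1 : f.coeff 1 = M.trace := Matrix.coeff_det_one_add_X_smul_one M
  have hg1 : g.coeff 1 = -(M * M).trace := by
    rw [hg, Matrix.coeff_det_one_add_X_smul_one, Matrix.trace_neg]
  have hf0 : f.coeff 0 = 1 := by
    rw [coeff_zero_eq_eval_zero, hf, eval_det_add_X_smul]; simp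
  have hcomp : f.comp (-X) = Matrix.det (1 - (X : A[X]) • M.map C) := by
    have h := RingHom.map_det (compRingHom (-X : A[X])) (1 + (X : A[X]) • M.map C)
    rw [coe_compRingHom_apply] at h
    rw [hf, h]
    congr 1
    ext1 i j
    simp only [RingHom.mapMatrix_apply, Matrix.map_apply, Matrix.add_apply, Matrix.smul_apply,
      smul_eq_mul, map_add, map_mul, coe_compRingHom_apply, X_comp, C_comp, Matrix.sub_apply]
    by_cases hij : i = j
    · subst hij; simp [sub_eq_add_neg]
    · simp [hij]
  have hexp : g.comp (X ^ 2) = Matrix.det (1 - (X : A[X]) ^ 2 • (M * M).map C) := by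
    have h := RingHom.map_det (compRingHom (X ^ 2 : A[X])) (1 + (X : A[X]) • (-(M * M)).map C)
    rw [coe_compRingHom_apply] at h
    rw [hg, h]
    congr 1
    ext1 i j
    simp only [RingHom.mapMatrix_apply, Matrix.map_apply, Matrix.add_apply, Matrix.smul_apply,
      smul_eq_mul, map_add, map_mul, coe_compRingHom_apply, X_comp, C_comp, Matrix.sub_apply]
    by_cases hij : i = j
    · subst hij; simp [sub_eq_add_neg]
    · simp [hij]
  have hprod : f * f.comp (-X) = g.comp (X ^ 2) := by
    rw [hcomp, hexp, hf, ← Matrix.det_mul]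
    congr 1
    rw [Matrix.map_mul, mul_sub, mul_one, add_mul, one_mul, Matrix.smul_mul, Matrix.mul_smul,
      smul_smul, sq]
    abel
  have hneg : ∀ k, (f.comp (-X)).coeff k = f.coeff k * (-1) ^ k := fun k => by
    rw [show (-X : A[X]) = C (-1) * X by simp, comp_C_mul_X_coeff]
  have h2 := congrArg (fun p => p.coeff 2) hprod
  simp only [coeff_mul, Finset.Nat.antidiagonal_succ, Finset.Nat.antidiagonal_zero,
    hneg] at h2
  have hX : (g.comp (X ^ 2)).coeff 2 = g.coeff 1 := by
    rw [← expand_eq_comp_X_pow]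
    exact coeff_expand_mul (p := 2) (by norm_num) g 1
  rw [hX, hg1] at h2
  simp [hf0, hf1] at h2
  have h3 : (2 : A) * f.coeff 2 = M.trace ^ 2 - (M * M).trace := by linear_combination h2
  rw [← h3, show (2 : A) = algebraMap ℂ A 2 from (map_ofNat _ 2).symm, ← Algebra.smul_def, smul_smul]
  norm_num

theorem coeff_det_mod {P Q : Matrix (Fin r) (Fin r) A[X]} {d : ℕ}
    (h : ∀ i j, X ^ d ∣ P i j - Q i j) {k : ℕ} (hk : k < d) :
    P.det.coeff k = Q.det.coeff k := by
  have h1 : (Ideal.Quotient.mk (Ideal.span {(X : A[X]) ^ d})) P.det =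
      (Ideal.Quotient.mk (Ideal.span {(X : A[X]) ^ d})) Q.det := by
    rw [RingHom.map_det, RingHom.map_det]
    congr 1
    ext1 i j
    simp only [RingHom.mapMatrix_apply, Matrix.map_apply]
    rw [Ideal.Quotient.mk_eq_mk_iff_sub_mem, Ideal.mem_span_singleton]
    exact h i j
  rw [Ideal.Quotient.mk_eq_mk_iff_sub_mem, Ideal.mem_span_singleton, X_pow_dvd_iff] at h1
  have := h1 k hk
  rwa [coeff_sub, sub_eq_zero] at this

variable [Algebra ℂ A]

theorem X_smul_map_pow (R : Matrix (Fin r) (Fin r) A) (k : ℕ) :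
    ((X : A[X]) • R.map C) ^ k = (X : A[X]) ^ k • (R ^ k).map C := by
  rw [_root_.smul_pow, Matrix.map_pow]

theorem todd_dvd (R : Matrix (Fin r) (Fin r) A) {K : ℕ} (hK : 2 ≤ K) (i j : Fin r) :
    (X : A[X]) ^ 3 ∣ (∑ k ∈ Finset.range (K + 1), (((bernoulli' k : ℚ) : ℂ) / (k.factorial : ℂ)) •
        ((X : A[X]) • R.map C) ^ k) i j -
      ((1 + (X : A[X]) • ((1 / 2 : ℂ) • R).map C) *
        (1 + (X : A[X]) ^ 2 • ((1 / 12 : ℂ) • (R * R)).map C)) i j := by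
  obtain ⟨p, rfl⟩ := Nat.exists_eq_add_of_le hK
  rw [show 2 + p + 1 = 3 + p by omega, Finset.sum_range_add, Finset.sum_range_succ,
    Finset.sum_range_succ, Finset.sum_range_succ, Finset.sum_range_zero]
  simp only [bernoulli'_zero, bernoulli'_one, bernoulli'_two, X_smul_map_pow]
  have e : ((X : A[X]) • ((1 / 2 : ℂ) • R).map C) *
      ((X : A[X]) ^ 2 • ((1 / 12 : ℂ) • (R * R)).map C) =
        (X : A[X]) ^ 3 • (((1 / 2 : ℂ) • R).map C * ((1 / 12 : ℂ) • (R * R)).map C) := by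
    rw [Matrix.smul_mul, Matrix.mul_smul, smul_smul, pow_succ' X 2]
  rw [mul_add, mul_one, add_mul, one_mul, e]
  have hm : ∀ (c : ℂ) (x : A), (C (c • x) : A[X]) = c • C x := fun c x => (smul_C c x).symm
  have hone : ((1 : Matrix (Fin r) (Fin r) A).map C) i j =
      (1 : Matrix (Fin r) (Fin r) A[X]) i j := by
    rw [Matrix.map_one _ C.map_zero C.map_one]
  have h0 : (X : A[X]) ^ 3 ∣
      (∑ x ∈ Finset.range p, (((bernoulli' (3 + x) : ℚ) : ℂ) / ((3 + x).factorial : ℂ)) •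
        (X : A[X]) ^ (3 + x) • (R ^ (3 + x)).map C) i j := by
    rw [Matrix.sum_apply]
    refine Finset.dvd_sum fun k _ => ?_
    rw [Matrix.smul_apply, Matrix.smul_apply, smul_eq_mul, ← mul_smul_comm, pow_add, mul_assoc]
    exact dvd_mul_right _ _
  have h1 : (X : A[X]) ^ 3 ∣ ((X : A[X]) ^ 3 •
      (((1 / 2 : ℂ) • R).map C * ((1 / 12 : ℂ) • (R * R)).map C)) i j := by
    rw [Matrix.smul_apply, smul_eq_mul]; exact dvd_mul_right _ _
  refine (dvd_sub h0 h1).trans (dvd_of_eq ?_)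
  simp only [Matrix.add_apply, Matrix.smul_apply, Matrix.map_apply, pow_zero, pow_one, one_smul,
    smul_eq_mul, pow_two R, hm, mul_smul_comm, zero_add]
  norm_num [Nat.factorial]
  rw [← hone]
  simp only [Matrix.map_apply]
  abel

theorem coeff_todd (R : Matrix (Fin r) (Fin r) A) {K : ℕ} (hK : 2 ≤ K) :
    (todd K ((X : A[X]) • R.map C)).coeff 0 = 1 ∧
    (todd K ((X : A[X]) • R.map C)).coeff 1 = (1 / 2 : ℂ) • R.trace ∧
    (todd K ((X : A[X]) • R.map C)).coeff 2 =
      (1 / 8 : ℂ) • R.trace ^ 2 - (1 / 24 : ℂ) • (R * R).trace := by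
  set f : A[X] := Matrix.det (1 + (X : A[X]) • ((1 / 2 : ℂ) • R).map C) with hf
  set g : A[X] := Matrix.det (1 + (X : A[X]) • ((1 / 12 : ℂ) • (R * R)).map C) with hg
  have hexp : expand A 2 g =
      Matrix.det (1 + (X : A[X]) ^ 2 • ((1 / 12 : ℂ) • (R * R)).map C) := by
    have h := RingHom.map_det (expand A 2 : A[X] →+* A[X])
      (1 + (X : A[X]) • ((1 / 12 : ℂ) • (R * R)).map C)
    rw [hg]
    refine h.trans ?_
    congr 1
    ext1 i j
    simp only [RingHom.mapMatrix_apply, Matrix.map_apply, Matrix.add_apply, Matrix.smul_apply,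
      smul_eq_mul, map_add, map_mul, RingHom.coe_coe, expand_X, expand_C]
    by_cases hij : i = j
    · subst hij; simp
    · simp [hij]
  have key : ∀ k < 3, (todd K ((X : A[X]) • R.map C)).coeff k = (f * expand A 2 g).coeff k := by
    intro k hk
    rw [hexp, hf, ← Matrix.det_mul, todd]
    exact coeff_det_mod (d := 3) (fun i j => todd_dvd R hK i j) hk
  have hf0 : f.coeff 0 = 1 := by
    rw [coeff_zero_eq_eval_zero, hf, eval_det_add_X_smul]; simp
  have hg0 : g.coeff 0 = 1 := by
    rw [coeff_zero_eq_eval_zero, hg, eval_det_add_X_smul]; simp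
  have hf1 : f.coeff 1 = (1 / 2 : ℂ) • R.trace := by
    rw [hf, Matrix.coeff_det_one_add_X_smul_one, Matrix.trace_smul]
  have hg1 : g.coeff 1 = (1 / 12 : ℂ) • (R * R).trace := by
    rw [hg, Matrix.coeff_det_one_add_X_smul_one, Matrix.trace_smul]
  have hf2 := coeff_two_det_one_add_X_smul ((1 / 2 : ℂ) • R)
  rw [← hf] at hf2
  have he0 : (expand A 2 g).coeff 0 = 1 := by
    rw [← hg0]; exact coeff_expand_mul (p := 2) (by norm_num) g 0
  have he1 : (expand A 2 g).coeff 1 = 0 := by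
    rw [coeff_expand (by norm_num)]; norm_num
  have he2 : (expand A 2 g).coeff 2 = (1 / 12 : ℂ) • (R * R).trace := by
    rw [← hg1]; exact coeff_expand_mul (p := 2) (by norm_num) g 1
  refine ⟨?_, ?_, ?_⟩
  · rw [key 0 (by norm_num), mul_coeff_zero, hf0, he0, mul_one]
  · rw [key 1 (by norm_num), coeff_mul]
    simp [Finset.Nat.antidiagonal_succ, hf0, hf1, he0, he1]
  · rw [key 2 (by norm_num), coeff_mul]
    simp only [Finset.Nat.antidiagonal_succ, Finset.Nat.antidiagonal_zero]
    simp [hf0, hf1, he0, he1, he2, hf2]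
    rw [_root_.smul_pow]
    module

end Todd

/-! ### The component of degree `n + 1` of `Td · Ch` -/

section ChernWeilPoly

open Polynomial

variable {A B : Type} [CommRing A] [Algebra ℂ A] [CommRing B] [Algebra ℂ B] {r : ℕ}

/-- The homogeneous component of degree `n + 1` of `Td(R) Ch(F)`. -/
def cwPoly (c : ℕ → ℂ) (n : ℕ) (R : Matrix (Fin r) (Fin r) A) (F : A) : A :=
  c (n - 1) • (((1 / 8 : ℂ) • R.trace ^ 2 - (1 / 24 : ℂ) • (R * R).trace) * F ^ (n - 1)) +
    c n • ((1 / 2 : ℂ) • R.trace * F ^ n) + c (n + 1) • F ^ (n + 1)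

/-- The derivative of `cwPoly` at `(R, F)` in the direction `(E, e)`. -/
def dcwPoly (c : ℕ → ℂ) (n : ℕ) (R : Matrix (Fin r) (Fin r) A) (F : A)
    (E : Matrix (Fin r) (Fin r) A) (e : A) : A :=
  c (n - 1) • (((1 / 4 : ℂ) • (R.trace * E.trace) - (1 / 12 : ℂ) • (R * E).trace) * F ^ (n - 1) +
      ((1 / 8 : ℂ) • R.trace ^ 2 - (1 / 24 : ℂ) • (R * R).trace) *
        (((n - 1 : ℕ) : ℂ) • (F ^ (n - 1 - 1) * e))) +
    c n • ((1 / 2 : ℂ) • E.trace * F ^ n +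
      (1 / 2 : ℂ) • R.trace * ((n : ℂ) • (F ^ (n - 1) * e))) +
    c (n + 1) • (((n + 1 : ℕ) : ℂ) • (F ^ n * e))

theorem map_trace_algHom (φ : A →ₐ[ℂ] B) (R : Matrix (Fin r) (Fin r) A) :
    (R.map φ).trace = φ R.trace := by
  simp [Matrix.trace]

theorem map_mul_algHom (φ : A →ₐ[ℂ] B) (R S : Matrix (Fin r) (Fin r) A) :
    R.map φ * S.map φ = (R * S).map φ := (Matrix.map_mul (f := (φ : A →+* B))).symm

theorem map_cwPoly (φ : A →ₐ[ℂ] B) (c : ℕ → ℂ) (n : ℕ) (R : Matrix (Fin r) (Fin r) A) (F : A) :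
    φ (cwPoly c n R F) = cwPoly c n (R.map φ) (φ F) := by
  simp only [cwPoly, map_add, map_smul, map_mul, map_sub, map_pow, map_mul_algHom,
    map_trace_algHom]

theorem map_dcwPoly (φ : A →ₐ[ℂ] B) (c : ℕ → ℂ) (n : ℕ) (R : Matrix (Fin r) (Fin r) A) (F : A)
    (E : Matrix (Fin r) (Fin r) A) (e : A) :
    φ (dcwPoly c n R F E e) = dcwPoly c n (R.map φ) (φ F) (E.map φ) (φ e) := by
  simp only [dcwPoly, map_add, map_smul, map_mul, map_sub, map_pow, map_mul_algHom,
    map_trace_algHom]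

theorem map_todd (φ : A →ₐ[ℂ] B) (K : ℕ) (R : Matrix (Fin r) (Fin r) A) :
    φ (todd K R) = todd K (R.map φ) := by
  unfold todd
  rw [AlgHom.map_det]
  congr 1
  rw [map_sum]
  refine sum_congr rfl fun k _ => ?_
  rw [map_smul, map_pow]
  rfl

theorem map_chVirtual (φ : A →ₐ[ℂ] B) (χ : ℚ[X]) (n l m : ℕ) (x : A) :
    φ (chVirtual χ n l m x) = chVirtual χ n l m (φ x) := by
  simp only [chVirtual, chLine, map_sum, map_smul, map_pow]

theorem cwPoly_congr (c : ℕ → ℂ) (n : ℕ) {R R' : Matrix (Fin r) (Fin r) A} {F F' : A}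
    (h1 : R.trace = R'.trace) (h2 : (R * R).trace = (R' * R').trace) (h3 : F = F') :
    cwPoly c n R F = cwPoly c n R' F' := by
  simp only [cwPoly, h1, h2, h3]

theorem dcwPoly_congr (c : ℕ → ℂ) (n : ℕ) {R R' E E' : Matrix (Fin r) (Fin r) A} {F F' e e' : A}
    (h1 : R.trace = R'.trace) (h2 : (R * R).trace = (R' * R').trace) (h3 : F = F')
    (h4 : E.trace = E'.trace) (h5 : (R * E).trace = (R' * E').trace) (h6 : e = e') :
    dcwPoly c n R F E e = dcwPoly c n R' F' E' e' := by
  simp only [dcwPoly, h1, h2, h3, h4, h5, h6]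

theorem dcwPoly_zero (c : ℕ → ℂ) (n : ℕ) (R : Matrix (Fin r) (Fin r) A) (F : A) :
    dcwPoly c n R F 0 0 = 0 := by
  simp [dcwPoly]

theorem dcwPoly_neg (c : ℕ → ℂ) (n : ℕ) (R E : Matrix (Fin r) (Fin r) A) (F e : A) :
    dcwPoly c n R F (-E) (-e) = -dcwPoly c n R F E e := by
  simp only [dcwPoly, Matrix.trace_neg, mul_neg, smul_neg, neg_mul]
  simp only [sub_eq_add_neg, neg_add, neg_mul, smul_neg, add_mul, smul_add, neg_neg]

theorem dcwPoly_add (c : ℕ → ℂ) (n : ℕ) (R E E' : Matrix (Fin r) (Fin r) A) (F e e' : A) :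
    dcwPoly c n R F (E + E') (e + e') = dcwPoly c n R F E e + dcwPoly c n R F E' e' := by
  simp only [dcwPoly, Matrix.trace_add, mul_add, smul_add, sub_eq_add_neg, add_mul, neg_mul, neg_add,
    smul_neg]
  abel

theorem dcwPoly_smul (c : ℕ → ℂ) (n : ℕ) (R E : Matrix (Fin r) (Fin r) A) (F e : A) (s : ℂ) :
    dcwPoly c n R F (s • E) (s • e) = s • dcwPoly c n R F E e := by
  simp only [dcwPoly, Matrix.trace_smul, mul_smul_comm, smul_mul_assoc, smul_add,
    sub_eq_add_neg, add_mul, neg_mul, smul_neg, smul_comm s]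

theorem dcwPoly_sum (c : ℕ → ℂ) (n : ℕ) {J : Type*} (s : Finset J)
    (R : Matrix (Fin r) (Fin r) A) (F : A) (E : J → Matrix (Fin r) (Fin r) A) (e : J → A) :
    dcwPoly c n R F (∑ j ∈ s, E j) (∑ j ∈ s, e j) = ∑ j ∈ s, dcwPoly c n R F (E j) (e j) := by
  classical
  induction s using Finset.induction_on with
  | empty => simp [dcwPoly_zero]
  | insert a s ha ih => rw [Finset.sum_insert ha, Finset.sum_insert ha, Finset.sum_insert ha,
      dcwPoly_add, ih]

theorem cwPoly_add_smul (c : ℕ → ℂ) (n : ℕ) (R E : Matrix (Fin r) (Fin r) A)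
    (F e x : A) : ∃ Q, cwPoly c n (R + x • E) (F + x * e) =
      cwPoly c n R F + x * dcwPoly c n R F E e + x ^ 2 * Q := by
  obtain ⟨k₀, h₀⟩ := Polynomial.powAddExpansion F (x * e) (n - 1)
  obtain ⟨k₁, h₁⟩ := Polynomial.powAddExpansion F (x * e) n
  obtain ⟨k₂, h₂⟩ := Polynomial.powAddExpansion F (x * e) (n + 1)
  have ht : (R + x • E).trace = R.trace + x * E.trace := by
    rw [Matrix.trace_add, Matrix.trace_smul, smul_eq_mul]
  have ht2 : ((R + x • E) * (R + x • E)).trace =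
      (R * R).trace + 2 * x * (R * E).trace + x ^ 2 * (E * E).trace := by
    rw [Matrix.add_mul, Matrix.mul_add, Matrix.mul_add]
    simp only [Matrix.trace_add, Matrix.smul_mul, Matrix.mul_smul, Matrix.trace_smul, smul_eq_mul]
    rw [Matrix.trace_mul_comm E R]
    ring
  set q : A := algebraMap ℂ A (1 / 24) with hq
  have a8 : algebraMap ℂ A (1 / 8) = 3 * q := by
    rw [hq, ← map_ofNat (algebraMap ℂ A) 3, ← map_mul]; norm_num
  have a4 : algebraMap ℂ A (1 / 4) = 6 * q := by
    rw [hq, ← map_ofNat (algebraMap ℂ A) 6, ← map_mul]; norm_num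
  have a12 : algebraMap ℂ A (1 / 12) = 2 * q := by
    rw [hq, ← map_ofNat (algebraMap ℂ A) 2, ← map_mul]; norm_num
  simp only [cwPoly, dcwPoly, ht, ht2, h₀, h₁, h₂, Nat.add_sub_cancel]
  simp only [Algebra.smul_def, a8, a4, a12, ← hq, map_natCast]
  generalize algebraMap ℂ A (1 / 2) = w
  generalize algebraMap ℂ A (c (n - 1)) = c₀
  generalize algebraMap ℂ A (c n) = c₁
  generalize algebraMap ℂ A (c (n + 1)) = c₂
  generalize R.trace = a
  generalize E.trace = b
  generalize (R * R).trace = d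
  generalize (R * E).trace = g
  generalize (E * E).trace = h
  generalize F ^ (n - 1 - 1) = f₁
  generalize F ^ (n - 1) = f₂
  generalize F ^ n = f₃
  generalize F ^ (n + 1) = f₄
  generalize ((n - 1 : ℕ) : A) = m₀
  generalize ((n : ℕ) : A) = m₁
  refine ⟨c₀ * ((3 * q * a ^ 2 - q * d) * (k₀ * e ^ 2) +
    (6 * q * a * b - 2 * q * g) * (m₀ * f₁ * e + x * k₀ * e ^ 2) +
    (3 * q * b ^ 2 - q * h) * (f₂ + m₀ * f₁ * (x * e) + k₀ * (x * e) ^ 2)) +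
    c₁ * (w * b * (m₁ * f₂ * e + x * k₁ * e ^ 2) + w * a * k₁ * e ^ 2) + c₂ * k₂ * e ^ 2, ?_⟩
  push_cast
  ring

theorem coeff_cwPoly (c : ℕ → ℂ) (n : ℕ) (R E : Matrix (Fin r) (Fin r) A) (F e : A) :
    (cwPoly c n (R.map C + (X : A[X]) • E.map C) (C F + X * C e)).coeff 0 = cwPoly c n R F ∧
    (cwPoly c n (R.map C + (X : A[X]) • E.map C) (C F + X * C e)).coeff 1 =
      dcwPoly c n R F E e := by
  obtain ⟨Q, hQ⟩ := cwPoly_add_smul c n (R.map C) (E.map C) (C F) (C e) (X : A[X])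
  have h1 : cwPoly c n (R.map C) (C F) = C (cwPoly c n R F) :=
    (map_cwPoly (CAlgHom : A →ₐ[ℂ] A[X]) c n R F).symm
  have h2 : dcwPoly c n (R.map C) (C F) (E.map C) (C e) = C (dcwPoly c n R F E e) :=
    (map_dcwPoly (CAlgHom : A →ₐ[ℂ] A[X]) c n R F E e).symm
  rw [hQ, h1, h2, show (X : A[X]) ^ 2 * Q = X * (X * Q) by ring]
  constructor
  · simp
  · rw [coeff_add, coeff_add, coeff_X_mul, coeff_X_mul, mul_coeff_zero, coeff_X_zero, coeff_C]
    simp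

theorem coeff_todd_mul_chVirtual (χ : ℚ[X]) {n : ℕ} (hn : 1 ≤ n) (m : ℕ)
    (R : Matrix (Fin r) (Fin r) A) (F : A) :
    (todd (n + 1) ((X : A[X]) • R.map C) * chVirtual χ n 2 m (X * C F)).coeff (n + 1) =
      cwPoly (hilbTerm χ n) n R F := by
  obtain ⟨t0, t1, t2⟩ := coeff_todd R (show 2 ≤ n + 1 by omega)
  have hterm : ∀ (T : A[X]) (c : ℂ) (p j : ℕ), p + j = n + 1 →
      (T * c • (X * C F) ^ p).coeff (n + 1) = c • (T.coeff j * F ^ p) := by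
    intro T c p j h
    rw [mul_smul_comm, coeff_smul, mul_pow, ← C_pow, ← mul_assoc, coeff_mul_C, ← h,
      add_comm p j, coeff_mul_X_pow]
  rw [chVirtual_two χ hn, mul_add, mul_add, coeff_add, coeff_add,
    hterm _ _ (n - 1) 2 (by omega), hterm _ _ n 1 rfl, hterm _ _ (n + 1) 0 rfl, t0, t1, t2, one_mul]
  rfl

theorem exists_poly_eval (Λ : B →ₗ[ℂ] ℂ) (Q : B[X]) : ∃ p : ℂ[X],
    (∀ k, p.coeff k = Λ (Q.coeff k)) ∧ ∀ s : ℂ, p.eval s = Λ (Q.eval (algebraMap ℂ B s)) := by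
  refine ⟨∑ k ∈ Finset.range (Q.natDegree + 1), monomial k (Λ (Q.coeff k)), ?_, ?_⟩
  · intro k
    rw [finsetSum_coeff]
    simp only [coeff_monomial, Finset.sum_ite_eq', Finset.mem_range]
    split_ifs with h
    · rfl
    · rw [coeff_eq_zero_of_natDegree_lt (by omega), map_zero]
  · intro s
    rw [eval_finsetSum, eval_eq_sum_range, map_sum]
    refine sum_congr rfl fun k _ => ?_
    rw [eval_monomial, ← map_pow, mul_comm (Q.coeff k), ← Algebra.smul_def, map_smul, smul_eq_mul,
      mul_comm]

theorem eq_of_eval_eq_of_ne {p q : ℂ[X]} (a : ℂ) (h : ∀ s, s ≠ a → p.eval s = q.eval s) :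
    p = q := by
  refine eq_of_infinite_eval_eq p q ?_
  refine Set.Infinite.mono (s := {a}ᶜ) (fun s hs => h s hs) ?_
  exact (Set.finite_singleton a).infinite_compl

theorem linearMap_dcwPoly_eq (c : ℕ → ℂ) (n : ℕ) (Λ : A →ₗ[ℂ] ℂ)
    (R E : Matrix (Fin r) (Fin r) A) (F e : A)
    (h : ∀ s : ℂ, s ≠ 0 → Λ (cwPoly c n (R + (s - 1) • E) (F + (s - 1) • e)) =
      s * Λ (cwPoly c n R F)) :
    Λ (dcwPoly c n R F E e) = Λ (cwPoly c n R F) := by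
  obtain ⟨h0, h1⟩ := coeff_cwPoly c n R E F e
  set Q := cwPoly c n (R.map C + (X : A[X]) • E.map C) (C F + X * C e) with hQ
  obtain ⟨p, hp, hev⟩ := exists_poly_eval Λ Q
  have hq : p = C (Λ (cwPoly c n R F)) * (1 + X) := by
    refine eq_of_eval_eq_of_ne (-1) fun t ht => ?_
    have hs : t + 1 ≠ 0 := fun h => ht (eq_neg_of_add_eq_zero_left h)
    have h2 := h (t + 1) hs
    have h3 : Q.eval (algebraMap ℂ A t) = cwPoly c n (R + t • E) (F + t • e) := by
      have := map_cwPoly ((aeval (algebraMap ℂ A t) : A[X] →ₐ[A] A).restrictScalars ℂ) c n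
        (R.map C + (X : A[X]) • E.map C) (C F + X * C e)
      rw [← hQ] at this
      simp only [AlgHom.coe_restrictScalars', coe_aeval_eq_eval] at this
      rw [this]
      congr 1
      · ext i j
        simp only [Matrix.map_apply, Matrix.add_apply, Matrix.smul_apply, smul_eq_mul, eval_add,
          eval_mul, eval_X, eval_C]
        rw [Algebra.smul_def]
      · rw [eval_add, eval_mul, eval_X, eval_C, eval_C, Algebra.smul_def]
    rw [hev, h3]
    rw [add_sub_cancel_right] at h2
    rw [h2]
    simp only [eval_mul, eval_C, eval_add, eval_one, eval_X]
    ring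
  have h2 := congrArg (fun p => p.coeff 1) hq
  simp only [hp, h1] at h2
  rw [h2]
  simp [coeff_one]

/-- The substitution `X ↦ s X`, combined with an endomorphism of the coefficients. -/
def rescaleHom (φ : A →ₐ[ℂ] A) (s : ℂ) : A[X] →ₐ[ℂ] A[X] :=
  ((aeval (C (algebraMap ℂ A s) * X) : A[X] →ₐ[A] A[X]).restrictScalars ℂ).comp (mapAlgHom φ)

theorem rescaleHom_apply (φ : A →ₐ[ℂ] A) (s : ℂ) (P : A[X]) :
    rescaleHom φ s P = (P.map (φ : A →+* A)).comp (C (algebraMap ℂ A s) * X) := rfl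

theorem rescaleHom_C (φ : A →ₐ[ℂ] A) (s : ℂ) (a : A) : rescaleHom φ s (C a) = C (φ a) := by
  rw [rescaleHom_apply, map_C, C_comp]; rfl

theorem rescaleHom_X (φ : A →ₐ[ℂ] A) (s : ℂ) : rescaleHom φ s X = s • X := by
  rw [rescaleHom_apply, map_X, X_comp, Algebra.smul_def]; rfl

theorem rescaleHom_coeff_one (φ : A →ₐ[ℂ] A) (s : ℂ) (P : A[X]) :
    (rescaleHom φ s P).coeff 1 = s • φ (P.coeff 1) := by
  rw [rescaleHom_apply, comp_C_mul_X_coeff, pow_one, coeff_map, mul_comm, ← Algebra.smul_def]; rfl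

/-- Evaluation at a scalar. -/
def evalScalar (s : ℂ) : A[X] →ₐ[ℂ] A :=
  (aeval (algebraMap ℂ A s) : A[X] →ₐ[A] A).restrictScalars ℂ

theorem evalScalar_apply (s : ℂ) (P : A[X]) : evalScalar s P = P.eval (algebraMap ℂ A s) := by
  rw [← coe_aeval_eq_eval]; rfl

theorem eval_todd_mul_chVirtual (χ : ℚ[X]) (n m : ℕ) (R : Matrix (Fin r) (Fin r) A) (F : A)
    (s : ℂ) :
    (todd (n + 1) ((X : A[X]) • R.map C) * chVirtual χ n 2 m (X * C F)).eval (algebraMap ℂ A s) =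
      todd (n + 1) (s • R) * chVirtual χ n 2 m (s • F) := by
  rw [← evalScalar_apply, map_mul, map_todd, map_chVirtual]
  congr 2
  · ext1 i j
    rw [Matrix.map_apply, evalScalar_apply, Matrix.smul_apply, Matrix.smul_apply, Matrix.map_apply,
      smul_eq_mul, eval_mul, eval_X, eval_C, Algebra.smul_def]
  · rw [evalScalar_apply, eval_mul, eval_X, eval_C, Algebra.smul_def]

theorem linearMap_coeff_eq (χ : ℚ[X]) {n : ℕ} (hn : 1 ≤ n) (m : ℕ) (Λ : A →ₗ[ℂ] ℂ)
    (φ : ℂ → A →ₐ[ℂ] A) (hφ : ∀ s, s ≠ 0 → ∀ x, Λ (φ s x) = s ^ n * Λ x)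
    (R E : Matrix (Fin r) (Fin r) A) (F e : A)
    (hR : ∀ s, s ≠ 0 → R.map (φ s) = s • R) (hF : ∀ s, s ≠ 0 → φ s F = s • F)
    (hE : ∀ s, s ≠ 0 → E.map (φ s) = E) (he : ∀ s, s ≠ 0 → φ s e = e) :
    Λ ((todd (n + 1) (R.map C + (X : A[X]) • E.map C) *
      chVirtual χ n 2 m (C F + X * C e)).coeff 1) = Λ (dcwPoly (hilbTerm χ n) n R F E e) := by
  set R' := R.map C + (X : A[X]) • E.map C with hR'
  set F' := C F + X * C e with hF'
  set Q : A[X][X] := todd (n + 1) ((X : A[X][X]) • R'.map C) * chVirtual χ n 2 m (X * C F') with hQ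
  obtain ⟨p, hp, hev⟩ := exists_poly_eval (Λ ∘ₗ (lcoeff A 1).restrictScalars ℂ) Q
  have h1 : p = C (Λ ((todd (n + 1) R' * chVirtual χ n 2 m F').coeff 1)) * X ^ (n + 1) := by
    refine eq_of_eval_eq_of_ne 0 fun s hs => ?_
    have e1 : Q.eval (algebraMap ℂ A[X] s) =
        todd (n + 1) (s • R') * chVirtual χ n 2 m (s • F') := eval_todd_mul_chVirtual χ n m R' F' s
    have e2 : s • R' = R'.map (rescaleHom (φ s) s) := by
      ext1 i j
      have b1 : φ s (R i j) = s • R i j := by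
        have := congrFun (congrFun (hR s hs) i) j
        simpa using this
      have b2 : φ s (E i j) = E i j := by
        have := congrFun (congrFun (hE s hs) i) j
        simpa using this
      simp only [hR', Matrix.smul_apply, Matrix.add_apply, Matrix.map_apply, smul_eq_mul, map_add,
        map_mul, rescaleHom_C, rescaleHom_X, b1, b2, smul_add, smul_mul_assoc, smul_C]
    have e3 : s • F' = rescaleHom (φ s) s F' := by
      simp only [hF', map_add, map_mul, rescaleHom_C, rescaleHom_X, hF s hs, he s hs, smul_add,
        smul_mul_assoc, smul_C]
    rw [hev, e1, e2, e3, ← map_todd, ← map_chVirtual, ← map_mul]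
    simp only [LinearMap.comp_apply, LinearMap.restrictScalars_apply, lcoeff_apply, eval_mul, eval_C,
      eval_pow, eval_X]
    rw [rescaleHom_coeff_one, map_smul, hφ s hs, smul_eq_mul]
    ring
  have h2 := congrArg (fun p => p.coeff (n + 1)) h1
  simp only [hp, coeff_C_mul, coeff_X_pow, if_true, mul_one] at h2
  rw [← h2, hQ, coeff_todd_mul_chVirtual χ hn m R' F', ← (coeff_cwPoly (hilbTerm χ n) n R E F e).2]
  rfl

theorem cwPoly_mem (S : Submodule ℂ A) (c : ℕ → ℂ) {n : ℕ} (hn : 1 ≤ n)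
    {R : Matrix (Fin r) (Fin r) A} {F : A} (hR : ∀ i j, R i j ∈ S) (hF : F ∈ S) :
    cwPoly c n R F ∈ S ^ (n + 1) := by
  have ht : R.trace ∈ S := Submodule.sum_mem _ fun i _ => hR i i
  have ht2 : (R * R).trace ∈ S ^ 2 := Submodule.sum_mem _ fun i _ => by
    rw [Matrix.diag_apply, Matrix.mul_apply, sq]
    exact Submodule.sum_mem _ fun j _ => Submodule.mul_mem_mul (hR i j) (hR j i)
  have e1 : S ^ (n + 1) = S ^ 2 * S ^ (n - 1) := by rw [← pow_add]; congr 1; omega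
  have e2 : S ^ (n + 1) = S * S ^ n := pow_succ' S n
  refine Submodule.add_mem _ (Submodule.add_mem _ ?_ ?_) ?_
  · rw [e1]
    refine Submodule.smul_mem _ _ (Submodule.mul_mem_mul ?_ (Submodule.pow_mem_pow S hF _))
    exact Submodule.sub_mem _ (Submodule.smul_mem _ _ (Submodule.pow_mem_pow S ht _))
      (Submodule.smul_mem _ _ ht2)
  · rw [e2]
    exact Submodule.smul_mem _ _ (Submodule.mul_mem_mul (Submodule.smul_mem _ _ ht)
      (Submodule.pow_mem_pow S hF _))
  · exact Submodule.smul_mem _ _ (Submodule.pow_mem_pow S hF _)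

theorem dcwPoly_mem (S : Submodule ℂ A) (c : ℕ → ℂ) {n : ℕ} (hn : 1 ≤ n)
    {R : Matrix (Fin r) (Fin r) A} {F : A} (hR : ∀ i j, R i j ∈ S) (hF : F ∈ S)
    (E : Matrix (Fin r) (Fin r) ℂ) (e : ℂ) :
    dcwPoly c n R F (E.map (algebraMap ℂ A)) (algebraMap ℂ A e) ∈ S ^ n := by
  have ht : R.trace ∈ S := Submodule.sum_mem _ fun i _ => hR i i
  have ht2 : (R * R).trace ∈ S ^ 2 := Submodule.sum_mem _ fun i _ => by
    rw [Matrix.diag_apply, Matrix.mul_apply, sq]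
    exact Submodule.sum_mem _ fun j _ => Submodule.mul_mem_mul (hR i j) (hR j i)
  have hRE : (R * E.map (algebraMap ℂ A)).trace ∈ S := Submodule.sum_mem _ fun i _ => by
    rw [Matrix.diag_apply, Matrix.mul_apply]
    refine Submodule.sum_mem _ fun j _ => ?_
    rw [mul_comm, Matrix.map_apply, ← Algebra.smul_def]
    exact Submodule.smul_mem _ _ (hR i j)
  have hE : (E.map (algebraMap ℂ A)).trace = algebraMap ℂ A E.trace := by simp [Matrix.trace]
  have hc : ∀ (T : Submodule ℂ A) (x : A), x ∈ T → x * algebraMap ℂ A e ∈ T := by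
    intro T x hx
    rw [mul_comm, ← Algebra.smul_def]
    exact Submodule.smul_mem _ _ hx
  have e1 : S ^ n = S * S ^ (n - 1) := by rw [← pow_succ']; congr 1; omega
  have hd : 2 ≤ n → S ^ n = S ^ 2 * S ^ (n - 1 - 1) := by
    intro h; rw [← pow_add]; congr 1; omega
  refine Submodule.add_mem _ (Submodule.add_mem _ (Submodule.smul_mem _ _
    (Submodule.add_mem _ ?_ ?_)) (Submodule.smul_mem _ _ (Submodule.add_mem _ ?_ ?_))) ?_
  · rw [e1]
    refine Submodule.mul_mem_mul (Submodule.sub_mem _ (Submodule.smul_mem _ _ ?_)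
      (Submodule.smul_mem _ _ hRE)) (Submodule.pow_mem_pow S hF _)
    rw [hE, mul_comm, ← Algebra.smul_def]
    exact Submodule.smul_mem _ _ ht
  · by_cases h2 : 2 ≤ n
    · rw [hd h2]
      refine Submodule.mul_mem_mul (Submodule.sub_mem _ (Submodule.smul_mem _ _
        (Submodule.pow_mem_pow S ht _)) (Submodule.smul_mem _ _ ht2)) (Submodule.smul_mem _ _ ?_)
      exact hc _ _ (Submodule.pow_mem_pow S hF _)
    · have : n - 1 = 0 := by omega
      rw [this]
      simp
  · rw [hE, smul_mul_assoc, ← Algebra.smul_def]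
    exact Submodule.smul_mem _ _ (Submodule.smul_mem _ _ (Submodule.pow_mem_pow S hF _))
  · rw [e1]
    exact Submodule.mul_mem_mul (Submodule.smul_mem _ _ ht) (Submodule.smul_mem _ _
      (hc _ _ (Submodule.pow_mem_pow S hF _)))
  · exact Submodule.smul_mem _ _ (Submodule.smul_mem _ _ (hc _ _ (Submodule.pow_mem_pow S hF _)))

end ChernWeilPoly

/-! ### Closed forms and transgression, with values in a commutative algebra -/

section Closed

variable {ι : Type} [Fintype ι] [DecidableEq ι]
variable {A : Type} [NormedCommRing A] [NormedAlgebra ℂ A] {r : ℕ}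

/-- `W` is differentiable at `x`, and `d` is the value there of the derivation `∑ e_β ∂_β`. -/
structure HasDelta (b : Bool) (e : ι → A) (W : ℂ^ι → A) (x : ℂ^ι) (d : A) : Prop where
  diff : DifferentiableAt ℝ W x
  eq : ∑ β, e β * wd b β W x = d

namespace HasDelta

variable {b : Bool} {e : ι → A} {W W' : ℂ^ι → A} {x : ℂ^ι} {d d' : A}

theorem congr_right (h : HasDelta b e W x d) (hd : d = d') : HasDelta b e W x d' := hd ▸ h

theorem add (h : HasDelta b e W x d) (h' : HasDelta b e W' x d') :
    HasDelta b e (fun y => W y + W' y) x (d + d') where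
  diff := h.diff.add h'.diff
  eq := by
    rw [← h.eq, ← h'.eq, ← sum_add_distrib]
    exact sum_congr rfl fun β _ => by rw [wd_add h.diff h'.diff, mul_add]

theorem sub (h : HasDelta b e W x d) (h' : HasDelta b e W' x d') :
    HasDelta b e (fun y => W y - W' y) x (d - d') where
  diff := h.diff.sub h'.diff
  eq := by
    rw [← h.eq, ← h'.eq, ← Finset.sum_sub_distrib]
    exact sum_congr rfl fun β _ => by rw [wd_sub h.diff h'.diff, mul_sub]

theorem mul (h : HasDelta b e W x d) (h' : HasDelta b e W' x d') :
    HasDelta b e (fun y => W y * W' y) x (W x * d' + d * W' x) where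
  diff := h.diff.mul h'.diff
  eq := by
    rw [← h.eq, ← h'.eq, mul_sum, sum_mul, ← sum_add_distrib]
    exact sum_congr rfl fun β _ => by rw [wd_mul h.diff h'.diff]; ring

theorem const_smul (h : HasDelta b e W x d) (c : ℂ) :
    HasDelta b e (fun y => c • W y) x (c • d) where
  diff := h.diff.const_smul c
  eq := by
    rw [← h.eq, smul_sum]
    exact sum_congr rfl fun β _ => by rw [wd_const_smul h.diff, mul_smul_comm]

theorem const (v : A) : HasDelta b e (fun _ => v) x 0 where
  diff := differentiableAt_const v
  eq := sum_eq_zero fun β _ => by rw [wd_const, mul_zero]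

theorem pow (h : HasDelta b e W x 0) (k : ℕ) : HasDelta b e (fun y => W y ^ k) x 0 := by
  induction k with
  | zero => simpa using const (1 : A)
  | succ k ih => simpa [pow_succ] using ih.mul h

theorem sum {J : Type*} (s : Finset J) {W : J → ℂ^ι → A} {d : J → A}
    (h : ∀ j ∈ s, HasDelta b e (W j) x (d j)) :
    HasDelta b e (fun y => ∑ j ∈ s, W j y) x (∑ j ∈ s, d j) := by
  classical
  induction s using Finset.induction_on with
  | empty => simpa using const (0 : A)
  | insert a s ha ih =>
    simp only [Finset.sum_insert ha]
    exact (h a (Finset.mem_insert_self a s)).add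
      (ih fun j hj => h j (Finset.mem_insert_of_mem hj))

theorem algebraMap {c : ℂ^ι → ℂ} (hc : DifferentiableAt ℝ c x) :
    HasDelta b e (fun y => algebraMap ℂ A (c y)) x (∑ β, wd b β c x • e β) where
  diff := ((Algebra.linearMap ℂ A).toContinuousLinearMap.restrictScalars ℝ).differentiableAt.comp
    x hc
  eq := sum_congr rfl fun β _ => by
    have := wd_clm (Algebra.linearMap ℂ A).toContinuousLinearMap hc b β
    simp only [LinearMap.coe_toContinuousLinearMap', Algebra.linearMap_apply] at this
    rw [this, mul_comm, ← Algebra.smul_def]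

theorem trace {R : ℂ^ι → Matrix (Fin r) (Fin r) A} {D : Matrix (Fin r) (Fin r) A}
    (h : ∀ i j, HasDelta b e (fun y => R y i j) x (D i j)) :
    HasDelta b e (fun y => (R y).trace) x D.trace :=
  HasDelta.sum _ fun i _ => h i i

theorem trace_mul {R S : ℂ^ι → Matrix (Fin r) (Fin r) A} {D : Matrix (Fin r) (Fin r) A}
    (hR : ∀ i j, HasDelta b e (fun y => R y i j) x 0)
    (hS : ∀ i j, HasDelta b e (fun y => S y i j) x (D i j)) :
    HasDelta b e (fun y => (R y * S y).trace) x (R x * D).trace := by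
  refine HasDelta.sum _ fun i _ => ?_
  simp only [Matrix.diag_apply, Matrix.mul_apply]
  refine HasDelta.sum _ fun j _ => ?_
  simpa using (hR i j).mul (hS j i)

theorem dcwPoly (c : ℕ → ℂ) (n : ℕ) {R E : ℂ^ι → Matrix (Fin r) (Fin r) A}
    {F ε : ℂ^ι → A} {D : Matrix (Fin r) (Fin r) A} (hR : ∀ i j, HasDelta b e (fun y => R y i j) x 0)
    (hF : HasDelta b e F x 0) (hE : ∀ i j, HasDelta b e (fun y => E y i j) x (D i j))
    (hε : HasDelta b e ε x d) :
    HasDelta b e (fun y => dcwPoly c n (R y) (F y) (E y) (ε y)) x (dcwPoly c n (R x) (F x) D d) := by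
  have hRt : HasDelta b e (fun y => (R y).trace) x 0 := by
    simpa using trace (D := 0) (R := R) (by simpa using hR)
  have hRR : HasDelta b e (fun y => (R y * R y).trace) x 0 := by
    simpa using trace_mul (D := 0) hR (by simpa using hR)
  have hEt := trace hE
  have hRE := trace_mul hR hE
  have t1 := (((hRt.mul hEt).const_smul (1 / 4)).sub (hRE.const_smul (1 / 12))).mul (hF.pow (n - 1))
  have t2 := (((hRt.pow 2).const_smul (1 / 8)).sub (hRR.const_smul (1 / 24))).mul
    (((hF.pow (n - 1 - 1)).mul hε).const_smul ((n - 1 : ℕ) : ℂ))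
  have t3 := (hEt.const_smul (1 / 2)).mul (hF.pow n)
  have t4 := (hRt.const_smul (1 / 2)).mul (((hF.pow (n - 1)).mul hε).const_smul (n : ℂ))
  have t5 := ((hF.pow n).mul hε).const_smul ((n + 1 : ℕ) : ℂ)
  have t := (((t1.add t2).const_smul (c (n - 1))).add ((t3.add t4).const_smul (c n))).add
    (t5.const_smul (c (n + 1)))
  refine t.congr_right ?_
  simp only [HigherEnergy.dcwPoly, mul_zero, zero_mul, add_zero, zero_add, smul_zero, sub_zero]

end HasDelta

/-- The form `∑_{a ∈ P} ∑_β (∂_β ζ_a) e_{aβ}`. -/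
def dd (b : Bool) (ee : ι → ι → A) (P : Finset ι) (ζ : ι → ℂ^ι → ℂ) (x : ℂ^ι) : A :=
  ∑ a ∈ P, ∑ β, wd b β (ζ a) x • ee a β

variable {b : Bool} {ee : ι → ι → A}

theorem dd_neg (P : Finset ι) (ζ : ι → ℂ^ι → ℂ) (x : ℂ^ι) :
    dd b ee P (fun a y => -ζ a y) x = -dd b ee P ζ x := by
  simp only [dd, wd_neg, neg_smul, sum_neg_distrib]

theorem hasDelta_dd (hee : ∀ a a' β β', ee a β * ee a' β' = -(ee a β' * ee a' β))
    {U : Set ℂ^ι} (hU : IsOpen U) {ζ : ι → ℂ^ι → ℂ} (hζ : ∀ a, SmoothOn (ζ a) U)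
    {x : ℂ^ι} (hx : x ∈ U) (P : Finset ι) (a : ι) :
    HasDelta b (ee a) (dd b ee P ζ) x 0 := by
  have hd : ∀ a' β', DifferentiableAt ℝ (wd b β' (ζ a')) x := fun a' β' =>
    diffAt_of_contDiffOn hU (contDiffOn_wd hU (hζ a') b β') hx
  have h : ∀ a', HasDelta b (ee a) (fun y => ∑ β', wd b β' (ζ a') y • ee a' β') x 0 := by
    intro a'
    have h1 : ∀ β', HasDelta b (ee a) (fun y => wd b β' (ζ a') y • ee a' β') x
        (∑ β, wd b β (wd b β' (ζ a')) x • (ee a β * ee a' β')) := by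
      intro β'
      have := (HasDelta.algebraMap (A := A) (b := b) (e := ee a) (hd a' β')).mul
        (HasDelta.const (ee a' β'))
      simp only [← Algebra.smul_def, smul_zero, zero_add] at this
      refine this.congr_right ?_
      rw [sum_mul]
      exact sum_congr rfl fun β _ => smul_mul_assoc _ _ _
    refine (HasDelta.sum univ fun β' _ => h1 β').congr_right ?_
    have h2 : ∑ β', ∑ β, wd b β (wd b β' (ζ a')) x • (ee a β * ee a' β') =
        -∑ β', ∑ β, wd b β (wd b β' (ζ a')) x • (ee a β * ee a' β') := by
      conv_lhs => rw [sum_comm]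
      rw [← sum_neg_distrib]
      refine sum_congr rfl fun β _ => ?_
      rw [← sum_neg_distrib]
      refine sum_congr rfl fun β' _ => ?_
      rw [hee a a' β β', wd_comm hU (hζ a') hx, smul_neg]
    have h3 : (2 : ℂ) • ∑ β', ∑ β, wd b β (wd b β' (ζ a')) x • (ee a β * ee a' β') = 0 := by
      rw [two_smul]
      nth_rewrite 1 [h2]
      exact neg_add_cancel _
    exact (smul_eq_zero.mp h3).resolve_left two_ne_zero
  exact (HasDelta.sum P fun a' _ => h a').congr_right (by simp)

/-- The Stokes density of the transgression forms `dcwPoly(R, F; η_a, -h_a)`. -/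
theorem sum_wd_transgression (hee : ∀ a a' β β', ee a β * ee a' β' = -(ee a β' * ee a' β))
    (Λ : A →L[ℂ] ℂ) (c : ℕ → ℂ) (n : ℕ) {U : Set ℂ^ι} (hU : IsOpen U)
    {η : ι → ℂ^ι → Matrix (Fin r) (Fin r) ℂ} {h : ι → ℂ^ι → ℂ}
    (hη : ∀ a i j, SmoothOn (fun y => η a y i j) U) (hh : ∀ a, SmoothOn (h a) U)
    {R : ℂ^ι → Matrix (Fin r) (Fin r) A} {F : ℂ^ι → A}
    (hR : ∀ y i j, R y i j = dd b ee univ (fun a z => -η a z i j) y)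
    (hF : ∀ y, F y = dd b ee univ h y) (P : Finset ι) {x : ℂ^ι} (hx : x ∈ U) :
    ∑ a ∈ P, ∑ β, wd b β (fun y => Λ (ee a β * dcwPoly c n (R y) (F y)
        ((η a y).map (algebraMap ℂ A)) (algebraMap ℂ A (-h a y)))) x =
      -Λ (dcwPoly c n (R x) (F x)
        (Matrix.of fun i j => dd b ee P (fun a z => -η a z i j) x) (dd b ee P h x)) := by
  have hdη : ∀ a i j, DifferentiableAt ℝ (fun y => η a y i j) x := fun a i j =>
    diffAt_of_contDiffOn hU (hη a i j) hx
  have hdh : ∀ a, DifferentiableAt ℝ (h a) x := fun a =>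
    diffAt_of_contDiffOn hU (hh a) hx
  have hW : ∀ a, HasDelta b (ee a) (fun y => dcwPoly c n (R y) (F y)
      ((η a y).map (algebraMap ℂ A)) (algebraMap ℂ A (-h a y))) x
      (dcwPoly c n (R x) (F x) (Matrix.of fun i j => ∑ β, wd b β (fun y => η a y i j) x • ee a β)
        (∑ β, wd b β (fun y => -h a y) x • ee a β)) := by
    intro a
    refine HasDelta.dcwPoly c n (fun i j => ?_) ?_ (fun i j => ?_) ?_
    · simp only [hR]
      exact hasDelta_dd hee hU (fun a => (hη a i j).neg) hx _ a
    · have := hasDelta_dd (b := b) hee hU hh hx univ a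
      exact (funext hF : F = _) ▸ this
    · exact HasDelta.algebraMap (hdη a i j)
    · exact HasDelta.algebraMap (hdh a).neg
  have h1 : ∀ a β, wd b β (fun y => Λ (ee a β * dcwPoly c n (R y) (F y)
        ((η a y).map (algebraMap ℂ A)) (algebraMap ℂ A (-h a y)))) x =
      Λ (ee a β * wd b β (fun y => dcwPoly c n (R y) (F y)
        ((η a y).map (algebraMap ℂ A)) (algebraMap ℂ A (-h a y))) x) := by
    intro a β
    exact wd_clm (Λ.comp (ContinuousLinearMap.mul ℂ A (ee a β))) (hW a).diff b β
  simp only [h1, ← map_sum, (hW _).eq]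
  rw [← dcwPoly_sum, ← map_neg, ← dcwPoly_neg]
  congr 2
  · ext i j
    simp only [Matrix.sum_apply, Matrix.of_apply, Matrix.neg_apply, dd_neg, neg_neg]
    rfl
  · simp only [wd_neg, neg_smul, sum_neg_distrib]
    rfl

theorem contDiffOn_dd {U : Set ℂ^ι} (hU : IsOpen U) {ζ : ι → ℂ^ι → ℂ}
    (hζ : ∀ a, SmoothOn (ζ a) U) (P : Finset ι) : SmoothOn (dd b ee P ζ) U :=
  ContDiffOn.sum fun a _ => ContDiffOn.sum fun β _ =>
    (contDiffOn_wd hU (hζ a) b β).smul contDiffOn_const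

section Smooth

variable {E : Type*} [NormedAddCommGroup E] [NormedSpace ℝ E]
  {R S : E → Matrix (Fin r) (Fin r) A} {F ε : E → A} {U : Set E}

theorem contDiffOn_trace (hR : ∀ i j, SmoothOn (fun y => R y i j) U) :
    SmoothOn (fun y => (R y).trace) U := ContDiffOn.sum fun i _ => hR i i

theorem contDiffOn_matrix_mul (hR : ∀ i j, SmoothOn (fun y => R y i j) U)
    (hS : ∀ i j, SmoothOn (fun y => S y i j) U) (i j : Fin r) :
    SmoothOn (fun y => (R y * S y) i j) U := by
  simp only [Matrix.mul_apply]
  exact ContDiffOn.sum fun k _ => (hR i k).mul (hS k j)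

theorem contDiffOn_cwPoly (c : ℕ → ℂ) (n : ℕ) (hR : ∀ i j, SmoothOn (fun y => R y i j) U)
    (hF : SmoothOn F U) : SmoothOn (fun y => cwPoly c n (R y) (F y)) U := by
  have h1 := contDiffOn_trace hR
  have h2 := contDiffOn_trace (contDiffOn_matrix_mul hR hR)
  have t1 := ((((h1.pow 2).const_smul (1 / 8 : ℂ)).sub (h2.const_smul (1 / 24 : ℂ))).mul
    (hF.pow (n - 1))).const_smul (c (n - 1))
  have t2 := ((h1.const_smul (1 / 2 : ℂ)).mul (hF.pow n)).const_smul (c n)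
  exact (t1.add t2).add ((hF.pow (n + 1)).const_smul (c (n + 1)))

theorem contDiffOn_dcwPoly (c : ℕ → ℂ) (n : ℕ) (hR : ∀ i j, SmoothOn (fun y => R y i j) U)
    (hF : SmoothOn F U) (hS : ∀ i j, SmoothOn (fun y => S y i j) U)
    (hε : SmoothOn ε U) :
    SmoothOn (fun y => dcwPoly c n (R y) (F y) (S y) (ε y)) U := by
  have h1 := contDiffOn_trace hR
  have h2 := contDiffOn_trace (contDiffOn_matrix_mul hR hR)
  have h3 := contDiffOn_trace hS
  have h4 := contDiffOn_trace (contDiffOn_matrix_mul hR hS)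
  have t1 := (((h1.mul h3).const_smul (1 / 4 : ℂ)).sub (h4.const_smul (1 / 12 : ℂ))).mul
    (hF.pow (n - 1))
  have t2 := (((h1.pow 2).const_smul (1 / 8 : ℂ)).sub (h2.const_smul (1 / 24 : ℂ))).mul
    (((hF.pow (n - 1 - 1)).mul hε).const_smul ((n - 1 : ℕ) : ℂ))
  have t3 := (h3.const_smul (1 / 2 : ℂ)).mul (hF.pow n)
  have t4 := (h1.const_smul (1 / 2 : ℂ)).mul (((hF.pow (n - 1)).mul hε).const_smul (n : ℂ))
  have t5 := ((hF.pow n).mul hε).const_smul ((n + 1 : ℕ) : ℂ)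
  exact (((t1.add t2).const_smul (c (n - 1))).add ((t3.add t4).const_smul (c n))).add
    (t5.const_smul (c (n + 1)))

theorem contDiffOn_algebraMap {f : E → ℂ} (hf : SmoothOn f U) :
    SmoothOn (fun y => algebraMap ℂ A (f y)) U :=
  ((Algebra.linearMap ℂ A).toContinuousLinearMap.restrictScalars ℝ).contDiff.comp_contDiffOn hf

theorem contDiffOn_det {g : E → Matrix (Fin r) (Fin r) ℂ}
    (hg : ∀ i j, SmoothOn (fun y => g y i j) U) :
    SmoothOn (fun y => (g y).det) U := by
  simp only [Matrix.det_apply]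
  exact ContDiffOn.sum fun p _ => (contDiffOn_prod fun i _ => hg (p i) i).const_smul (Equiv.Perm.sign p)

theorem contDiffOn_inv {g : E → Matrix (Fin r) (Fin r) ℂ}
    (hg : ∀ i j, SmoothOn (fun y => g y i j) U) (hdet : ∀ y ∈ U, (g y).det ≠ 0) (i j : Fin r) :
    SmoothOn (fun y => (g y)⁻¹ i j) U := by
  simp only [Matrix.inv_def, Ring.inverse_eq_inv', Matrix.smul_apply, Matrix.adjugate_apply]
  refine ((contDiffOn_det hg).inv hdet).smul (contDiffOn_det fun k l => ?_)
  by_cases hk : k = j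
  · subst hk; simpa using contDiffOn_const
  · simpa [Matrix.updateRow_ne hk] using hg k l

end Smooth

end Closed

/-! ### A norm on the exterior algebra -/

section Norm

attribute [local instance] Matrix.linftyOpNormedRing Matrix.linftyOpNormedAlgebra

/-- The regular representation of the exterior algebra. -/
def frmRep (ι : Type) [Fintype ι] : Frm ι →ₐ[ℂ]
    Matrix (Fin (Module.finrank ℂ (Frm ι))) (Fin (Module.finrank ℂ (Frm ι))) ℂ :=
  Algebra.leftMulMatrix (Module.finBasis ℂ (Frm ι))

/-- The norm of the regular representation. -/
abbrev normedRingFrm (ι : Type) [Fintype ι] : NormedRing (Frm ι) :=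
  NormedRing.induced (Frm ι) _ (frmRep ι) (Algebra.leftMulMatrix_injective _)

attribute [local instance] normedRingFrm

/-- The norm of the regular representation. -/
abbrev normedAlgebraFrm (ι : Type) [Fintype ι] : NormedAlgebra ℂ (Frm ι) :=
  NormedAlgebra.induced ℂ (Frm ι) _ (frmRep ι)

attribute [local instance] normedAlgebraFrm

/-- The norm of the regular representation. -/
abbrev normedCommRingCFrm (ι : Type) [Fintype ι] : NormedCommRing (CFrm ι) :=
  { (inferInstance : NormedRing (CFrm ι)) with mul_comm := mul_comm }

attribute [local instance] normedCommRingCFrm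

/-- The norm of the regular representation. -/
abbrev normedAlgebraCFrm (ι : Type) [Fintype ι] : NormedAlgebra ℂ (CFrm ι) := inferInstance

attribute [local instance] normedAlgebraCFrm

/-- The norm of the regular representation. -/
abbrev normedSpaceCFrm (ι : Type) [Fintype ι] : NormedSpace ℝ (CFrm ι) :=
  @NormedSpace.complexToReal (CFrm ι) _ (normedAlgebraCFrm ι).toNormedSpace

end Norm

/-! ### Wirtinger derivatives of matrices -/

section MatrixWirtinger

variable {ι : Type} [Fintype ι] [DecidableEq ι] {r : ℕ}

/-- Entrywise Wirtinger derivative. -/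
def wdM (b : Bool) (a : ι) (g : ℂ^ι → Matrix (Fin r) (Fin r) ℂ) (x : ℂ^ι) :
    Matrix (Fin r) (Fin r) ℂ := Matrix.of fun i j => wd b a (fun y => g y i j) x

theorem wdM_apply (b : Bool) (a : ι) (g : ℂ^ι → Matrix (Fin r) (Fin r) ℂ) (x : ℂ^ι)
    (i j : Fin r) : wdM b a g x i j = wd b a (fun y => g y i j) x := rfl

theorem wdM_mul {g h : ℂ^ι → Matrix (Fin r) (Fin r) ℂ} {x : ℂ^ι}
    (hg : ∀ i j, DifferentiableAt ℝ (fun y => g y i j) x)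
    (hh : ∀ i j, DifferentiableAt ℝ (fun y => h y i j) x) (b : Bool) (a : ι) :
    wdM b a (fun y => g y * h y) x = g x * wdM b a h x + wdM b a g x * h x := by
  ext i j
  simp only [wdM_apply, Matrix.mul_apply, Matrix.add_apply]
  rw [wd_sum _ (f := fun k y => g y i k * h y k j) (fun k _ => (hg i k).mul (hh k j)),
    ← sum_add_distrib]
  exact sum_congr rfl fun k _ => wd_mul (hg i k) (hh k j) b a

theorem wdM_congr_on {g h : ℂ^ι → Matrix (Fin r) (Fin r) ℂ} {U : Set ℂ^ι} (hU : IsOpen U)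
    (H : Set.EqOn g h U) (b : Bool) (a : ι) : Set.EqOn (wdM b a g) (wdM b a h) U := fun x hx => by
  ext i j
  exact wd_congr_on hU (fun y hy => by simp only [H hy]) b a hx

theorem wdM_inv {g : ℂ^ι → Matrix (Fin r) (Fin r) ℂ} {U : Set ℂ^ι} (hU : IsOpen U)
    (hg : ∀ i j, SmoothOn (fun y => g y i j) U) (hdet : ∀ y ∈ U, (g y).det ≠ 0)
    {x : ℂ^ι} (hx : x ∈ U) (b : Bool) (a : ι) :
    wdM b a (fun y => (g y)⁻¹) x = -((g x)⁻¹ * wdM b a g x * (g x)⁻¹) := by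
  have hd : ∀ i j, DifferentiableAt ℝ (fun y => g y i j) x := fun i j =>
    diffAt_of_contDiffOn hU (hg i j) hx
  have hi : ∀ i j, DifferentiableAt ℝ (fun y => (g y)⁻¹ i j) x := fun i j =>
    diffAt_of_contDiffOn hU (contDiffOn_inv hg hdet i j) hx
  have h1 : wdM b a (fun y => g y * (g y)⁻¹) x = 0 := by
    have : Set.EqOn (fun y => g y * (g y)⁻¹) (fun _ => 1) U := fun y hy =>
      Matrix.mul_nonsing_inv _ (isUnit_iff_ne_zero.mpr (hdet y hy))
    rw [wdM_congr_on hU this b a hx]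
    ext i j
    rw [wdM_apply, wd_const]; rfl
  rw [wdM_mul hd hi] at h1
  have h2 := congrArg (fun M => (g x)⁻¹ * M) h1
  simp only [mul_add, mul_zero, ← mul_assoc,
    Matrix.nonsing_inv_mul _ (isUnit_iff_ne_zero.mpr (hdet x hx)), one_mul] at h2
  exact eq_neg_of_add_eq_zero_left h2

theorem contDiffOn_wdM {g : ℂ^ι → Matrix (Fin r) (Fin r) ℂ} {U : Set ℂ^ι} (hU : IsOpen U)
    (hg : ∀ i j, SmoothOn (fun y => g y i j) U) (b : Bool) (a : ι) (i j : Fin r) :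
    SmoothOn (fun y => wdM b a g y i j) U := contDiffOn_wd hU (hg i j) b a

theorem wdM_comm {g : ℂ^ι → Matrix (Fin r) (Fin r) ℂ} {U : Set ℂ^ι} (hU : IsOpen U)
    (hg : ∀ i j, SmoothOn (fun y => g y i j) U) {x : ℂ^ι} (hx : x ∈ U) (b b' : Bool)
    (a a' : ι) : wdM b a (wdM b' a' g) x = wdM b' a' (wdM b a g) x := by
  ext i j
  exact wd_comm hU (hg i j) hx b b' a a'

/-- The Chern connection and its `\bar∂`-counterpart have conjugate curvatures. -/
theorem wdM_connection {g : ℂ^ι → Matrix (Fin r) (Fin r) ℂ} {U : Set ℂ^ι} (hU : IsOpen U)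
    (hg : ∀ i j, SmoothOn (fun y => g y i j) U) (hdet : ∀ y ∈ U, (g y).det ≠ 0)
    {x : ℂ^ι} (hx : x ∈ U) (b b' : Bool) (a a' : ι) :
    wdM b a (fun y => (g y)⁻¹ * wdM b' a' g y) x =
      (g x)⁻¹ * wdM b' a' (fun y => wdM b a g y * (g y)⁻¹) x * g x := by
  have hd : ∀ i j, DifferentiableAt ℝ (fun y => g y i j) x := fun i j =>
    diffAt_of_contDiffOn hU (hg i j) hx
  have hi : ∀ i j, DifferentiableAt ℝ (fun y => (g y)⁻¹ i j) x := fun i j =>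
    diffAt_of_contDiffOn hU (contDiffOn_inv hg hdet i j) hx
  have hw : ∀ b a i j, DifferentiableAt ℝ (fun y => wdM b a g y i j) x := fun b a i j =>
    diffAt_of_contDiffOn hU (contDiffOn_wdM hU hg b a i j) hx
  rw [wdM_mul hi (hw b' a'), wdM_mul (hw b a) hi, wdM_inv hU hg hdet hx, wdM_inv hU hg hdet hx,
    wdM_comm hU hg hx b b']
  have h1 := Matrix.nonsing_inv_mul _ (isUnit_iff_ne_zero.mpr (hdet x hx))
  simp only [mul_add, add_mul, mul_neg, neg_mul, mul_assoc, h1, mul_one]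
  abel

end MatrixWirtinger

theorem trace_conj {A : Type} [CommRing A] {r : ℕ} {P Q : Matrix (Fin r) (Fin r) A} (h : P * Q = 1)
    (R : Matrix (Fin r) (Fin r) A) : (Q * R * P).trace = R.trace := by
  rw [mul_assoc, Matrix.trace_mul_comm, mul_assoc, h, mul_one]

theorem conj_mul_conj {A : Type} [CommRing A] {r : ℕ} {P Q : Matrix (Fin r) (Fin r) A}
    (h : P * Q = 1) (R S : Matrix (Fin r) (Fin r) A) :
    (Q * R * P) * (Q * S * P) = Q * (R * S) * P := by
  calc (Q * R * P) * (Q * S * P) = Q * R * (P * Q) * S * P := by simp only [mul_assoc]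
    _ = _ := by rw [h, mul_one]; simp only [mul_assoc]

theorem cwPoly_conj {A : Type} [CommRing A] [Algebra ℂ A] (c : ℕ → ℂ) (n : ℕ) {r : ℕ}
    {P Q : Matrix (Fin r) (Fin r) A} (h : P * Q = 1) (R : Matrix (Fin r) (Fin r) A) (F : A) :
    cwPoly c n (Q * R * P) F = cwPoly c n R F :=
  cwPoly_congr c n (trace_conj h R) (by rw [conj_mul_conj h, trace_conj h]) rfl

theorem dcwPoly_conj {A : Type} [CommRing A] [Algebra ℂ A] (c : ℕ → ℂ) (n : ℕ) {r : ℕ}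
    {P Q : Matrix (Fin r) (Fin r) A} (h : P * Q = 1) (R E : Matrix (Fin r) (Fin r) A) (F e : A) :
    dcwPoly c n (Q * R * P) F (Q * E * P) e = dcwPoly c n R F E e :=
  dcwPoly_congr c n (trace_conj h R) (by rw [conj_mul_conj h, trace_conj h]) rfl
    (trace_conj h E) (by rw [conj_mul_conj h, trace_conj h]) rfl

/-! ### The transgression identity for families of potentials -/

section Family

attribute [local instance] normedRingFrm normedAlgebraFrm normedCommRingCFrm normedAlgebraCFrm
  normedSpaceCFrm

variable {ι : Type} [Fintype ι] [DecidableEq ι] {n : ℕ}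

/-- `dz_a ∧ d\bar z_b` or `dz_b ∧ d\bar z_a`. -/
def dzdz {J : Type} [Fintype J] : Bool → J → J → CFrm J
  | false, a, b => dzdzbar a b
  | true, a, b => dzdzbar b a

theorem dzdzbar_mul_swap {J : Type} [Fintype J] (a a' β β' : J) :
    dzdzbar a β * dzdzbar a' β' = -(dzdzbar a β' * dzdzbar a' β) := by
  have anti : ∀ x y : Cov J, ιF ℂ x * ιF ℂ y =
      -(ιF ℂ y * ιF ℂ x) := fun x y =>
    eq_neg_of_add_eq_zero_left (ι_add_mul_swap x y)
  apply Subtype.ext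
  change ιF ℂ (dz a) * ιF ℂ (dzbar β) *
      (ιF ℂ (dz a') * ιF ℂ (dzbar β')) =
    -(ιF ℂ (dz a) * ιF ℂ (dzbar β') *
      (ιF ℂ (dz a') * ιF ℂ (dzbar β)))
  generalize ιF ℂ (dz a) = A
  have h1 := anti (dzbar β) (dz a')
  have h2 := anti (dzbar β) (dzbar β')
  have h3 := anti (dz a') (dzbar β')
  calc _ = A * ((ιF ℂ (dzbar β) * ιF ℂ (dz a')) *
        ιF ℂ (dzbar β')) := by simp only [mul_assoc]
    _ = -(A * (ιF ℂ (dz a') * (ιF ℂ (dzbar β) *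
        ιF ℂ (dzbar β')))) := by rw [h1]; simp only [mul_assoc, neg_mul, mul_neg]
    _ = A * ((ιF ℂ (dz a') * ιF ℂ (dzbar β')) *
        ιF ℂ (dzbar β)) := by
          rw [h2]; simp only [mul_assoc, mul_neg, neg_neg]
    _ = _ := by rw [h3]; simp only [mul_assoc, neg_mul, mul_neg]

theorem dzdz_mul_swap {J : Type} [Fintype J] (b : Bool) (a a' β β' : J) :
    dzdz b a β * dzdz b a' β' = -(dzdz b a β' * dzdz b a' β) := by
  cases b
  · exact dzdzbar_mul_swap a a' β β'
  · change dzdzbar β a * dzdzbar β' a' = -(dzdzbar β' a * dzdzbar β a')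
    rw [mul_comm (dzdzbar β' a), dzdzbar_mul_swap]

theorem dzdz_mem {J : Type} [Fintype J] [DecidableEq J] (b : Bool) (a β : J) : dzdz b a β ∈ oneOne J := by
  cases b
  · exact dzdzbar_mem a β
  · exact dzdzbar_mem β a

/-- The matrix of the metrics on the fibres with potential `f`. -/
def fibreMetric (f : ℂ^(ι ⊕ Fin n) → ℝ) (z : ℂ^(ι ⊕ Fin n)) : Matrix (Fin n) (Fin n) ℂ :=
  Matrix.of fun a b => wd false (Sum.inr a) (wd true (Sum.inr b) fun y => (f y : ℂ)) z

/-- `∂_a g g⁻¹` or `\bar∂_a g g⁻¹`. -/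
def logDeriv (b : Bool) (a : ι ⊕ Fin n) (f : ℂ^(ι ⊕ Fin n) → ℝ) (z : ℂ^(ι ⊕ Fin n)) :
    Matrix (Fin n) (Fin n) ℂ := wdM b a (fibreMetric f) z * (fibreMetric f z)⁻¹

/-- The derivative of the potential as a complex valued function. -/
def potDeriv (b : Bool) (a : ι ⊕ Fin n) (f : ℂ^(ι ⊕ Fin n) → ℝ) (z : ℂ^(ι ⊕ Fin n)) : ℂ :=
  wd b a (fun y => (f y : ℂ)) z

/-- The transgression form in the direction of the `a`-th coordinate. -/
def transForm (c : ℕ → ℂ) (b : Bool) (a : ι ⊕ Fin n) (f : ℂ^(ι ⊕ Fin n) → ℝ)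
    (z : ℂ^(ι ⊕ Fin n)) : CFrm (ι ⊕ Fin n) :=
  dcwPoly c n (curvature (fibreMetric f) z) (ddbarFun f z)
    ((logDeriv b a f z).map (algebraMap ℂ _)) (algebraMap ℂ _ (-potDeriv b a f z))

/-- The Chern-Weil form of the family, up to powers of `√-1/2π`. -/
def cwForm (c : ℕ → ℂ) (f : ℂ^(ι ⊕ Fin n) → ℝ) (z : ℂ^(ι ⊕ Fin n)) : CFrm (ι ⊕ Fin n) :=
  cwPoly c n (curvature (fibreMetric f) z) (ddbarFun f z)

/-- The potentials `f` are smooth on `U` and define nondegenerate metrics on the fibres. -/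
structure IsFamily (f : ℂ^(ι ⊕ Fin n) → ℝ) (U : Set ℂ^(ι ⊕ Fin n)) : Prop where
  isOpen : IsOpen U
  smooth : SmoothOn f U
  det_ne_zero : ∀ z ∈ U, (fibreMetric f z).det ≠ 0

theorem contDiffOn_ofReal {E : Type*} [NormedAddCommGroup E] [NormedSpace ℝ E] {f : E → ℝ}
    {U : Set E} (hf : SmoothOn f U) : SmoothOn (fun y => (f y : ℂ)) U :=
  Complex.ofRealCLM.contDiff.comp_contDiffOn hf

namespace IsFamily

variable {f : ℂ^(ι ⊕ Fin n) → ℝ} {U : Set ℂ^(ι ⊕ Fin n)}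

theorem contDiffOn_fibreMetric (hf : IsFamily f U) (i j : Fin n) :
    SmoothOn (fun z => fibreMetric f z i j) U :=
  contDiffOn_wd hf.isOpen (contDiffOn_wd hf.isOpen (contDiffOn_ofReal hf.smooth) _ _) _ _

theorem contDiffOn_logDeriv (hf : IsFamily f U) (b : Bool) (a : ι ⊕ Fin n) (i j : Fin n) :
    SmoothOn (fun z => logDeriv b a f z i j) U :=
  contDiffOn_matrix_mul (contDiffOn_wdM hf.isOpen hf.contDiffOn_fibreMetric b a)
    (contDiffOn_inv hf.contDiffOn_fibreMetric hf.det_ne_zero) i j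

theorem contDiffOn_potDeriv (hf : IsFamily f U) (b : Bool) (a : ι ⊕ Fin n) :
    SmoothOn (potDeriv b a f) U :=
  contDiffOn_wd hf.isOpen (contDiffOn_ofReal hf.smooth) _ _

end IsFamily

theorem curvature_apply (f : ℂ^(ι ⊕ Fin n) → ℝ) (z : ℂ^(ι ⊕ Fin n)) (i j : Fin n) :
    curvature (fibreMetric f) z i j =
      dd true (dzdz false) univ (fun a y => -logDeriv false a f y i j) z := by
  simp only [curvature, Matrix.of_apply, dd, pd_eq, pdbar_eq, wd_neg]
  rfl

theorem ddbarFun_eq {J : Type} [Fintype J] [DecidableEq J] {f : ℂ^J → ℝ} {U : Set ℂ^J}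
    (hU : IsOpen U) (hf : SmoothOn f U) {z : ℂ^J} (hz : z ∈ U) :
    ddbarFun f z = dd true (dzdz false) univ (fun a => wd false a fun y => (f y : ℂ)) z := by
  simp only [ddbarFun, dd, pd_eq, pdbar_eq]
  refine sum_congr rfl fun a _ => sum_congr rfl fun b _ => ?_
  rw [wd_comm hU (contDiffOn_ofReal hf) hz]
  rfl

theorem ddbarFun_eq' {J : Type} [Fintype J] [DecidableEq J] (f : ℂ^J → ℝ) (z : ℂ^J) :
    ddbarFun f z = dd false (dzdz true) univ (fun a => wd true a fun y => (f y : ℂ)) z := by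
  simp only [ddbarFun, dd, pd_eq, pdbar_eq]
  rw [sum_comm]
  rfl

theorem curvature_mem {J : Type} [Fintype J] [DecidableEq J] {r : ℕ}
    (g : ℂ^J → Matrix (Fin r) (Fin r) ℂ) (z : ℂ^J) (i j : Fin r) :
    curvature g z i j ∈ oneOne J :=
  Submodule.sum_mem _ fun _ _ => Submodule.sum_mem _ fun _ _ =>
    Submodule.smul_mem _ _ (dzdzbar_mem _ _)

theorem ddbarFun_mem {J : Type} [Fintype J] [DecidableEq J] (f : ℂ^J → ℝ) (z : ℂ^J) :
    ddbarFun f z ∈ oneOne J :=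
  Submodule.sum_mem _ fun _ _ => Submodule.sum_mem _ fun _ _ =>
    Submodule.smul_mem _ _ (dzdzbar_mem _ _)

theorem transForm_mem (c : ℕ → ℂ) (hn : 1 ≤ n) (b : Bool) (a : ι ⊕ Fin n)
    (f : ℂ^(ι ⊕ Fin n) → ℝ) (z : ℂ^(ι ⊕ Fin n)) :
    transForm c b a f z ∈ oneOne (ι ⊕ Fin n) ^ n :=
  dcwPoly_mem _ c hn (curvature_mem _ z) (ddbarFun_mem f z) _ _

theorem IsFamily.contDiffOn_curvature {f : ℂ^(ι ⊕ Fin n) → ℝ} {U : Set ℂ^(ι ⊕ Fin n)}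
    (hf : IsFamily f U) (i j : Fin n) :
    SmoothOn (fun z => curvature (fibreMetric f) z i j) U := by
  simp only [curvature_apply]
  exact contDiffOn_dd hf.isOpen (fun a => (hf.contDiffOn_logDeriv false a i j).neg) _

theorem IsFamily.contDiffOn_ddbarFun {f : ℂ^(ι ⊕ Fin n) → ℝ} {U : Set ℂ^(ι ⊕ Fin n)}
    (hf : IsFamily f U) : SmoothOn (ddbarFun f) U := by
  rw [funext (ddbarFun_eq' f)]
  exact contDiffOn_dd hf.isOpen (fun a => hf.contDiffOn_potDeriv true a) _

theorem IsFamily.contDiffOn_transForm {f : ℂ^(ι ⊕ Fin n) → ℝ} {U : Set ℂ^(ι ⊕ Fin n)}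
    (hf : IsFamily f U) (c : ℕ → ℂ) (b : Bool) (a : ι ⊕ Fin n) :
    SmoothOn (transForm c b a f) U :=
  contDiffOn_dcwPoly c n hf.contDiffOn_curvature hf.contDiffOn_ddbarFun
    (fun i j => contDiffOn_algebraMap (hf.contDiffOn_logDeriv b a i j))
    (contDiffOn_algebraMap (hf.contDiffOn_potDeriv b a).neg)

theorem IsFamily.contDiffOn_cwForm {f : ℂ^(ι ⊕ Fin n) → ℝ} {U : Set ℂ^(ι ⊕ Fin n)}
    (hf : IsFamily f U) (c : ℕ → ℂ) : SmoothOn (cwForm c f) U :=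
  contDiffOn_cwPoly c n hf.contDiffOn_curvature hf.contDiffOn_ddbarFun

/-- `wedgeTop` as a continuous functional on the centre. -/
def wedgeCLM (n : ℕ) (ψ : Frm ι) : CFrm (ι ⊕ Fin n) →L[ℂ] ℂ :=
  ((wedgeTop (Fin n) ψ).comp
    (Subalgebra.center ℂ (Frm (ι ⊕ Fin n))).val.toLinearMap).toContinuousLinearMap

theorem wedgeCLM_apply (ψ : Frm ι) (Ω : CFrm (ι ⊕ Fin n)) :
    wedgeCLM n ψ Ω = topCoeff (ι ⊕ Fin n) ((Ω : Frm (ι ⊕ Fin n)) * frmFst ι (Fin n) ψ) := rfl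

/-- Rescaling of the forms `dz_a` (`b = false`) or `d\bar z_a` (`b = true`) of the first factor. -/
def fstScale (b : Bool) (s : ℂ) : Cov (ι ⊕ Fin n) →ₗ[ℂ] Cov (ι ⊕ Fin n) :=
  match b with
  | false => covScale (Sum.elim (fun _ : ι => s) (fun _ : Fin n => 1)) (fun _ => 1)
  | true => covScale (fun _ => 1) (Sum.elim (fun _ : ι => s) (fun _ : Fin n => 1))

theorem fstScale_surjective (b : Bool) {s : ℂ} (hs : s ≠ 0) :
    Function.Surjective (fstScale b s : Cov (ι ⊕ Fin n) →ₗ[ℂ] Cov (ι ⊕ Fin n)) := by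
  cases b
  · exact covScale_surjective (by rintro (a | a) <;> simp [hs]) (by simp)
  · exact covScale_surjective (by simp) (by rintro (a | a) <;> simp [hs])

theorem wedgeCLM_cmap_fstScale (b : Bool) {s : ℂ} (hs : s ≠ 0) (ψ : Frm ι) {Ω : CFrm (ι ⊕ Fin n)}
    (hΩ : Ω ∈ oneOne (ι ⊕ Fin n) ^ (n + 1)) :
    wedgeCLM n ψ (cmap (fstScale b s) (fstScale_surjective b hs) Ω) = s * wedgeCLM n ψ Ω := by
  have hΩ' : Ω ∈ oneOne (ι ⊕ Fin n) ^ (Fintype.card (Fin n) + 1) := by simpa using hΩ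
  have h1 : (Sum.elim (fun _ => 1) fun _ => 1 : ℂ^(ι ⊕ Fin n)) = fun _ => 1 :=
    funext (by rintro (a | a) <;> rfl)
  cases b
  · have := topCoeff_scale_fst hΩ' ψ s 1
    rwa [h1, mul_one] at this
  · have := topCoeff_scale_fst hΩ' ψ 1 s
    rwa [h1, one_mul] at this

theorem cmap_fstScale_dzdz (b : Bool) {s : ℂ} (hs : s ≠ 0) (a β : ι ⊕ Fin n) :
    cmap (fstScale b s) (fstScale_surjective b hs) (dzdz b a β) =
      (Sum.elim (fun _ : ι => s) (fun _ : Fin n => 1) a : ℂ) • dzdz b a β := by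
  apply Subtype.ext
  rw [coe_cmap]
  cases b
  · simp only [dzdz, map_dzdzbar, fstScale, covScale_dz, covScale_dzbar, map_smul, one_smul]
    exact smul_mul_assoc _ _ _
  · simp only [dzdz, map_dzdzbar, fstScale, covScale_dz, covScale_dzbar, map_smul, one_smul]
    exact mul_smul_comm _ _ _

/-- The coordinates of the first factor. -/
def fstIdx (ι : Type) [Fintype ι] (n : ℕ) : Finset (ι ⊕ Fin n) :=
  univ.map ⟨Sum.inl, Sum.inl_injective⟩

theorem cmap_fstScale_dd (b b' : Bool) {s : ℂ} (hs : s ≠ 0) (ζ : ι ⊕ Fin n → ℂ^(ι ⊕ Fin n) → ℂ)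
    (x : ℂ^(ι ⊕ Fin n)) :
    cmap (fstScale b s) (fstScale_surjective b hs) (dd b' (dzdz b) univ ζ x) =
      dd b' (dzdz b) univ ζ x + (s - 1) • dd b' (dzdz b) (fstIdx ι n) ζ x := by
  have h : ∀ a : ι ⊕ Fin n, ∑ β, wd b' β (ζ a) x •
      ((Sum.elim (fun _ : ι => s) (fun _ : Fin n => 1) a : ℂ) • dzdz b a β) =
      (Sum.elim (fun _ : ι => s) (fun _ : Fin n => 1) a : ℂ) •
        ∑ β, wd b' β (ζ a) x • dzdz b a β := fun a => by
    rw [smul_sum]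
    exact sum_congr rfl fun β _ => smul_comm _ _ _
  simp only [dd, map_sum, map_smul, cmap_fstScale_dzdz b hs, h]
  rw [Fintype.sum_sum_type, Fintype.sum_sum_type, fstIdx, Finset.sum_map]
  simp only [Sum.elim_inl, Sum.elim_inr, one_smul, ← smul_sum, Function.Embedding.coeFn_mk]
  module

theorem wedgeCLM_dcwPoly_fst (c : ℕ → ℂ) (hn : 1 ≤ n) (b b' : Bool) (ψ : Frm ι)
    (ζ : ι ⊕ Fin n → ℂ^(ι ⊕ Fin n) → Matrix (Fin n) (Fin n) ℂ)
    (h : ι ⊕ Fin n → ℂ^(ι ⊕ Fin n) → ℂ) (x : ℂ^(ι ⊕ Fin n)) :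
    wedgeCLM n ψ (dcwPoly c n
        (Matrix.of fun i j => dd b' (dzdz b) univ (fun a z => ζ a z i j) x)
        (dd b' (dzdz b) univ h x)
        (Matrix.of fun i j => dd b' (dzdz b) (fstIdx ι n) (fun a z => ζ a z i j) x)
        (dd b' (dzdz b) (fstIdx ι n) h x)) =
      wedgeCLM n ψ (cwPoly c n
        (Matrix.of fun i j => dd b' (dzdz b) univ (fun a z => ζ a z i j) x)
        (dd b' (dzdz b) univ h x)) := by
  have hmem : ∀ ζ : ι ⊕ Fin n → ℂ^(ι ⊕ Fin n) → ℂ,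
      dd b' (dzdz b) univ ζ x ∈ oneOne (ι ⊕ Fin n) := fun ζ =>
    Submodule.sum_mem _ fun _ _ => Submodule.sum_mem _ fun _ _ =>
      Submodule.smul_mem _ _ (dzdz_mem b _ _)
  refine linearMap_dcwPoly_eq c n (wedgeCLM n ψ).toLinearMap _ _ _ _ fun s hs => ?_
  have h1 := wedgeCLM_cmap_fstScale b hs ψ (cwPoly_mem (oneOne (ι ⊕ Fin n)) c hn
    (R := Matrix.of fun i j => dd b' (dzdz b) univ (fun a z => ζ a z i j) x)
    (F := dd b' (dzdz b) univ h x) (fun i j => hmem _) (hmem _))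
  rw [map_cwPoly, cmap_fstScale_dd b b' hs] at h1
  refine Eq.trans ?_ h1
  change wedgeCLM n ψ _ = _
  congr 2
  ext1 i j
  rw [Matrix.map_apply, Matrix.of_apply, cmap_fstScale_dd b b' hs]
  rfl

end Family

section Stokes

attribute [local instance] normedRingFrm normedAlgebraFrm normedCommRingCFrm normedAlgebraCFrm
  normedSpaceCFrm

/-- The matrix of forms `∑ M_{ab} w_{ab}`. -/
def matForm {J A : Type} [Fintype J] [CommRing A] [Algebra ℂ A] {r : ℕ}
    (M : J → J → Matrix (Fin r) (Fin r) ℂ) (w : J → J → A) : Matrix (Fin r) (Fin r) A :=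
  Matrix.of fun i j => ∑ a, ∑ b, M a b i j • w a b

theorem matForm_eq {J A : Type} [Fintype J] [CommRing A] [Algebra ℂ A] {r : ℕ}
    (M : J → J → Matrix (Fin r) (Fin r) ℂ) (w : J → J → A) :
    matForm M w = ∑ a, ∑ b, w a b • (M a b).map (algebraMap ℂ A) := by
  ext i j
  simp only [matForm, Matrix.of_apply, Matrix.sum_apply, Matrix.smul_apply, Matrix.map_apply,
    smul_eq_mul]
  exact sum_congr rfl fun a _ => sum_congr rfl fun b _ => by
    rw [Algebra.smul_def, mul_comm]

theorem map_mul_algebraMap {A : Type} [CommRing A] [Algebra ℂ A] {r : ℕ}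
    (M N : Matrix (Fin r) (Fin r) ℂ) :
    (M * N).map (algebraMap ℂ A) = M.map (algebraMap ℂ A) * N.map (algebraMap ℂ A) :=
  Matrix.map_mul

theorem map_one_algebraMap {A : Type} [CommRing A] [Algebra ℂ A] {r : ℕ} :
    (1 : Matrix (Fin r) (Fin r) ℂ).map (algebraMap ℂ A) = 1 :=
  Matrix.map_one _ (map_zero _) (map_one _)

theorem mul_matForm_mul {J A : Type} [Fintype J] [CommRing A] [Algebra ℂ A] {r : ℕ}
    (M : J → J → Matrix (Fin r) (Fin r) ℂ) (w : J → J → A) (P Q : Matrix (Fin r) (Fin r) ℂ) :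
    P.map (algebraMap ℂ A) * matForm M w * Q.map (algebraMap ℂ A) =
      matForm (fun a b => P * M a b * Q) w := by
  rw [matForm_eq, matForm_eq, mul_sum, sum_mul]
  refine sum_congr rfl fun a _ => ?_
  rw [mul_sum, sum_mul]
  refine sum_congr rfl fun b _ => ?_
  rw [Matrix.mul_smul, Matrix.smul_mul, map_mul_algebraMap, map_mul_algebraMap]

variable {ι : Type} [Fintype ι] [DecidableEq ι] {n : ℕ}

theorem curvature_eq_matForm {J : Type} [Fintype J] [DecidableEq J] {r : ℕ}
    (g : ℂ^J → Matrix (Fin r) (Fin r) ℂ) (z : ℂ^J) :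
    curvature g z = matForm (fun a b => -wdM true b (fun y => wdM false a g y * (g y)⁻¹) z)
      dzdzbar := by
  ext1 i j
  simp only [curvature, matForm, Matrix.of_apply, pd_eq, pdbar_eq]
  rfl

/-- The connection form `∂_a g g⁻¹` or `g⁻¹ \bar∂_a g`. -/
def connForm (b : Bool) (a : ι ⊕ Fin n) (f : ℂ^(ι ⊕ Fin n) → ℝ) (z : ℂ^(ι ⊕ Fin n)) :
    Matrix (Fin n) (Fin n) ℂ :=
  match b with
  | false => logDeriv false a f z
  | true => (fibreMetric f z)⁻¹ * wdM true a (fibreMetric f) z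

/-- Curvature of the connection `connForm`. -/
def connCurv (b : Bool) (f : ℂ^(ι ⊕ Fin n) → ℝ) (z : ℂ^(ι ⊕ Fin n)) :
    Matrix (Fin n) (Fin n) (CFrm (ι ⊕ Fin n)) :=
  Matrix.of fun i j => dd (!b) (dzdz b) univ (fun a y => -connForm b a f y i j) z

variable {f : ℂ^(ι ⊕ Fin n) → ℝ} {U : Set ℂ^(ι ⊕ Fin n)}

theorem IsFamily.contDiffOn_connForm (hf : IsFamily f U) (b : Bool) (a : ι ⊕ Fin n) (i j : Fin n) :
    SmoothOn (fun z => connForm b a f z i j) U := by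
  cases b
  · exact hf.contDiffOn_logDeriv false a i j
  · exact contDiffOn_matrix_mul (contDiffOn_inv hf.contDiffOn_fibreMetric hf.det_ne_zero)
      (contDiffOn_wdM hf.isOpen hf.contDiffOn_fibreMetric true a) i j

theorem IsFamily.inv_mul (hf : IsFamily f U) {z : ℂ^(ι ⊕ Fin n)} (hz : z ∈ U) :
    (fibreMetric f z)⁻¹ * fibreMetric f z = 1 :=
  Matrix.nonsing_inv_mul _ (isUnit_iff_ne_zero.mpr (hf.det_ne_zero z hz))

theorem IsFamily.mul_inv (hf : IsFamily f U) {z : ℂ^(ι ⊕ Fin n)} (hz : z ∈ U) :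
    fibreMetric f z * (fibreMetric f z)⁻¹ = 1 :=
  Matrix.mul_nonsing_inv _ (isUnit_iff_ne_zero.mpr (hf.det_ne_zero z hz))

theorem IsFamily.connCurv_eq (hf : IsFamily f U) (b : Bool) {z : ℂ^(ι ⊕ Fin n)} (hz : z ∈ U) :
    ∃ P Q : Matrix (Fin n) (Fin n) ℂ, P * Q = 1 ∧
      curvature (fibreMetric f) z = Q.map (algebraMap ℂ _) * connCurv b f z *
        P.map (algebraMap ℂ _) ∧
      ∀ a, logDeriv b a f z = Q * connForm b a f z * P := by
  cases b
  · refine ⟨1, 1, mul_one _, ?_, fun a => by rw [mul_one, one_mul]; rfl⟩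
    rw [map_one_algebraMap, mul_one, one_mul]
    ext1 i j
    exact curvature_apply f z i j
  · refine ⟨(fibreMetric f z)⁻¹, fibreMetric f z, hf.inv_mul hz, ?_, fun a => ?_⟩
    · have h1 : connCurv true f z = matForm (fun a b => (fibreMetric f z)⁻¹ *
          (-wdM true b (fun y => wdM false a (fibreMetric f) y * (fibreMetric f y)⁻¹) z) *
            fibreMetric f z) dzdzbar := by
        ext1 i j
        simp only [connCurv, matForm, Matrix.of_apply, dd]
        rw [sum_comm]
        refine sum_congr rfl fun a _ => sum_congr rfl fun b _ => ?_
        rw [mul_neg, neg_mul, ← wdM_connection hf.isOpen hf.contDiffOn_fibreMetric hf.det_ne_zero hz,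
          wd_neg]
        rfl
      rw [h1, mul_matForm_mul, curvature_eq_matForm]
      congr 1
      ext1 a
      ext1 b
      have h2 := hf.mul_inv hz
      calc _ = (fibreMetric f z * (fibreMetric f z)⁻¹) *
            (-wdM true b (fun y => wdM false a (fibreMetric f) y * (fibreMetric f y)⁻¹) z) *
            (fibreMetric f z * (fibreMetric f z)⁻¹) := by rw [h2, one_mul, mul_one]
        _ = _ := by simp only [mul_assoc]
    · change wdM true a (fibreMetric f) z * (fibreMetric f z)⁻¹ =
        fibreMetric f z * ((fibreMetric f z)⁻¹ * wdM true a (fibreMetric f) z) *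
          (fibreMetric f z)⁻¹
      rw [← mul_assoc (fibreMetric f z), hf.mul_inv hz, one_mul]

theorem IsFamily.ddbarFun_eq (hf : IsFamily f U) (b : Bool) {z : ℂ^(ι ⊕ Fin n)} (hz : z ∈ U) :
    ddbarFun f z = dd (!b) (dzdz b) univ (fun a => potDeriv b a f) z := by
  cases b
  · exact HigherEnergy.ddbarFun_eq hf.isOpen hf.smooth hz
  · exact ddbarFun_eq' f z

theorem IsFamily.transForm_eq (hf : IsFamily f U) (c : ℕ → ℂ) (b : Bool) (a : ι ⊕ Fin n)
    {z : ℂ^(ι ⊕ Fin n)} (hz : z ∈ U) :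
    transForm c b a f z = dcwPoly c n (connCurv b f z)
      (dd (!b) (dzdz b) univ (fun a => potDeriv b a f) z)
      ((connForm b a f z).map (algebraMap ℂ _)) (algebraMap ℂ _ (-potDeriv b a f z)) := by
  obtain ⟨P, Q, hPQ, h1, h2⟩ := hf.connCurv_eq b hz
  rw [transForm, h1, h2, hf.ddbarFun_eq b hz, map_mul_algebraMap, map_mul_algebraMap]
  exact dcwPoly_conj c n (by rw [← map_mul_algebraMap, hPQ, map_one_algebraMap]) _ _ _ _

theorem IsFamily.cwForm_eq (hf : IsFamily f U) (c : ℕ → ℂ) (b : Bool)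
    {z : ℂ^(ι ⊕ Fin n)} (hz : z ∈ U) :
    cwForm c f z = cwPoly c n (connCurv b f z)
      (dd (!b) (dzdz b) univ (fun a => potDeriv b a f) z) := by
  obtain ⟨P, Q, hPQ, h1, -⟩ := hf.connCurv_eq b hz
  rw [cwForm, h1, hf.ddbarFun_eq b hz]
  exact cwPoly_conj c n (by rw [← map_mul_algebraMap, hPQ, map_one_algebraMap]) _ _

/-- The components of `∂̄` (`b = false`) or `∂` (`b = true`) of the transgression forms. -/
theorem IsFamily.sum_wd_transForm (hf : IsFamily f U) (c : ℕ → ℂ) (hn : 1 ≤ n) (b : Bool)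
    (ψ : Frm ι) {x : ℂ^(ι ⊕ Fin n)} (hx : x ∈ U) :
    ∑ a : ι, ∑ β, wd (!b) β (fun z => wedgeCLM n ψ
        (dzdz b (Sum.inl a) β * transForm c b (Sum.inl a) f z)) x =
      -wedgeCLM n ψ (cwForm c f x) := by
  have h1 := sum_wd_transgression (b := !b) (ee := dzdz b) (fun a a' β β' => dzdz_mul_swap b a a' β β')
    (wedgeCLM n ψ) c n hf.isOpen (η := fun a => connForm b a f) (h := fun a => potDeriv b a f)
    (fun a i j => hf.contDiffOn_connForm b a i j) (fun a => hf.contDiffOn_potDeriv b a)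
    (R := connCurv b f) (F := dd (!b) (dzdz b) univ (fun a => potDeriv b a f))
    (fun y i j => rfl) (fun y => rfl) (fstIdx ι n) hx
  have h2 := wedgeCLM_dcwPoly_fst c hn b (!b) ψ (fun a z => -connForm b a f z)
    (fun a => potDeriv b a f) x
  have h3 := hf.cwForm_eq c b hx
  rw [h3]
  refine Eq.trans ?_ (h1.trans (congrArg Neg.neg h2))
  rw [fstIdx, Finset.sum_map]
  refine sum_congr rfl fun a _ => sum_congr rfl fun β _ => ?_
  refine wd_congr_on hf.isOpen (fun y hy => ?_) _ _ hx
  simp only [hf.transForm_eq c b _ hy, Function.Embedding.coeFn_mk]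
  rfl

/-- The density on the fibre of the transgression form. -/
def fibreDensity (c : ℕ → ℂ) (b : Bool) (a : ι ⊕ Fin n) (f : ℂ^(ι ⊕ Fin n) → ℝ)
    (z : ℂ^(ι ⊕ Fin n)) : ℂ :=
  topCoeff (Fin n) (map (covRes ι (Fin n))
    (transForm c b a f z : Frm (ι ⊕ Fin n)))

/-- The coefficients of `ψ` against `dz_a ∧ d\bar z_b`. -/
def testCoeff (b : Bool) (a β : ι) (ψ : Frm ι) : ℂ := topCoeff ι ((dzdz b a β : Frm ι) * ψ)

theorem wedgeCLM_dzdz_inl (c : ℕ → ℂ) (hn : 1 ≤ n) (b : Bool) (a : ι ⊕ Fin n) (a' β : ι)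
    (f : ℂ^(ι ⊕ Fin n) → ℝ) (ψ : Frm ι) (z : ℂ^(ι ⊕ Fin n)) :
    wedgeCLM n ψ (dzdz b (Sum.inl a') (Sum.inl β) * transForm c b a f z) =
      fibreDensity c b a f z * testCoeff b a' β ψ := by
  have h1 : ((dzdz b (Sum.inl a') (Sum.inl β) : CFrm (ι ⊕ Fin n)) : Frm (ι ⊕ Fin n)) =
      frmFst ι (Fin n) (dzdz b a' β : Frm ι) := by
    cases b
    · exact (frmFst_dzdzbar _ _).symm
    · exact (frmFst_dzdzbar _ _).symm
  have hm : transForm c b a f z ∈ oneOne (ι ⊕ Fin n) ^ Fintype.card (Fin n) := by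
    rw [Fintype.card_fin]; exact transForm_mem c hn b a f z
  rw [wedgeCLM_apply, mul_comm (dzdz b (Sum.inl a') (Sum.inl β))]
  have h2 := topCoeff_mul_frmFst hm ((dzdz b a' β : Frm ι) * ψ)
  rw [fibreDensity, testCoeff, ← h2, map_mul (frmFst ι (Fin n)), ← h1]
  congr 1
  exact mul_assoc _ _ _

/-- `fibreDensity` as a functional of the transgression form. -/
def resCLM (ι : Type) [Fintype ι] [DecidableEq ι] (n : ℕ) : CFrm (ι ⊕ Fin n) →L[ℂ] ℂ :=
  (((topCoeff (Fin n)).comp (map (covRes ι (Fin n))).toLinearMap).comp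
    (Subalgebra.center ℂ (Frm (ι ⊕ Fin n))).val.toLinearMap).toContinuousLinearMap

theorem fibreDensity_eq (c : ℕ → ℂ) (b : Bool) (a : ι ⊕ Fin n) (f : ℂ^(ι ⊕ Fin n) → ℝ)
    (z : ℂ^(ι ⊕ Fin n)) : fibreDensity c b a f z = resCLM ι n (transForm c b a f z) := rfl

theorem contDiffOn_clm {A E : Type*} [NormedAddCommGroup A] [NormedSpace ℂ A]
    [NormedAddCommGroup E] [NormedSpace ℝ E] (L : A →L[ℂ] ℂ) {W : E → A} {U : Set E}
    (h : SmoothOn W U) : SmoothOn (fun z => L (W z)) U :=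
  (L.restrictScalars ℝ).contDiff.comp_contDiffOn h

theorem IsFamily.contDiffOn_fibreDensity (hf : IsFamily f U) (c : ℕ → ℂ) (b : Bool)
    (a : ι ⊕ Fin n) : SmoothOn (fibreDensity c b a f) U := by
  rw [funext (fibreDensity_eq c b a f)]
  exact contDiffOn_clm _ (hf.contDiffOn_transForm c b a)

theorem IsFamily.contDiffOn_wedgeCLM_transForm (hf : IsFamily f U) (c : ℕ → ℂ) (b : Bool)
    (a : ι ⊕ Fin n) (w : CFrm (ι ⊕ Fin n)) (ψ : Frm ι) :
    SmoothOn (fun z => wedgeCLM n ψ (w * transForm c b a f z)) U :=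
  contDiffOn_clm _ (contDiffOn_const.mul (hf.contDiffOn_transForm c b a))

theorem IsFamily.contDiffOn_wedgeCLM_cwForm (hf : IsFamily f U) (c : ℕ → ℂ) (ψ : Frm ι) :
    SmoothOn (fun z => wedgeCLM n ψ (cwForm c f z)) U :=
  contDiffOn_clm _ (hf.contDiffOn_cwForm c)

end Stokes

/-! ### Holomorphic changes of coordinates -/

section HolomorphicMap

variable {ι κ : Type} [Fintype ι] [DecidableEq ι] [Fintype κ] [DecidableEq κ]
variable {T : ℂ^ι → ℂ^κ} {U' : Set ℂ^ι} {U : Set ℂ^κ}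

/-- The entries of the complex Jacobian matrix. -/
def jac (T : ℂ^ι → ℂ^κ) (a : ι) (c : κ) (z : ℂ^ι) : ℂ :=
  fderiv ℂ T z (Pi.single a 1) c

theorem differentiableOn_apply (hT : DifferentiableOn ℂ T U') (c : κ) :
    DifferentiableOn ℂ (fun y => T y c) U' :=
  fun z hz => differentiableWithinAt_pi.mp (hT z hz) c

theorem jac_eq (hU' : IsOpen U') (hT : DifferentiableOn ℂ T U') {z : ℂ^ι} (hz : z ∈ U') (a : ι)
    (c : κ) : jac T a c z = wd false a (fun y => T y c) z := by
  have hd := hT.differentiableAt (hU'.mem_nhds hz)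
  rw [wd_false_holomorphic ((differentiableOn_apply hT c).differentiableAt (hU'.mem_nhds hz)), jac]
  have : HasFDerivAt (fun y => T y c) ((ContinuousLinearMap.proj c).comp (fderiv ℂ T z)) z :=
    (ContinuousLinearMap.proj (R := ℂ) (φ := fun _ : κ => ℂ) c).hasFDerivAt.comp z hd.hasFDerivAt
  rw [this.fderiv]
  rfl

theorem contDiffOn_jac (hU' : IsOpen U') (hT : DifferentiableOn ℂ T U') (a : ι) (c : κ) :
    SmoothOn (jac T a c) U' :=
  (contDiffOn_wd hU' (contDiffOn_of_holomorphic hU' (differentiableOn_apply hT c))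
    false a).congr fun _ hz => jac_eq hU' hT hz a c

theorem wd_true_jac (hU' : IsOpen U') (hT : DifferentiableOn ℂ T U') {z : ℂ^ι} (hz : z ∈ U')
    (a : ι) (c : κ) (β : ι) : wd true β (jac T a c) z = 0 := by
  rw [wd_congr_on hU' (fun y hy => jac_eq hU' hT hy a c) true β hz,
    wd_comm hU' (contDiffOn_of_holomorphic hU' (differentiableOn_apply hT c)) hz]
  have : Set.EqOn (wd true β fun y => T y c) (fun _ => 0) U' := fun y hy =>
    wd_true_holomorphic ((differentiableOn_apply hT c).differentiableAt (hU'.mem_nhds hy)) β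
  rw [wd_congr_on hU' this false a hz, wd_const]

theorem wd_false_conj_jac (hU' : IsOpen U') (hT : DifferentiableOn ℂ T U') {z : ℂ^ι}
    (hz : z ∈ U') (a : ι) (c : κ) (β : ι) :
    wd false β (fun y => conj (jac T a c y)) z = 0 := by
  rw [wd_conj (diffAt_of_contDiffOn hU' (contDiffOn_jac hU' hT a c) hz)]
  simp [wd_true_jac hU' hT hz]

theorem contDiffOn_conj {E : Type*} [NormedAddCommGroup E] [NormedSpace ℝ E] {f : E → ℂ}
    {U : Set E} (hf : SmoothOn f U) : SmoothOn (fun y => conj (f y)) U :=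
  (Complex.conjCLE : ℂ →L[ℝ] ℂ).contDiff.comp_contDiffOn hf

theorem wd_comp_jac {f : ℂ^κ → ℂ} (hU' : IsOpen U') (hT : DifferentiableOn ℂ T U')
    {z : ℂ^ι} (hz : z ∈ U') (hf : DifferentiableAt ℝ f (T z)) (b : Bool) (a : ι) :
    wd b a (fun y => f (T y)) z = ∑ c, wconj b (jac T a c z) * wd b c f (T z) :=
  wd_comp hf (hT.differentiableAt (hU'.mem_nhds hz)) b a

theorem wd_wd_comp {f : ℂ^κ → ℂ} (hU' : IsOpen U') (hU : IsOpen U)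
    (hT : DifferentiableOn ℂ T U') (hm : Set.MapsTo T U' U) (hf : SmoothOn f U)
    {z : ℂ^ι} (hz : z ∈ U') (a β : ι) :
    wd false a (wd true β fun y => f (T y)) z = ∑ d, ∑ c, jac T a d z *
      conj (jac T β c z) * wd false d (wd true c f) (T z) := by
  have hTs : SmoothOn T U' := contDiffOn_of_holomorphic hU' hT
  have h1 : Set.EqOn (wd true β fun y => f (T y))
      (fun y => ∑ c, conj (jac T β c y) * wd true c f (T y)) U' := fun y hy =>
    wd_comp_jac hU' hT hy (diffAt_of_contDiffOn hU hf (hm hy)) true β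
  have hw : ∀ c, SmoothOn (wd true c f) U := fun c => contDiffOn_wd hU hf true c
  have h2 : ∀ c, DifferentiableAt ℝ (fun y => wd true c f (T y)) z := fun c =>
    diffAt_of_contDiffOn hU' ((hw c).comp hTs hm) hz
  have h3 : ∀ c, DifferentiableAt ℝ (fun y => conj (jac T β c y)) z := fun c =>
    diffAt_of_contDiffOn hU' (contDiffOn_conj (contDiffOn_jac hU' hT β c)) hz
  rw [wd_congr_on hU' h1 false a hz,
    wd_sum _ (f := fun c y => conj (jac T β c y) * wd true c f (T y))
      fun c _ => (h3 c).mul (h2 c)]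
  rw [sum_comm]
  refine sum_congr rfl fun c _ => ?_
  rw [wd_mul (h3 c) (h2 c), wd_false_conj_jac hU' hT hz, zero_mul, add_zero,
    wd_comp_jac hU' hT hz (diffAt_of_contDiffOn hU (hw c) (hm hz)), mul_sum]
  refine sum_congr rfl fun d _ => ?_
  simp only [wconj, RingHom.id_apply]
  ring

theorem wd_true_jac_mul {f : ℂ^κ → ℂ} (hU' : IsOpen U') (hU : IsOpen U)
    (hT : DifferentiableOn ℂ T U') (hm : Set.MapsTo T U' U) (hf : SmoothOn f U)
    {z : ℂ^ι} (hz : z ∈ U') (a β : ι) (d : κ) :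
    wd true β (fun y => jac T a d y * f (T y)) z =
      ∑ c, jac T a d z * conj (jac T β c z) * wd true c f (T z) := by
  have hTs : SmoothOn T U' := contDiffOn_of_holomorphic hU' hT
  rw [wd_mul (g := fun y => f (T y))
    (diffAt_of_contDiffOn hU' (contDiffOn_jac hU' hT a d) hz)
    (diffAt_of_contDiffOn hU' (hf.comp hTs hm) hz), wd_true_jac hU' hT hz, zero_mul,
    add_zero, wd_comp_jac hU' hT hz (diffAt_of_contDiffOn hU hf (hm hz)), mul_sum]
  refine sum_congr rfl fun c _ => ?_
  simp only [wconj]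
  ring

theorem cmap_covPullback_dzdzbar (hU' : IsOpen U') (hT : DifferentiableOn ℂ T U') {z : ℂ^ι}
    (hz : z ∈ U') (hs : Function.Surjective (covPullback T z)) (d c : κ) :
    cmap (covPullback T z) hs (dzdzbar d c) =
      ∑ a, ∑ β, (jac T a d z * conj (jac T β c z)) • dzdzbar a β := by
  apply Subtype.ext
  rw [coe_cmap, map_dzdzbar, covPullback_eq (hT.differentiableAt (hU'.mem_nhds hz)), covComp_dz,
    covComp_dzbar, map_sum, map_sum, sum_mul, AddSubmonoidClass.coe_finsetSum]
  refine sum_congr rfl fun a _ => ?_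
  rw [mul_sum, AddSubmonoidClass.coe_finsetSum]
  refine sum_congr rfl fun β _ => ?_
  rw [map_smul, map_smul, smul_mul_smul_comm]
  rfl

theorem cmap_covPullback_sum (hU' : IsOpen U') (hT : DifferentiableOn ℂ T U') {z : ℂ^ι}
    (hz : z ∈ U') (hs : Function.Surjective (covPullback T z)) (t : κ → κ → ℂ) :
    cmap (covPullback T z) hs (∑ d, ∑ c, t d c • dzdzbar d c) =
      ∑ a, ∑ β, (∑ d, ∑ c, jac T a d z * conj (jac T β c z) * t d c) • dzdzbar a β := by
  simp only [map_sum, map_smul, cmap_covPullback_dzdzbar hU' hT hz hs, smul_sum,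
    sum_smul, smul_smul]
  calc _ = ∑ d, ∑ a, ∑ c, ∑ β, (t d c * (jac T a d z * conj (jac T β c z))) •
        dzdzbar a β := sum_congr rfl fun d _ => sum_comm
    _ = ∑ a, ∑ d, ∑ c, ∑ β, (t d c * (jac T a d z * conj (jac T β c z))) •
        dzdzbar a β := sum_comm
    _ = ∑ a, ∑ d, ∑ β, ∑ c, (t d c * (jac T a d z * conj (jac T β c z))) •
        dzdzbar a β := sum_congr rfl fun a _ => sum_congr rfl fun d _ =>
          sum_comm
    _ = ∑ a, ∑ β, ∑ d, ∑ c, (t d c * (jac T a d z * conj (jac T β c z))) •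
        dzdzbar a β := sum_congr rfl fun a _ => sum_comm
    _ = _ := sum_congr rfl fun a _ => sum_congr rfl fun β _ =>
        sum_congr rfl fun d _ => sum_congr rfl fun c _ => by rw [mul_comm]

end HolomorphicMap

section ChartChange

attribute [local instance] normedRingFrm normedAlgebraFrm normedCommRingCFrm normedAlgebraCFrm
  normedSpaceCFrm

variable {ι : Type} [Fintype ι] [DecidableEq ι] {n : ℕ}

/-- `T` is a holomorphic change of coordinates that maps fibres to fibres, and the potentials `f'`
and `f ∘ T` differ by a pluriharmonic function `H`. -/
structure ChartChange (T : ℂ^(ι ⊕ Fin n) → ℂ^(ι ⊕ Fin n)) (f f' H : ℂ^(ι ⊕ Fin n) → ℝ)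
    (U U' : Set ℂ^(ι ⊕ Fin n)) : Prop where
  family : IsFamily f U
  family' : IsFamily f' U'
  mapsTo : Set.MapsTo T U' U
  holomorphic : DifferentiableOn ℂ T U'
  surjective : ∀ z ∈ U', Function.Surjective (covPullback T z)
  vertical : ∀ z ∈ U', ∀ a c, jac T (Sum.inr a) (Sum.inl c) z = 0
  smooth : SmoothOn H U'
  pluriharmonic : ∀ z ∈ U', ∀ a b, wd false a (wd true b fun y => (H y : ℂ)) z = 0
  potential : ∀ z ∈ U', f' z = f (T z) + H z

/-- The transposed Jacobian matrix on the fibres. -/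
def fibreJac (T : ℂ^(ι ⊕ Fin n) → ℂ^(ι ⊕ Fin n)) (z : ℂ^(ι ⊕ Fin n)) :
    Matrix (Fin n) (Fin n) ℂ := Matrix.of fun a c => jac T (Sum.inr a) (Sum.inr c) z

/-- The conjugate Jacobian matrix on the fibres. -/
def fibreJacConj (T : ℂ^(ι ⊕ Fin n) → ℂ^(ι ⊕ Fin n)) (z : ℂ^(ι ⊕ Fin n)) :
    Matrix (Fin n) (Fin n) ℂ :=
  Matrix.of fun c b => conj (jac T (Sum.inr b) (Sum.inr c) z)

namespace ChartChange

variable {T : ℂ^(ι ⊕ Fin n) → ℂ^(ι ⊕ Fin n)} {f f' H : ℂ^(ι ⊕ Fin n) → ℝ}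
  {U U' : Set ℂ^(ι ⊕ Fin n)}

theorem contDiffOn_map (h : ChartChange T f f' H U U') : SmoothOn T U' :=
  contDiffOn_of_holomorphic h.family'.isOpen h.holomorphic

theorem wd_wd_potential (h : ChartChange T f f' H U U') {z : ℂ^(ι ⊕ Fin n)} (hz : z ∈ U')
    (a β : ι ⊕ Fin n) :
    wd false a (wd true β fun y => (f' y : ℂ)) z = ∑ d, ∑ c, jac T a d z *
      conj (jac T β c z) * wd false d (wd true c fun y => (f y : ℂ)) (T z) := by
  have hU' := h.family'.isOpen
  have hfT : SmoothOn (fun y => (f (T y) : ℂ)) U' :=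
    (contDiffOn_ofReal h.family.smooth).comp h.contDiffOn_map h.mapsTo
  have hH := contDiffOn_ofReal h.smooth
  have h1 : Set.EqOn (fun y => (f' y : ℂ)) (fun y => (f (T y) : ℂ) + (H y : ℂ)) U' :=
    fun y hy => by
      change (f' y : ℂ) = (f (T y) : ℂ) + (H y : ℂ)
      rw [h.potential y hy]; push_cast; rfl
  have h2 : Set.EqOn (wd true β fun y => (f' y : ℂ))
      (fun y => wd true β (fun y => (f (T y) : ℂ)) y + wd true β (fun y => (H y : ℂ)) y) U' :=
    fun y hy => by
      rw [wd_congr_on hU' h1 true β hy]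
      exact wd_add (diffAt_of_contDiffOn hU' hfT hy)
        (diffAt_of_contDiffOn hU' hH hy) true β
  rw [wd_congr_on hU' h2 false a hz,
    wd_add (diffAt_of_contDiffOn hU' (contDiffOn_wd hU' hfT true β) hz)
      (diffAt_of_contDiffOn hU' (contDiffOn_wd hU' hH true β) hz),
    h.pluriharmonic z hz, add_zero]
  exact wd_wd_comp hU' h.family.isOpen h.holomorphic h.mapsTo (contDiffOn_ofReal h.family.smooth)
    hz a β

theorem ddbarFun_eq (h : ChartChange T f f' H U U') {z : ℂ^(ι ⊕ Fin n)} (hz : z ∈ U') :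
    ddbarFun f' z = cmap (covPullback T z) (h.surjective z hz) (ddbarFun f (T z)) := by
  simp only [ddbarFun, pd_eq, pdbar_eq]
  rw [cmap_covPullback_sum h.family'.isOpen h.holomorphic hz]
  exact sum_congr rfl fun a _ => sum_congr rfl fun β _ => by
    rw [h.wd_wd_potential hz]

theorem fibreMetric_eq (h : ChartChange T f f' H U U') {z : ℂ^(ι ⊕ Fin n)} (hz : z ∈ U') :
    fibreMetric f' z = fibreJac T z * fibreMetric f (T z) * fibreJacConj T z := by
  ext a b
  rw [fibreMetric, Matrix.of_apply, h.wd_wd_potential hz, Fintype.sum_sum_type]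
  simp only [h.vertical z hz, zero_mul, Finset.sum_const_zero, zero_add, Fintype.sum_sum_type,
    map_zero, mul_zero, Matrix.mul_apply, sum_mul]
  rw [sum_comm]
  refine sum_congr rfl fun c _ => sum_congr rfl fun d _ => ?_
  simp only [fibreJac, fibreJacConj, fibreMetric, Matrix.of_apply]
  ring

theorem det_fibreJac (h : ChartChange T f f' H U U') {z : ℂ^(ι ⊕ Fin n)} (hz : z ∈ U') :
    (fibreJac T z).det ≠ 0 ∧ (fibreJacConj T z).det ≠ 0 := by
  have h1 := h.family'.det_ne_zero z hz
  rw [h.fibreMetric_eq hz, Matrix.det_mul, Matrix.det_mul] at h1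
  exact ⟨fun h0 => h1 (by rw [h0]; ring), fun h0 => h1 (by rw [h0]; ring)⟩

theorem contDiffOn_fibreJac (h : ChartChange T f f' H U U') (i j : Fin n) :
    SmoothOn (fun z => fibreJac T z i j) U' :=
  contDiffOn_jac h.family'.isOpen h.holomorphic _ _

theorem contDiffOn_fibreJacConj (h : ChartChange T f f' H U U') (i j : Fin n) :
    SmoothOn (fun z => fibreJacConj T z i j) U' :=
  contDiffOn_conj (contDiffOn_jac h.family'.isOpen h.holomorphic _ _)

theorem contDiffOn_comp (h : ChartChange T f f' H U U') {g : ℂ^(ι ⊕ Fin n) → ℂ}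
    (hg : SmoothOn g U) : SmoothOn (fun z => g (T z)) U' :=
  hg.comp h.contDiffOn_map h.mapsTo

theorem inv_fibreMetric (h : ChartChange T f f' H U U') {z : ℂ^(ι ⊕ Fin n)} (hz : z ∈ U') :
    (fibreMetric f' z)⁻¹ =
      (fibreJacConj T z)⁻¹ * ((fibreMetric f (T z))⁻¹ * (fibreJac T z)⁻¹) := by
  rw [h.fibreMetric_eq hz, Matrix.mul_inv_rev, Matrix.mul_inv_rev]

theorem wdM_fibreMetric (h : ChartChange T f f' H U U') {z : ℂ^(ι ⊕ Fin n)} (hz : z ∈ U')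
    (b : Bool) (a : ι ⊕ Fin n) :
    wdM b a (fibreMetric f') z =
      fibreJac T z * fibreMetric f (T z) * wdM b a (fibreJacConj T) z +
      (fibreJac T z * wdM b a (fun y => fibreMetric f (T y)) z +
        wdM b a (fibreJac T) z * fibreMetric f (T z)) * fibreJacConj T z := by
  have hU' := h.family'.isOpen
  have hg : ∀ i j, SmoothOn (fun y => fibreMetric f (T y) i j) U' := fun i j =>
    h.contDiffOn_comp (h.family.contDiffOn_fibreMetric i j)
  have hd : ∀ {g : ℂ^(ι ⊕ Fin n) → Matrix (Fin n) (Fin n) ℂ},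
      (∀ i j, SmoothOn (fun y => g y i j) U') →
      ∀ i j, DifferentiableAt ℝ (fun y => g y i j) z := fun hg i j =>
    diffAt_of_contDiffOn hU' (hg i j) hz
  have h1 : Set.EqOn (fibreMetric f')
      (fun y => fibreJac T y * fibreMetric f (T y) * fibreJacConj T y) U' :=
    fun y hy => h.fibreMetric_eq hy
  rw [wdM_congr_on hU' h1 b a hz,
    wdM_mul (hd (contDiffOn_matrix_mul h.contDiffOn_fibreJac hg)) (hd h.contDiffOn_fibreJacConj),
    wdM_mul (hd h.contDiffOn_fibreJac) (hd hg)]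

theorem wdM_comp (h : ChartChange T f f' H U U') {z : ℂ^(ι ⊕ Fin n)} (hz : z ∈ U')
    (b : Bool) (a : ι ⊕ Fin n) :
    wdM b a (fun y => fibreMetric f (T y)) z =
      ∑ c, wconj b (jac T a c z) • wdM b c (fibreMetric f) (T z) := by
  ext i j
  simp only [wdM_apply, Matrix.sum_apply, Matrix.smul_apply, smul_eq_mul]
  exact wd_comp_jac h.family'.isOpen h.holomorphic hz
    (diffAt_of_contDiffOn h.family.isOpen (h.family.contDiffOn_fibreMetric i j)
      (h.mapsTo hz)) b a

theorem wdM_false_fibreJacConj (h : ChartChange T f f' H U U') {z : ℂ^(ι ⊕ Fin n)} (hz : z ∈ U')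
    (a : ι ⊕ Fin n) : wdM false a (fibreJacConj T) z = 0 := by
  ext i j
  exact wd_false_conj_jac h.family'.isOpen h.holomorphic hz _ _ _

theorem logDeriv_eq (h : ChartChange T f f' H U U') {z : ℂ^(ι ⊕ Fin n)} (hz : z ∈ U')
    (b : Bool) (a : ι ⊕ Fin n) (h0 : wdM b a (fibreJacConj T) z = 0) :
    logDeriv b a f' z = fibreJac T z * (∑ c, wconj b (jac T a c z) • logDeriv b c f (T z)) *
      (fibreJac T z)⁻¹ + wdM b a (fibreJac T) z * (fibreJac T z)⁻¹ := by
  have hq := Matrix.mul_nonsing_inv _ (isUnit_iff_ne_zero.mpr (h.det_fibreJac hz).2)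
  have hg := h.family.mul_inv (h.mapsTo hz)
  simp only [logDeriv, ← Matrix.smul_mul]
  rw [← sum_mul, ← h.wdM_comp hz, h.inv_fibreMetric hz, h.wdM_fibreMetric hz, h0]
  simp only [mul_zero, zero_add, mul_assoc]
  rw [← mul_assoc (fibreJacConj T z) (fibreJacConj T z)⁻¹, hq, one_mul, add_mul]
  simp only [mul_assoc]
  rw [← mul_assoc (fibreMetric f (T z)) (fibreMetric f (T z))⁻¹, hg, one_mul]

theorem wdM_true_logDeriv (h : ChartChange T f f' H U U') {z : ℂ^(ι ⊕ Fin n)} (hz : z ∈ U')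
    (a β : ι ⊕ Fin n) :
    wdM true β (logDeriv false a f') z = fibreJac T z *
      (∑ d, ∑ c, (jac T a d z * conj (jac T β c z)) •
        wdM true c (logDeriv false d f) (T z)) * (fibreJac T z)⁻¹ := by
  have hU' := h.family'.isOpen
  have hJ := h.contDiffOn_fibreJac
  have hJi : ∀ i j, SmoothOn (fun y => (fibreJac T y)⁻¹ i j) U' := fun i j =>
    contDiffOn_inv hJ (fun y hy => (h.det_fibreJac hy).1) i j
  have hS : ∀ i j, SmoothOn
      (fun y => (∑ c, jac T a c y • logDeriv false c f (T y)) i j) U' := fun i j => by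
    simp only [Matrix.sum_apply, Matrix.smul_apply, smul_eq_mul]
    exact ContDiffOn.sum fun c _ => (contDiffOn_jac hU' h.holomorphic a c).mul
      (h.contDiffOn_comp (h.family.contDiffOn_logDeriv false c i j))
  have hD := contDiffOn_wdM hU' hJ false a
  have hd : ∀ {g : ℂ^(ι ⊕ Fin n) → Matrix (Fin n) (Fin n) ℂ},
      (∀ i j, SmoothOn (fun y => g y i j) U') →
      ∀ i j, DifferentiableAt ℝ (fun y => g y i j) z := fun hg i j =>
    diffAt_of_contDiffOn hU' (hg i j) hz
  have z1 : Set.EqOn (wdM true β (fibreJac T)) 0 U' := fun y hy => by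
    ext i j
    exact wd_true_jac hU' h.holomorphic hy _ _ _
  have z2 : wdM true β (fun y => (fibreJac T y)⁻¹) z = 0 := by
    rw [wdM_inv hU' hJ (fun y hy => (h.det_fibreJac hy).1) hz, z1 hz]; simp
  have z3 : wdM true β (wdM false a (fibreJac T)) z = 0 := by
    rw [wdM_comm hU' hJ hz, wdM_congr_on hU' z1 false a hz]
    ext i j
    exact wd_const _ _ _ _
  have h1 : Set.EqOn (logDeriv false a f') (fun y => fibreJac T y *
      (∑ c, jac T a c y • logDeriv false c f (T y)) * (fibreJac T y)⁻¹ +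
        wdM false a (fibreJac T) y * (fibreJac T y)⁻¹) U' := fun y hy =>
    h.logDeriv_eq hy false a (h.wdM_false_fibreJacConj hy a)
  have hadd : ∀ {g k : ℂ^(ι ⊕ Fin n) → Matrix (Fin n) (Fin n) ℂ},
      (∀ i j, SmoothOn (fun y => g y i j) U') → (∀ i j, SmoothOn (fun y => k y i j) U') →
      wdM true β (fun y => g y + k y) z = wdM true β g z + wdM true β k z := fun hg hk => by
    ext i j
    exact wd_add (hd hg i j) (hd hk i j) true β
  rw [wdM_congr_on hU' h1 true β hz, hadd (contDiffOn_matrix_mul (contDiffOn_matrix_mul hJ hS) hJi)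
    (contDiffOn_matrix_mul hD hJi), wdM_mul (hd (contDiffOn_matrix_mul hJ hS)) (hd hJi),
    wdM_mul (hd hJ) (hd hS), wdM_mul (hd hD) (hd hJi), z1 hz, z2, z3]
  simp only [mul_zero, zero_mul, add_zero, zero_add, Pi.zero_apply]
  congr 2
  ext i j
  simp only [wdM_apply, Matrix.sum_apply, Matrix.smul_apply, smul_eq_mul]
  rw [wd_sum _ (f := fun c y => jac T a c y * logDeriv false c f (T y) i j) fun c _ =>
    diffAt_of_contDiffOn hU' ((contDiffOn_jac hU' h.holomorphic a c).mul
      (h.contDiffOn_comp (h.family.contDiffOn_logDeriv false c i j))) hz]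
  exact sum_congr rfl fun d _ => wd_true_jac_mul hU' h.family.isOpen h.holomorphic h.mapsTo
    (h.family.contDiffOn_logDeriv false d i j) hz a β d

theorem curvature_eq (h : ChartChange T f f' H U U') {z : ℂ^(ι ⊕ Fin n)} (hz : z ∈ U') :
    curvature (fibreMetric f') z = (fibreJac T z).map (algebraMap ℂ _) *
      (curvature (fibreMetric f) (T z)).map (cmap (covPullback T z) (h.surjective z hz)) *
      ((fibreJac T z)⁻¹).map (algebraMap ℂ _) := by
  have h1 : (curvature (fibreMetric f) (T z)).map (cmap (covPullback T z) (h.surjective z hz)) =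
      matForm (fun a β => ∑ d, ∑ c, (jac T a d z * conj (jac T β c z)) •
        (-wdM true c (logDeriv false d f) (T z))) dzdzbar := by
    ext1 i j
    rw [Matrix.map_apply, curvature_eq_matForm, matForm, Matrix.of_apply,
      cmap_covPullback_sum h.family'.isOpen h.holomorphic hz]
    simp only [matForm, Matrix.of_apply, Matrix.sum_apply, Matrix.smul_apply, smul_eq_mul]
    rfl
  rw [h1, mul_matForm_mul, curvature_eq_matForm]
  congr 1
  ext1 a
  ext1 β
  have h2 := h.wdM_true_logDeriv hz a β
  simp only [smul_neg, sum_neg_distrib, mul_neg, neg_mul]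
  exact congrArg Neg.neg h2

theorem cwForm_eq (h : ChartChange T f f' H U U') (c : ℕ → ℂ) {z : ℂ^(ι ⊕ Fin n)} (hz : z ∈ U') :
    cwForm c f' z = cmap (covPullback T z) (h.surjective z hz) (cwForm c f (T z)) := by
  have hq := Matrix.nonsing_inv_mul _ (isUnit_iff_ne_zero.mpr (h.det_fibreJac hz).1)
  rw [cwForm, cwForm, map_cwPoly, ← h.ddbarFun_eq hz, h.curvature_eq hz]
  exact cwPoly_conj c n (by rw [← map_mul_algebraMap, hq, map_one_algebraMap]) _ _

/-- Transgression forms are invariant under coordinate changes on the fibre. -/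
theorem transForm_eq (h : ChartChange T f f' H U U') (c : ℕ → ℂ) (b : Bool) (a : ι)
    (ha : ∀ z ∈ U', ∀ c, jac T (Sum.inl a) c z = if c = Sum.inl a then 1 else 0)
    (hJ : ∀ z ∈ U', ∀ i j b, wd b (Sum.inl a) (jac T i j) z = 0)
    (hH : ∀ z ∈ U', wd b (Sum.inl a) (fun y => (H y : ℂ)) z = 0)
    {z : ℂ^(ι ⊕ Fin n)} (hz : z ∈ U') :
    transForm c b (Sum.inl a) f' z =
      cmap (covPullback T z) (h.surjective z hz) (transForm c b (Sum.inl a) f (T z)) := by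
  have hU' := h.family'.isOpen
  have hq := Matrix.nonsing_inv_mul _ (isUnit_iff_ne_zero.mpr (h.det_fibreJac hz).1)
  have hdJ : ∀ i j, DifferentiableAt ℝ (jac T i j) z := fun i j =>
    diffAt_of_contDiffOn hU' (contDiffOn_jac hU' h.holomorphic i j) hz
  have z1 : wdM b (Sum.inl a) (fibreJac T) z = 0 := by
    ext i j
    exact hJ z hz _ _ b
  have z2 : wdM b (Sum.inl a) (fibreJacConj T) z = 0 := by
    ext i j
    refine (wd_conj (hdJ _ _) b _).trans ?_
    rw [hJ z hz]; simp
  have h1 : logDeriv b (Sum.inl a) f' z =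
      fibreJac T z * logDeriv b (Sum.inl a) f (T z) * (fibreJac T z)⁻¹ := by
    rw [h.logDeriv_eq hz b _ z2, z1, zero_mul, add_zero]
    congr 2
    simp only [ha z hz]
    rw [Finset.sum_eq_single (Sum.inl a)]
    · simp
    · intro c _ hc
      rw [if_neg hc, map_zero, zero_smul]
    · simp
  have h2 : potDeriv b (Sum.inl a) f' z = potDeriv b (Sum.inl a) f (T z) := by
    have hfT : SmoothOn (fun y => (f (T y) : ℂ)) U' :=
      h.contDiffOn_comp (contDiffOn_ofReal h.family.smooth)
    have h3 : Set.EqOn (fun y => (f' y : ℂ)) (fun y => (f (T y) : ℂ) + (H y : ℂ)) U' :=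
      fun y hy => by
        change (f' y : ℂ) = (f (T y) : ℂ) + (H y : ℂ)
        rw [h.potential y hy]; push_cast; rfl
    rw [potDeriv, wd_congr_on hU' h3 b _ hz, wd_add (diffAt_of_contDiffOn hU' hfT hz)
      (diffAt_of_contDiffOn hU' (contDiffOn_ofReal h.smooth) hz), hH z hz, add_zero,
      wd_comp_jac (f := fun y => (f y : ℂ)) hU' h.holomorphic hz (diffAt_of_contDiffOn
        h.family.isOpen (contDiffOn_ofReal h.family.smooth) (h.mapsTo hz))]
    simp only [ha z hz]
    rw [Finset.sum_eq_single (Sum.inl a)]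
    · simp [potDeriv]
    · intro c _ hc
      rw [if_neg hc, map_zero, zero_mul]
    · simp
  have h4 : ∀ M : Matrix (Fin n) (Fin n) ℂ, (M.map (algebraMap ℂ (CFrm (ι ⊕ Fin n)))).map
      (cmap (covPullback T z) (h.surjective z hz)) = M.map (algebraMap ℂ _) := fun M => by
    ext1 i j
    exact (cmap (covPullback T z) (h.surjective z hz)).commutes (M i j)
  rw [transForm, transForm, map_dcwPoly, ← h.ddbarFun_eq hz, h.curvature_eq hz, h1, h2, h4,
    AlgHom.commutes, map_mul_algebraMap, map_mul_algebraMap]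
  exact dcwPoly_conj c n (by rw [← map_mul_algebraMap, hq, map_one_algebraMap]) _ _ _ _

end ChartChange

end ChartChange

/-! ### Integration on manifolds with an atlas -/

section ChartSystem

variable {κ : Type} [Fintype κ] [DecidableEq κ] {S I : Type}

/-- The part of the `i`-th chart whose image meets the `j`-th chart. -/
def overlap (dom : I → Set ℂ^κ) (q : I → ℂ^κ → S) (i j : I) : Set ℂ^κ :=
  {u | u ∈ dom i ∧ q i u ∈ q j '' dom j}

/-- An atlas with parametrizations `q i` and holomorphic transition maps `τ i j`. -/
structure ChartSystem (dom : I → Set ℂ^κ) (q : I → ℂ^κ → S)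
    (τ : I → I → ℂ^κ → ℂ^κ) : Prop where
  isOpen : ∀ i, IsOpen (dom i)
  injOn : ∀ i, Set.InjOn (q i) (dom i)
  isOpen_overlap : ∀ i j, IsOpen (overlap dom q i j)
  mapsTo : ∀ i j, ∀ u ∈ overlap dom q i j, τ i j u ∈ dom j
  compat : ∀ i j, ∀ u ∈ overlap dom q i j, q j (τ i j u) = q i u
  holomorphic : ∀ i j, DifferentiableOn ℂ (τ i j) (overlap dom q i j)

/-- Measurable parts of the charts whose images partition the manifold. -/
structure IsPartition (dom : I → Set ℂ^κ) (q : I → ℂ^κ → S) (P : I → Set ℂ^κ) :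
    Prop where
  measurableSet : ∀ i, MeasurableSet (P i)
  subset : ∀ i, P i ⊆ dom i
  cover : ∀ i, ∀ u ∈ dom i, ∃ j, q i u ∈ q j '' P j
  disjoint : ∀ i j, ∀ u ∈ P i, ∀ v ∈ P j, q i u = q j v → i = j

variable {dom : I → Set ℂ^κ} {q : I → ℂ^κ → S} {τ : I → I → ℂ^κ → ℂ^κ}

namespace ChartSystem

theorem mem_overlap_symm (h : ChartSystem dom q τ) {i j : I} {u : ℂ^κ}
    (hu : u ∈ overlap dom q i j) : τ i j u ∈ overlap dom q j i :=
  ⟨h.mapsTo i j u hu, u, hu.1, (h.compat i j u hu).symm⟩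

theorem trans_trans (h : ChartSystem dom q τ) {i j : I} {u : ℂ^κ}
    (hu : u ∈ overlap dom q i j) : τ j i (τ i j u) = u := by
  refine h.injOn i (h.mapsTo j i _ (h.mem_overlap_symm hu)) hu.1 ?_
  rw [h.compat j i _ (h.mem_overlap_symm hu), h.compat i j u hu]

theorem injOn_trans (h : ChartSystem dom q τ) (i j : I) : Set.InjOn (τ i j) (overlap dom q i j) :=
  fun u hu v hv huv => by rw [← h.trans_trans hu, huv, h.trans_trans hv]

theorem trans_eq (h : ChartSystem dom q τ) {i j : I} {u v : ℂ^κ} (hu : u ∈ dom i)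
    (hv : v ∈ dom j) (huv : q i u = q j v) : u ∈ overlap dom q i j ∧ τ i j u = v := by
  have hu' : u ∈ overlap dom q i j := ⟨hu, v, hv, huv.symm⟩
  exact ⟨hu', h.injOn j (h.mapsTo i j u hu') hv (by rw [h.compat i j u hu', huv])⟩

theorem differentiableAt (h : ChartSystem dom q τ) {i j : I} {u : ℂ^κ}
    (hu : u ∈ overlap dom q i j) : DifferentiableAt ℂ (τ i j) u :=
  (h.holomorphic i j).differentiableAt ((h.isOpen_overlap i j).mem_nhds hu)

theorem covPullback_surjective (h : ChartSystem dom q τ) {i j : I} {u : ℂ^κ}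
    (hu : u ∈ overlap dom q i j) : Function.Surjective (covPullback (τ i j) u) := by
  have h1 := (h.differentiableAt hu).restrictScalars ℝ
  have h2 := (h.differentiableAt (h.mem_overlap_symm hu)).restrictScalars ℝ
  have h3 : HasFDerivAt (fun v => τ j i (τ i j v))
      ((fderiv ℝ (τ j i) (τ i j u)).comp (fderiv ℝ (τ i j) u)) u :=
    h2.hasFDerivAt.comp u h1.hasFDerivAt
  have h4 : (fun v => τ j i (τ i j v)) =ᶠ[nhds u] id :=
    Filter.eventually_of_mem ((h.isOpen_overlap i j).mem_nhds hu) fun v hv => h.trans_trans hv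
  have h5 := (h3.congr_of_eventuallyEq h4.symm).unique (hasFDerivAt_id u)
  intro α
  refine ⟨covPullback (τ j i) (τ i j u) α, LinearMap.ext fun v => ?_⟩
  change α (fderiv ℝ (τ j i) (τ i j u) (fderiv ℝ (τ i j) u v)) = α v
  exact congrArg α (DFunLike.congr_fun h5 v)

/-- `h` is the coefficient of a density on the manifold. -/
def IsDensity (dom : I → Set ℂ^κ) (q : I → ℂ^κ → S) (τ : I → I → ℂ^κ → ℂ^κ)
    (h : I → ℂ^κ → ℂ) : Prop :=
  ∀ i j, ∀ u ∈ overlap dom q i j, h i u = |(fderiv ℝ (τ i j) u).det| * h j (τ i j u)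

/-- The integral of a density supported in one chart. -/
theorem hasSum_integral [Countable I] (h : ChartSystem dom q τ) {P : I → Set ℂ^κ}
    (hP : IsPartition dom q P) {d : I → ℂ^κ → ℂ} (hd : IsDensity dom q τ d) (k : I)
    (hint : IntegrableOn (d k) (dom k))
    (hsupp : ∀ i, ∀ u ∈ dom i, q i u ∉ q k '' dom k → d i u = 0) :
    HasSum (fun i => ∫ u in P i, d i u) (∫ u in dom k, d k u) := by
  have hmeas : ∀ i, MeasurableSet (P i ∩ overlap dom q i k) := fun i =>
    (hP.measurableSet i).inter (h.isOpen_overlap i k).measurableSet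
  have hderiv : ∀ i, ∀ u ∈ P i ∩ overlap dom q i k,
      HasFDerivWithinAt (τ i k) (fderiv ℝ (τ i k) u) (P i ∩ overlap dom q i k) u := fun i u hu =>
    ((h.differentiableAt hu.2).restrictScalars ℝ).hasFDerivAt.hasFDerivWithinAt
  have hinj : ∀ i, Set.InjOn (τ i k) (P i ∩ overlap dom q i k) := fun i =>
    (h.injOn_trans i k).mono Set.inter_subset_right
  have hV : ⋃ i, τ i k '' (P i ∩ overlap dom q i k) = dom k := by
    apply Set.Subset.antisymm
    · rintro v ⟨_, ⟨i, rfl⟩, u, hu, rfl⟩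
      exact h.mapsTo i k u hu.2
    · intro v hv
      obtain ⟨i, u, hu, huv⟩ := hP.cover k v hv
      obtain ⟨h1, h2⟩ := h.trans_eq (hP.subset i hu) hv huv
      exact Set.mem_iUnion.mpr ⟨i, u, ⟨hu, h1⟩, h2⟩
  have hdisj : Pairwise (Function.onFun Disjoint fun i => τ i k '' (P i ∩ overlap dom q i k)) := by
    intro i j hij
    refine Set.disjoint_left.mpr ?_
    rintro _ ⟨u, hu, rfl⟩ ⟨v, hv, hvu⟩
    refine hij (hP.disjoint i j u hu.1 v hv.1 ?_)
    rw [← h.compat i k u hu.2, ← h.compat j k v hv.2, hvu]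
  have hsum := hasSum_integral_iUnion (f := d k)
    (fun i => measurable_image_of_fderivWithin (hmeas i) (hderiv i) (hinj i)) hdisj (by rwa [hV])
  rw [hV] at hsum
  refine hsum.congr_fun ?_ |> fun h => h
  intro i
  rw [integral_image_eq_integral_abs_det_fderiv_smul volume (hmeas i) (hderiv i) (hinj i)]
  rw [setIntegral_eq_of_subset_of_forall_sdiff_eq_zero (s := P i ∩ overlap dom q i k) (t := P i)
    (hP.measurableSet i) Set.inter_subset_left]
  · refine setIntegral_congr_fun (hmeas i) fun u hu => ?_
    rw [hd i k u hu.2, Complex.real_smul]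
  · rintro u ⟨hu, hu'⟩
    exact hsupp i u (hP.subset i hu) fun hq => hu' ⟨hu, hP.subset i hu, hq⟩

/-- The parts of the charts not covered by the previous charts. -/
theorem isPartition_piece {dom : ℕ → Set ℂ^κ} {q : ℕ → ℂ^κ → S}
    {τ : ℕ → ℕ → ℂ^κ → ℂ^κ} (h : ChartSystem dom q τ) :
    IsPartition dom q fun i => {u | u ∈ dom i ∧ ∀ j < i, q i u ∉ q j '' dom j} where
  measurableSet i := by
    have : {u | u ∈ dom i ∧ ∀ j < i, q i u ∉ q j '' dom j} =
        dom i ∩ ⋂ j ∈ Set.Iio i, (overlap dom q i j)ᶜ := by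
      ext u
      simp only [Set.mem_ofPred_eq, Set.mem_inter_iff, Set.mem_iInter, Set.mem_compl_iff,
        Set.mem_Iio, overlap, not_and]
      exact and_congr_right fun hu => forall₂_congr fun j _ => by simp [hu]
    rw [this]
    exact (h.isOpen i).measurableSet.inter (MeasurableSet.biInter (Set.to_countable _) fun j _ =>
      (h.isOpen_overlap i j).measurableSet.compl)
  subset i u hu := hu.1
  cover i u hu := by
    classical
    have hex : ∃ j, q i u ∈ q j '' dom j := ⟨i, u, hu, rfl⟩
    obtain ⟨v, hv, hvu⟩ := Nat.find_spec hex
    exact ⟨Nat.find hex, v, ⟨hv, fun j hj hq => Nat.find_min hex hj (hvu ▸ hq)⟩, hvu⟩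
  disjoint i j u hu v hv huv := by
    rcases lt_trichotomy i j with hij | hij | hij
    · exact absurd ⟨u, hu.1, huv⟩ (hv.2 i hij)
    · exact hij
    · exact absurd ⟨v, hv.1, huv.symm⟩ (hu.2 j hij)

end ChartSystem

end ChartSystem

section ProductSystem

variable {ι κ : Type} [Fintype ι] [DecidableEq ι] [Fintype κ] [DecidableEq κ] {S S' I I' : Type}

/-- The coordinates of the first factor. -/
def zFst (z : ℂ^(ι ⊕ κ)) : ι → ℂ := fun a => z (Sum.inl a)

/-- The coordinates of the second factor. -/
def zSnd (z : ℂ^(ι ⊕ κ)) : κ → ℂ := fun a => z (Sum.inr a)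

/-- Product of sets of coordinates. -/
def zProd (V : Set ℂ^ι) (W : Set ℂ^κ) : Set ℂ^(ι ⊕ κ) := {z | zFst z ∈ V ∧ zSnd z ∈ W}

/-- Product of maps of coordinates. -/
def zMap (f : ℂ^ι → ℂ^ι) (g : ℂ^κ → ℂ^κ) (z : ℂ^(ι ⊕ κ)) : ι ⊕ κ → ℂ :=
  Sum.elim (f (zFst z)) (g (zSnd z))

theorem contDiff_zFst : ContDiff ℝ ∞ (zFst : ℂ^(ι ⊕ κ) → ℂ^ι) :=
  contDiff_pi.mpr fun a => contDiff_apply ℝ ℂ (Sum.inl a : ι ⊕ κ)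

theorem contDiff_zSnd : ContDiff ℝ ∞ (zSnd : ℂ^(ι ⊕ κ) → ℂ^κ) :=
  contDiff_pi.mpr fun a => contDiff_apply ℝ ℂ (Sum.inr a : ι ⊕ κ)

theorem differentiable_zFst : Differentiable ℂ (zFst : ℂ^(ι ⊕ κ) → ℂ^ι) :=
  differentiable_pi.mpr fun a => differentiable_apply (Sum.inl a : ι ⊕ κ)

theorem differentiable_zSnd : Differentiable ℂ (zSnd : ℂ^(ι ⊕ κ) → ℂ^κ) :=
  differentiable_pi.mpr fun a => differentiable_apply (Sum.inr a : ι ⊕ κ)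

theorem isOpen_zProd {V : Set ℂ^ι} {W : Set ℂ^κ} (hV : IsOpen V) (hW : IsOpen W) :
    IsOpen (zProd V W) :=
  (hV.preimage contDiff_zFst.continuous).inter (hW.preimage contDiff_zSnd.continuous)

theorem differentiableOn_zMap {f : ℂ^ι → ℂ^ι} {g : ℂ^κ → ℂ^κ} {V : Set ℂ^ι}
    {W : Set ℂ^κ} (hf : DifferentiableOn ℂ f V) (hg : DifferentiableOn ℂ g W) :
    DifferentiableOn ℂ (zMap f g) (zProd V W) := by
  refine differentiableOn_pi.mpr ?_
  rintro (a | a)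
  · exact (differentiableOn_apply hf a).comp differentiable_zFst.differentiableOn fun z hz => hz.1
  · exact (differentiableOn_apply hg a).comp differentiable_zSnd.differentiableOn fun z hz => hz.2

/-- The product of two parametrizations. -/
def qProd (q : I → ℂ^ι → S) (q' : I' → ℂ^κ → S') (p : I × I') (z : ℂ^(ι ⊕ κ)) : S × S' :=
  (q p.1 (zFst z), q' p.2 (zSnd z))

variable {dom : I → Set ℂ^ι} {q : I → ℂ^ι → S} {τ : I → I → ℂ^ι → ℂ^ι}
  {dom' : I' → Set ℂ^κ} {q' : I' → ℂ^κ → S'} {τ' : I' → I' → ℂ^κ → ℂ^κ}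

theorem mem_image_qProd (V : I → Set ℂ^ι) (W : I' → Set ℂ^κ) (p : I × I') (s : S × S') :
    s ∈ qProd q q' p '' zProd (V p.1) (W p.2) ↔
      s.1 ∈ q p.1 '' V p.1 ∧ s.2 ∈ q' p.2 '' W p.2 := by
  constructor
  · rintro ⟨z, hz, rfl⟩
    exact ⟨⟨_, hz.1, rfl⟩, ⟨_, hz.2, rfl⟩⟩
  · rintro ⟨⟨v, hv, h1⟩, ⟨u, hu, h2⟩⟩
    exact ⟨Sum.elim v u, ⟨hv, hu⟩, Prod.ext h1 h2⟩

theorem overlap_prod (p p' : I × I') :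
    overlap (fun p : I × I' => zProd (dom p.1) (dom' p.2)) (qProd q q') p p' =
      zProd (overlap dom q p.1 p'.1) (overlap dom' q' p.2 p'.2) := by
  ext z
  simp only [overlap, Set.mem_ofPred_eq]
  rw [mem_image_qProd dom dom']
  exact and_and_and_comm

theorem ChartSystem.prod (h : ChartSystem dom q τ) (h' : ChartSystem dom' q' τ') :
    ChartSystem (fun p : I × I' => zProd (dom p.1) (dom' p.2)) (qProd q q')
      (fun p p' => zMap (τ p.1 p'.1) (τ' p.2 p'.2)) where
  isOpen p := isOpen_zProd (h.isOpen p.1) (h'.isOpen p.2)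
  injOn p z hz w hw hzw := by
    have h1 := h.injOn p.1 hz.1 hw.1 (congrArg Prod.fst hzw)
    have h2 := h'.injOn p.2 hz.2 hw.2 (congrArg Prod.snd hzw)
    ext (a | a)
    · exact congrFun h1 a
    · exact congrFun h2 a
  isOpen_overlap p p' := by
    rw [overlap_prod]
    exact isOpen_zProd (h.isOpen_overlap _ _) (h'.isOpen_overlap _ _)
  mapsTo p p' z hz := by
    rw [overlap_prod] at hz
    exact ⟨h.mapsTo _ _ _ hz.1, h'.mapsTo _ _ _ hz.2⟩
  compat p p' z hz := by
    rw [overlap_prod] at hz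
    exact Prod.ext (h.compat _ _ _ hz.1) (h'.compat _ _ _ hz.2)
  holomorphic p p' := by
    rw [overlap_prod]
    exact differentiableOn_zMap (h.holomorphic _ _) (h'.holomorphic _ _)

theorem IsPartition.prod {P : I → Set ℂ^ι} {P' : I' → Set ℂ^κ} (h : IsPartition dom q P)
    (h' : IsPartition dom' q' P') :
    IsPartition (fun p : I × I' => zProd (dom p.1) (dom' p.2)) (qProd q q')
      (fun p => zProd (P p.1) (P' p.2)) where
  measurableSet p := ((h.measurableSet p.1).preimage contDiff_zFst.continuous.measurable).inter
    ((h'.measurableSet p.2).preimage contDiff_zSnd.continuous.measurable)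
  subset p z hz := ⟨h.subset _ hz.1, h'.subset _ hz.2⟩
  cover p z hz := by
    obtain ⟨j, hj⟩ := h.cover p.1 _ hz.1
    obtain ⟨j', hj'⟩ := h'.cover p.2 _ hz.2
    exact ⟨(j, j'), (mem_image_qProd P P' (j, j') _).mpr ⟨hj, hj'⟩⟩
  disjoint p p' z hz w hw hzw := Prod.ext
    (h.disjoint _ _ _ hz.1 _ hw.1 (congrArg Prod.fst hzw))
    (h'.disjoint _ _ _ hz.2 _ hw.2 (congrArg Prod.snd hzw))

/-- Fubini's theorem on a product of coordinate spaces. -/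
theorem integral_zProd {V : Set ℂ^ι} {W : Set ℂ^κ} {f : ℂ^(ι ⊕ κ) → ℂ}
    (hf : IntegrableOn f (zProd V W)) :
    ∫ z in zProd V W, f z = ∫ v in V, ∫ u in W, f (Sum.elim v u) := by
  have mp := volume_measurePreserving_sumPiEquivProdPi (fun _ : ι ⊕ κ => ℂ)
  have hpre : zProd V W = (MeasurableEquiv.sumPiEquivProdPi (fun _ : ι ⊕ κ => ℂ)) ⁻¹' (V ×ˢ W) :=
    rfl
  have hcomp : f = (fun p : ℂ^ι × ℂ^κ => f (Sum.elim p.1 p.2)) ∘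
      (MeasurableEquiv.sumPiEquivProdPi (fun _ : ι ⊕ κ => ℂ)) := by
    ext z
    simp only [Function.comp_apply]
    congr 1
    ext (a | a) <;> rfl
  have hint : IntegrableOn (fun p : ℂ^ι × ℂ^κ => f (Sum.elim p.1 p.2)) (V ×ˢ W)
      (volume.prod volume) := by
    rw [hpre, hcomp] at hf
    exact (mp.integrableOn_comp_preimage (MeasurableEquiv.measurableEmbedding _)).mp hf
  have h1 : ∫ z in zProd V W, f z =
      ∫ p in V ×ˢ W, f (Sum.elim p.1 p.2) ∂((volume : Measure ℂ^ι).prod volume) := by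
    rw [hpre]
    conv_lhs => rw [hcomp]
    exact mp.setIntegral_preimage_emb (MeasurableEquiv.measurableEmbedding _)
      (fun p : ℂ^ι × ℂ^κ => f (Sum.elim p.1 p.2)) _
  rw [h1, setIntegral_prod _ hint]

end ProductSystem

/-! ### Partitions of unity -/

theorem exists_finite_partition {V D : Type} [TopologicalSpace V] {Sm : (V → ℝ) → Prop}
    (hone : Sm fun _ => 1) (hmul : ∀ f g, Sm f → Sm g → Sm fun z => f z * g z)
    (hsub : ∀ f, Sm f → Sm fun z => 1 - f z)
    {Bd : D → (V → ℝ) → Prop} {K : Set V} (hK : IsCompact K)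
    (h : ∀ z ∈ K, ∃ d b, Sm b ∧ Bd d b ∧ ∀ᶠ w in nhds z, b w = 1) :
    ∃ (L : ℕ) (d : Fin L → D) (b ρ : Fin L → V → ℝ), (∀ l, Sm (ρ l)) ∧ (∀ l, Bd (d l) (b l)) ∧
      (∀ l w, ρ l w ≠ 0 → b l w ≠ 0) ∧ ∀ z ∈ K, ∑ l, ρ l z = 1 := by
  choose d b hb using h
  obtain ⟨t, ht⟩ := hK.elim_nhds_subcover' (fun z hz => {w | b z hz w = 1})
    fun z hz => (hb z hz).2.2
  let e : Fin t.card → K := fun l => (t.equivFin.symm l : K)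
  let β : Fin t.card → V → ℝ := fun l => b (e l) (e l).2
  refine ⟨t.card, fun l => d (e l) (e l).2, β,
    fun l w => β l w * ∏ j ∈ univ.filter (· < l), (1 - β j w), fun l => ?_,
    fun l => (hb (e l) (e l).2).2.1, fun l w => left_ne_zero_of_mul, fun z hz => ?_⟩
  · have hβ : ∀ j, Sm (β j) := fun j => (hb (e j) (e j).2).1
    have hprod : ∀ s : Finset (Fin t.card), Sm fun w => ∏ j ∈ s, (1 - β j w) := by
      intro s
      induction s using Finset.induction_on with
      | empty => simpa using hone
      | insert a s ha ih =>
        simp only [Finset.prod_insert ha]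
        exact hmul _ _ (hsub _ (hβ a)) ih
    exact hmul _ _ (hβ l) (hprod _)
  · have h1 := Finset.prod_one_sub_ordered univ fun l => β l z
    obtain ⟨y, hy, hyz⟩ := Set.mem_iUnion₂.mp (ht hz)
    have h2 : ∏ l, (1 - β l z) = 0 := by
      refine Finset.prod_eq_zero (Finset.mem_univ (t.equivFin ⟨y, hy⟩)) ?_
      have : e (t.equivFin ⟨y, hy⟩) = y := by simp [e]
      change 1 - b (e _) (e _).2 z = 0
      rw [this]
      exact sub_eq_zero.mpr hyz.symm
    rw [h2] at h1
    linarith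

/-! ### Integrals depending on parameters -/

section ParametricIntegral

variable {ι G : Type} [Fintype ι] [DecidableEq ι] [NormedAddCommGroup G] [NormedSpace ℝ G]
  [FiniteDimensional ℝ G] [MeasureSpace G] [BorelSpace G] [(volume : Measure G).IsAddHaarMeasure]
  {V : Set ℂ^ι} {f : G → ℝ} {g : ℂ^ι × G → ℂ} {C : Set G}

theorem integral_eq_convolution (k : G → ℂ) : ∫ x, f x • k x =
    convolution (fun x => f (-x)) k (ContinuousLinearMap.lsmul ℝ ℝ) volume 0 := by
  rw [convolution_eq_swap]
  simp

theorem locallyIntegrable_neg (hf : LocallyIntegrable f) : LocallyIntegrable fun x => f (-x) :=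
  (locallyIntegrable_map_homeomorph (Homeomorph.neg G)).mp
    (by rwa [show Measure.map (Homeomorph.neg G) volume = volume from Measure.map_neg_eq_self _])

variable (hV : IsOpen V) (hC : IsCompact C) (hz : ∀ v ∈ V, ∀ x ∉ C, g (v, x) = 0)
  (hf : LocallyIntegrable f) (hg : SmoothOn g (V ×ˢ Set.univ))
include hV hC hz hf hg

theorem contDiffOn_integral : SmoothOn (fun v => ∫ x, f x • g (v, x)) V := by
  simp only [fun v => integral_eq_convolution (f := f) fun x => g (v, x)]
  exact contDiffOn_convolution_right_with_param_comp (n := ⊤) (g := fun v x => g (v, x))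
    (ContinuousLinearMap.lsmul ℝ ℝ) contDiffOn_const hV hC (fun v x hv => hz v hv x)
    (locallyIntegrable_neg hf) hg

theorem wd_integral {v : ℂ^ι} (hv : v ∈ V) (b : Bool) (a : ι) :
    wd b a (fun v => ∫ x, f x • g (v, x)) v = ∫ x, f x • wd b a (fun y => g (y, x)) v := by
  have hO : IsOpen (V ×ˢ (Set.univ : Set G)) := hV.prod isOpen_univ
  have hs : HasCompactSupport fun x => fderiv ℝ g (v, x) := HasCompactSupport.intro hC fun x hx => by
    have h : Set.EqOn g (fun _ => 0) (V ×ˢ Cᶜ) := fun y hy => hz y.1 hy.1 y.2 hy.2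
    rw [(h.eventuallyEq_of_mem ((hV.prod hC.isClosed.isOpen_compl).mem_nhds
      (show (v, x) ∈ V ×ˢ Cᶜ from ⟨hv, hx⟩))).fderiv_eq]
    simp
  have hc : Continuous fun x => fderiv ℝ g (v, x) :=
    (hg.fderiv_of_isOpen (m := ∞) hO (by simp)).continuousOn.comp_continuous (by fun_prop)
      fun x => ⟨hv, trivial⟩
  have h1 : ∀ w, fderiv ℝ (fun v => ∫ x, f x • g (v, x)) v w =
      ∫ x, f x • fderiv ℝ g (v, x) (w, 0) := fun w => by
    have h := HasFDerivAt.comp (f := fun v : ℂ^ι => (v, (0 : G))) v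
      (hasFDerivAt_convolution_right_with_param (μ := volume) (g := fun v x => g (v, x))
        (ContinuousLinearMap.lsmul ℝ ℝ : ℝ →L[ℝ] ℂ →L[ℝ] ℂ) hV hC (fun v x hv => hz v hv x)
        (locallyIntegrable_neg hf) (hg.of_le (by exact_mod_cast le_top)) (v, (0 : G)) hv)
      (hasFDerivAt_prodMk_left v 0)
    simp only [integral_eq_convolution]
    refine (DFunLike.congr_fun h.fderiv w).trans ?_
    exact convolution_precompR_apply _ (locallyIntegrable_neg hf) hs hc 0 ((w, 0) : ℂ^ι × G)
  have hi : ∀ w, Integrable fun x => f x • fderiv ℝ g (v, x) (w, 0) := fun w =>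
    hf.integrable_smul_right_of_hasCompactSupport (hc.clm_apply continuous_const)
      (hs.comp_left (g := fun L : ℂ^ι × G →L[ℝ] ℂ => L (w, 0)) rfl)
  have h2 : ∀ x w, fderiv ℝ (fun y => g (y, x)) v w = fderiv ℝ g (v, x) (w, 0) := fun x w =>
    DFunLike.congr_fun ((diffAt_of_contDiffOn hO hg ⟨hv, trivial⟩).hasFDerivAt.comp v
      (hasFDerivAt_prodMk_left v x)).fderiv w
  simp only [wd, wdir, h1, h2, smul_comm (f _), smul_add]
  refine Eq.trans ?_ (integral_add ((hi _).smul (1 / 2 : ℂ))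
    (((hi _).smul (wsgn b * Complex.I)).smul (1 / 2 : ℂ))).symm
  simp only [Pi.smul_apply, integral_smul]

end ParametricIntegral

/-! ### Integration along the second factor -/

section FibreIntegral

variable {ι κ : Type} [Fintype ι] [DecidableEq ι] [Fintype κ] [DecidableEq κ]

/-- `Sum.elim` as a continuous linear map. -/
def elimCLM (ι κ : Type) [Fintype ι] [Fintype κ] :
    (ℂ^ι × ℂ^κ) →L[ℝ] ℂ^(ι ⊕ κ) :=
  ContinuousLinearMap.pi fun
    | Sum.inl a => (ContinuousLinearMap.proj (R := ℝ) (φ := fun _ : ι => ℂ) a).comp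
        (ContinuousLinearMap.fst ℝ ℂ^ι ℂ^κ)
    | Sum.inr a => (ContinuousLinearMap.proj (R := ℝ) (φ := fun _ : κ => ℂ) a).comp
        (ContinuousLinearMap.snd ℝ ℂ^ι ℂ^κ)

theorem elimCLM_apply (p : ℂ^ι × ℂ^κ) : elimCLM ι κ p = Sum.elim p.1 p.2 := by
  ext (a | a) <;> rfl

theorem contDiff_elim_right (v : ℂ^ι) :
    ContDiff ℝ ∞ (fun u : ℂ^κ => (Sum.elim v u : ℂ^(ι ⊕ κ))) := by
  have : (fun u : ℂ^κ => (Sum.elim v u : ℂ^(ι ⊕ κ))) = fun u => elimCLM ι κ (v, u) := by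
    ext1 u; rw [elimCLM_apply]
  rw [this]
  exact (elimCLM ι κ).contDiff.comp (contDiff_const.prodMk contDiff_id)

theorem single_inl (a : ι) (c : ℂ) :
    (Pi.single (Sum.inl a) c : ℂ^(ι ⊕ κ)) = elimCLM ι κ (Pi.single a c, 0) := by
  rw [elimCLM_apply]
  ext (b | b)
  · simp [Pi.single_apply]
  · simp

theorem single_inr (a : κ) (c : ℂ) :
    (Pi.single (Sum.inr a) c : ℂ^(ι ⊕ κ)) = elimCLM ι κ (0, Pi.single a c) := by
  rw [elimCLM_apply]
  ext (b | b)
  · simp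
  · simp [Pi.single_apply]

theorem wd_fibre {h : ℂ^(ι ⊕ κ) → ℂ} {v : ℂ^ι}
    {u : ℂ^κ} (hh : DifferentiableAt ℝ h (Sum.elim v u)) (b : Bool) (a : κ) :
    wd b a (fun y => h (Sum.elim v y)) u = wd b (Sum.inr a) h (Sum.elim v u) := by
  have h1 : HasFDerivAt (fun y : ℂ^κ => (Sum.elim v y : ℂ^(ι ⊕ κ)))
      ((elimCLM ι κ).comp (ContinuousLinearMap.inr ℝ ℂ^ι ℂ^κ)) u := by
    have h2 : (fun y : ℂ^κ => (Sum.elim v y : ℂ^(ι ⊕ κ))) = fun y => elimCLM ι κ (v, y) := by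
      ext1 y; rw [elimCLM_apply]
    rw [h2]
    exact (elimCLM ι κ).hasFDerivAt.comp u (hasFDerivAt_prodMk_right v u)
  have h3 : fderiv ℝ (fun y => h (Sum.elim v y)) u = _ := (hh.hasFDerivAt.comp u h1).fderiv
  rw [wd, wdir, wd, wdir, h3, I_smul_single, I_smul_single, single_inr, single_inr]
  rfl

theorem wd_base {h : ℂ^(ι ⊕ κ) → ℂ} {v : ℂ^ι}
    {u : ℂ^κ} (hh : DifferentiableAt ℝ h (Sum.elim v u)) (b : Bool) (a : ι) :
    wd b a (fun y => h (Sum.elim y u)) v = wd b (Sum.inl a) h (Sum.elim v u) := by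
  have h1 : HasFDerivAt (fun y : ℂ^ι => (Sum.elim y u : ℂ^(ι ⊕ κ)))
      ((elimCLM ι κ).comp (ContinuousLinearMap.inl ℝ ℂ^ι ℂ^κ)) v := by
    have h2 : (fun y : ℂ^ι => (Sum.elim y u : ℂ^(ι ⊕ κ))) = fun y => elimCLM ι κ (y, u) := by
      ext1 y; rw [elimCLM_apply]
    rw [h2]
    exact (elimCLM ι κ).hasFDerivAt.comp v (hasFDerivAt_prodMk_left v u)
  have h3 : fderiv ℝ (fun y => h (Sum.elim y u)) v = _ := (hh.hasFDerivAt.comp v h1).fderiv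
  rw [wd, wdir, wd, wdir, h3, I_smul_single, I_smul_single, single_inl, single_inl]
  rfl

/-- Integral along the second factor. -/
def fibreInt (h : ℂ^(ι ⊕ κ) → ℂ) (v : ℂ^ι) : ℂ := ∫ u, h (Sum.elim v u)

/-- `h` is smooth over `W` with support in the compact set `C` along the second factor. -/
structure FibreCompact (h : ℂ^(ι ⊕ κ) → ℂ) (W : Set ℂ^ι) (C : Set ℂ^κ) : Prop where
  isOpen : IsOpen W
  isCompact : IsCompact C
  smooth : SmoothOn h (zFst ⁻¹' W)
  support : ∀ z, zFst z ∈ W → zSnd z ∉ C → h z = 0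

namespace FibreCompact

variable {h k : ℂ^(ι ⊕ κ) → ℂ} {W : Set ℂ^ι} {C : Set ℂ^κ}

theorem isOpen_preimage (hh : FibreCompact h W C) :
    IsOpen (zFst ⁻¹' W : Set ℂ^(ι ⊕ κ)) := hh.isOpen.preimage contDiff_zFst.continuous

theorem continuous_fibre (hh : FibreCompact h W C) {v : ℂ^ι} (hv : v ∈ W) :
    Continuous fun u => h (Sum.elim v u) :=
  hh.smooth.continuousOn.comp_continuous (contDiff_elim_right v).continuous fun _ => hv

theorem integrable (hh : FibreCompact h W C) {v : ℂ^ι} (hv : v ∈ W) :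
    Integrable fun u => h (Sum.elim v u) :=
  (hh.continuous_fibre hv).integrable_of_hasCompactSupport
    (HasCompactSupport.intro hh.isCompact fun _ hu => hh.support _ hv hu)

theorem wd (hh : FibreCompact h W C) (b : Bool) (a : ι ⊕ κ) : FibreCompact (wd b a h) W C where
  isOpen := hh.isOpen
  isCompact := hh.isCompact
  smooth := contDiffOn_wd hh.isOpen_preimage hh.smooth b a
  support z hz hz' := by
    have hO : IsOpen (zProd W Cᶜ) := isOpen_zProd hh.isOpen hh.isCompact.isClosed.isOpen_compl
    have h1 : Set.EqOn h (fun _ => 0) (zProd W Cᶜ) := fun y hy => hh.support y hy.1 hy.2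
    rw [wd_congr_on hO h1 b a ⟨hz, hz'⟩, wd_const]

theorem smooth_elim (hh : FibreCompact h W C) :
    SmoothOn (fun p : ℂ^ι × ℂ^κ => h (Sum.elim p.1 p.2)) (W ×ˢ Set.univ) := by
  simp only [← elimCLM_apply]
  exact hh.smooth.comp (elimCLM ι κ).contDiff.contDiffOn fun p hp => by
    rw [elimCLM_apply]; exact hp.1

theorem contDiffOn_fibreInt (hh : FibreCompact h W C) : SmoothOn (fibreInt h) W := by
  have := contDiffOn_integral hh.isOpen hh.isCompact (f := fun _ => 1)
    (fun v hv u hu => hh.support (Sum.elim v u) hv hu) continuous_const.locallyIntegrable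
    hh.smooth_elim
  simp only [one_smul] at this
  exact this

theorem wd_fibreInt (hh : FibreCompact h W C) {v : ℂ^ι} (hv : v ∈ W) (b : Bool) (a : ι) :
    HigherEnergy.wd b a (fibreInt h) v = fibreInt (HigherEnergy.wd b (Sum.inl a) h) v := by
  have := wd_integral hh.isOpen hh.isCompact (f := fun _ => 1)
    (fun v hv u hu => hh.support (Sum.elim v u) hv hu) continuous_const.locallyIntegrable
    hh.smooth_elim hv b a
  simp only [one_smul] at this
  exact this.trans (integral_congr_ae (ae_of_all _ fun u =>
    wd_base (diffAt_of_contDiffOn hh.isOpen_preimage hh.smooth hv) b a))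

theorem fibreInt_wd_inr (hh : FibreCompact h W C) {v : ℂ^ι} (hv : v ∈ W) (b : Bool) (a : κ) :
    fibreInt (HigherEnergy.wd b (Sum.inr a) h) v = 0 := by
  have hk : ContDiff ℝ ∞ fun u => h (Sum.elim v u) :=
    contDiffOn_univ.mp (hh.smooth.comp (contDiff_elim_right v).contDiffOn fun _ _ => hv)
  have h1 : ∀ w, Integrable fun u => fderiv ℝ (fun u => h (Sum.elim v u)) u w := fun w =>
    ((hk.continuous_fderiv (by simp)).clm_apply continuous_const).integrable_of_hasCompactSupport
      ((HasCompactSupport.intro hh.isCompact fun u hu =>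
        hh.support (Sum.elim v u) hv hu).fderiv_apply ℝ w)
  have h2 : ∀ w, ∫ u, fderiv ℝ (fun u => h (Sum.elim v u)) u w = 0 := fun w => by
    simpa using integral_mul_fderiv_eq_neg_fderiv_mul_of_integrable (μ := volume)
      (f := fun _ => (1 : ℂ)) (v := w) (by simp) (by simpa using h1 w)
      (by simpa using hh.integrable hv) (by simp) fun u _ => hk.differentiable (by simp) u
  refine (integral_congr_ae (ae_of_all _ fun u =>
    (wd_fibre (diffAt_of_contDiffOn hh.isOpen_preimage hh.smooth hv) b a).symm)).trans ?_
  simp only [HigherEnergy.wd, wdir]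
  rw [integral_smul]
  refine smul_eq_zero_of_right _
    ((integral_add (h1 _) ((h1 _).smul (wsgn b * Complex.I))).trans ?_)
  simp only [Pi.smul_apply, integral_smul, h2, smul_zero, add_zero]

end FibreCompact

end FibreIntegral

/-! ### Partitions of unity and integrals of densities -/

section UnityPartition

variable {κ : Type} [Fintype κ] [DecidableEq κ] {S I Λ : Type}
  {dom : I → Set ℂ^κ} {q : I → ℂ^κ → S} {τ : I → I → ℂ^κ → ℂ^κ}
  {P : I → Set ℂ^κ} {idx : Λ → I}

theorem ChartSystem.integrableOn_part (h : ChartSystem dom q τ)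
    (hP : IsPartition dom q P) {d : I → ℂ^κ → ℂ} (hd : ChartSystem.IsDensity dom q τ d) (k : I)
    (hint : IntegrableOn (d k) (dom k))
    (hsupp : ∀ i, ∀ u ∈ dom i, q i u ∉ q k '' dom k → d i u = 0) (i : I) :
    IntegrableOn (d i) (P i) := by
  have hmeas : MeasurableSet (P i ∩ overlap dom q i k) :=
    (hP.measurableSet i).inter (h.isOpen_overlap i k).measurableSet
  have hderiv : ∀ u ∈ P i ∩ overlap dom q i k,
      HasFDerivWithinAt (τ i k) (fderiv ℝ (τ i k) u) (P i ∩ overlap dom q i k) u := fun u hu =>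
    ((h.differentiableAt hu.2).restrictScalars ℝ).hasFDerivAt.hasFDerivWithinAt
  have hinj : Set.InjOn (τ i k) (P i ∩ overlap dom q i k) :=
    (h.injOn_trans i k).mono Set.inter_subset_right
  have h1 : IntegrableOn (d k) (τ i k '' (P i ∩ overlap dom q i k)) :=
    hint.mono_set (by rintro _ ⟨u, hu, rfl⟩; exact h.mapsTo i k u hu.2)
  rw [integrableOn_image_iff_integrableOn_abs_det_fderiv_smul volume hmeas hderiv hinj] at h1
  have h2 : IntegrableOn (d i) (P i ∩ overlap dom q i k) :=
    h1.congr_fun (fun u hu => by rw [hd i k u hu.2, ← Complex.real_smul]) hmeas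
  refine h2.of_forall_sdiff_eq_zero (hP.measurableSet i) ?_
  rintro u ⟨hu, hu'⟩
  exact hsupp i u (hP.subset i hu) fun hq => hu' ⟨hu, hP.subset i hu, hq⟩

theorem ChartSystem.hasSum_integral_sum [Countable I] [Fintype Λ] (h : ChartSystem dom q τ)
    (hP : IsPartition dom q P) {d : Λ → I → ℂ^κ → ℂ}
    (hd : ∀ l, ChartSystem.IsDensity dom q τ (d l))
    (hint : ∀ l, IntegrableOn (d l (idx l)) (dom (idx l)))
    (hsupp : ∀ l i, ∀ u ∈ dom i, q i u ∉ q (idx l) '' dom (idx l) → d l i u = 0)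
    {D : I → ℂ^κ → ℂ} (hD : ∀ i, ∀ u ∈ dom i, D i u = ∑ l, d l i u) :
    HasSum (fun i => ∫ u in P i, D i u) (∑ l, ∫ u in dom (idx l), d l (idx l) u) := by
  refine (hasSum_sum fun l _ => h.hasSum_integral hP (hd l) (idx l) (hint l) (hsupp l)).congr_fun ?_
  intro i
  rw [← integral_finsetSum _ fun l _ =>
    h.integrableOn_part hP (hd l) (idx l) (hint l) (hsupp l) i]
  exact setIntegral_congr_fun (hP.measurableSet i) fun u hu => hD i u (hP.subset i hu)

/-- A finite partition of unity on the subset `K` of the manifold, whose members have compact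
support in the charts with indices `idx l`. -/
structure UnityPartition (dom : I → Set ℂ^κ) (q : I → ℂ^κ → S)
    (τ : I → I → ℂ^κ → ℂ^κ) [Fintype Λ] (idx : Λ → I) (ρ : Λ → I → ℂ^κ → ℝ)
    (C : Λ → Set ℂ^κ) (K : Set S) : Prop where
  smooth : ∀ l i, SmoothOn (ρ l i) (dom i)
  nonneg : ∀ l i u, 0 ≤ ρ l i u
  isCompact : ∀ l, IsCompact (C l)
  subset : ∀ l, C l ⊆ dom (idx l)
  invariant : ∀ l i j, ∀ u ∈ overlap dom q i j, ρ l i u = ρ l j (τ i j u)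
  support : ∀ l i u, ρ l i u ≠ 0 → u ∈ dom i ∧ q i u ∈ q (idx l) '' C l
  sum_eq_one : ∀ i, ∀ u ∈ dom i, q i u ∈ K → ∑ l, ρ l i u = 1

variable [Fintype Λ] {ρ : Λ → I → ℂ^κ → ℝ} {C : Λ → Set ℂ^κ} {K : Set S}

theorem UnityPartition.mem (U : UnityPartition dom q τ idx ρ C K) (h : ChartSystem dom q τ) {l : Λ}
    {u : ℂ^κ} (hu : ρ l (idx l) u ≠ 0) : u ∈ C l := by
  obtain ⟨h1, v, hv, hvu⟩ := U.support l _ u hu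
  rwa [← h.injOn _ (U.subset l hv) h1 hvu]

theorem UnityPartition.eq_zero (U : UnityPartition dom q τ idx ρ C K) (h : ChartSystem dom q τ)
    {l : Λ} {u : ℂ^κ} (hu : u ∉ C l) : ρ l (idx l) u = 0 := by
  by_contra h0
  exact hu (U.mem h h0)

/-- The integral of a density that vanishes outside `K`. -/
theorem UnityPartition.hasSum_integral [Countable I] (U : UnityPartition dom q τ idx ρ C K)
    (h : ChartSystem dom q τ) (hP : IsPartition dom q P) {d : I → ℂ^κ → ℂ}
    (hd : ChartSystem.IsDensity dom q τ d) (hc : ∀ i, ContinuousOn (d i) (dom i))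
    (hK : ∀ i, ∀ u ∈ dom i, q i u ∉ K → d i u = 0) :
    HasSum (fun i => ∫ u in P i, d i u)
      (∑ l, ∫ u in dom (idx l), (ρ l (idx l) u : ℂ) * d (idx l) u) := by
  refine h.hasSum_integral_sum hP (d := fun l i u => (ρ l i u : ℂ) * d i u) ?_ ?_ ?_ ?_
  · intro l i j u hu
    change (ρ l i u : ℂ) * d i u = _ * ((ρ l j (τ i j u) : ℂ) * d j (τ i j u))
    rw [U.invariant l i j u hu, hd i j u hu]
    ring
  · intro l
    have h1 : IntegrableOn (fun u => (ρ l (idx l) u : ℂ) * d (idx l) u) (C l) :=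
      ((Complex.continuous_ofReal.comp_continuousOn ((U.smooth l _).continuousOn)).mul
        (hc _)).mono (U.subset l) |>.integrableOn_compact (U.isCompact l)
    refine h1.of_forall_sdiff_eq_zero (h.isOpen _).measurableSet fun u hu => ?_
    rw [U.eq_zero h hu.2, Complex.ofReal_zero, zero_mul]
  · intro l i u hu hq
    have : ρ l i u = 0 := by
      by_contra h0
      exact hq (Set.image_mono (U.subset l) (U.support l i u h0).2)
    rw [this, Complex.ofReal_zero, zero_mul]
  · intro i u hu
    rw [← sum_mul]
    by_cases hq : q i u ∈ K
    · rw [← Complex.ofReal_sum, U.sum_eq_one i u hu hq, Complex.ofReal_one, one_mul]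
    · rw [hK i u hu hq, mul_zero]

end UnityPartition

section UnityProduct

variable {ι κ : Type} [Fintype ι] [DecidableEq ι] [Fintype κ] [DecidableEq κ] {S S' I I' Λ Λ' : Type}
  {dom : I → Set ℂ^ι} {q : I → ℂ^ι → S} {τ : I → I → ℂ^ι → ℂ^ι}
  {dom' : I' → Set ℂ^κ} {q' : I' → ℂ^κ → S'} {τ' : I' → I' → ℂ^κ → ℂ^κ}
  {idx : Λ → I} {idx' : Λ' → I'} [Fintype Λ] [Fintype Λ'] {ρ : Λ → I → ℂ^ι → ℝ}
  {C : Λ → Set ℂ^ι} {K : Set S} {ρ' : Λ' → I' → ℂ^κ → ℝ}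
  {C' : Λ' → Set ℂ^κ} {K' : Set S'}

theorem isCompact_zProd {C : Set ℂ^ι} {C' : Set ℂ^κ} (h : IsCompact C)
    (h' : IsCompact C') : IsCompact (zProd C C') := by
  have : zProd C C' = elimCLM ι κ '' (C ×ˢ C') := by
    ext z
    constructor
    · intro hz
      refine ⟨(zFst z, zSnd z), hz, ?_⟩
      rw [elimCLM_apply]
      ext (a | a) <;> rfl
    · rintro ⟨p, hp, rfl⟩
      rw [elimCLM_apply]
      exact hp
  rw [this]
  exact (h.prod h').image (elimCLM ι κ).continuous

theorem UnityPartition.prod (U : UnityPartition dom q τ idx ρ C K)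
    (U' : UnityPartition dom' q' τ' idx' ρ' C' K') :
    UnityPartition (fun p : I × I' => zProd (dom p.1) (dom' p.2)) (qProd q q')
      (fun p p' => zMap (τ p.1 p'.1) (τ' p.2 p'.2)) (fun l : Λ × Λ' => (idx l.1, idx' l.2))
      (fun l p z => ρ l.1 p.1 (zFst z) * ρ' l.2 p.2 (zSnd z))
      (fun l => zProd (C l.1) (C' l.2)) (K ×ˢ K') where
  smooth l p := ((U.smooth l.1 p.1).comp contDiff_zFst.contDiffOn fun z hz => hz.1).mul
    ((U'.smooth l.2 p.2).comp contDiff_zSnd.contDiffOn fun z hz => hz.2)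
  nonneg l p z := mul_nonneg (U.nonneg l.1 p.1 _) (U'.nonneg l.2 p.2 _)
  isCompact l := isCompact_zProd (U.isCompact l.1) (U'.isCompact l.2)
  subset l z hz := ⟨U.subset l.1 hz.1, U'.subset l.2 hz.2⟩
  invariant l p p' z hz := by
    rw [overlap_prod] at hz
    rw [U.invariant l.1 _ _ _ hz.1, U'.invariant l.2 _ _ _ hz.2]
    rfl
  support l p z hz := by
    have h1 := U.support l.1 p.1 (zFst z) (left_ne_zero_of_mul hz)
    have h2 := U'.support l.2 p.2 (zSnd z) (right_ne_zero_of_mul hz)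
    refine ⟨⟨h1.1, h2.1⟩, ?_⟩
    exact (mem_image_qProd (fun i => C l.1) (fun i => C' l.2) (idx l.1, idx' l.2) _).mpr
      ⟨h1.2, h2.2⟩
  sum_eq_one p z hz hK := by
    rw [Fintype.sum_prod_type]
    simp only [← mul_sum, U'.sum_eq_one _ _ hz.2 hK.2, mul_one]
    exact U.sum_eq_one _ _ hz.1 hK.1

end UnityProduct

/-! ### Coordinate changes on the second factor -/

section ZMap

variable {ι κ : Type} [Fintype ι] [DecidableEq ι] [Fintype κ] [DecidableEq κ]

/-- `zFst` as a continuous linear map. -/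
def zFstCLM (ι κ : Type) [Fintype ι] [Fintype κ] : ℂ^(ι ⊕ κ) →L[ℂ] ℂ^ι :=
  ContinuousLinearMap.pi fun a => ContinuousLinearMap.proj (Sum.inl a)

/-- `zSnd` as a continuous linear map. -/
def zSndCLM (ι κ : Type) [Fintype ι] [Fintype κ] : ℂ^(ι ⊕ κ) →L[ℂ] ℂ^κ :=
  ContinuousLinearMap.pi fun a => ContinuousLinearMap.proj (Sum.inr a)

theorem hasFDerivAt_zFst (z : ℂ^(ι ⊕ κ)) :
    HasFDerivAt (zFst : ℂ^(ι ⊕ κ) → ℂ^ι) (zFstCLM ι κ) z := (zFstCLM ι κ).hasFDerivAt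

theorem hasFDerivAt_zSnd (z : ℂ^(ι ⊕ κ)) :
    HasFDerivAt (zSnd : ℂ^(ι ⊕ κ) → ℂ^κ) (zSndCLM ι κ) z := (zSndCLM ι κ).hasFDerivAt

theorem zFst_single_inl (a : ι) : zFst (Pi.single (Sum.inl a) 1 : ℂ^(ι ⊕ κ)) = Pi.single a 1 := by
  ext b; simp [zFst, Pi.single_apply]

theorem zSnd_single_inl (a : ι) : zSnd (Pi.single (Sum.inl a) 1 : ℂ^(ι ⊕ κ)) = 0 := by
  ext b; simp [zSnd]

theorem zFst_single_inr (a : κ) : zFst (Pi.single (Sum.inr a) 1 : ℂ^(ι ⊕ κ)) = 0 := by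
  ext b; simp [zFst]

theorem zSnd_single_inr (a : κ) : zSnd (Pi.single (Sum.inr a) 1 : ℂ^(ι ⊕ κ)) = Pi.single a 1 := by
  ext b; simp [zSnd, Pi.single_apply]

variable {V : Type*} [NormedAddCommGroup V] [NormedSpace ℂ V]

theorem wdir_comp_clm {J J' : Type} [Fintype J] [Fintype J'] (L : ℂ^J →L[ℂ] (J' → ℂ))
    {g : (J' → ℂ) → V} {z : ℂ^J} (hg : DifferentiableAt ℝ g (L z)) (b : Bool) (w : ℂ^J) :
    wdir b (fun y => g (L y)) z w = wdir b g (L z) (L w) := by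
  have h : fderiv ℝ (fun y => g (L y)) z = (fderiv ℝ g (L z)).comp (L.restrictScalars ℝ) :=
    (hg.hasFDerivAt.comp z (L.restrictScalars ℝ).hasFDerivAt).fderiv
  simp [wdir, h]

theorem wdir_zero_right {J : Type} [Fintype J] (g : ℂ^J → V) (z : ℂ^J) (b : Bool) :
    wdir b g z 0 = 0 := by simp [wdir]

theorem wd_inl_comp_zSnd {g : ℂ^κ → V} {z : ℂ^(ι ⊕ κ)} (hg : DifferentiableAt ℝ g (zSnd z))
    (b : Bool) (a : ι) : wd b (Sum.inl a) (fun y => g (zSnd y)) z = 0 := by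
  have h := wdir_comp_clm (zSndCLM ι κ) (g := g) (z := z) hg b (Pi.single (Sum.inl a) 1)
  have h0 : zSndCLM ι κ (Pi.single (Sum.inl a) 1) = 0 := zSnd_single_inl a
  rw [h0, wdir_zero_right] at h
  exact h

theorem wd_inr_comp_zSnd {g : ℂ^κ → V} {z : ℂ^(ι ⊕ κ)} (hg : DifferentiableAt ℝ g (zSnd z))
    (b : Bool) (a : κ) : wd b (Sum.inr a) (fun y => g (zSnd y)) z = wd b a g (zSnd z) := by
  have h := wdir_comp_clm (zSndCLM ι κ) (g := g) (z := z) hg b (Pi.single (Sum.inr a) 1)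
  have h0 : zSndCLM ι κ (Pi.single (Sum.inr a) 1) = Pi.single a 1 := zSnd_single_inr a
  rw [h0] at h
  exact h

variable {f : ℂ^ι → ℂ^ι} {g : ℂ^κ → ℂ^κ} {z : ℂ^(ι ⊕ κ)}

theorem differentiableAt_zMap (hf : DifferentiableAt ℂ f (zFst z))
    (hg : DifferentiableAt ℂ g (zSnd z)) : DifferentiableAt ℂ (zMap f g) z := by
  refine differentiableAt_pi.mpr ?_
  rintro (a | a)
  · exact (differentiableAt_pi.mp hf a).comp z (differentiable_zFst z)
  · exact (differentiableAt_pi.mp hg a).comp z (differentiable_zSnd z)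

theorem fderiv_zMap (hf : DifferentiableAt ℂ f (zFst z)) (hg : DifferentiableAt ℂ g (zSnd z))
    (w : ℂ^(ι ⊕ κ)) :
    fderiv ℂ (zMap f g) z w =
      Sum.elim (fderiv ℂ f (zFst z) (zFst w)) (fderiv ℂ g (zSnd z) (zSnd w)) := by
  have h := (differentiableAt_zMap hf hg).hasFDerivAt
  have h1 : HasFDerivAt (fun y => f (zFst y)) _ z := hf.hasFDerivAt.comp z (hasFDerivAt_zFst z)
  have h2 : HasFDerivAt (fun y => g (zSnd y)) _ z := hg.hasFDerivAt.comp z (hasFDerivAt_zSnd z)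
  have h1' : HasFDerivAt (fun y => f (zFst y)) _ z :=
    (hasFDerivAt_zFst (zMap f g z)).comp z h
  have h2' : HasFDerivAt (fun y => g (zSnd y)) _ z :=
    (hasFDerivAt_zSnd (zMap f g z)).comp z h
  have e1 := DFunLike.congr_fun (h1'.unique h1) w
  have e2 := DFunLike.congr_fun (h2'.unique h2) w
  ext (a | a)
  · exact congrFun e1 a
  · exact congrFun e2 a

theorem covPullback_zMap_comp_covFst (hf : DifferentiableAt ℂ f (zFst z))
    (hg : DifferentiableAt ℂ g (zSnd z)) :
    (covPullback (zMap f g) z).comp (covFst ι κ) = (covFst ι κ).comp (covPullback f (zFst z)) := by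
  refine LinearMap.ext fun α => LinearMap.ext fun w => ?_
  have h1 := (differentiableAt_zMap hf hg).fderiv_restrictScalars ℝ
  have h2 := hf.fderiv_restrictScalars ℝ
  change α (zFst (fderiv ℝ (zMap f g) z w)) = α (fderiv ℝ f (zFst z) (zFst w))
  rw [h1, h2]
  change α (zFst (fderiv ℂ (zMap f g) z w)) = α (fderiv ℂ f (zFst z) (zFst w))
  rw [fderiv_zMap hf hg]
  rfl

theorem covPullback_zMap_comp_covSnd (hf : DifferentiableAt ℂ f (zFst z))
    (hg : DifferentiableAt ℂ g (zSnd z)) :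
    (covPullback (zMap f g) z).comp (covSnd ι κ) = (covSnd ι κ).comp (covPullback g (zSnd z)) := by
  refine LinearMap.ext fun α => LinearMap.ext fun w => ?_
  have h1 := (differentiableAt_zMap hf hg).fderiv_restrictScalars ℝ
  have h2 := hg.fderiv_restrictScalars ℝ
  change α (zSnd (fderiv ℝ (zMap f g) z w)) = α (fderiv ℝ g (zSnd z) (zSnd w))
  rw [h1, h2]
  change α (zSnd (fderiv ℂ (zMap f g) z w)) = α (fderiv ℂ g (zSnd z) (zSnd w))
  rw [fderiv_zMap hf hg]
  rfl

theorem map_zMap_frmFst (hf : DifferentiableAt ℂ f (zFst z))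
    (hg : DifferentiableAt ℂ g (zSnd z)) (θ : Frm ι) :
    map (covPullback (zMap f g) z) (frmFst ι κ θ) =
      frmFst ι κ (map (covPullback f (zFst z)) θ) := by
  rw [← AlgHom.comp_apply, ← AlgHom.comp_apply, map_comp_map,
    map_comp_map, covPullback_zMap_comp_covFst hf hg]

theorem map_zMap_frmSnd (hf : DifferentiableAt ℂ f (zFst z))
    (hg : DifferentiableAt ℂ g (zSnd z)) (θ : Frm κ) :
    map (covPullback (zMap f g) z) (frmSnd ι κ θ) =
      frmSnd ι κ (map (covPullback g (zSnd z)) θ) := by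
  rw [← AlgHom.comp_apply, ← AlgHom.comp_apply, map_comp_map,
    map_comp_map, covPullback_zMap_comp_covSnd hf hg]

theorem abs_det_zMap (hf : DifferentiableAt ℂ f (zFst z)) (hg : DifferentiableAt ℂ g (zSnd z)) :
    |(fderiv ℝ (zMap f g) z).det| =
      |(fderiv ℝ g (zSnd z)).det| * |(fderiv ℝ f (zFst z)).det| := by
  have h1 := topCoeff_covPullback (differentiableAt_zMap hf hg)
    (frmSnd ι κ (volForm κ) * frmFst ι κ (volForm ι))
  rw [map_mul, map_zMap_frmFst hf hg, map_zMap_frmSnd hf hg, topCoeff_frmSnd_mul_frmFst,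
    topCoeff_frmSnd_mul_frmFst, topCoeff_covPullback hf, topCoeff_covPullback hg,
    topCoeff_volForm, topCoeff_volForm] at h1
  have h2 := ne_zero_aux (Fintype.card ι)
  have h3 := ne_zero_aux (Fintype.card κ)
  have h4 : ((|(fderiv ℝ (zMap f g) z).det| : ℝ) : ℂ) =
      ((|(fderiv ℝ g (zSnd z)).det| * |(fderiv ℝ f (zFst z)).det| : ℝ) : ℂ) := by
    push_cast
    refine mul_right_cancel₀ (mul_ne_zero h3 h2) ?_
    rw [← h1]
    ring
  exact_mod_cast h4

theorem covPullback_id (z : ℂ^ι) : covPullback (id : ℂ^ι → ℂ^ι) z = LinearMap.id := by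
  refine LinearMap.ext fun α => LinearMap.ext fun w => ?_
  change α (fderiv ℝ id z w) = α w
  rw [fderiv_id]
  rfl

end ZMap

/-! ### Families of potentials on a compact manifold -/

section PotFamily

attribute [local instance] normedRingFrm normedAlgebraFrm normedCommRingCFrm normedAlgebraCFrm
  normedSpaceCFrm

variable {ι : Type} [Fintype ι] [DecidableEq ι] {n : ℕ} {S I Λ : Type}
  {dom : I → Set ℂ^(Fin n)} {q : I → ℂ^(Fin n) → S} {τ : I → I → ℂ^(Fin n) → ℂ^(Fin n)}
  {V : Set ℂ^ι} {f : I → ℂ^(ι ⊕ Fin n) → ℝ} {H : I → I → ℂ^(Fin n) → ℝ}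

/-- A family of potentials on a manifold with parameters in `V`; the potentials in different charts
differ by pluriharmonic functions. -/
structure PotFamily (dom : I → Set ℂ^(Fin n)) (q : I → ℂ^(Fin n) → S)
    (τ : I → I → ℂ^(Fin n) → ℂ^(Fin n)) (V : Set ℂ^ι) (f : I → ℂ^(ι ⊕ Fin n) → ℝ)
    (H : I → I → ℂ^(Fin n) → ℝ) : Prop where
  isOpen : IsOpen V
  family : ∀ i, IsFamily (f i) (zProd V (dom i))
  smooth : ∀ i j, SmoothOn (H i j) (overlap dom q i j)
  pluriharmonic : ∀ i j, ∀ u ∈ overlap dom q i j, ∀ a b,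
    wd false a (wd true b fun y => (H i j y : ℂ)) u = 0
  potential : ∀ i j z, zFst z ∈ V → zSnd z ∈ overlap dom q i j →
    f i z = f j (zMap id (τ i j) z) + H i j (zSnd z)

theorem IsFamily.mono {f : ℂ^(ι ⊕ Fin n) → ℝ} {U U' : Set ℂ^(ι ⊕ Fin n)} (hf : IsFamily f U)
    (hU' : IsOpen U') (h : U' ⊆ U) : IsFamily f U' :=
  ⟨hU', hf.smooth.mono h, fun z hz => hf.det_ne_zero z (h hz)⟩

theorem chartSystem_id (hV : IsOpen V) :
    ChartSystem (fun _ : Unit => V) (fun _ => id) (fun _ _ => id) where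
  isOpen _ := hV
  injOn _ := Function.injective_id.injOn
  isOpen_overlap _ _ := by
    have : overlap (fun _ : Unit => V) (fun _ => id) () () = V := by
      ext v
      simp [overlap]
    change IsOpen (overlap (fun _ : Unit => V) (fun _ => id) () ())
    rw [this]
    exact hV
  mapsTo _ _ u hu := hu.1
  compat _ _ _ _ := rfl
  holomorphic _ _ := differentiableOn_id

namespace PotFamily

theorem isOpen_overlap (h : ChartSystem dom q τ) (F : PotFamily dom q τ V f H) (i j : I) :
    IsOpen (zProd V (overlap dom q i j)) := isOpen_zProd F.isOpen (h.isOpen_overlap i j)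

theorem wd_inl_potential (h : ChartSystem dom q τ) (F : PotFamily dom q τ V f H) {i j : I}
    {z : ℂ^(ι ⊕ Fin n)} (hz : z ∈ zProd V (overlap dom q i j)) (b : Bool) (a : ι) :
    wd b (Sum.inl a) (fun y => (H i j (zSnd y) : ℂ)) z = 0 :=
  wd_inl_comp_zSnd (g := fun u => (H i j u : ℂ)) (diffAt_of_contDiffOn
    (h.isOpen_overlap i j) (contDiffOn_ofReal (F.smooth i j)) hz.2) b a

theorem pluriharmonic_zSnd (h : ChartSystem dom q τ) (F : PotFamily dom q τ V f H) {i j : I}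
    {z : ℂ^(ι ⊕ Fin n)} (hz : z ∈ zProd V (overlap dom q i j)) (a b : ι ⊕ Fin n) :
    wd false a (wd true b fun y => (H i j (zSnd y) : ℂ)) z = 0 := by
  have hO := F.isOpen_overlap h i j
  have hs := contDiffOn_ofReal (F.smooth i j)
  rcases b with b | b
  · have : Set.EqOn (wd true (Sum.inl b) fun y : ℂ^(ι ⊕ Fin n) => (H i j (zSnd y) : ℂ))
        (fun _ => 0) (zProd V (overlap dom q i j)) := fun y hy => F.wd_inl_potential h hy true b
    rw [wd_congr_on hO this false a hz, wd_const]
  · have : Set.EqOn (wd true (Sum.inr b) fun y : ℂ^(ι ⊕ Fin n) => (H i j (zSnd y) : ℂ))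
        (fun y => wd true b (fun u => (H i j u : ℂ)) (zSnd y)) (zProd V (overlap dom q i j)) :=
      fun y hy => wd_inr_comp_zSnd (g := fun u => (H i j u : ℂ))
        (diffAt_of_contDiffOn (h.isOpen_overlap i j) hs hy.2) true b
    have hd := diffAt_of_contDiffOn (h.isOpen_overlap i j)
      (contDiffOn_wd (h.isOpen_overlap i j) hs true b) hz.2
    rw [wd_congr_on hO this false a hz]
    rcases a with a | a
    · exact wd_inl_comp_zSnd (g := wd true b fun u => (H i j u : ℂ)) hd false a
    · rw [wd_inr_comp_zSnd (g := wd true b fun u => (H i j u : ℂ)) hd false a]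
      exact F.pluriharmonic i j _ hz.2 a b

section Jac

variable {T : ℂ^(Fin n) → ℂ^(Fin n)} {z : ℂ^(ι ⊕ Fin n)}

theorem jac_inl_inl (hT : DifferentiableAt ℂ T (zSnd z)) (a c : ι) :
    jac (zMap id T) (Sum.inl a) (Sum.inl c) z = if c = a then 1 else 0 := by
  rw [jac, fderiv_zMap differentiableAt_id hT, Sum.elim_inl, fderiv_id, zFst_single_inl]
  simp [Pi.single_apply]

theorem jac_inl_inr (hT : DifferentiableAt ℂ T (zSnd z)) (a : ι) (c : Fin n) :
    jac (zMap id T) (Sum.inl a) (Sum.inr c) z = 0 := by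
  rw [jac, fderiv_zMap differentiableAt_id hT, Sum.elim_inr, zSnd_single_inl, map_zero]
  rfl

theorem jac_inr_inl (hT : DifferentiableAt ℂ T (zSnd z)) (a : Fin n) (c : ι) :
    jac (zMap id T) (Sum.inr a) (Sum.inl c) z = 0 := by
  rw [jac, fderiv_zMap differentiableAt_id hT, Sum.elim_inl, zFst_single_inr, map_zero]
  rfl

theorem jac_inr_inr (hT : DifferentiableAt ℂ T (zSnd z)) (a c : Fin n) :
    jac (zMap id T) (Sum.inr a) (Sum.inr c) z = jac T a c (zSnd z) := by
  rw [jac, fderiv_zMap differentiableAt_id hT, Sum.elim_inr, zSnd_single_inr]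
  rfl

end Jac

theorem chartChange (h : ChartSystem dom q τ) (F : PotFamily dom q τ V f H) (i j : I) :
    ChartChange (zMap id (τ i j)) (f j) (f i) (fun z => H i j (zSnd z)) (zProd V (dom j))
      (zProd V (overlap dom q i j)) where
  family := F.family j
  family' := (F.family i).mono (F.isOpen_overlap h i j) fun z hz => ⟨hz.1, hz.2.1⟩
  mapsTo z hz := ⟨hz.1, h.mapsTo i j _ hz.2⟩
  holomorphic := differentiableOn_zMap differentiableOn_id (h.holomorphic i j)
  surjective z hz := by
    refine ((chartSystem_id F.isOpen).prod h).covPullback_surjective (i := ((), i)) (j := ((), j)) ?_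
    exact (Set.ext_iff.mp (overlap_prod (dom := fun _ : Unit => V) (q := fun _ => id)
      (dom' := dom) (q' := q) ((), i) ((), j)) z).mpr ⟨⟨hz.1, _, hz.1, rfl⟩, hz.2⟩
  vertical z hz a c := jac_inr_inl (h.differentiableAt hz.2) a c
  smooth := (F.smooth i j).comp contDiff_zSnd.contDiffOn fun z hz => hz.2
  pluriharmonic z hz a b := F.pluriharmonic_zSnd h hz a b
  potential z hz := F.potential i j z hz.1 hz.2

theorem transForm_eq (h : ChartSystem dom q τ) (F : PotFamily dom q τ V f H) (c : ℕ → ℂ) (b : Bool)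
    (a : ι) {i j : I} {z : ℂ^(ι ⊕ Fin n)} (hz : z ∈ zProd V (overlap dom q i j)) :
    transForm c b (Sum.inl a) (f i) z = cmap (covPullback (zMap id (τ i j)) z)
      ((F.chartChange h i j).surjective z hz)
      (transForm c b (Sum.inl a) (f j) (zMap id (τ i j) z)) := by
  have hO := F.isOpen_overlap h i j
  refine (F.chartChange h i j).transForm_eq c b a ?_ ?_
    (fun z hz => F.wd_inl_potential h hz b a) hz
  · rintro z hz (c | c)
    · rw [jac_inl_inl (h.differentiableAt hz.2)]
      simp
    · rw [jac_inl_inr (h.differentiableAt hz.2)]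
      simp
  · rintro z hz e c b
    have hconst : ∀ k : ℂ, Set.EqOn (jac (zMap id (τ i j)) e c) (fun _ => k)
        (zProd V (overlap dom q i j)) → wd b (Sum.inl a) (jac (zMap id (τ i j)) e c) z = 0 :=
      fun k hk => by rw [wd_congr_on hO hk b _ hz, wd_const]
    rcases e with e | e <;> rcases c with c | c
    · exact hconst _ fun y hy => jac_inl_inl (h.differentiableAt hy.2) _ _
    · exact hconst _ fun y hy => jac_inl_inr (h.differentiableAt hy.2) _ _
    · exact hconst _ fun y hy => jac_inr_inl (h.differentiableAt hy.2) _ _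
    · have : Set.EqOn (jac (zMap id (τ i j)) (Sum.inr e) (Sum.inr c))
          (fun y => jac (τ i j) e c (zSnd y)) (zProd V (overlap dom q i j)) :=
        fun y hy => jac_inr_inr (h.differentiableAt hy.2) _ _
      rw [wd_congr_on hO this b _ hz]
      exact wd_inl_comp_zSnd (g := jac (τ i j) e c) (diffAt_of_contDiffOn
        (h.isOpen_overlap i j) (contDiffOn_jac (h.isOpen_overlap i j) (h.holomorphic i j) e c)
        hz.2) b a

theorem wedgeCLM_cmap (h : ChartSystem dom q τ) (F : PotFamily dom q τ V f H) {i j : I}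
    {z : ℂ^(ι ⊕ Fin n)} (hz : z ∈ zProd V (overlap dom q i j)) (ψ : Frm ι) (Ω : CFrm (ι ⊕ Fin n)) :
    wedgeCLM n ψ (cmap (covPullback (zMap id (τ i j)) z)
      ((F.chartChange h i j).surjective z hz) Ω) =
      |(fderiv ℝ (τ i j) (zSnd z)).det| * wedgeCLM n ψ Ω := by
  have hd := h.differentiableAt hz.2
  have hid : DifferentiableAt ℂ (id : ℂ^ι → ℂ^ι) (zFst z) := differentiableAt_id
  have h1 : frmFst ι (Fin n) ψ =
      map (covPullback (zMap id (τ i j)) z) (frmFst ι (Fin n) ψ) := by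
    rw [map_zMap_frmFst hid hd, covPullback_id, map_id]
    rfl
  rw [wedgeCLM_apply, wedgeCLM_apply, coe_cmap]
  conv_lhs => rw [h1]
  rw [← map_mul, topCoeff_covPullback (differentiableAt_zMap hid hd), abs_det_zMap hid hd]
  simp [ContinuousLinearMap.det]

theorem cmap_dzdz_inl_inr (h : ChartSystem dom q τ) (F : PotFamily dom q τ V f H) {i j : I}
    {z : ℂ^(ι ⊕ Fin n)} (hz : z ∈ zProd V (overlap dom q i j)) (b : Bool) (a : ι) (c : Fin n) :
    cmap (covPullback (zMap id (τ i j)) z) ((F.chartChange h i j).surjective z hz)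
        (dzdz b (Sum.inl a) (Sum.inr c)) =
      ∑ β, wconj (!b) (jac (τ i j) β c (zSnd z)) • dzdz b (Sum.inl a) (Sum.inr β) := by
  have hd := h.differentiableAt hz.2
  cases b
  · simp only [dzdz]
    rw [cmap_covPullback_dzdzbar (F.isOpen_overlap h i j) (F.chartChange h i j).holomorphic hz]
    simp only [Fintype.sum_sum_type, jac_inl_inl hd, jac_inl_inr hd, jac_inr_inl hd,
      jac_inr_inr hd, map_zero, mul_zero, zero_mul, zero_smul, Finset.sum_const_zero, zero_add,
      add_zero, ite_mul, one_mul, ite_smul]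
    rw [Finset.sum_eq_single a]
    · simp [wconj]
    · intro a' _ ha'
      simp [Ne.symm ha']
    · simp
  · simp only [dzdz]
    rw [cmap_covPullback_dzdzbar (F.isOpen_overlap h i j) (F.chartChange h i j).holomorphic hz]
    simp only [Fintype.sum_sum_type, jac_inl_inl hd, jac_inl_inr hd, jac_inr_inl hd,
      jac_inr_inr hd, map_zero, mul_zero, zero_mul, zero_smul, Finset.sum_const_zero, zero_add,
      add_zero]
    refine sum_congr rfl fun β _ => ?_
    rw [Finset.sum_eq_single a]
    · simp [wconj]
    · intro a' _ ha'
      simp [Ne.symm ha']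
    · simp

theorem cmap_dzdz_inl_inl (h : ChartSystem dom q τ) (F : PotFamily dom q τ V f H) {i j : I}
    {z : ℂ^(ι ⊕ Fin n)} (hz : z ∈ zProd V (overlap dom q i j)) (b : Bool) (a c : ι) :
    cmap (covPullback (zMap id (τ i j)) z) ((F.chartChange h i j).surjective z hz)
        (dzdz b (Sum.inl a) (Sum.inl c)) = dzdz b (Sum.inl a) (Sum.inl c) := by
  have hd := h.differentiableAt hz.2
  have key : ∀ a c : ι, cmap (covPullback (zMap id (τ i j)) z)
      ((F.chartChange h i j).surjective z hz) (dzdzbar (Sum.inl a) (Sum.inl c)) =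
        dzdzbar (Sum.inl a) (Sum.inl c) := by
    intro a c
    apply Subtype.ext
    rw [coe_cmap, ← frmFst_dzdzbar, map_zMap_frmFst differentiableAt_id hd, covPullback_id,
      map_id]
    rfl
  cases b
  · exact key a c
  · exact key c a

end PotFamily

end PotFamily

/-! ### Integrals of transgression forms over the fibres -/

section CompactSupport

variable {ι κ : Type} [Fintype ι] [DecidableEq ι] [Fintype κ] [DecidableEq κ]
  {V : Set ℂ^ι} {W C : Set ℂ^κ} {r : ℂ^κ → ℂ} {h : ℂ^(ι ⊕ κ) → ℂ}

/-- `r` is smooth with support in a compact subset `C` of `W`. -/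
structure CompactBump (r : ℂ^κ → ℂ) (W C : Set ℂ^κ) : Prop where
  isOpen : IsOpen W
  isCompact : IsCompact C
  subset : C ⊆ W
  smooth : SmoothOn r W
  support : ∀ u, u ∉ C → r u = 0

namespace CompactBump

theorem wd (hr : CompactBump r W C) (b : Bool) (a : κ) : CompactBump (wd b a r) W C where
  isOpen := hr.isOpen
  isCompact := hr.isCompact
  subset := hr.subset
  smooth := contDiffOn_wd hr.isOpen hr.smooth b a
  support u hu := by
    have h1 : Set.EqOn r (fun _ => 0) Cᶜ := fun y hy => hr.support y hy
    rw [wd_congr_on hr.isCompact.isClosed.isOpen_compl h1 b a hu, wd_const]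

theorem fibreCompact (hr : CompactBump r W C) (hV : IsOpen V)
    (hh : SmoothOn h (zProd V W)) :
    FibreCompact (fun z => r (zSnd z) * h z) V C where
  isOpen := hV
  isCompact := hr.isCompact
  smooth := by
    have hU : (zFst ⁻¹' V : Set ℂ^(ι ⊕ κ)) = zProd V W ∪ zProd V Cᶜ := by
      ext z
      constructor
      · intro hz
        by_cases hc : zSnd z ∈ C
        · exact Or.inl ⟨hz, hr.subset hc⟩
        · exact Or.inr ⟨hz, hc⟩
      · rintro (hz | hz)
        · exact hz.1
        · exact hz.1
    rw [hU]
    refine ContDiffOn.union_of_isOpen ?_ ?_ (isOpen_zProd hV hr.isOpen)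
      (isOpen_zProd hV hr.isCompact.isClosed.isOpen_compl)
    · exact (hr.smooth.comp contDiff_zSnd.contDiffOn fun z hz => hz.2).mul hh
    · exact contDiffOn_const.congr fun z hz => by rw [hr.support _ hz.2, zero_mul]
  support z _ hz := by rw [hr.support _ hz, zero_mul]

theorem wd_inl_mul (hr : CompactBump r W C) (hV : IsOpen V)
    (hh : SmoothOn h (zProd V W)) {z : ℂ^(ι ⊕ κ)} (hz : zFst z ∈ V) (b : Bool) (a : ι) :
    HigherEnergy.wd b (Sum.inl a) (fun z => r (zSnd z) * h z) z =
      r (zSnd z) * HigherEnergy.wd b (Sum.inl a) h z := by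
  by_cases hc : zSnd z ∈ C
  · have hz' : z ∈ zProd V W := ⟨hz, hr.subset hc⟩
    have hd := diffAt_of_contDiffOn hr.isOpen hr.smooth hz'.2
    rw [wd_mul (f := fun z : ℂ^(ι ⊕ κ) => r (zSnd z))
      (hd.comp z (contDiff_zSnd.differentiable (by simp) z))
      (diffAt_of_contDiffOn (isOpen_zProd hV hr.isOpen) hh hz'),
      wd_inl_comp_zSnd (g := r) hd, zero_mul, add_zero]
  · rw [((hr.fibreCompact hV hh).wd b (Sum.inl a)).support z hz hc, hr.support _ hc, zero_mul]

theorem wd_inr_mul (hr : CompactBump r W C) (hV : IsOpen V)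
    (hh : SmoothOn h (zProd V W)) {z : ℂ^(ι ⊕ κ)} (hz : zFst z ∈ V) (b : Bool) (a : κ) :
    HigherEnergy.wd b (Sum.inr a) (fun z => r (zSnd z) * h z) z =
      r (zSnd z) * HigherEnergy.wd b (Sum.inr a) h z + HigherEnergy.wd b a r (zSnd z) * h z := by
  by_cases hc : zSnd z ∈ C
  · have hz' : z ∈ zProd V W := ⟨hz, hr.subset hc⟩
    have hd := diffAt_of_contDiffOn hr.isOpen hr.smooth hz'.2
    rw [wd_mul (f := fun z : ℂ^(ι ⊕ κ) => r (zSnd z))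
      (hd.comp z (contDiff_zSnd.differentiable (by simp) z))
      (diffAt_of_contDiffOn (isOpen_zProd hV hr.isOpen) hh hz'),
      wd_inr_comp_zSnd (g := r) hd]
  · rw [((hr.fibreCompact hV hh).wd b (Sum.inr a)).support z hz hc, hr.support _ hc,
      (hr.wd b a).support _ hc]
    ring

theorem fibreInt_wd_inl (hr : CompactBump r W C) (hV : IsOpen V)
    (hh : SmoothOn h (zProd V W)) {v : ℂ^ι} (hv : v ∈ V) (b : Bool) (a : ι) :
    fibreInt (fun z => r (zSnd z) * HigherEnergy.wd b (Sum.inl a) h z) v =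
      HigherEnergy.wd b a (fibreInt fun z => r (zSnd z) * h z) v := by
  rw [(hr.fibreCompact hV hh).wd_fibreInt hv]
  refine integral_congr_ae (ae_of_all _ fun u => ?_)
  exact (hr.wd_inl_mul hV hh (z := Sum.elim v u) hv b a).symm

theorem fibreInt_wd_inr (hr : CompactBump r W C) (hV : IsOpen V)
    (hh : SmoothOn h (zProd V W)) {v : ℂ^ι} (hv : v ∈ V) (b : Bool) (a : κ) :
    fibreInt (fun z => r (zSnd z) * HigherEnergy.wd b (Sum.inr a) h z) v =
      -fibreInt (fun z => HigherEnergy.wd b a r (zSnd z) * h z) v := by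
  have hO := isOpen_zProd hV hr.isOpen
  have h1 := (hr.fibreCompact hV (contDiffOn_wd hO hh b (Sum.inr a))).integrable hv
  have h2 := ((hr.wd b a).fibreCompact hV hh).integrable hv
  have h3 := (hr.fibreCompact hV hh).fibreInt_wd_inr hv b a
  rw [eq_neg_iff_add_eq_zero, ← h3]
  simp only [fibreInt]
  rw [← integral_add h1 h2]
  refine integral_congr_ae (ae_of_all _ fun u => ?_)
  exact (hr.wd_inr_mul hV hh (z := Sum.elim v u) hv b a).symm

end CompactBump

end CompactSupport

section Stokes

attribute [local instance] normedRingFrm normedAlgebraFrm normedCommRingCFrm normedAlgebraCFrm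
  normedSpaceCFrm

variable {ι : Type} [Fintype ι] [DecidableEq ι] {n : ℕ} {S I Λ : Type} [Fintype Λ]
  {dom : I → Set ℂ^(Fin n)} {q : I → ℂ^(Fin n) → S} {τ : I → I → ℂ^(Fin n) → ℂ^(Fin n)}
  {P : I → Set ℂ^(Fin n)}
  {V : Set ℂ^ι} {f : I → ℂ^(ι ⊕ Fin n) → ℝ} {H : I → I → ℂ^(Fin n) → ℝ}
  {idx : Λ → I} {ρ : Λ → I → ℂ^(Fin n) → ℝ} {C : Λ → Set ℂ^(Fin n)} {K : Set S}

theorem UnityPartition.compactBump (U : UnityPartition dom q τ idx ρ C K)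
    (h : ChartSystem dom q τ) (l : Λ) :
    CompactBump (fun u => (ρ l (idx l) u : ℂ)) (dom (idx l)) (C l) where
  isOpen := h.isOpen _
  isCompact := U.isCompact l
  subset := U.subset l
  smooth := contDiffOn_ofReal (U.smooth l _)
  support u hu := by rw [U.eq_zero h hu, Complex.ofReal_zero]

theorem UnityPartition.wd_eq_zero (U : UnityPartition dom q τ idx ρ C K) {l : Λ} {i : I}
    {u : ℂ^(Fin n)} (h0 : ρ l i u = 0) (b : Bool) (a : Fin n) :
    wd b a (fun y => (ρ l i y : ℂ)) u = 0 := by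
  have h1 : fderiv ℝ (ρ l i) u = 0 :=
    IsLocalMin.fderiv_eq_zero (Filter.Eventually.of_forall fun y => by rw [h0]; exact U.nonneg l i y)
  have h2 : fderiv ℝ (fun y => (ρ l i y : ℂ)) u = 0 := by
    by_cases hd : DifferentiableAt ℝ (ρ l i) u
    · have := Complex.ofRealCLM.hasFDerivAt.comp u hd.hasFDerivAt
      rw [h1, ContinuousLinearMap.comp_zero] at this
      exact this.fderiv
    · refine fderiv_zero_of_not_differentiableAt fun hd' => hd ?_
      exact Complex.reCLM.differentiableAt.comp u hd'
  simp [wd, wdir, h2]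

/-- The contraction of `∂\bar∂`-closed transgression forms with `∂̄ρ` or `∂ρ`, as a density. -/
theorem PotFamily.isDensity_wd (h : ChartSystem dom q τ) (F : PotFamily dom q τ V f H)
    {r : I → ℂ^(Fin n) → ℂ} (hr : ∀ i, SmoothOn (r i) (dom i))
    (hinv : ∀ i j, ∀ u ∈ overlap dom q i j, r i u = r j (τ i j u)) (c : ℕ → ℂ) (b : Bool)
    (a : ι) (ψ : Frm ι) {v : ℂ^ι} (hv : v ∈ V) :
    ChartSystem.IsDensity dom q τ fun i u => ∑ β, wd (!b) β (r i) u * wedgeCLM n ψ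
      (dzdz b (Sum.inl a) (Sum.inr β) * transForm c b (Sum.inl a) (f i) (Sum.elim v u)) := by
  intro i j u hu
  have hz : (Sum.elim v u : ℂ^(ι ⊕ Fin n)) ∈ zProd V (overlap dom q i j) := ⟨hv, hu⟩
  have h1 : ∀ β, wd (!b) β (r i) u =
      ∑ c, wconj (!b) (jac (τ i j) β c u) * wd (!b) c (r j) (τ i j u) := by
    intro β
    have hO := h.isOpen_overlap i j
    rw [wd_congr_on hO (g := fun y => r j (τ i j y)) (fun y hy => hinv i j y hy) _ _ hu]
    exact wd_comp_jac hO (h.holomorphic i j) hu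
      (diffAt_of_contDiffOn (h.isOpen j) (hr j) (h.mapsTo i j u hu)) _ _
  have h2 : ∑ β, wd (!b) β (r i) u • dzdz b (Sum.inl a) (Sum.inr β) =
      cmap (covPullback (zMap id (τ i j)) (Sum.elim v u))
        ((F.chartChange h i j).surjective _ hz)
        (∑ c, wd (!b) c (r j) (τ i j u) • dzdz b (Sum.inl a) (Sum.inr c)) := by
    simp only [map_sum, map_smul, F.cmap_dzdz_inl_inr h hz, smul_sum, smul_smul, h1,
      sum_smul]
    rw [sum_comm]
    refine sum_congr rfl fun _ _ => sum_congr rfl fun _ _ => ?_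
    rw [mul_comm]
    rfl
  have h3 : ∀ (g : ℂ^(Fin n)) (ω' : CFrm (ι ⊕ Fin n)),
      ∑ β, g β * wedgeCLM n ψ (dzdz b (Sum.inl a) (Sum.inr β) * ω') =
        wedgeCLM n ψ ((∑ β, g β • dzdz b (Sum.inl a) (Sum.inr β)) * ω') := by
    intro g w
    rw [sum_mul, map_sum]
    refine sum_congr rfl fun β _ => ?_
    rw [smul_mul_assoc, map_smul, smul_eq_mul]
  beta_reduce
  rw [h3, h3, h2, F.transForm_eq h c b a hz, ← map_mul, F.wedgeCLM_cmap h hz]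
  rfl

theorem PotFamily.isDensity_fibreDensity (h : ChartSystem dom q τ) (F : PotFamily dom q τ V f H)
    (c : ℕ → ℂ) (hn : 1 ≤ n) (b : Bool) (a : ι) {ψ : Frm ι} (hψ : testCoeff b a a ψ ≠ 0)
    {v : ℂ^ι} (hv : v ∈ V) :
    ChartSystem.IsDensity dom q τ fun i u =>
      fibreDensity c b (Sum.inl a) (f i) (Sum.elim v u) := by
  intro i j u hu
  have hz : (Sum.elim v u : ℂ^(ι ⊕ Fin n)) ∈ zProd V (overlap dom q i j) := ⟨hv, hu⟩
  refine mul_right_cancel₀ hψ ?_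
  have h1 := wedgeCLM_dzdz_inl c hn b (Sum.inl a) a a (f i) ψ (Sum.elim v u)
  have h2 := wedgeCLM_dzdz_inl c hn b (Sum.inl a) a a (f j) ψ (zMap id (τ i j) (Sum.elim v u))
  rw [F.transForm_eq h c b a hz, ← F.cmap_dzdz_inl_inl h hz, ← map_mul, F.wedgeCLM_cmap h hz,
    h2] at h1
  rw [← h1, mul_assoc]
  rfl

/-- The integral over the fibres of the transgression form in the direction of `a`. -/
def fibreTheta (idx : Λ → I) (ρ : Λ → I → ℂ^(Fin n) → ℝ) (f : I → ℂ^(ι ⊕ Fin n) → ℝ)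
    (c : ℕ → ℂ) (b : Bool) (a : ι) (v : ℂ^ι) : ℂ :=
  ∑ l, fibreInt (fun z => (ρ l (idx l) (zSnd z) : ℂ) *
    fibreDensity c b (Sum.inl a) (f (idx l)) z) v

/-- The integral over the fibres of the Chern-Weil form, paired with `ψ`. -/
def fibreChern (idx : Λ → I) (ρ : Λ → I → ℂ^(Fin n) → ℝ) (f : I → ℂ^(ι ⊕ Fin n) → ℝ)
    (c : ℕ → ℂ) (ψ : Frm ι) (v : ℂ^ι) : ℂ :=
  ∑ l, fibreInt (fun z => (ρ l (idx l) (zSnd z) : ℂ) * wedgeCLM n ψ (cwForm c (f (idx l)) z)) v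

theorem PotFamily.fibreCompact_theta (h : ChartSystem dom q τ) (F : PotFamily dom q τ V f H)
    (U : UnityPartition dom q τ idx ρ C K) (c : ℕ → ℂ) (b : Bool) (a : ι ⊕ Fin n) (l : Λ) :
    FibreCompact (fun z => (ρ l (idx l) (zSnd z) : ℂ) * fibreDensity c b a (f (idx l)) z)
      V (C l) :=
  (U.compactBump h l).fibreCompact F.isOpen ((F.family _).contDiffOn_fibreDensity c b a)

theorem PotFamily.contDiffOn_fibreTheta (h : ChartSystem dom q τ) (F : PotFamily dom q τ V f H)
    (U : UnityPartition dom q τ idx ρ C K) (c : ℕ → ℂ) (b : Bool) (a : ι) :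
    SmoothOn (fibreTheta idx ρ f c b a) V :=
  ContDiffOn.sum fun l _ => (F.fibreCompact_theta h U c b (Sum.inl a) l).contDiffOn_fibreInt

theorem PotFamily.sum_fibreInt_wd [Countable I] (h : ChartSystem dom q τ)
    (hP : IsPartition dom q P)
    (F : PotFamily dom q τ V f H) (U : UnityPartition dom q τ idx ρ C Set.univ) (c : ℕ → ℂ)
    (b : Bool) (a : ι) (ψ : Frm ι) {v : ℂ^ι} (hv : v ∈ V) :
    ∑ l, ∑ β, fibreInt (fun z => wd (!b) β (fun u => (ρ l (idx l) u : ℂ)) (zSnd z) *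
      wedgeCLM n ψ (dzdz b (Sum.inl a) (Sum.inr β) *
        transForm c b (Sum.inl a) (f (idx l)) z)) v = 0 := by
  have hint : ∀ l β, Integrable fun u => wd (!b) β (fun u => (ρ l (idx l) u : ℂ)) u *
      wedgeCLM n ψ (dzdz b (Sum.inl a) (Sum.inr β) *
        transForm c b (Sum.inl a) (f (idx l)) (Sum.elim v u)) := fun l β =>
    (((U.compactBump h l).wd (!b) β).fibreCompact F.isOpen
      ((F.family _).contDiffOn_wedgeCLM_transForm c b _ _ ψ)).integrable hv
  have key := h.hasSum_integral_sum hP (idx := idx)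
    (d := fun l i u => ∑ β, wd (!b) β (fun u => (ρ l i u : ℂ)) u * wedgeCLM n ψ
      (dzdz b (Sum.inl a) (Sum.inr β) * transForm c b (Sum.inl a) (f i) (Sum.elim v u)))
    (fun l => F.isDensity_wd h (r := fun i u => (ρ l i u : ℂ))
      (fun i => contDiffOn_ofReal (U.smooth l i))
      (fun i j u hu => by rw [U.invariant l i j u hu]) c b a ψ hv)
    (fun l => (integrable_finsetSum _ fun β _ => hint l β).integrableOn)
    (fun l i u hu hq => sum_eq_zero fun β _ => by
      rw [U.wd_eq_zero, zero_mul]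
      by_contra h0
      exact hq (Set.image_mono (U.subset l) (U.support l i u h0).2))
    (D := fun _ _ => 0) (fun i u hu => by
      rw [sum_comm]
      refine (sum_eq_zero fun β _ => ?_).symm
      rw [← sum_mul, ← wd_sum _ (f := fun l u => (ρ l i u : ℂ)) fun l _ =>
        diffAt_of_contDiffOn (h.isOpen i) (contDiffOn_ofReal (U.smooth l i)) hu]
      have h1 : Set.EqOn (fun u => ∑ l, (ρ l i u : ℂ)) (fun _ => 1) (dom i) := fun y hy => by
        have := U.sum_eq_one i y hy (Set.mem_univ _)
        simp only [← Complex.ofReal_sum, this, Complex.ofReal_one]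
      rw [wd_congr_on (h.isOpen i) h1 _ _ hu, wd_const, zero_mul])
  simp only [integral_zero] at key
  rw [← key.unique hasSum_zero]
  refine sum_congr rfl fun l _ => ?_
  rw [setIntegral_eq_integral_of_forall_compl_eq_zero]
  · rw [integral_finsetSum _ fun β _ => hint l β]
    rfl
  · intro u hu
    refine sum_eq_zero fun β _ => ?_
    rw [((U.compactBump h l).wd (!b) β).support u fun hc => hu (U.subset l hc), zero_mul]

/-- Stokes' theorem on the fibres. -/
theorem PotFamily.sum_wd_fibreTheta [Countable I] (h : ChartSystem dom q τ)
    (hP : IsPartition dom q P)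
    (F : PotFamily dom q τ V f H) (U : UnityPartition dom q τ idx ρ C Set.univ) (c : ℕ → ℂ)
    (hn : 1 ≤ n) (b : Bool) (ψ : Frm ι) {v : ℂ^ι} (hv : v ∈ V) :
    ∑ a, ∑ β, wd (!b) β (fibreTheta idx ρ f c b a) v * testCoeff b a β ψ =
      -fibreChern idx ρ f c ψ v := by
  have hs : ∀ l a β, SmoothOn (fun z => wedgeCLM n ψ (dzdz b (Sum.inl a) β *
      transForm c b (Sum.inl a) (f (idx l)) z)) (zProd V (dom (idx l))) := fun l a β =>
    (F.family _).contDiffOn_wedgeCLM_transForm c b _ _ ψ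
  have hθ : ∀ l a, DifferentiableAt ℝ (fibreInt fun z => (ρ l (idx l) (zSnd z) : ℂ) *
      fibreDensity c b (Sum.inl a) (f (idx l)) z) v := fun l a =>
    diffAt_of_contDiffOn F.isOpen
      (F.fibreCompact_theta h U c b (Sum.inl a) l).contDiffOn_fibreInt hv
  have h1 : ∀ l (a β : ι), fibreInt (fun z => (ρ l (idx l) (zSnd z) : ℂ) *
        wd (!b) (Sum.inl β) (fun z => wedgeCLM n ψ (dzdz b (Sum.inl a) (Sum.inl β) *
          transForm c b (Sum.inl a) (f (idx l)) z)) z) v =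
      wd (!b) β (fibreInt fun z => (ρ l (idx l) (zSnd z) : ℂ) *
        fibreDensity c b (Sum.inl a) (f (idx l)) z) v * testCoeff b a β ψ := by
    intro l a β
    rw [(U.compactBump h l).fibreInt_wd_inl F.isOpen (hs l a _) hv]
    simp only [wedgeCLM_dzdz_inl c hn]
    have e1 : (fibreInt fun z => (ρ l (idx l) (zSnd z) : ℂ) *
        (fibreDensity c b (Sum.inl a) (f (idx l)) z * testCoeff b a β ψ)) = fun v =>
        testCoeff b a β ψ • fibreInt (fun z => (ρ l (idx l) (zSnd z) : ℂ) *
          fibreDensity c b (Sum.inl a) (f (idx l)) z) v := by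
      ext1 v
      simp only [fibreInt, ← mul_assoc, integral_mul_const]
      rw [smul_eq_mul, mul_comm]
    rw [e1, wd_const_smul (hθ l a), smul_eq_mul, mul_comm]
  have h2 : ∀ l, ∑ a, ((∑ β, fibreInt (fun z => (ρ l (idx l) (zSnd z) : ℂ) *
        wd (!b) (Sum.inl β) (fun z => wedgeCLM n ψ (dzdz b (Sum.inl a) (Sum.inl β) *
          transForm c b (Sum.inl a) (f (idx l)) z)) z) v) -
      ∑ β, fibreInt (fun z => wd (!b) β (fun u => (ρ l (idx l) u : ℂ)) (zSnd z) *
        wedgeCLM n ψ (dzdz b (Sum.inl a) (Sum.inr β) *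
          transForm c b (Sum.inl a) (f (idx l)) z)) v) =
      -fibreInt (fun z => (ρ l (idx l) (zSnd z) : ℂ) *
        wedgeCLM n ψ (cwForm c (f (idx l)) z)) v := by
    intro l
    have e1 : ∀ a β, Integrable fun u => (ρ l (idx l) u : ℂ) *
        wd (!b) β (fun z => wedgeCLM n ψ (dzdz b (Sum.inl a) β *
          transForm c b (Sum.inl a) (f (idx l)) z)) (Sum.elim v u) := fun a β =>
      ((U.compactBump h l).fibreCompact F.isOpen (contDiffOn_wd
        (isOpen_zProd F.isOpen (h.isOpen _)) (hs l a β) _ _)).integrable hv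
    have e2 : ∑ a : ι, ∑ β, fibreInt (fun z => (ρ l (idx l) (zSnd z) : ℂ) *
        wd (!b) β (fun z => wedgeCLM n ψ (dzdz b (Sum.inl a) β *
          transForm c b (Sum.inl a) (f (idx l)) z)) z) v =
        -fibreInt (fun z => (ρ l (idx l) (zSnd z) : ℂ) *
          wedgeCLM n ψ (cwForm c (f (idx l)) z)) v := by
      simp only [fibreInt]
      rw [← integral_neg]
      refine ((integral_finsetSum univ fun a _ => integrable_finsetSum _ fun β _ =>
        e1 a β).trans (sum_congr rfl fun a _ =>
          integral_finsetSum _ fun β _ => e1 a β)).symm.trans ?_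
      refine integral_congr_ae (ae_of_all _ fun u => ?_)
      change ∑ a : ι, ∑ β, (ρ l (idx l) u : ℂ) * _ = -((ρ l (idx l) u : ℂ) * _)
      simp only [← mul_sum]
      by_cases hu : ρ l (idx l) u = 0
      · rw [hu]
        simp
      · rw [(F.family (idx l)).sum_wd_transForm c hn b ψ (x := Sum.elim v u)
          ⟨hv, (U.support l _ u hu).1⟩]
        exact mul_neg _ _
    rw [← e2]
    refine sum_congr rfl fun a _ => ?_
    rw [Fintype.sum_sum_type, sub_eq_add_neg, ← sum_neg_distrib]
    congr 1
    exact sum_congr rfl fun β _ =>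
      ((U.compactBump h l).fibreInt_wd_inr F.isOpen (hs l a _) hv (!b) β).symm
  have h3 : ∑ l, ∑ a, ∑ β, fibreInt (fun z => wd (!b) β (fun u => (ρ l (idx l) u : ℂ)) (zSnd z) *
        wedgeCLM n ψ (dzdz b (Sum.inl a) (Sum.inr β) *
          transForm c b (Sum.inl a) (f (idx l)) z)) v = 0 := by
    rw [sum_comm]
    exact sum_eq_zero fun a _ => F.sum_fibreInt_wd h hP U c b a ψ hv
  have h4 := sum_congr (s₁ := univ) rfl fun l _ => h2 l
  simp only [Finset.sum_sub_distrib] at h4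
  rw [h3, sub_zero, sum_neg_distrib] at h4
  rw [fibreChern, ← h4]
  refine Eq.trans ?_ sum_comm
  refine sum_congr rfl fun a _ => ?_
  rw [sum_comm]
  refine sum_congr rfl fun β _ => ?_
  simp only [h1]
  rw [← sum_mul]
  congr 1
  exact wd_sum _ (f := fun l v => fibreInt (fun z => (ρ l (idx l) (zSnd z) : ℂ) *
    fibreDensity c b (Sum.inl a) (f (idx l)) z) v) (fun l _ => hθ l a) _ _

/-- A form dual to `dz_a ∧ d\bar z_β`. -/
theorem exists_testCoeff (a β : ι) : ∃ ψ : Frm ι, (∀ a' β', testCoeff false a' β' ψ =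
    if a' = a ∧ β' = β then 1 else 0) := by
  have hvol : ∀ x : Cov ι, ιF ℂ x * (volForm ι : Frm ι) = 0 := by
    intro x
    have h1 : ιF ℂ x * (volForm ι : Frm ι) =
        ιMulti ℂ (Fintype.card ι * 2).succ (Matrix.vecCons x (volCov ι)) := by
      rw [ιMulti_succ_apply, volForm_eq]
      simp [Matrix.vecTail, Function.comp_def]
    have h2 : ιMulti ℂ (Fintype.card ι * 2).succ (Matrix.vecCons x (volCov ι)) ∈
        ⋀[ℂ]^(Fintype.card ι * 2).succ (Cov ι) := ιMulti_range ℂ _ ⟨_, rfl⟩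
    have h3 := exteriorPower.finrank_eq ℂ (M := Cov ι) (Fintype.card ι * 2).succ
    rw [finrank_cov, Nat.choose_eq_zero_of_lt (Nat.lt_succ_self _)] at h3
    rw [Submodule.finrank_eq_zero.mp h3, Submodule.mem_bot] at h2
    rw [h1, h2]
  have hmul : ∀ (d : Module.Dual ℂ (Cov ι)) (x : Cov ι) (w : Frm ι),
      ιF ℂ x * CliffordAlgebra.contractLeft d w =
        d x • w - CliffordAlgebra.contractLeft d (ιF ℂ x * w) := by
    intro d x w
    rw [CliffordAlgebra.contractLeft_ι_mul]
    abel
  refine ⟨((-2 * Complex.I) ^ Fintype.card ι)⁻¹ • CliffordAlgebra.contractLeft (czbarCoord β)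
    (CliffordAlgebra.contractLeft (czCoord a) (volForm ι : Frm ι)), fun a' β' => ?_⟩
  have h1 : (dzdzbar a' β' : Frm ι) * CliffordAlgebra.contractLeft (czbarCoord β)
      (CliffordAlgebra.contractLeft (czCoord a) (volForm ι : Frm ι)) =
        (czbarCoord β (dzbar β') * czCoord a (dz a')) • (volForm ι : Frm ι) := by
    change ιF ℂ (dz a') * ιF ℂ (dzbar β') * _ = _
    rw [mul_assoc, hmul, hmul, hvol, czCoord_dzbar, map_zero, zero_smul, sub_zero, map_zero,
      sub_zero, mul_smul_comm, hmul, hvol, map_zero, sub_zero, smul_smul]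
  change topCoeff ι ((dzdzbar a' β' : Frm ι) * _) = _
  rw [mul_smul_comm, h1, map_smul, map_smul, topCoeff_volForm, czCoord_dz, czbarCoord_dzbar]
  by_cases ha : a = a'
  · by_cases hb : β = β'
    · simp [ha, hb]
    · simp [ha, hb, Ne.symm hb]
  · simp [ha, Ne.symm ha]

theorem testCoeff_true (a β : ι) (ψ : Frm ι) : testCoeff true a β ψ = testCoeff false β a ψ := rfl

/-- The fibre integrals of the transgression forms define a closed form. -/
theorem PotFamily.wd_fibreTheta [Countable I] (h : ChartSystem dom q τ)
    (hP : IsPartition dom q P)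
    (F : PotFamily dom q τ V f H) (U : UnityPartition dom q τ idx ρ C Set.univ) (c : ℕ → ℂ)
    (hn : 1 ≤ n) (a β : ι) {v : ℂ^ι} (hv : v ∈ V) :
    wd true β (fibreTheta idx ρ f c false a) v = wd false a (fibreTheta idx ρ f c true β) v := by
  obtain ⟨ψ, hψ⟩ := exists_testCoeff a β
  have h1 := F.sum_wd_fibreTheta h hP U c hn false ψ hv
  have h2 := F.sum_wd_fibreTheta h hP U c hn true ψ hv
  rw [← h2] at h1
  simp only [testCoeff_true, hψ, Bool.not_false, Bool.not_true] at h1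
  simpa [ite_and] using h1

theorem PotFamily.isDensity_fibreDensity' (h : ChartSystem dom q τ) (F : PotFamily dom q τ V f H)
    (c : ℕ → ℂ) (hn : 1 ≤ n) (b : Bool) (a : ι) {v : ℂ^ι} (hv : v ∈ V) :
    ChartSystem.IsDensity dom q τ fun i u =>
      fibreDensity c b (Sum.inl a) (f i) (Sum.elim v u) := by
  obtain ⟨ψ, hψ⟩ := exists_testCoeff a a
  refine F.isDensity_fibreDensity h c hn b a (ψ := ψ) ?_ hv
  cases b
  · rw [hψ]; simp
  · rw [testCoeff_true, hψ]; simp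

end Stokes

/-! ### Restriction of transgression forms to a fibre -/

section Restriction

variable {ι : Type} [Fintype ι] [DecidableEq ι] {n : ℕ} {V : Set ℂ^ι} {W : Set ℂ^(Fin n)}
  {f : ℂ^(ι ⊕ Fin n) → ℝ}

theorem hessMatrix_fibre (hO : IsOpen (zProd V W)) (hW : IsOpen W)
    (hf : SmoothOn f (zProd V W)) {v : ℂ^ι} (hv : v ∈ V) {u : ℂ^(Fin n)} (hu : u ∈ W) :
    hessMatrix (fun y => f (Sum.elim v y)) u = fibreMetric f (Sum.elim v u) := by
  have hs := contDiffOn_ofReal hf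
  ext a b
  change pd a (pdbar b fun y => (f (Sum.elim v y) : ℂ)) u =
    wd false (Sum.inr a) (wd true (Sum.inr b) fun y => (f y : ℂ)) (Sum.elim v u)
  have h1 : Set.EqOn (wd true b fun y => (f (Sum.elim v y) : ℂ))
      (fun y => wd true (Sum.inr b) (fun z => (f z : ℂ)) (Sum.elim v y)) W := fun y hy =>
    wd_fibre (h := fun z => (f z : ℂ)) (diffAt_of_contDiffOn hO hs
      (x := Sum.elim v y) ⟨hv, hy⟩) true b
  rw [pd_eq, pdbar_eq, wd_congr_on hW h1 false a hu]
  exact wd_fibre (diffAt_of_contDiffOn hO (contDiffOn_wd hO hs _ _)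
    (x := Sum.elim v u) ⟨hv, hu⟩) false a

theorem cmap_covRes_sum (t : ι ⊕ Fin n → ι ⊕ Fin n → ℂ) :
    cmap (covRes ι (Fin n)) covRes_surjective (∑ a, ∑ b, t a b • dzdzbar a b) =
      ∑ a, ∑ b, t (Sum.inr a) (Sum.inr b) • dzdzbar a b := by
  have h1 : ∀ a b, cmap (covRes ι (Fin n)) covRes_surjective (dzdzbar (Sum.inl a) b) = 0 := by
    intro a b
    apply Subtype.ext
    rw [coe_cmap, map_dzdzbar, covRes_dz_inl, map_zero, zero_mul]
    rfl
  have h2 : ∀ a b, cmap (covRes ι (Fin n)) covRes_surjective (dzdzbar a (Sum.inl b)) = 0 := by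
    intro a b
    apply Subtype.ext
    rw [coe_cmap, map_dzdzbar, covRes_dzbar_inl, map_zero, mul_zero]
    rfl
  have h3 : ∀ a b, cmap (covRes ι (Fin n)) covRes_surjective (dzdzbar (Sum.inr a) (Sum.inr b)) =
      dzdzbar a b := by
    intro a b
    apply Subtype.ext
    rw [coe_cmap, map_dzdzbar, covRes_dz, covRes_dzbar]
    rfl
  simp only [map_sum, map_add, map_smul, Fintype.sum_sum_type, h1, h2, h3, smul_zero,
    Finset.sum_const_zero, zero_add]

theorem cmap_covRes_curvature (hW : IsOpen W) (hf : IsFamily f (zProd V W)) {v : ℂ^ι}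
    (hv : v ∈ V) {u : ℂ^(Fin n)} (hu : u ∈ W) :
    (curvature (fibreMetric f) (Sum.elim v u)).map (cmap (covRes ι (Fin n)) covRes_surjective) =
      curvature (hessMatrix fun y => f (Sum.elim v y)) u := by
  ext1 i j
  rw [Matrix.map_apply]
  change cmap (covRes ι (Fin n)) covRes_surjective (∑ a, ∑ b, _ • dzdzbar a b) =
    ∑ a, ∑ b, _ • dzdzbar a b
  rw [cmap_covRes_sum]
  refine sum_congr rfl fun a _ => sum_congr rfl fun b _ => ?_
  congr 2
  rw [pdbar_eq, pdbar_eq, ← wd_fibre (h := fun y => ((Matrix.of fun k l =>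
    pd (Sum.inr a) (fun w => fibreMetric f w k l) y) * (fibreMetric f y)⁻¹) i j)]
  · refine wd_congr_on hW (fun y hy => ?_) _ _ hu
    have h1 : (Matrix.of fun k l => pd (Sum.inr a) (fun w => fibreMetric f w k l)
        (Sum.elim v y)) = Matrix.of fun k l =>
          pd a (fun w => hessMatrix (fun y => f (Sum.elim v y)) w k l) y := by
      ext k l
      simp only [Matrix.of_apply, pd_eq]
      rw [← wd_fibre (h := fun w => fibreMetric f w k l)]
      · exact wd_congr_on hW (fun w hw => by rw [hessMatrix_fibre hf.isOpen hW hf.smooth hv hw]) _ _ hy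
      · exact diffAt_of_contDiffOn hf.isOpen (hf.contDiffOn_fibreMetric k l)
          (x := Sum.elim v y) ⟨hv, hy⟩
    simp only [h1, hessMatrix_fibre hf.isOpen hW hf.smooth hv hy]
  · have h2 := hf.contDiffOn_logDeriv false (Sum.inr a) i j
    have h3 : (fun y => ((Matrix.of fun k l =>
        pd (Sum.inr a) (fun w => fibreMetric f w k l) y) * (fibreMetric f y)⁻¹) i j) =
        fun z => logDeriv false (Sum.inr a) f z i j := by
      ext1 y
      simp only [pd_eq]
      rfl
    rw [h3]
    exact diffAt_of_contDiffOn hf.isOpen h2 (x := Sum.elim v u) ⟨hv, hu⟩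

theorem cmap_covRes_ddbarFun (hW : IsOpen W) (hf : IsFamily f (zProd V W)) {v : ℂ^ι}
    (hv : v ∈ V) {u : ℂ^(Fin n)} (hu : u ∈ W) :
    cmap (covRes ι (Fin n)) covRes_surjective (ddbarFun f (Sum.elim v u)) =
      ddbarFun (fun y => f (Sum.elim v y)) u := by
  simp only [ddbarFun]
  rw [cmap_covRes_sum]
  refine sum_congr rfl fun a _ => sum_congr rfl fun b _ => ?_
  have := congrFun (congrFun (hessMatrix_fibre hf.isOpen hW hf.smooth hv hu) a) b
  rw [pd_eq, pdbar_eq]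
  exact congrArg (fun c : ℂ => c • dzdzbar a b) this.symm

/-- The transgression density of a potential `f` on a fibre, for an infinitesimal variation with
`ġ g⁻¹ = E` and `Ḣ H⁻¹ = e`. -/
def transDensity (c : ℕ → ℂ) (f : ℂ^(Fin n) → ℝ) (u : ℂ^(Fin n)) (E : Matrix (Fin n) (Fin n) ℂ)
    (e : ℂ) : ℂ :=
  topCoeff (Fin n) (dcwPoly c n (curvature (hessMatrix f) u) (ddbarFun f u)
    (E.map (algebraMap ℂ (CFrm (Fin n)))) (algebraMap ℂ (CFrm (Fin n)) e) : CFrm (Fin n))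

theorem fibreDensity_eq_transDensity (c : ℕ → ℂ) (hW : IsOpen W) (hf : IsFamily f (zProd V W))
    (b : Bool) (a : ι ⊕ Fin n) {v : ℂ^ι} (hv : v ∈ V) {u : ℂ^(Fin n)} (hu : u ∈ W) :
    fibreDensity c b a f (Sum.elim v u) = transDensity c (fun y => f (Sum.elim v y)) u
      (logDeriv b a f (Sum.elim v u)) (-potDeriv b a f (Sum.elim v u)) := by
  rw [fibreDensity, transDensity, ← coe_cmap (covRes ι (Fin n)) covRes_surjective, transForm,
    map_dcwPoly, cmap_covRes_curvature hW hf hv hu, cmap_covRes_ddbarFun hW hf hv hu]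
  congr 3
  · ext1 i j
    simp only [Matrix.map_apply, AlgHom.commutes]
  · simp only [AlgHom.commutes]

theorem transDensity_smul (c : ℕ → ℂ) (f : ℂ^(Fin n) → ℝ) (u : ℂ^(Fin n))
    (E : Matrix (Fin n) (Fin n) ℂ) (e s : ℂ) :
    transDensity c f u (s • E) (s * e) = s * transDensity c f u E e := by
  have h1 : (s • E).map (algebraMap ℂ (CFrm (Fin n))) =
      s • E.map (algebraMap ℂ (CFrm (Fin n))) := by
    ext1 i j
    rw [Matrix.map_apply, Matrix.smul_apply, Matrix.smul_apply, Matrix.map_apply, smul_eq_mul,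
      map_mul, Algebra.smul_def]
  have h2 : algebraMap ℂ (CFrm (Fin n)) (s * e) = s • algebraMap ℂ (CFrm (Fin n)) e := by
    rw [map_mul, Algebra.smul_def]
  rw [transDensity, h1, h2, dcwPoly_smul]
  exact map_smul (topCoeff (Fin n)) s _

theorem transDensity_zero (c : ℕ → ℂ) (f : ℂ^(Fin n) → ℝ) (u : ℂ^(Fin n)) :
    transDensity c f u 0 0 = 0 := by
  have := transDensity_smul c f u 0 0 0
  rwa [smul_zero, zero_mul, zero_mul] at this

end Restriction

/-! ### Integrals over an interval depending on parameters -/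

section IntervalIntegral

variable {ι : Type} [Fintype ι] [DecidableEq ι] {V : Set ℂ^ι} {g : ℂ^ι × ℝ → ℂ}

/-- A smooth function of compact support which is `1` on `[0, π]`. -/
def piBump : ContDiffBump (0 : ℝ) := ⟨4, 5, by norm_num, by norm_num⟩

theorem intervalIntegral_eq (k : ℝ → ℝ → ℂ) : ∫ x in (0 : ℝ)..Real.pi, k 1 x =
    ∫ x, (Set.Ioc 0 Real.pi).indicator (fun _ => (1 : ℝ)) x • k (piBump x) x := by
  rw [intervalIntegral.integral_of_le Real.pi_pos.le, ← integral_indicator measurableSet_Ioc]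
  refine integral_congr_ae (ae_of_all _ fun x => ?_)
  by_cases hx : x ∈ Set.Ioc 0 Real.pi
  · have h1 : piBump x = 1 := piBump.one_of_mem_closedBall (by
      rw [mem_closedBall_zero_iff, Real.norm_of_nonneg hx.1.le]
      exact hx.2.trans Real.pi_le_four)
    simp only [Set.indicator_of_mem hx, h1, one_smul]
  · simp [Set.indicator_of_notMem hx]

theorem locallyIntegrable_indicator :
    LocallyIntegrable ((Set.Ioc 0 Real.pi).indicator fun _ => (1 : ℝ)) volume :=
  ((integrable_indicator_iff measurableSet_Ioc).mpr (by simp)).locallyIntegrable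

theorem piBump_smul_eq_zero (v : ℂ^ι) (x : ℝ) (hx : x ∉ Metric.closedBall 0 piBump.rOut) :
    piBump x • g (v, x) = 0 := by
  rw [piBump.zero_of_le_dist (le_of_lt (not_le.mp hx)), zero_smul]

theorem contDiffOn_piBump_smul (hg : SmoothOn g (V ×ˢ Set.univ)) :
    SmoothOn (fun p => piBump p.2 • g p) (V ×ˢ Set.univ) :=
  ((piBump.contDiff (n := ⊤)).comp contDiff_snd).contDiffOn.smul hg

theorem contDiffOn_intervalIntegral (hV : IsOpen V) (hg : SmoothOn g (V ×ˢ Set.univ)) :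
    SmoothOn (fun v => ∫ x in (0 : ℝ)..Real.pi, g (v, x)) V := by
  have h := fun v => intervalIntegral_eq fun s x => s • g (v, x)
  simp only [one_smul] at h
  simp only [h]
  exact contDiffOn_integral hV (isCompact_closedBall 0 _) (fun v _ => piBump_smul_eq_zero v)
    locallyIntegrable_indicator (contDiffOn_piBump_smul hg)

theorem wd_intervalIntegral (hV : IsOpen V) (hg : SmoothOn g (V ×ˢ Set.univ)) {v : ℂ^ι}
    (hv : v ∈ V) (b : Bool) (a : ι) : wd b a (fun v => ∫ x in (0 : ℝ)..Real.pi, g (v, x)) v =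
      ∫ x in (0 : ℝ)..Real.pi, wd b a (fun y => g (y, x)) v := by
  have h := fun v => intervalIntegral_eq fun s x => s • g (v, x)
  have h' := intervalIntegral_eq fun s x => wd b a (fun y => s • g (y, x)) v
  simp only [one_smul] at h h'
  simp only [h, h']
  exact wd_integral hV (isCompact_closedBall 0 _) (fun v _ => piBump_smul_eq_zero v)
    locallyIntegrable_indicator (contDiffOn_piBump_smul hg) hv b a

end IntervalIntegral

/-! ### The parametrization of the unit interval by `(1 - cos x) / 2` -/

section Ramp

/-- A smooth map of the real line onto the unit interval. -/
def ramp (x : ℝ) : ℝ := (1 - Real.cos x) / 2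

theorem contDiff_ramp : ContDiff ℝ ∞ ramp := by unfold ramp; fun_prop

theorem ramp_zero : ramp 0 = 0 := by simp [ramp]

theorem ramp_pi : ramp Real.pi = 1 := by simp [ramp]

theorem ramp_mem (x : ℝ) : ramp x ∈ Set.Icc (0 : ℝ) 1 := by
  have h1 := Real.neg_one_le_cos x
  have h2 := Real.cos_le_one x
  constructor <;> unfold ramp <;> linarith

theorem hasDerivAt_ramp (x : ℝ) : HasDerivAt ramp (Real.sin x / 2) x := by
  have h := ((Real.hasDerivAt_cos x).const_sub 1).div_const 2
  rwa [neg_neg] at h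

theorem ramp_arccos {t : ℝ} (h0 : 0 ≤ t) (h1 : t ≤ 1) : ramp (Real.arccos (1 - 2 * t)) = t := by
  rw [ramp, Real.cos_arccos (by linarith) (by linarith)]
  ring

theorem arccos_ramp {x : ℝ} (h0 : 0 ≤ x) (h1 : x ≤ Real.pi) :
    Real.arccos (1 - 2 * ramp x) = x := by
  rw [ramp, show 1 - 2 * ((1 - Real.cos x) / 2) = Real.cos x by ring, Real.arccos_cos h0 h1]

theorem ramp_mem_Ioo {x : ℝ} (hx : x ∈ Set.Ioo 0 Real.pi) : ramp x ∈ Set.Ioo (0 : ℝ) 1 := by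
  have h1 := Real.cos_lt_cos_of_nonneg_of_le_pi le_rfl hx.2.le hx.1
  have h2 := Real.cos_lt_cos_of_nonneg_of_le_pi hx.1.le le_rfl hx.2
  rw [Real.cos_zero] at h1
  rw [Real.cos_pi] at h2
  constructor <;> unfold ramp <;> linarith

theorem integral_ramp (T : ℝ → ℂ) :
    ∫ t in (0 : ℝ)..1, T t = ∫ x in (0 : ℝ)..Real.pi, ((Real.sin x / 2 : ℝ) : ℂ) * T (ramp x) := by
  have himg : ramp '' Set.Ioo 0 Real.pi = Set.Ioo 0 1 := by
    ext t
    constructor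
    · rintro ⟨x, hx, rfl⟩
      exact ramp_mem_Ioo hx
    · intro ht
      refine ⟨Real.arccos (1 - 2 * t), ⟨?_, ?_⟩, ramp_arccos ht.1.le ht.2.le⟩
      · rw [Real.arccos_pos]; linarith [ht.1]
      · rw [Real.arccos_lt_pi]; linarith [ht.2]
  have h := integral_image_eq_integral_abs_deriv_smul (s := Set.Ioo 0 Real.pi) measurableSet_Ioo
    (fun x _ => (hasDerivAt_ramp x).hasDerivWithinAt)
    (fun x hx y hy hxy => by
      rw [← arccos_ramp hx.1.le hx.2.le, hxy, arccos_ramp hy.1.le hy.2.le]) T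
  rw [himg] at h
  rw [intervalIntegral.integral_of_le zero_le_one, intervalIntegral.integral_of_le Real.pi_pos.le,
    integral_Ioc_eq_integral_Ioo, integral_Ioc_eq_integral_Ioo, h]
  refine setIntegral_congr_fun measurableSet_Ioo fun x hx => ?_
  have : 0 ≤ Real.sin x / 2 := by
    have := Real.sin_nonneg_of_nonneg_of_le_pi hx.1.le hx.2.le
    linarith
  simp only [abs_of_nonneg this, Complex.real_smul]

theorem deriv_comp_ramp {E : Type*} [NormedAddCommGroup E] [NormedSpace ℝ E] {k : ℝ → E} {x : ℝ}
    (hx : x ∈ Set.Ioo 0 Real.pi) (hk : DifferentiableAt ℝ (fun x => k (ramp x)) x) :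
    deriv (fun x => k (ramp x)) x = (Real.sin x / 2) • deriv k (ramp x) := by
  have ht := ramp_mem_Ioo hx
  have h1 : k =ᶠ[nhds (ramp x)] fun t => k (ramp (Real.arccos (1 - 2 * t))) :=
    Filter.eventuallyEq_of_mem (Ioo_mem_nhds ht.1 ht.2) fun t ht => by
      simp only [ramp_arccos ht.1.le ht.2.le]
  have h2 : DifferentiableAt ℝ (fun t : ℝ => Real.arccos (1 - 2 * t)) (ramp x) :=
    DifferentiableAt.comp (g := Real.arccos) (f := fun t : ℝ => 1 - 2 * t) _
      (Real.differentiableAt_arccos.mpr ⟨by linarith [ht.2], by linarith [ht.1]⟩) (by fun_prop)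
  have h3 : DifferentiableAt ℝ k (ramp x) := by
    refine DifferentiableAt.congr_of_eventuallyEq ?_ h1
    have : DifferentiableAt ℝ (fun x => k (ramp x)) (Real.arccos (1 - 2 * ramp x)) := by
      rwa [arccos_ramp hx.1.le hx.2.le]
    exact DifferentiableAt.comp (g := fun x => k (ramp x))
      (f := fun t : ℝ => Real.arccos (1 - 2 * t)) (ramp x) this h2
  exact (h3.hasDerivAt.scomp x (hasDerivAt_ramp x)).deriv

end Ramp

/-! ### Functions of the real parts of some coordinates -/

section RealDirection

variable {J : Type} [Fintype J] [DecidableEq J] {V : Type*} [NormedAddCommGroup V] [NormedSpace ℂ V]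

/-- `h` does not depend on the imaginary part of the `a`-th coordinate. -/
def IsRealIn (a : J) {R : Type*} (h : ℂ^J → R) : Prop :=
  ∀ z (s : ℝ), h (z + Pi.single a (Complex.I * s)) = h z

theorem fderiv_apply_eq_zero {a : J} {h : ℂ^J → V} {z : ℂ^J}
    (hh : ∀ s : ℝ, h (z + Pi.single a (Complex.I * s)) = h z) :
    fderiv ℝ h z (Pi.single a Complex.I) = 0 := by
  by_cases hd : DifferentiableAt ℝ h z
  · have h1 := hd.hasFDerivAt.hasLineDerivAt (Pi.single a Complex.I)
    have h2 : HasLineDerivAt ℝ h 0 z (Pi.single a Complex.I) := by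
      have : (fun t : ℝ => h (z + t • (Pi.single a Complex.I : ℂ^J))) = fun _ => h z := by
        ext1 t
        rw [← hh t]
        congr 2
        rw [← Pi.single_smul, Complex.real_smul, mul_comm]
      rw [HasLineDerivAt, this]
      exact hasDerivAt_const _ _
    exact h1.unique h2
  · rw [fderiv_zero_of_not_differentiableAt hd]
    rfl

theorem IsRealIn.wd_eq {a : J} {h : ℂ^J → V} (hh : IsRealIn a h) (b : Bool) (z : ℂ^J) :
    wd b a h z = (1 / 2 : ℂ) • fderiv ℝ h z (Pi.single a 1) := by
  rw [wd, wdir, I_smul_single, fderiv_apply_eq_zero (hh z), smul_zero, add_zero]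

theorem IsRealIn.wd {a : J} {h : ℂ^J → V} (hh : IsRealIn a h) (b : Bool) (c : J) :
    IsRealIn a (wd b c h) := by
  intro z s
  have h1 : fderiv ℝ h (z + Pi.single a (Complex.I * s)) = fderiv ℝ h z := by
    rw [← fderiv_comp_add_right]
    congr 1
    ext1 y
    exact hh y s
  simp only [HigherEnergy.wd, wdir, h1]

end RealDirection

/-! ### Potentials on cones -/

section Cone

variable {N n : ℕ}

theorem sum_normSq_pos {z : ℂ^(Fin (N + 1))} (hz : z ≠ 0) : 0 < ∑ i, Complex.normSq (z i) := by
  obtain ⟨i, hi⟩ := Function.ne_iff.mp hz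
  exact Finset.sum_pos' (fun j _ => Complex.normSq_nonneg _)
    ⟨i, Finset.mem_univ _, Complex.normSq_pos.mpr hi⟩

theorem logNormSq_smul {c : ℂ} (hc : c ≠ 0) {z : ℂ^(Fin (N + 1))} (hz : z ≠ 0) :
    logNormSq (c • z) = Real.log (Complex.normSq c) + logNormSq z := by
  rw [logNormSq, logNormSq, ← Real.log_mul (Complex.normSq_pos.mpr hc).ne' (sum_normSq_pos hz).ne',
    mul_sum]
  simp

theorem contDiff_normSq : ContDiff ℝ ∞ Complex.normSq := by
  have : (Complex.normSq : ℂ → ℝ) = fun z => Complex.reCLM z * Complex.reCLM z +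
      Complex.imCLM z * Complex.imCLM z := funext Complex.normSq_apply
  rw [this]
  fun_prop

theorem contDiffOn_logNormSq {E : Type*} [NormedAddCommGroup E] [NormedSpace ℝ E]
    {g : E → Fin (N + 1) → ℂ} {U : Set E} (hg : SmoothOn g U) (h0 : ∀ x ∈ U, g x ≠ 0) :
    SmoothOn (fun x => logNormSq (g x)) U :=
  ContDiffOn.log (ContDiffOn.sum fun i _ => contDiff_normSq.comp_contDiffOn (contDiffOn_pi.mp hg i))
    fun x hx => (sum_normSq_pos (h0 x hx)).ne'

theorem pluriharmonic_log {κ : Type} [Fintype κ] [DecidableEq κ] {c : ℂ^κ → ℂ}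
    {U : Set ℂ^κ} (hU : IsOpen U) (hc : DifferentiableOn ℂ c U) (h0 : ∀ u ∈ U, c u ≠ 0)
    {u : ℂ^κ} (hu : u ∈ U) (a b : κ) :
    wd false a (wd true b fun y => ((Real.log (Complex.normSq (c y)) : ℝ) : ℂ)) u = 0 := by
  have hO : IsOpen (U ∩ (fun y => c y / c u) ⁻¹' Complex.slitPlane) :=
    (hc.continuousOn.div_const (c u)).isOpen_inter_preimage hU Complex.isOpen_slitPlane
  have huO : u ∈ U ∩ (fun y => c y / c u) ⁻¹' Complex.slitPlane :=
    ⟨hu, by simp [div_self (h0 u hu)]⟩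
  set O := U ∩ (fun y => c y / c u) ⁻¹' Complex.slitPlane
  have hL : ∀ y ∈ O, DifferentiableAt ℂ (fun y => Complex.log (c y / c u)) y := fun y hy =>
    (Complex.differentiableAt_log hy.2).comp (f := fun y => c y / c u) y
      ((hc.differentiableAt (hU.mem_nhds hy.1)).mul_const (c u)⁻¹)
  have hLs : SmoothOn (fun y => Complex.log (c y / c u)) O :=
    contDiffOn_of_holomorphic hO fun y hy => (hL y hy).differentiableWithinAt
  have h1 : Set.EqOn (fun y => ((Real.log (Complex.normSq (c y)) : ℝ) : ℂ))
      (fun y => (Complex.log (c y / c u) + conj (Complex.log (c y / c u))) +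
        ((Real.log (Complex.normSq (c u)) : ℝ) : ℂ)) O := by
    intro y hy
    have e1 : Real.log (Complex.normSq (c y)) = 2 * Real.log ‖c y / c u‖ +
        Real.log (Complex.normSq (c u)) := by
      rw [norm_div, Real.log_div (norm_ne_zero_iff.mpr (h0 y hy.1))
        (norm_ne_zero_iff.mpr (h0 u hu)), Complex.normSq_eq_norm_sq, Complex.normSq_eq_norm_sq,
        Real.log_pow, Real.log_pow]
      push_cast
      ring
    simp only [Complex.add_conj, Complex.log_re, e1]
    push_cast
    ring
  have h2 : Set.EqOn (wd true b fun y => ((Real.log (Complex.normSq (c y)) : ℝ) : ℂ))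
      (fun y => conj (wd false b (fun y => Complex.log (c y / c u)) y)) O := by
    intro y hy
    have hd := diffAt_of_contDiffOn hO hLs hy
    have hd' := diffAt_of_contDiffOn hO (contDiffOn_conj hLs) hy
    rw [wd_congr_on hO h1 true b hy, wd_add (hd.fun_add hd') (differentiableAt_const _), wd_add hd hd',
      wd_true_holomorphic (hL y hy), wd_conj hd, wd_const, zero_add, add_zero]
    rfl
  have hd := diffAt_of_contDiffOn hO (contDiffOn_wd hO hLs false b) huO
  rw [wd_congr_on hO h2 false a huO, wd_conj hd, Bool.not_false, wd_comm hO hLs huO,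
    wd_congr_on hO (g := fun _ => 0) (fun y hy => wd_true_holomorphic (hL y hy) a) false b huO,
    wd_const, map_zero]

variable {X : Set (PSpace N)} {A : ℕ → Param (Fin n) (Fin (N + 1))} {S : Type}
  {q : ℕ → ℂ^(Fin n) → S} {τ : ℕ → ℕ → ℂ^(Fin n) → ℂ^(Fin n)} {cc : ℕ → ℕ → ℂ^(Fin n) → ℂ}

/-- Transition functions of an atlas of a projective manifold and of its tautological bundle. -/
structure ProjSystem (X : Set (PSpace N)) (A : ℕ → Param (Fin n) (Fin (N + 1)))
    (q : ℕ → ℂ^(Fin n) → S) (τ : ℕ → ℕ → ℂ^(Fin n) → ℂ^(Fin n))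
    (cc : ℕ → ℕ → ℂ^(Fin n) → ℂ) : Prop extends ChartSystem (fun i => (A i).dom) q τ where
  mem_cone : ∀ i, ∀ u ∈ (A i).dom, (A i).map u ∈ cone X
  holomorphic_map : ∀ i, DifferentiableOn ℂ (A i).map (A i).dom
  holomorphic_factor : ∀ i j, DifferentiableOn ℂ (cc i j) (overlap (fun i => (A i).dom) q i j)
  factor_ne_zero : ∀ i j, ∀ u ∈ overlap (fun i => (A i).dom) q i j, cc i j u ≠ 0
  map_eq : ∀ i j, ∀ u ∈ overlap (fun i => (A i).dom) q i j,
    (A i).map u = cc i j u • (A j).map (τ i j u)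

variable {ι : Type} [Fintype ι] [DecidableEq ι] {V : Set ℂ^ι}
  {Φ : ℂ^ι → ℂ^(Fin (N + 1)) → ℝ}

/-- The family of potentials of the metrics `ω + √-1/2π ∂\bar∂ Φ_v`. -/
def coneFamily (A : ℕ → Param (Fin n) (Fin (N + 1))) (Φ : ℂ^ι → ℂ^(Fin (N + 1)) → ℝ) (i : ℕ)
    (z : ℂ^(ι ⊕ Fin n)) : ℝ := localPotential (A i) (Φ (zFst z)) (zSnd z)

/-- `Φ_v`, `v ∈ V`, is a smooth family of functions on `X` that define nondegenerate metrics. -/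
structure IsConeFamily (X : Set (PSpace N)) (A : ℕ → Param (Fin n) (Fin (N + 1))) (V : Set ℂ^ι)
    (Φ : ℂ^ι → ℂ^(Fin (N + 1)) → ℝ) : Prop where
  isOpen : IsOpen V
  smooth : ∀ i, SmoothOn (fun z : ℂ^(ι ⊕ Fin n) => Φ (zFst z) ((A i).map (zSnd z)))
    (zProd V (A i).dom)
  homogeneous : ∀ v ∈ V, ∀ z ∈ cone X, ∀ c : ℂ, c ≠ 0 → Φ v (c • z) = Φ v z
  det_ne_zero : ∀ v ∈ V, ∀ i, ∀ u ∈ (A i).dom, (metric (A i) (Φ v) u).det ≠ 0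

theorem ProjSystem.contDiffOn_map (h : ProjSystem X A q τ cc) (i : ℕ) :
    SmoothOn (A i).map (A i).dom :=
  contDiffOn_of_holomorphic (h.isOpen i) (h.holomorphic_map i)

theorem ProjSystem.contDiffOn_coneFamily (h : ProjSystem X A q τ cc) (hΦ : IsConeFamily X A V Φ)
    (i : ℕ) : SmoothOn (coneFamily A Φ i) (zProd V (A i).dom) :=
  (contDiffOn_logNormSq ((h.contDiffOn_map i).comp contDiff_zSnd.contDiffOn fun _ hz => hz.2)
    fun _ hz => (h.mem_cone i _ hz.2).1).add (hΦ.smooth i)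

theorem ProjSystem.fibreMetric_coneFamily (h : ProjSystem X A q τ cc) (hΦ : IsConeFamily X A V Φ)
    {i : ℕ} {v : ℂ^ι} (hv : v ∈ V) {u : ℂ^(Fin n)} (hu : u ∈ (A i).dom) :
    fibreMetric (coneFamily A Φ i) (Sum.elim v u) = metric (A i) (Φ v) u :=
  (hessMatrix_fibre (isOpen_zProd hΦ.isOpen (h.isOpen i)) (h.isOpen i)
    (h.contDiffOn_coneFamily hΦ i) hv hu).symm

theorem ProjSystem.isFamily (h : ProjSystem X A q τ cc) (hΦ : IsConeFamily X A V Φ) (i : ℕ) :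
    IsFamily (coneFamily A Φ i) (zProd V (A i).dom) where
  isOpen := isOpen_zProd hΦ.isOpen (h.isOpen i)
  smooth := h.contDiffOn_coneFamily hΦ i
  det_ne_zero z hz := by
    rw [← Sum.elim_comp_inl_inr z]
    exact (h.fibreMetric_coneFamily hΦ (v := zFst z) hz.1 hz.2).symm ▸
      hΦ.det_ne_zero _ hz.1 i _ hz.2

theorem ProjSystem.potFamily (h : ProjSystem X A q τ cc) (hΦ : IsConeFamily X A V Φ) :
    PotFamily (fun i => (A i).dom) q τ V (coneFamily A Φ)
      (fun i j u => Real.log (Complex.normSq (cc i j u))) where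
  isOpen := hΦ.isOpen
  family := h.isFamily hΦ
  smooth i j := ContDiffOn.log (contDiff_normSq.comp_contDiffOn
    (contDiffOn_of_holomorphic (h.isOpen_overlap i j) (h.holomorphic_factor i j)))
    fun u hu => (Complex.normSq_pos.mpr (h.factor_ne_zero i j u hu)).ne'
  pluriharmonic i j u hu a b := pluriharmonic_log (h.isOpen_overlap i j)
    (h.holomorphic_factor i j) (h.factor_ne_zero i j) hu a b
  potential i j z hz hu := by
    have h1 := h.mem_cone j _ (h.mapsTo i j _ hu)
    have h2 := h.factor_ne_zero i j _ hu
    change logNormSq ((A i).map (zSnd z)) + Φ (zFst z) ((A i).map (zSnd z)) =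
      logNormSq ((A j).map (τ i j (zSnd z))) + Φ (zFst z) ((A j).map (τ i j (zSnd z))) + _
    rw [h.map_eq i j _ hu, logNormSq_smul h2 h1.1, hΦ.homogeneous _ hz _ h1 _ h2]
    ring

/-- The density on the fibre of the transgression form in the direction of `a`. -/
def coneDensity (c : ℕ → ℂ) (b : Bool) (a : ι) (p : Param (Fin n) (Fin (N + 1)))
    (Φ : ℂ^ι → ℂ^(Fin (N + 1)) → ℝ) (v : ℂ^ι) (u : ℂ^(Fin n)) : ℂ :=
  transDensity c (localPotential p (Φ v)) u
    ((Matrix.of fun k l => wd b a (fun y => metric p (Φ y) u k l) v) * (metric p (Φ v) u)⁻¹)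
    (-wd b a (fun y => (localPotential p (Φ y) u : ℂ)) v)

theorem ProjSystem.fibreDensity_eq (h : ProjSystem X A q τ cc) (hΦ : IsConeFamily X A V Φ)
    (c : ℕ → ℂ) (b : Bool) (a : ι) {i : ℕ} {v : ℂ^ι} (hv : v ∈ V) {u : ℂ^(Fin n)}
    (hu : u ∈ (A i).dom) : fibreDensity c b (Sum.inl a) (coneFamily A Φ i) (Sum.elim v u) =
      coneDensity c b a (A i) Φ v u := by
  have hf := h.isFamily hΦ i
  have hz : (Sum.elim v u : ℂ^(ι ⊕ Fin n)) ∈ zProd V (A i).dom := ⟨hv, hu⟩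
  rw [fibreDensity_eq_transDensity c (h.isOpen i) hf b _ hv hu, coneDensity, logDeriv,
    h.fibreMetric_coneFamily hΦ hv hu, potDeriv,
    ← wd_base (h := fun y => (coneFamily A Φ i y : ℂ)) (diffAt_of_contDiffOn hf.isOpen
      (contDiffOn_ofReal hf.smooth) hz) b a]
  congr 2
  ext1 k l
  rw [wdM_apply, ← wd_base (h := fun y => fibreMetric (coneFamily A Φ i) y k l)
    (diffAt_of_contDiffOn hf.isOpen (hf.contDiffOn_fibreMetric k l) hz) b a]
  exact wd_congr_on hΦ.isOpen (fun y hy => by rw [h.fibreMetric_coneFamily hΦ hy hu]) b a hv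

variable {Λ : Type} [Fintype Λ] {idx : Λ → ℕ} {ρ : Λ → ℕ → ℂ^(Fin n) → ℝ}
  {C : Λ → Set ℂ^(Fin n)} {K : Set S}

theorem ProjSystem.fibreTheta_eq (h : ProjSystem X A q τ cc) (hΦ : IsConeFamily X A V Φ)
    (U : UnityPartition (fun i => (A i).dom) q τ idx ρ C K) (c : ℕ → ℂ) (b : Bool) (a : ι)
    {v : ℂ^ι} (hv : v ∈ V) : fibreTheta idx ρ (coneFamily A Φ) c b a v =
      ∑ l, ∫ u, (ρ l (idx l) u : ℂ) * coneDensity c b a (A (idx l)) Φ v u := by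
  refine sum_congr rfl fun l _ => integral_congr_ae (ae_of_all _ fun u => ?_)
  change (ρ l (idx l) u : ℂ) * _ = (ρ l (idx l) u : ℂ) * _
  by_cases hu : ρ l (idx l) u = 0
  · simp [hu]
  · rw [h.fibreDensity_eq hΦ c b a hv (U.support l _ u hu).1]

theorem coneDensity_congr {c : ℕ → ℂ} {b : Bool} {a : ι} {ι' : Type} [Fintype ι'] [DecidableEq ι']
    {b' : Bool} {a' : ι'} {p : Param (Fin n) (Fin (N + 1))}
    {Φ' : ℂ^ι' → ℂ^(Fin (N + 1)) → ℝ} {v : ℂ^ι} {v' : ℂ^ι'} {u : ℂ^(Fin n)}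
    (h0 : Φ v = Φ' v') (h1 : ∀ k l, wd b a (fun y => metric p (Φ y) u k l) v =
      wd b' a' (fun y => metric p (Φ' y) u k l) v')
    (h2 : wd b a (fun y => (localPotential p (Φ y) u : ℂ)) v =
      wd b' a' (fun y => (localPotential p (Φ' y) u : ℂ)) v') :
    coneDensity c b a p Φ v u = coneDensity c b' a' p Φ' v' u := by
  simp only [coneDensity, h0, h1, h2]

/-- The density of the transgression form along a path. -/
def lineDensity (c : ℕ → ℂ) (p : Param (Fin n) (Fin (N + 1)))
    (φ : ℝ → ℂ^(Fin (N + 1)) → ℝ) (t : ℝ) (u : ℂ^(Fin n)) : ℂ :=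
  transDensity c (localPotential p (φ t)) u
    ((Matrix.of fun k l => deriv (fun s => metric p (φ s) u k l) t) * (metric p (φ t) u)⁻¹)
    (-((deriv (fun s => φ s (p.map u)) t : ℝ) : ℂ))

theorem topCoeff_transgression (χ : Polynomial ℚ) (hn : 1 ≤ n) (m : ℕ)
    (p : Param (Fin n) (Fin (N + 1))) (φ : ℝ → ℂ^(Fin (N + 1)) → ℝ) (t : ℝ) (u : ℂ^(Fin n)) :
    topCoeff (Fin n) (transgression χ 2 m p φ t u) = lineDensity (hilbTerm χ n) p φ t u := by
  have hs : ∀ s : ℂ, s ≠ 0 → Function.Surjective (covScale (ι := Fin n) (fun _ => s) fun _ => 1) :=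
    fun s hs => covScale_surjective (fun _ => hs) fun _ => one_ne_zero
  have hw : ∀ s (h : s ≠ 0), ∀ w ∈ oneOne (Fin n), cmap _ (hs s h) w = s • w := by
    intro s h w hw
    induction hw using Submodule.span_induction with
    | mem x hx =>
      obtain ⟨ab, rfl⟩ := hx
      apply Subtype.ext
      rw [coe_cmap, map_dzdzbar, covScale_dz, covScale_dzbar, map_smul, map_smul, one_smul,
        smul_mul_assoc]
      rfl
    | zero => simp
    | add x y _ _ hx hy => rw [map_add, hx, hy, smul_add]
    | smul c x _ hx => rw [map_smul, hx, smul_comm]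
  refine linearMap_coeff_eq χ hn m ((topCoeff (Fin n)) ∘ₗ (Subalgebra.center ℂ _).val.toLinearMap)
    (fun s => if h : s ≠ 0 then cmap _ (hs s h) else AlgHom.id ℂ _) ?_ _ _ _ _ ?_ ?_ ?_ ?_
  · intro s h x
    simp only [dif_pos h]
    change topCoeff (Fin n) (cmap _ (hs s h) x : CFrm (Fin n)) = _
    rw [coe_cmap, topCoeff_map, det_covScale]
    simp
  · intro s h
    ext1 i j
    simp only [dif_pos h]
    exact hw s h _ (curvature_mem _ _ i j)
  · intro s h
    simp only [dif_pos h]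
    exact hw s h _ (ddbarFun_mem _ _)
  · intro s h
    ext1 i j
    simp only [Matrix.map_apply, AlgHom.commutes]
  · intro s h
    rw [AlgHom.commutes]

end Cone

/-! ### Families of paths -/

section PathFamily

variable {κ : Type} [Fintype κ] [DecidableEq κ]

/-- The inclusion of the path over `v`. -/
def pathCLM (κ : Type) [Fintype κ] : ℂ^κ × ℝ →L[ℝ] ℂ^(κ ⊕ Fin 1) :=
  (elimCLM κ (Fin 1)).comp ((ContinuousLinearMap.id ℝ ℂ^κ).prodMap
    (ContinuousLinearMap.pi fun _ => Complex.ofRealCLM))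

/-- The point with parameter `x` of the path over `v`. -/
def pathPt (v : ℂ^κ) (x : ℝ) : κ ⊕ Fin 1 → ℂ := Sum.elim v fun _ => (x : ℂ)

theorem pathCLM_apply (p : ℂ^κ × ℝ) : pathCLM κ p = pathPt p.1 p.2 := elimCLM_apply _

theorem hasDerivAt_pathPt (v : ℂ^κ) (x : ℝ) :
    HasDerivAt (pathPt v) (Pi.single (Sum.inr 0) 1) x := by
  refine hasDerivAt_pi.mpr fun a => ?_
  rcases a with a | a
  · simpa [pathPt] using hasDerivAt_const x (v a)
  · simpa [pathPt, Subsingleton.elim a 0] using (hasDerivAt_id x).ofReal_comp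

theorem wd_pathPt {h : ℂ^(κ ⊕ Fin 1) → ℂ} (hr : IsRealIn (Sum.inr 0) h) {v : ℂ^κ} {x : ℝ}
    (hd : DifferentiableAt ℝ h (pathPt v x)) (b : Bool) :
    wd b (Sum.inr 0) h (pathPt v x) = (1 / 2 : ℂ) * deriv (fun s => h (pathPt v s)) x := by
  rw [hr.wd_eq, smul_eq_mul]
  congr 1
  exact (hd.hasFDerivAt.comp_hasDerivAt x (hasDerivAt_pathPt v x)).deriv.symm

variable {N n : ℕ} {X : Set (PSpace N)} {A : ℕ → Param (Fin n) (Fin (N + 1))} {S : Type}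
  {q : ℕ → ℂ^(Fin n) → S} {τ : ℕ → ℕ → ℂ^(Fin n) → ℂ^(Fin n)} {cc : ℕ → ℕ → ℂ^(Fin n) → ℂ}
  {Λ : Type} [Fintype Λ] {idx : Λ → ℕ} {ρ : Λ → ℕ → ℂ^(Fin n) → ℝ} {C : Λ → Set ℂ^(Fin n)}
  {W : Set ℂ^κ} {Φ : ℂ^(κ ⊕ Fin 1) → ℂ^(Fin (N + 1)) → ℝ} {P : ℕ → Set ℂ^(Fin n)}

theorem IsRealIn.coneDensity {ι : Type} [Fintype ι] [DecidableEq ι] {a : ι}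
    {Φ : ℂ^ι → ℂ^(Fin (N + 1)) → ℝ} (hr : IsRealIn a Φ) (c : ℕ → ℂ) (b : Bool) (a' : ι)
    (p : Param (Fin n) (Fin (N + 1))) (u : ℂ^(Fin n)) :
    IsRealIn a fun v => coneDensity c b a' p Φ v u := fun z s =>
  coneDensity_congr (hr z s)
    (fun k l => (IsRealIn.wd (h := fun y => metric p (Φ y) u k l)
      (fun z s => by simp only [hr z s]) b a') z s)
    ((IsRealIn.wd (h := fun y => (localPotential p (Φ y) u : ℂ))
      (fun z s => by simp only [hr z s]) b a') z s)

theorem mem_pathPt {v : ℂ^κ} (hv : v ∈ W) (x : ℝ) :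
    pathPt v x ∈ (zFst ⁻¹' W : Set ℂ^(κ ⊕ Fin 1)) := hv

/-- The integral over the fibre and along the path of the transgression form. -/
def pathEnergy (idx : Λ → ℕ) (ρ : Λ → ℕ → ℂ^(Fin n) → ℝ) (A : ℕ → Param (Fin n) (Fin (N + 1)))
    (Φ : ℂ^(κ ⊕ Fin 1) → ℂ^(Fin (N + 1)) → ℝ) (c : ℕ → ℂ) (v : ℂ^κ) : ℂ :=
  ∫ x in (0 : ℝ)..Real.pi,
    2 * fibreTheta idx ρ (coneFamily A Φ) c false (Sum.inr 0) (pathPt v x)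

theorem contDiffOn_pathPt {h : ℂ^(κ ⊕ Fin 1) → ℂ} (hh : SmoothOn h (zFst ⁻¹' W)) :
    SmoothOn (fun p : ℂ^κ × ℝ => h (pathPt p.1 p.2)) (W ×ˢ Set.univ) :=
  (hh.comp (pathCLM κ).contDiff.contDiffOn fun p hp => by
    rw [pathCLM_apply]; exact hp.1).congr fun p _ => by
      rw [Function.comp_apply, pathCLM_apply]

theorem contDiff_comp_pathPt {h : ℂ^(κ ⊕ Fin 1) → ℂ} (hh : SmoothOn h (zFst ⁻¹' W))
    {v : ℂ^κ} (hv : v ∈ W) : ContDiff ℝ ∞ fun x => h (pathPt v x) := by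
  have : ContDiff ℝ ∞ (pathPt v) := by
    have h1 : pathPt v = fun x => pathCLM κ (v, x) := funext fun x => (pathCLM_apply (v, x)).symm
    rw [h1]
    fun_prop
  exact contDiffOn_univ.mp (ContDiffOn.comp (f := pathPt v) hh this.contDiffOn fun x _ => hv)

theorem contDiffOn_elim_pathPt {G : Type*} [NormedAddCommGroup G] [NormedSpace ℝ G]
    {g : ((κ ⊕ Fin 1) ⊕ Fin n → ℂ) → G} {O : Set ℂ^(Fin n)} {v : ℂ^κ} (hv : v ∈ W)
    (hg : SmoothOn g (zProd (zFst ⁻¹' W) O)) :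
    SmoothOn (fun p : ℂ^(Fin n) × ℝ => g (Sum.elim (pathPt v p.2) p.1))
      (O ×ˢ Set.univ) := by
  have : ContDiff ℝ ∞ fun p : ℂ^(Fin n) × ℝ =>
      elimCLM (κ ⊕ Fin 1) (Fin n) (pathCLM κ (v, p.2), p.1) := by fun_prop
  refine (hg.comp this.contDiffOn fun p hp => ?_).congr fun p _ => ?_
  · rw [elimCLM_apply, pathCLM_apply]; exact ⟨hv, hp.1⟩
  · rw [Function.comp_apply, elimCLM_apply, pathCLM_apply]

theorem deriv_ofReal (f : ℝ → ℝ) (t : ℝ) :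
    deriv (fun s => (f s : ℂ)) t = ((deriv f t : ℝ) : ℂ) := by
  by_cases hf : DifferentiableAt ℝ f t
  · exact hf.hasDerivAt.ofReal_comp.deriv
  · rw [deriv_zero_of_not_differentiableAt hf, deriv_zero_of_not_differentiableAt fun h =>
      hf (DifferentiableAt.comp (f := fun s => (f s : ℂ)) (g := Complex.reCLM) t
        Complex.reCLM.differentiableAt h), Complex.ofReal_zero]

theorem ProjSystem.fibreDensity_pathPt (h : ProjSystem X A q τ cc)
    (hΦ : IsConeFamily X A (zFst ⁻¹' W) Φ) (hr : IsRealIn (Sum.inr 0) Φ) (c : ℕ → ℂ) {v : ℂ^κ}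
    (hv : v ∈ W) {φ : ℝ → ℂ^(Fin (N + 1)) → ℝ} (hφ : ∀ x : ℝ, Φ (pathPt v x) = φ (ramp x))
    {i : ℕ} {u : ℂ^(Fin n)} (hu : u ∈ (A i).dom) {x : ℝ} (hx : x ∈ Set.Ioo 0 Real.pi) :
    2 * fibreDensity c false (Sum.inl (Sum.inr 0)) (coneFamily A Φ i) (Sum.elim (pathPt v x) u) =
      ((Real.sin x / 2 : ℝ) : ℂ) * lineDensity c (A i) φ (ramp x) u := by
  have hf := h.isFamily hΦ i
  have hz : (Sum.elim (pathPt v x) u : (κ ⊕ Fin 1) ⊕ Fin n → ℂ) ∈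
    zProd (zFst ⁻¹' W) (A i).dom := ⟨hv, hu⟩
  have hel : DifferentiableAt ℝ (fun y : ℂ^(κ ⊕ Fin 1) => (Sum.elim y u : (κ ⊕ Fin 1) ⊕ Fin n → ℂ))
      (pathPt v x) := by
    have : DifferentiableAt ℝ (fun y => elimCLM (κ ⊕ Fin 1) (Fin n) (y, u)) (pathPt v x) := by
      fun_prop
    exact this.congr_of_eventuallyEq (.of_forall fun y => (elimCLM_apply (y, u)).symm)
  have hwd : ∀ g : (ℂ^(Fin (N + 1)) → ℝ) → ℂ, DifferentiableAt ℝ (fun y => g (Φ y)) (pathPt v x) →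
      wd false (Sum.inr 0) (fun y => g (Φ y)) (pathPt v x) =
        (1 / 2 * ((Real.sin x / 2 : ℝ) : ℂ)) * deriv (fun s => g (φ s)) (ramp x) := by
    intro g hg
    have hd : DifferentiableAt ℝ (fun s => g (φ (ramp s))) x := by
      simp only [← hφ]
      exact hg.comp x (hasDerivAt_pathPt v x).differentiableAt
    rw [wd_pathPt (h := fun y => g (Φ y)) (fun z s => by simp only [hr z s]) hg]
    simp only [hφ]
    rw [deriv_comp_ramp (k := fun s => g (φ s)) hx hd, Complex.real_smul, mul_assoc]
  rw [h.fibreDensity_eq hΦ c false _ (mem_pathPt hv x) hu, coneDensity, lineDensity, hφ]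
  have h1 : (Matrix.of fun k l => wd false (Sum.inr 0) (fun y => metric (A i) (Φ y) u k l)
      (pathPt v x)) = (1 / 2 * ((Real.sin x / 2 : ℝ) : ℂ)) •
        Matrix.of fun k l => deriv (fun s => metric (A i) (φ s) u k l) (ramp x) := by
    ext1 k l
    refine hwd (fun f => metric (A i) f u k l) ?_
    refine ((diffAt_of_contDiffOn hf.isOpen (hf.contDiffOn_fibreMetric k l) hz).comp
      (pathPt v x) hel).congr_of_eventuallyEq (Filter.eventuallyEq_of_mem
        (hΦ.isOpen.mem_nhds (mem_pathPt hv x)) fun y hy => ?_)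
    exact (congrFun (congrFun (h.fibreMetric_coneFamily hΦ hy hu) k) l).symm
  have h2 : wd false (Sum.inr 0) (fun y => (localPotential (A i) (Φ y) u : ℂ)) (pathPt v x) =
      (1 / 2 * ((Real.sin x / 2 : ℝ) : ℂ)) *
        ((deriv (fun s => φ s ((A i).map u)) (ramp x) : ℝ) : ℂ) := by
    rw [hwd (fun f => (localPotential (A i) f u : ℂ)) ((diffAt_of_contDiffOn hf.isOpen
      (contDiffOn_ofReal hf.smooth) hz).comp (pathPt v x) hel), deriv_ofReal]
    simp only [localPotential, deriv_const_add]
  rw [h1, h2, Matrix.smul_mul, ← mul_neg, transDensity_smul]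
  ring

variable (h : ProjSystem X A q τ cc) (hP : IsPartition (fun i => (A i).dom) q P)
  (U : UnityPartition (fun i => (A i).dom) q τ idx ρ C Set.univ)
  (hΦ : IsConeFamily X A (zFst ⁻¹' W) Φ) (hr : IsRealIn (Sum.inr 0) Φ) (hW : IsOpen W)
include h U hΦ hW

theorem contDiffOn_pathEnergy (c : ℕ → ℂ) : SmoothOn (pathEnergy idx ρ A Φ c) W :=
  contDiffOn_intervalIntegral hW (contDiffOn_const.mul (contDiffOn_pathPt
    ((h.potFamily hΦ).contDiffOn_fibreTheta h.toChartSystem U c false (Sum.inr 0))))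

include hP hr

/-- The first variation of the energy. -/
theorem wd_pathEnergy (c : ℕ → ℂ) (hn : 1 ≤ n) {v : ℂ^κ} (hv : v ∈ W) (β : κ) :
    wd true β (pathEnergy idx ρ A Φ c) v =
      fibreTheta idx ρ (coneFamily A Φ) c true (Sum.inl β) (pathPt v Real.pi) -
        fibreTheta idx ρ (coneFamily A Φ) c true (Sum.inl β) (pathPt v 0) := by
  have hO := hΦ.isOpen
  have hθ := fun b a => (h.potFamily hΦ).contDiffOn_fibreTheta h.toChartSystem U c b a
  set θ₀ := fibreTheta idx ρ (coneFamily A Φ) c false (Sum.inr 0) with h₀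
  set θ₁ := fibreTheta idx ρ (coneFamily A Φ) c true (Sum.inl β) with h₁
  have hg := contDiffOn_pathPt (contDiffOn_const (c := (2 : ℂ)) |>.mul (hθ false (Sum.inr 0)))
  have hθr : ∀ x s, θ₁ (pathPt v x + Pi.single (Sum.inr 0) (Complex.I * (s : ℝ))) =
      θ₁ (pathPt v x) := by
    intro x s
    have hm : pathPt v x + Pi.single (Sum.inr 0) (Complex.I * (s : ℝ)) ∈
        (zFst ⁻¹' W : Set ℂ^(κ ⊕ Fin 1)) := by
      change (fun a => pathPt v x (Sum.inl a) + _) ∈ W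
      simpa [pathPt] using hv
    rw [h₁, h.fibreTheta_eq hΦ U c _ _ hm, h.fibreTheta_eq hΦ U c _ _ (mem_pathPt hv x)]
    refine sum_congr rfl fun l _ => integral_congr_ae (ae_of_all _ fun u => ?_)
    exact congrArg _ (hr.coneDensity c true _ (A (idx l)) u (pathPt v x) s)
  have hd : ∀ x, 2 * wd true (Sum.inl β) θ₀ (pathPt v x) = deriv (fun s => θ₁ (pathPt v s)) x := by
    intro x
    have e2 : fderiv ℝ θ₁ (pathPt v x) (Pi.single (Sum.inr 0) Complex.I) = 0 :=
      fderiv_apply_eq_zero (hθr x)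
    rw [(h.potFamily hΦ).wd_fibreTheta h.toChartSystem hP U c hn _ _ (mem_pathPt hv x), ← h₁,
      wd, wdir, I_smul_single, e2, smul_zero, add_zero, smul_eq_mul, ← mul_assoc]
    norm_num
    exact ((diffAt_of_contDiffOn hO (hθ true (Sum.inl β))
      (mem_pathPt hv x)).hasFDerivAt.comp_hasDerivAt x (hasDerivAt_pathPt v x)).deriv.symm
  have hdiff : ∀ x, DifferentiableAt ℝ (fun s => θ₁ (pathPt v s)) x := fun x =>
    (diffAt_of_contDiffOn hO (hθ true (Sum.inl β)) (mem_pathPt hv x)).comp x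
      (hasDerivAt_pathPt v x).differentiableAt
  rw [← intervalIntegral.integral_deriv_eq_sub (fun x _ => hdiff x)]
  · simp only [← hd]
    change wd true β (fun v => ∫ x in (0 : ℝ)..Real.pi, 2 * θ₀ (pathPt v x)) v = _
    rw [wd_intervalIntegral hW hg hv]
    refine intervalIntegral.integral_congr fun x _ => ?_
    have hd := diffAt_of_contDiffOn hO (hθ false (Sum.inr 0)) (mem_pathPt hv x)
    exact (wd_base (hd.const_mul 2) _ _).trans (wd_const_smul hd 2 _ _)
  · exact ((contDiff_comp_pathPt (hθ true (Sum.inl β)) hv).continuous_deriv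
      (by simp)).intervalIntegrable _ _

/-- The energy along a path of the family. -/
theorem energyAlong_eq_pathEnergy (χ : Polynomial ℚ) (hn : 1 ≤ n) (m : ℕ) {v : ℂ^κ} (hv : v ∈ W)
    {φ : ℝ → ℂ^(Fin (N + 1)) → ℝ} (hφ : ∀ (x : ℝ) z, Φ (pathPt v x) z = φ (ramp x) z)
    (hPA : P = projPiece A) :
    energyAlong A χ 2 m φ = ci ^ n * pathEnergy idx ρ A Φ (hilbTerm χ n) v := by
  have hO := hΦ.isOpen
  have hF := h.potFamily hΦ
  set c := hilbTerm χ n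
  have hm : ∀ x : ℝ, pathPt v x ∈ (zFst ⁻¹' W : Set ℂ^(κ ⊕ Fin 1)) := mem_pathPt hv
  have hφ' : ∀ x : ℝ, Φ (pathPt v x) = φ (ramp x) := fun x => funext (hφ x)
  let d : ℕ → ℝ → ℂ^(Fin n) → ℂ := fun i x u =>
    2 * fibreDensity c false (Sum.inl (Sum.inr 0)) (coneFamily A Φ i) (Sum.elim (pathPt v x) u)
  have hds : ∀ i, SmoothOn (fun p : ℂ^(Fin n) × ℝ => d i p.2 p.1)
      ((A i).dom ×ˢ Set.univ) := fun i => contDiffOn_const.mul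
    (contDiffOn_elim_pathPt hv ((hF.family i).contDiffOn_fibreDensity c false _))
  have hD : ∀ i, SmoothOn (fun u => ∫ x in (0 : ℝ)..Real.pi, d i x u) (A i).dom := fun i =>
    contDiffOn_intervalIntegral (h.isOpen i) (hds i)
  have hsum := (U.hasSum_integral h.toChartSystem hP (fun i j u hu => by
      rw [← intervalIntegral.integral_const_mul]
      refine intervalIntegral.integral_congr fun x _ => ?_
      have := hF.isDensity_fibreDensity' h.toChartSystem c hn false (Sum.inr 0) (hm x) i j u hu
      simp only [d, this]
      ring) (fun i => (hD i).continuousOn) fun i u _ hu => absurd (Set.mem_univ _) hu).tsum_eq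
  have hpt : ∀ i, ∀ u ∈ P i, ∫ t in (0 : ℝ)..1, topCoeff (Fin n) (transgression χ 2 m (A i) φ t u) =
      ∫ x in (0 : ℝ)..Real.pi, d i x u := by
    intro i u hu
    rw [integral_ramp, intervalIntegral.integral_of_le Real.pi_pos.le,
      intervalIntegral.integral_of_le Real.pi_pos.le, integral_Ioc_eq_integral_Ioo,
      integral_Ioc_eq_integral_Ioo]
    refine setIntegral_congr_fun measurableSet_Ioo fun x hx => ?_
    rw [topCoeff_transgression χ hn]
    exact (h.fibreDensity_pathPt hΦ hr c hv hφ' (hP.subset i hu) hx).symm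
  have hint : ∀ l, ∫ u in (A (idx l)).dom, (ρ l (idx l) u : ℂ) *
      ∫ x in (0 : ℝ)..Real.pi, d (idx l) x u = ∫ x in (0 : ℝ)..Real.pi, ∫ u,
        (ρ l (idx l) u : ℂ) * d (idx l) x u := by
    intro l
    rw [setIntegral_eq_integral_of_forall_compl_eq_zero fun u hu => by
      rw [U.eq_zero h.toChartSystem fun hc => hu (U.subset l hc), Complex.ofReal_zero, zero_mul]]
    simp only [← intervalIntegral.integral_const_mul]
    simp only [intervalIntegral.integral_of_le Real.pi_pos.le]
    have hB := hF.fibreCompact_theta h.toChartSystem U c false (Sum.inl (Sum.inr 0)) l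
    have hG : SmoothOn (fun p : ℂ^(Fin n) × ℝ => (ρ l (idx l) p.1 : ℂ) *
        d (idx l) p.2 p.1) (Set.univ ×ˢ Set.univ) := by
      refine (contDiffOn_const.mul (contDiffOn_elim_pathPt (O := Set.univ) hv
        (hB.smooth.mono fun z hz => hz.1))).congr (f := fun p => 2 * _) fun p _ => ?_
      change _ * (2 * _) = 2 * ((ρ l (idx l) p.1 : ℂ) * _)
      ring
    rw [Set.univ_prod_univ, contDiffOn_univ] at hG
    refine integral_integral_swap ?_
    rw [← Measure.restrict_univ (μ := (volume : Measure ℂ^(Fin n))), Measure.prod_restrict]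
    refine IntegrableOn.of_forall_sdiff_eq_zero (s := C l ×ˢ Set.Icc 0 Real.pi) ?_
      (MeasurableSet.univ.prod measurableSet_Ioc) fun p hp => ?_
    · exact hG.continuous.continuousOn.integrableOn_compact ((U.isCompact l).prod isCompact_Icc)
    · have : p.1 ∉ C l := fun hc => hp.2 ⟨hc, Set.Ioc_subset_Icc_self hp.1.2⟩
      change (ρ l (idx l) p.1 : ℂ) * _ = 0
      rw [U.eq_zero h.toChartSystem this, Complex.ofReal_zero, zero_mul]
  have hcont : ∀ l, Continuous fun x : ℝ => ∫ u, (ρ l (idx l) u : ℂ) * d (idx l) x u := by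
    intro l
    have h2 := continuous_const (y := (2 : ℂ)).mul (contDiff_comp_pathPt (hF.fibreCompact_theta
      h.toChartSystem U c false (Sum.inl (Sum.inr 0)) l).contDiffOn_fibreInt hv).continuous
    convert h2 using 2 with x
    refine Eq.trans ?_ (integral_const_mul _ _)
    exact integral_congr_ae (ae_of_all _ fun u => by
      change _ * (2 * _) = 2 * ((ρ l (idx l) u : ℂ) * _); ring)
  rw [energyAlong, ← hPA, pathEnergy]
  congr 1
  rw [tsum_congr fun i => setIntegral_congr_fun (hP.measurableSet i) (hpt i), hsum,
    sum_congr rfl fun l _ => hint l,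
    ← intervalIntegral.integral_finsetSum fun l _ => (hcont l).intervalIntegrable _ _]
  refine intervalIntegral.integral_congr fun x _ => ?_
  simp only [fibreTheta, mul_sum, fibreInt, ← integral_const_mul]
  exact sum_congr rfl fun l _ => integral_congr_ae (ae_of_all _ fun u => by
    change _ * (2 * _) = 2 * ((ρ l (idx l) u : ℂ) * _); ring)

end PathFamily

/-! ### The energy of a Bergman potential -/

section Paths

variable {ι : Type} [Fintype ι] [DecidableEq ι] {N n : ℕ} {X : Set (PSpace N)}
  {A : ℕ → Param (Fin n) (Fin (N + 1))} {S : Type} {q : ℕ → ℂ^(Fin n) → S}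
  {τ : ℕ → ℕ → ℂ^(Fin n) → ℂ^(Fin n)} {cc : ℕ → ℕ → ℂ^(Fin n) → ℂ}

theorem hessMatrix_combo {f g : ℂ^(Fin n) → ℝ} {O : Set ℂ^(Fin n)} (hO : IsOpen O)
    (hf : SmoothOn f O) (hg : SmoothOn g O) (s t : ℝ) {u : ℂ^(Fin n)} (hu : u ∈ O) :
    hessMatrix (fun y => s * f y + t * g y) u =
      (s : ℂ) • hessMatrix f u + (t : ℂ) • hessMatrix g u := by
  have hf' := contDiffOn_ofReal hf
  have hg' := contDiffOn_ofReal hg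
  have key : ∀ {F G : ℂ^(Fin n) → ℂ}, SmoothOn F O → SmoothOn G O →
      ∀ b a, ∀ y ∈ O, wd b a (fun y => (s : ℂ) • F y + (t : ℂ) • G y) y =
        (s : ℂ) • wd b a F y + (t : ℂ) • wd b a G y := by
    intro F G hF hG b a y hy
    have dF := diffAt_of_contDiffOn hO hF hy
    have dG := diffAt_of_contDiffOn hO hG hy
    rw [wd_add (dF.fun_const_smul (s : ℂ)) (dG.fun_const_smul (t : ℂ)), wd_const_smul dF, wd_const_smul dG]
  ext a b
  simp only [hessMatrix, Matrix.of_apply, Matrix.add_apply, Matrix.smul_apply, pd_eq, pdbar_eq]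
  rw [← key (contDiffOn_wd hO hf' true b) (contDiffOn_wd hO hg' true b) false a u hu]
  refine wd_congr_on hO (fun y hy => ?_) false a hu
  rw [← key hf' hg' true b y hy]
  congr 1
  ext1 y
  simp

theorem posDef_combo {M M' : Matrix (Fin n) (Fin n) ℂ} (h : M.PosDef) (h' : M'.PosDef) {t : ℝ}
    (ht : t ∈ Set.Icc (0 : ℝ) 1) : (((1 - t : ℝ) : ℂ) • M + (t : ℂ) • M').PosDef := by
  rcases eq_or_lt_of_le ht.1 with h0 | h0
  · simpa [← h0] using h
  rcases eq_or_lt_of_le ht.2 with h1 | h1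
  · simpa [h1] using h'
  exact (h.smul (Complex.zero_lt_real.mpr (sub_pos.mpr h1))).add
    (h'.smul (Complex.zero_lt_real.mpr h0))

theorem ProjSystem.contDiffOn_localPotential (h : ProjSystem X A q τ cc)
    {φ : ℂ^(Fin (N + 1)) → ℝ} {i : ℕ}
    (hφ : SmoothOn (fun u => φ ((A i).map u)) (A i).dom) :
    SmoothOn (localPotential (A i) φ) (A i).dom :=
  (contDiffOn_logNormSq (h.contDiffOn_map i) fun u hu => (h.mem_cone i u hu).1).add hφ

theorem ProjSystem.posDef_combo (h : ProjSystem X A q τ cc) {φ φ' : ℂ^(Fin (N + 1)) → ℝ} {i : ℕ}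
    (hφ : SmoothOn (fun u => φ ((A i).map u)) (A i).dom)
    (hφ' : SmoothOn (fun u => φ' ((A i).map u)) (A i).dom) {u : ℂ^(Fin n)}
    (hu : u ∈ (A i).dom) (h1 : (metric (A i) φ u).PosDef) (h2 : (metric (A i) φ' u).PosDef) {t : ℝ}
    (ht : t ∈ Set.Icc (0 : ℝ) 1) :
    (metric (A i) (fun z => (1 - t) * φ z + t * φ' z) u).PosDef := by
  convert HigherEnergy.posDef_combo h1 h2 ht using 1
  rw [metric, metric, metric, ← hessMatrix_combo (h.isOpen i) (h.contDiffOn_localPotential hφ)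
    (h.contDiffOn_localPotential hφ') _ _ hu]
  congr 1
  ext1 y
  simp only [localPotential]
  ring

theorem ProjSystem.metric_congr (h : ProjSystem X A q τ cc) {φ φ' : ℂ^(Fin (N + 1)) → ℝ}
    (hφ : ∀ z ∈ cone X, φ z = φ' z) {i : ℕ} {u : ℂ^(Fin n)} (hu : u ∈ (A i).dom) :
    metric (A i) φ u = metric (A i) φ' u := by
  ext a b
  simp only [metric, hessMatrix, Matrix.of_apply, pd_eq, pdbar_eq]
  refine wd_congr_on (h.isOpen i) (wd_congr_on (h.isOpen i) (fun y hy => ?_) true b) false a hu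
  simp only [localPotential, hφ _ (h.mem_cone i y hy)]

theorem ProjSystem.coneDensity_eq_zero (h : ProjSystem X A q τ cc)
    {Φ : ℂ^ι → ℂ^(Fin (N + 1)) → ℝ} {φ : ℂ^(Fin (N + 1)) → ℝ}
    (hΦ : ∀ y, ∀ z ∈ cone X, Φ y z = φ z) (c : ℕ → ℂ) (b : Bool) (a : ι) (v : ℂ^ι) {i : ℕ}
    {u : ℂ^(Fin n)} (hu : u ∈ (A i).dom) : coneDensity c b a (A i) Φ v u = 0 := by
  have h1 : ∀ y, metric (A i) (Φ y) u = metric (A i) φ u := fun y => h.metric_congr (hΦ y) hu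
  have h2 : ∀ y, localPotential (A i) (Φ y) u = localPotential (A i) φ u := fun y => by
    simp only [localPotential, hΦ y _ (h.mem_cone i u hu)]
  have h3 : (Matrix.of fun _ _ => 0 : Matrix (Fin n) (Fin n) ℂ) = 0 := rfl
  simp only [coneDensity, h1, h2, wd_const, h3, Matrix.zero_mul, neg_zero, transDensity_zero]

/-- A function of the real part of a coordinate with values in the unit interval. -/
def rampAt (a : ι) (w : ℂ^ι) : ℝ := ramp (w a).re

theorem contDiff_rampAt (a : ι) : ContDiff ℝ ∞ (rampAt a) :=
  contDiff_ramp.comp (Complex.reCLM.contDiff.comp (contDiff_apply ℝ ℂ a))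

theorem rampAt_add_single (a b : ι) (w : ℂ^ι) (s : ℝ) :
    rampAt b (w + Pi.single a (Complex.I * s)) = rampAt b w := by
  by_cases hab : b = a
  · subst hab; simp [rampAt]
  · simp [rampAt, hab]

theorem IsPath.contDiffOn_rampAt {φ : ℝ → ℂ^(Fin (N + 1)) → ℝ} {φ' : ℂ^(Fin (N + 1)) → ℝ}
    (hφ : IsPath X A φ φ') (a : ι) (V : Set ℂ^ι) (i : ℕ) :
    SmoothOn (fun z : ℂ^(ι ⊕ Fin n) => φ (rampAt a (zFst z)) ((A i).map (zSnd z)))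
      (zProd V (A i).dom) :=
  (hφ.smooth i).comp (((contDiff_rampAt a).comp contDiff_zFst).prodMk contDiff_zSnd).contDiffOn
    fun _ hz => ⟨ramp_mem _, hz.2⟩

theorem IsPath.contDiffOn {φ : ℝ → ℂ^(Fin (N + 1)) → ℝ} {φ' : ℂ^(Fin (N + 1)) → ℝ}
    (hφ : IsPath X A φ φ') {t : ℝ} (ht : t ∈ Set.Icc (0 : ℝ) 1) (i : ℕ) :
    SmoothOn (fun u => φ t ((A i).map u)) (A i).dom :=
  (hφ.smooth i).comp (contDiffOn_const.prodMk contDiffOn_id) fun _ hu => ⟨ht, hu⟩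

/-- The homotopy between two paths. -/
def homotopy (φ₀ φ₁ : ℝ → ℂ^(Fin (N + 1)) → ℝ) (w : Fin 1 ⊕ Fin 1 → ℂ) (z : ℂ^(Fin (N + 1))) :
    ℝ := (1 - rampAt (Sum.inl 0) w) * φ₀ (rampAt (Sum.inr 0) w) z +
      rampAt (Sum.inl 0) w * φ₁ (rampAt (Sum.inr 0) w) z

theorem ProjSystem.isConeFamily_homotopy (h : ProjSystem X A q τ cc)
    {φ₀ φ₁ : ℝ → ℂ^(Fin (N + 1)) → ℝ} {φ' : ℂ^(Fin (N + 1)) → ℝ} (h₀ : IsPath X A φ₀ φ')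
    (h₁ : IsPath X A φ₁ φ') : IsConeFamily X A (zFst ⁻¹' Set.univ) (homotopy φ₀ φ₁) where
  isOpen := isOpen_univ.preimage contDiff_zFst.continuous
  smooth i := by
    have hr := ((contDiff_rampAt (Sum.inl 0 : Fin 1 ⊕ Fin 1)).comp
      (contDiff_zFst (κ := Fin n))).contDiffOn (s := zProd (zFst ⁻¹' Set.univ) (A i).dom)
    exact ((contDiffOn_const.sub hr).mul (h₀.contDiffOn_rampAt _ _ i)).add
      (hr.mul (h₁.contDiffOn_rampAt _ _ i))
  homogeneous v _ z hz c hc := by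
    simp only [homotopy, h₀.homogeneous _ (ramp_mem _) z hz c hc,
      h₁.homogeneous _ (ramp_mem _) z hz c hc, rampAt]
  det_ne_zero v _ i u hu := (h.posDef_combo (h₀.contDiffOn (ramp_mem _) i)
    (h₁.contDiffOn (ramp_mem _) i) hu (h₀.positive _ (ramp_mem _) i u hu)
    (h₁.positive _ (ramp_mem _) i u hu) (ramp_mem _)).det_pos.ne'

theorem ProjSystem.differentiableAt_metric (h : ProjSystem X A q τ cc) {V : Set ℂ^ι}
    {Φ : ℂ^ι → ℂ^(Fin (N + 1)) → ℝ} (hΦ : IsConeFamily X A V Φ) {v : ℂ^ι} (hv : v ∈ V)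
    {i : ℕ} {u : ℂ^(Fin n)} (hu : u ∈ (A i).dom) :
    (∀ k l, DifferentiableAt ℝ (fun y => metric (A i) (Φ y) u k l) v) ∧
      DifferentiableAt ℝ (fun y => (localPotential (A i) (Φ y) u : ℂ)) v := by
  have hf := h.isFamily hΦ i
  have hz : (Sum.elim v u : ℂ^(ι ⊕ Fin n)) ∈ zProd V (A i).dom := ⟨hv, hu⟩
  have hel : DifferentiableAt ℝ (fun y : ℂ^ι => (Sum.elim y u : ℂ^(ι ⊕ Fin n))) v := by
    have : DifferentiableAt ℝ (fun y => elimCLM ι (Fin n) (y, u)) v := by fun_prop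
    exact this.congr_of_eventuallyEq (.of_forall fun y => (elimCLM_apply (y, u)).symm)
  refine ⟨fun k l => ?_, (diffAt_of_contDiffOn hf.isOpen
      (contDiffOn_ofReal hf.smooth) hz).comp v hel⟩
  refine ((diffAt_of_contDiffOn hf.isOpen (hf.contDiffOn_fibreMetric k l) hz).comp
    v hel).congr_of_eventuallyEq (Filter.eventuallyEq_of_mem (hΦ.isOpen.mem_nhds hv) fun y hy => ?_)
  exact (congrFun (congrFun (h.fibreMetric_coneFamily hΦ hy hu) k) l).symm

theorem ProjSystem.coneDensity_pathPt {κ : Type} [Fintype κ] [DecidableEq κ] {W : Set ℂ^κ}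
    {Φ : ℂ^(κ ⊕ Fin 1) → ℂ^(Fin (N + 1)) → ℝ} (h : ProjSystem X A q τ cc)
    (hΦ : IsConeFamily X A (zFst ⁻¹' W) Φ) (c : ℕ → ℂ) (b : Bool) (a : κ) {v : ℂ^κ} (hv : v ∈ W)
    (x : ℝ) {i : ℕ} {u : ℂ^(Fin n)} (hu : u ∈ (A i).dom) :
    coneDensity c b (Sum.inl a) (A i) Φ (pathPt v x) u =
      coneDensity c b a (A i) (fun y => Φ (pathPt y x)) v u := by
  obtain ⟨h1, h2⟩ := h.differentiableAt_metric hΦ (mem_pathPt hv x) hu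
  exact coneDensity_congr rfl
    (fun k l => (wd_base (h := fun y => metric (A i) (Φ y) u k l) (h1 k l) b a).symm)
    (wd_base (h := fun y => (localPotential (A i) (Φ y) u : ℂ)) h2 b a).symm

variable {Λ : Type} [Fintype Λ] {idx : Λ → ℕ} {ρ : Λ → ℕ → ℂ^(Fin n) → ℝ}
  {C : Λ → Set ℂ^(Fin n)} (h : ProjSystem X A q τ cc)
  (hP : IsPartition (fun i => (A i).dom) q (projPiece A))
  (U : UnityPartition (fun i => (A i).dom) q τ idx ρ C Set.univ)
include h U

theorem fibreTheta_congr {ι' : Type} [Fintype ι'] [DecidableEq ι'] {V : Set ℂ^ι}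
    {V' : Set ℂ^ι'} {Φ : ℂ^ι → ℂ^(Fin (N + 1)) → ℝ}
    {Φ' : ℂ^ι' → ℂ^(Fin (N + 1)) → ℝ} (hΦ : IsConeFamily X A V Φ)
    (hΦ' : IsConeFamily X A V' Φ') {c : ℕ → ℂ} {b b' : Bool} {a : ι} {a' : ι'} {v : ℂ^ι}
    {v' : ℂ^ι'} (hv : v ∈ V) (hv' : v' ∈ V') (he : ∀ i, ∀ u ∈ (A i).dom,
      coneDensity c b a (A i) Φ v u = coneDensity c b' a' (A i) Φ' v' u) :
    fibreTheta idx ρ (coneFamily A Φ) c b a v = fibreTheta idx ρ (coneFamily A Φ') c b' a' v' := by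
  rw [h.fibreTheta_eq hΦ U c _ _ hv, h.fibreTheta_eq hΦ' U c _ _ hv']
  refine sum_congr rfl fun l _ => integral_congr_ae (ae_of_all _ fun u => ?_)
  beta_reduce
  by_cases hu : ρ l (idx l) u = 0
  · simp [hu]
  · rw [he _ u (U.support l _ u hu).1]

theorem fibreTheta_pathPt_eq_zero {κ : Type} [Fintype κ] [DecidableEq κ] {W : Set ℂ^κ}
    {Φ : ℂ^(κ ⊕ Fin 1) → ℂ^(Fin (N + 1)) → ℝ} (hΦ : IsConeFamily X A (zFst ⁻¹' W) Φ) {x : ℝ}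
    {φ : ℂ^(Fin (N + 1)) → ℝ} (hφ : ∀ y, ∀ z ∈ cone X, Φ (pathPt y x) z = φ z) (c : ℕ → ℂ)
    (b : Bool) (a : κ) {v : ℂ^κ} (hv : v ∈ W) :
    fibreTheta idx ρ (coneFamily A Φ) c b (Sum.inl a) (pathPt v x) = 0 := by
  rw [h.fibreTheta_eq hΦ U c _ _ (mem_pathPt hv x)]
  refine sum_eq_zero fun l _ => integral_eq_zero_of_ae (Filter.Eventually.of_forall
    fun u => ?_)
  change (ρ l (idx l) u : ℂ) * _ = (0 : ℂ)
  by_cases hu : ρ l (idx l) u = 0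
  · rw [hu, Complex.ofReal_zero, zero_mul]
  · rw [h.coneDensity_pathPt hΦ c b a hv x (U.support l _ u hu).1,
      h.coneDensity_eq_zero hφ c b a v (U.support l _ u hu).1, mul_zero]

include hP

/-- The energy depends only on the end point of the path. -/
theorem energyAlong_congr (χ : Polynomial ℚ) (hn : 1 ≤ n) (m : ℕ)
    {φ₀ φ₁ : ℝ → ℂ^(Fin (N + 1)) → ℝ} {φ' : ℂ^(Fin (N + 1)) → ℝ} (h₀ : IsPath X A φ₀ φ')
    (h₁ : IsPath X A φ₁ φ') : energyAlong A χ 2 m φ₀ = energyAlong A χ 2 m φ₁ := by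
  have hΦ := h.isConeFamily_homotopy h₀ h₁
  have hr : ∀ a, IsRealIn a (homotopy φ₀ φ₁) := fun a w s => by
    funext z
    simp only [homotopy, rampAt_add_single]
  have hv : ∀ v : ℂ^(Fin 1), v ∈ Set.univ := fun v => Set.mem_univ v
  have key : ∀ (y : ℝ) (φ : ℝ → ℂ^(Fin (N + 1)) → ℝ), (∀ (x : ℝ) z,
      homotopy φ₀ φ₁ (pathPt (fun _ => (y : ℂ)) x) z = φ (ramp x) z) →
      energyAlong A χ 2 m φ = ci ^ n * pathEnergy idx ρ A (homotopy φ₀ φ₁) (hilbTerm χ n)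
        (fun _ => (y : ℂ)) := fun y φ hφ =>
    energyAlong_eq_pathEnergy h hP U hΦ (hr _) isOpen_univ χ hn m (hv _) hφ rfl
  rw [key 0 φ₀ fun x z => by simp [homotopy, pathPt, rampAt, ramp_zero],
    key Real.pi φ₁ fun x z => by simp [homotopy, pathPt, rampAt, ramp_pi]]
  refine congrArg (ci ^ n * ·) ?_
  obtain ⟨E, hE⟩ : ∃ E, E = pathEnergy idx ρ A (homotopy φ₀ φ₁) (hilbTerm χ n) := ⟨_, rfl⟩
  rw [← hE]
  have hd : ∀ v, DifferentiableAt ℝ E v := fun v => hE ▸ diffAt_of_contDiffOn isOpen_univ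
    (contDiffOn_pathEnergy h U hΦ isOpen_univ _) (hv v)
  have hre : ∀ v, fderiv ℝ E v (Pi.single 0 Complex.I) = 0 := by
    refine fun v => fderiv_apply_eq_zero fun s => ?_
    rw [hE, pathEnergy, pathEnergy]
    refine intervalIntegral.integral_congr fun x _ => congrArg _ ?_
    have : pathPt (v + Pi.single 0 (Complex.I * s)) x =
        pathPt v x + Pi.single (Sum.inl 0) (Complex.I * s) := by
      ext a
      rcases a with a | a
      · simp [pathPt, Subsingleton.elim a 0]
      · simp [pathPt]
    rw [this]
    exact fibreTheta_congr h U hΦ hΦ trivial trivial fun i u _ =>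
      (hr _).coneDensity _ _ _ (A i) u _ s
  have hder : ∀ v, fderiv ℝ E v (Pi.single 0 1) = 0 := by
    intro v
    have h1 := wd_pathEnergy h hP U hΦ (hr _) isOpen_univ (hilbTerm χ n) hn (hv v) 0
    rw [← hE, fibreTheta_pathPt_eq_zero h U hΦ (φ := φ') (fun y z hz => by
        simp only [homotopy, pathPt, rampAt, Sum.elim_inl, Sum.elim_inr, Complex.ofReal_re,
          ramp_pi, h₀.finish z hz, h₁.finish z hz]; ring) _ _ _ (hv v),
      fibreTheta_pathPt_eq_zero h U hΦ (φ := fun _ => 0) (fun y z hz => by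
        simp only [homotopy, pathPt, rampAt, Sum.elim_inl, Sum.elim_inr, Complex.ofReal_re,
          ramp_zero, h₀.start z hz, h₁.start z hz]; ring) _ _ _ (hv v), sub_zero, wd, wdir,
      I_smul_single, hre, smul_zero, add_zero] at h1
    simpa using h1
  have hl : ∀ y : ℝ, HasDerivAt (fun y : ℝ => E fun _ => (y : ℂ)) 0 y := by
    intro y
    have h1 : HasDerivAt (fun y : ℝ => (fun _ => (y : ℂ) : ℂ^(Fin 1))) (Pi.single 0 1) y :=
      hasDerivAt_pi.mpr fun a => by
        rw [Subsingleton.elim a 0, Pi.single_eq_same]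
        exact (hasDerivAt_id y).ofReal_comp
    have h2 := (hd fun _ => (y : ℂ)).hasFDerivAt.comp_hasDerivAt y h1
    rwa [hder] at h2
  exact is_const_of_deriv_eq_zero (fun y => (hl y).differentiableAt) (fun y => (hl y).deriv) _ _

end Paths

/-! ### The energy as a function on the group -/

section Bergman

variable {N n M : ℕ} {X : Set (PSpace N)} {A : ℕ → Param (Fin n) (Fin (N + 1))} {S : Type}
  {q : ℕ → ℂ^(Fin n) → S} {τ : ℕ → ℕ → ℂ^(Fin n) → ℂ^(Fin n)} {cc : ℕ → ℕ → ℂ^(Fin n) → ℂ}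
  {s : Param (Fin M) (MatIdx N)}

theorem act_ne_zero {σ : ℂ^(MatIdx N)} (hσ : σ ∈ SL N) {z : ℂ^(Fin (N + 1))} (hz : z ≠ 0) :
    act σ z ≠ 0 := fun h0 => hz (Matrix.eq_zero_of_mulVec_eq_zero
  (by rw [show (Matrix.of fun i j => σ (i, j)).det = 1 from hσ]; exact one_ne_zero) h0)

theorem bergman_smul {σ : ℂ^(MatIdx N)} (hσ : σ ∈ SL N) {z : ℂ^(Fin (N + 1))} (hz : z ≠ 0) {c : ℂ}
    (hc : c ≠ 0) : bergman σ (c • z) = bergman σ z := by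
  rw [bergman, bergman, logNormSq_smul hc hz, act, Matrix.mulVec_smul]
  change logNormSq (c • act σ z) - _ = _
  rw [logNormSq_smul hc (act_ne_zero hσ hz)]
  ring

theorem contDiffOn_act {E : Type*} [NormedAddCommGroup E] [NormedSpace ℝ E]
    {g : E → MatIdx N → ℂ} {k : E → Fin (N + 1) → ℂ} {O : Set E} (hg : SmoothOn g O)
    (hk : SmoothOn k O) : SmoothOn (fun y => act (g y) (k y)) O :=
  contDiffOn_pi.mpr fun i => ContDiffOn.sum (s := univ)
    (f := fun j y => g y (i, j) * k y j) fun j _ => (contDiffOn_pi.mp hg (i, j)).mul (contDiffOn_pi.mp hk j)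

theorem contDiffOn_bergman {E : Type*} [NormedAddCommGroup E] [NormedSpace ℝ E]
    {g : E → MatIdx N → ℂ} {k : E → Fin (N + 1) → ℂ} {O : Set E} (hg : SmoothOn g O)
    (hgm : ∀ y ∈ O, g y ∈ SL N) (hk : SmoothOn k O) (hk0 : ∀ y ∈ O, k y ≠ 0) :
    SmoothOn (fun y => bergman (g y) (k y)) O :=
  (contDiffOn_logNormSq (contDiffOn_act hg hk) fun y hy => act_ne_zero (hgm y hy) (hk0 y hy)).sub
    (contDiffOn_logNormSq hk hk0)

theorem ProjSystem.isPath_bergman (h : ProjSystem X A q τ cc) {σ : ℂ^(MatIdx N)} (hσ : σ ∈ SL N)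
    {φ : ℝ → ℂ^(Fin (N + 1)) → ℝ} (hφ : IsPath X A φ (bergman σ)) :
    IsPath X A (fun t z => t * bergman σ z) (bergman σ) where
  homogeneous t _ z hz c hc := by rw [bergman_smul hσ hz.1 hc]
  smooth i := contDiffOn_fst.mul (contDiffOn_bergman contDiffOn_const (fun _ _ => hσ)
    ((h.contDiffOn_map i).comp contDiffOn_snd fun _ hy => hy.2)
    fun y hy => (h.mem_cone i _ hy.2).1)
  positive t ht i u hu := by
    have h0 : (0 : ℝ) ∈ Set.Icc (0 : ℝ) 1 := by simp
    have h1 : (1 : ℝ) ∈ Set.Icc (0 : ℝ) 1 := by simp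
    rw [h.metric_congr (φ' := fun z => (1 - t) * φ 0 z + t * φ 1 z) (fun z hz => by
      rw [hφ.start z hz, hφ.finish z hz]; ring) hu]
    exact h.posDef_combo (hφ.contDiffOn h0 i) (hφ.contDiffOn h1 i) hu (hφ.positive 0 h0 i u hu)
      (hφ.positive 1 h1 i u hu) ht
  start z _ := zero_mul _
  finish z _ := one_mul _

/-- The Bergman potentials in a chart of the group. -/
def bergmanFamily (s : Param (Fin M) (MatIdx N)) (v : ℂ^(Fin M)) : ℂ^(Fin (N + 1)) → ℝ :=
  bergman (s.map v)

/-- The paths to the Bergman potentials in a chart of the group. -/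
def bergmanPaths (s : Param (Fin M) (MatIdx N)) (w : Fin M ⊕ Fin 1 → ℂ)
    (z : ℂ^(Fin (N + 1))) : ℝ := rampAt (Sum.inr 0) w * bergman (s.map (zFst w)) z

theorem IsChart.contDiffOn {ι κ : Type} [Fintype ι] [Fintype κ] {T : Set ℂ^κ} {p : Param ι κ}
    (hp : IsChart T p) : SmoothOn p.map p.dom :=
  contDiffOn_of_holomorphic hp.isOpen_dom hp.holomorphic

theorem isRealIn_bergmanPaths : IsRealIn (Sum.inr 0) (bergmanPaths s) := fun w t => by
  funext z
  have : zFst (w + Pi.single (Sum.inr 0) (Complex.I * t)) = zFst w := by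
    ext a; simp [zFst]
  rw [bergmanPaths, bergmanPaths, rampAt_add_single, this]

variable (h : ProjSystem X A q τ cc) (hs : IsChart (SL N) s)
  (hF : ∀ σ ∈ SL N, ∃ φ, IsPath X A φ (bergman σ))
include h hs hF

theorem isConeFamily_bergmanPaths : IsConeFamily X A (zFst ⁻¹' s.dom) (bergmanPaths s) where
  isOpen := hs.isOpen_dom.preimage contDiff_zFst.continuous
  smooth i := (((contDiff_rampAt (Sum.inr 0)).comp contDiff_zFst).contDiffOn).mul
    (contDiffOn_bergman (hs.contDiffOn.comp (contDiff_zFst.comp contDiff_zFst).contDiffOn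
      fun y hy => hy.1) (fun y hy => hs.mapsTo hy.1)
      ((h.contDiffOn_map i).comp contDiff_zSnd.contDiffOn fun y hy => hy.2)
      fun y hy => (h.mem_cone i _ hy.2).1)
  homogeneous v hv z hz c hc := by
    rw [bergmanPaths, bergmanPaths, bergman_smul (hs.mapsTo hv) hz.1 hc]
  det_ne_zero v hv i u hu := by
    obtain ⟨φ, hφ⟩ := hF _ (hs.mapsTo hv)
    exact ((h.isPath_bergman (hs.mapsTo hv) hφ).positive _ (ramp_mem _) i u hu).det_pos.ne'

theorem isConeFamily_bergman : IsConeFamily X A s.dom (bergmanFamily s) where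
  isOpen := hs.isOpen_dom
  smooth i := contDiffOn_bergman (hs.contDiffOn.comp contDiff_zFst.contDiffOn fun y hy => hy.1)
    (fun y hy => hs.mapsTo hy.1) ((h.contDiffOn_map i).comp contDiff_zSnd.contDiffOn
      fun y hy => hy.2) fun y hy => (h.mem_cone i _ hy.2).1
  homogeneous v hv z hz c hc := bergman_smul (hs.mapsTo hv) hz.1 hc
  det_ne_zero v hv i u hu := by
    obtain ⟨φ, hφ⟩ := hF _ (hs.mapsTo hv)
    have h1 : metric (A i) (bergmanFamily s v) u = metric (A i) (φ 1) u :=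
      h.metric_congr (fun z hz => (hφ.finish z hz).symm) hu
    rw [h1]
    exact (hφ.positive 1 (by simp) i u hu).det_pos.ne'

variable {Λ : Type} [Fintype Λ] {idx : Λ → ℕ} {ρ : Λ → ℕ → ℂ^(Fin n) → ℝ}
  {C : Λ → Set ℂ^(Fin n)} (hP : IsPartition (fun i => (A i).dom) q (projPiece A))
  (U : UnityPartition (fun i => (A i).dom) q τ idx ρ C Set.univ) {χ : Polynomial ℚ} (hn : 1 ≤ n)
  {m : ℕ} {F : ℂ^(MatIdx N) → ℂ}
  (hE : ∀ σ ∈ SL N, IsHigherEnergy X A χ 2 m (bergman σ) (F σ))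
include hP U hn hE

theorem energy_eq_pathEnergy : Set.EqOn (fun v => F (s.map v))
    (fun v => ci ^ n * pathEnergy idx ρ A (bergmanPaths s) (hilbTerm χ n) v) s.dom := by
  intro v hv
  obtain ⟨φ, hφ, h1⟩ := hE _ (hs.mapsTo hv)
  change F (s.map v) = _
  rw [h1, energyAlong_congr h hP U χ hn m hφ (h.isPath_bergman (hs.mapsTo hv) hφ)]
  exact energyAlong_eq_pathEnergy h hP U (isConeFamily_bergmanPaths h hs hF)
    isRealIn_bergmanPaths hs.isOpen_dom χ hn m hv (fun x z => rfl) rfl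

theorem contDiffOn_energy : SmoothOn (fun v => F (s.map v)) s.dom :=
  (contDiffOn_const.mul (contDiffOn_pathEnergy h U (isConeFamily_bergmanPaths h hs hF)
    hs.isOpen_dom _)).congr (energy_eq_pathEnergy h hs hF hP U hn hE)

theorem wd_energy (β : Fin M) : Set.EqOn (wd true β fun v => F (s.map v))
    (fun v => ci ^ n * fibreTheta idx ρ (coneFamily A (bergmanFamily s)) (hilbTerm χ n) true β v)
    s.dom := by
  intro v hv
  have hΦ := isConeFamily_bergmanPaths h hs hF
  rw [wd_congr_on hs.isOpen_dom (energy_eq_pathEnergy h hs hF hP U hn hE) true β hv]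
  refine (wd_const_smul (diffAt_of_contDiffOn hs.isOpen_dom
    (contDiffOn_pathEnergy h U hΦ hs.isOpen_dom _) hv) _ true β).trans ?_
  rw [wd_pathEnergy h hP U hΦ isRealIn_bergmanPaths hs.isOpen_dom _ hn hv,
    fibreTheta_pathPt_eq_zero h U hΦ (x := 0) (φ := fun _ => 0) (fun y z _ => by
      simp [bergmanPaths, pathPt, rampAt, ramp_zero]) _ _ _ hv, sub_zero, smul_eq_mul]
  refine congrArg _ (fibreTheta_congr h U hΦ (isConeFamily_bergman h hs hF) (mem_pathPt hv _) hv
    fun i u hu => ?_)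
  rw [h.coneDensity_pathPt hΦ _ _ _ hv _ hu]
  congr 1
  funext y z
  simp [bergmanPaths, pathPt, rampAt, ramp_pi, bergmanFamily]
  rfl

/-- The second variation of the energy. -/
theorem sum_wd_energy (ψ : Frm (Fin M)) {v : ℂ^(Fin M)} (hv : v ∈ s.dom) :
    ∑ a, ∑ β, wd false a (wd true β fun v => F (s.map v)) v * testCoeff false a β ψ =
      -(ci ^ n * fibreChern idx ρ (coneFamily A (bergmanFamily s)) (hilbTerm χ n) ψ v) := by
  have hB := h.potFamily (isConeFamily_bergman h hs hF)
  rw [← mul_neg, ← hB.sum_wd_fibreTheta h.toChartSystem hP U _ hn true ψ hv, sum_comm,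
    mul_sum]
  refine sum_congr rfl fun a _ => ?_
  rw [mul_sum]
  refine sum_congr rfl fun β _ => ?_
  rw [wd_congr_on hs.isOpen_dom (wd_energy h hs hF hP U hn hE a) false β hv, testCoeff_true,
    ← mul_assoc]
  congr 1
  exact wd_const_smul (diffAt_of_contDiffOn hs.isOpen_dom
    (hB.contDiffOn_fibreTheta h.toChartSystem U _ true a) hv) _ _ _

end Bergman

/-! ### Atlases of embedded submanifolds -/

section Embedded

variable {κ : Type} [Fintype κ] [DecidableEq κ] {E : Type} [NormedAddCommGroup E]
  [NormedSpace ℝ E] {I : Type} {dom : I → Set ℂ^κ} {q : I → ℂ^κ → E}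

/-- Parametrizations `q i` of the open parts of a submanifold of `E`. -/
structure EmbeddedSystem (dom : I → Set ℂ^κ) (q : I → ℂ^κ → E) : Prop where
  isOpen : ∀ i, IsOpen (dom i)
  injOn : ∀ i, Set.InjOn (q i) (dom i)
  contDiffOn : ∀ i, SmoothOn (q i) (dom i)
  openMap : ∀ i, ∀ V ⊆ dom i, IsOpen V →
    ∃ O : Set E, IsOpen O ∧ ∀ j, ∀ u ∈ dom j, q j u ∈ O ↔ q j u ∈ q i '' V

/-- The transition maps between the parametrizations `q i`. -/
def transMap (dom : I → Set ℂ^κ) (q : I → ℂ^κ → E) (i j : I) (u : ℂ^κ) : κ → ℂ :=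
  Function.invFunOn (q j) (dom j) (q i u)

theorem transMap_mem {i j : I} {u : ℂ^κ} (hu : u ∈ overlap dom q i j) :
    transMap dom q i j u ∈ dom j := Function.invFunOn_mem hu.2

theorem apply_transMap {i j : I} {u : ℂ^κ} (hu : u ∈ overlap dom q i j) :
    q j (transMap dom q i j u) = q i u := Function.invFunOn_eq hu.2

theorem EmbeddedSystem.isOpen_overlap (h : EmbeddedSystem dom q) (i j : I) :
    IsOpen (overlap dom q i j) := by
  obtain ⟨O, hO, hOV⟩ := h.openMap j _ subset_rfl (h.isOpen j)
  have : overlap dom q i j = dom i ∩ q i ⁻¹' O :=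
    Set.ext fun u => and_congr_right fun hu => (hOV i u hu).symm
  rw [this]
  exact (h.contDiffOn i).continuousOn.isOpen_inter_preimage (h.isOpen i) hO

theorem EmbeddedSystem.continuousAt_transMap (h : EmbeddedSystem dom q) {i j : I} {u : ℂ^κ}
    (hu : u ∈ overlap dom q i j) : ContinuousAt (transMap dom q i j) u := by
  refine tendsto_nhds.mpr fun W hW hWu => ?_
  obtain ⟨O, hO, hOV⟩ := h.openMap j (W ∩ dom j) Set.inter_subset_right (hW.inter (h.isOpen j))
  have h1 : q i u ∈ O :=
    (hOV i u hu.1).mpr ⟨_, ⟨hWu, transMap_mem hu⟩, apply_transMap hu⟩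
  filter_upwards [(h.isOpen_overlap i j).mem_nhds hu, ((h.contDiffOn i).continuousOn.continuousAt
    ((h.isOpen i).mem_nhds hu.1)).preimage_mem_nhds (hO.mem_nhds h1)] with y hy hyO
  obtain ⟨w, hw, hwy⟩ := (hOV i y hy.1).mp hyO
  rw [Set.mem_preimage, h.injOn j (transMap_mem hy) hw.2 ((apply_transMap hy).trans hwy.symm)]
  exact hw.1

theorem EmbeddedSystem.chartSystem (h : EmbeddedSystem dom q)
    (hτ : ∀ i j, ∀ u ∈ overlap dom q i j, DifferentiableAt ℂ (transMap dom q i j) u) :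
    ChartSystem dom q (transMap dom q) where
  isOpen := h.isOpen
  injOn := h.injOn
  isOpen_overlap := h.isOpen_overlap
  mapsTo _ _ _ hu := transMap_mem hu
  compat _ _ _ hu := apply_transMap hu
  holomorphic i j u hu := (hτ i j u hu).differentiableWithinAt

theorem EmbeddedSystem.exists_unityPartition [FiniteDimensional ℝ E] (h : EmbeddedSystem dom q)
    {K : Set E} (hK : IsCompact K) (hc : ∀ x ∈ K, ∃ i, x ∈ q i '' dom i) :
    ∃ (L : ℕ) (idx : Fin L → I) (ρ : Fin L → I → ℂ^κ → ℝ) (C : Fin L → Set ℂ^κ),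
      UnityPartition dom q (transMap dom q) idx ρ C K := by
  classical
  obtain ⟨L, d, b, ρ, hρ, hd, hb, hsum⟩ := exists_finite_partition (D := I × Set ℂ^κ)
    (Sm := fun f : E → ℝ => ContDiff ℝ ∞ f ∧ ∀ x, 0 ≤ f x ∧ f x ≤ 1)
    (Bd := fun d b => IsCompact d.2 ∧ d.2 ⊆ dom d.1 ∧
      ∀ j, ∀ u ∈ dom j, b (q j u) ≠ 0 → q j u ∈ q d.1 '' d.2)
    ⟨contDiff_const, fun _ => by norm_num⟩
    (fun f g hf hg => ⟨hf.1.mul hg.1, fun x => ⟨mul_nonneg (hf.2 x).1 (hg.2 x).1,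
      mul_le_one₀ (hf.2 x).2 (hg.2 x).1 (hg.2 x).2⟩⟩)
    (fun f hf => ⟨contDiff_const.sub hf.1, fun x => by
      have := hf.2 x
      constructor <;> linarith⟩) hK (fun x hx => by
      obtain ⟨i, u, hu, rfl⟩ := hc x hx
      obtain ⟨r, hr, hrd⟩ := Metric.nhds_basis_closedBall.mem_iff.mp ((h.isOpen i).mem_nhds hu)
      obtain ⟨O, hO, hOV⟩ := h.openMap i (Metric.ball u r)
        (Metric.ball_subset_closedBall.trans hrd) Metric.isOpen_ball
      obtain ⟨ε, hε, hεO⟩ := Metric.isOpen_iff.mp hO _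
        ((hOV i u hu).mpr ⟨u, Metric.mem_ball_self hr, rfl⟩)
      let f : ContDiffBump (q i u) := ⟨ε / 2, ε, half_pos hε, half_lt_self hε⟩
      refine ⟨(i, Metric.closedBall u r), f, ⟨f.contDiff, fun x => ⟨f.nonneg, f.le_one⟩⟩,
        ⟨isCompact_closedBall _ _, hrd, fun j v hv hf => ?_⟩, f.eventuallyEq_one⟩
      have h1 : q j v ∈ Metric.ball (q i u) ε := by
        have : q j v ∈ Function.support f := hf
        rwa [f.support_eq] at this
      exact Set.image_mono Metric.ball_subset_closedBall ((hOV j v hv).mp (hεO h1)))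
  refine ⟨L, fun l => (d l).1, fun l i => (dom i).indicator fun u => ρ l (q i u), fun l => (d l).2,
    ⟨fun l i => ?_, fun l i u => Set.indicator_nonneg (fun u _ => ((hρ l).2 _).1) u,
      fun l => (hd l).1, fun l => (hd l).2.1, fun l i j u hu => ?_, fun l i u hu => ?_,
      fun i u hu hK => ?_⟩⟩
  · exact ((hρ l).1.comp_contDiffOn (h.contDiffOn i)).congr fun u hu => Set.indicator_of_mem hu _
  · rw [Set.indicator_of_mem hu.1, Set.indicator_of_mem (transMap_mem hu), apply_transMap hu]
  · have hu' := Set.mem_of_indicator_ne_zero hu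
    rw [Set.indicator_of_mem hu'] at hu
    exact ⟨hu', (hd l).2.2 i u hu' (hb l _ hu)⟩
  · rw [← hsum _ hK]
    exact sum_congr rfl fun l _ => Set.indicator_of_mem hu _

end Embedded

section Inverse

variable {E V W : Type} [NormedAddCommGroup E] [NormedSpace ℂ E] [NormedAddCommGroup V]
  [NormedSpace ℂ V] [FiniteDimensional ℂ V] [NormedAddCommGroup W] [NormedSpace ℂ W]
  [FiniteDimensional ℂ W]

/-- A continuous lift along a holomorphic immersion is holomorphic. -/
theorem differentiableAt_of_immersion {f : V → W} {D : Set V} (hD : IsOpen D)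
    (hf : DifferentiableOn ℂ f D) {σ : E → V} {k : E → W} {x : E} (hx : σ x ∈ D)
    (hinj : Function.Injective (fderiv ℂ f (σ x))) (hσ : ContinuousAt σ x)
    (hk : DifferentiableAt ℂ k x) (hfk : ∀ᶠ y in nhds x, f (σ y) = k y) :
    DifferentiableAt ℂ σ x := by
  have := FiniteDimensional.complete ℂ V
  obtain ⟨l, hl⟩ := (fderiv ℂ f (σ x) : V →ₗ[ℂ] W).exists_leftInverse_of_injective
    (LinearMap.ker_eq_bot.mpr hinj)
  let l' : W →L[ℂ] V := LinearMap.toContinuousLinearMap l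
  have h1 : HasStrictFDerivAt f (fderiv ℂ f (σ x)) (σ x) :=
    ((contDiffOn_of_differentiableOn_complex hD hf).contDiffAt (hD.mem_nhds hx)).hasStrictFDerivAt
      (by simp)
  have h2 : HasStrictFDerivAt (fun y => l' (f y))
      ((ContinuousLinearEquiv.refl ℂ V : V ≃L[ℂ] V) : V →L[ℂ] V) (σ x) := by
    have h3 := l'.hasStrictFDerivAt.comp (σ x) h1
    have h4 : l'.comp (fderiv ℂ f (σ x)) = ContinuousLinearMap.id ℂ V :=
      ContinuousLinearMap.ext fun v => DFunLike.congr_fun hl v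
    rw [h4] at h3
    exact h3
  have h5 : ∀ᶠ y in nhds x, σ y = h2.localInverse _ _ _ (l' (k y)) := by
    filter_upwards [hfk, hσ.eventually h2.eventually_left_inverse] with y hy hy'
    rw [← hy]
    exact hy'.symm
  have h6 : DifferentiableAt ℂ (h2.localInverse _ _ _) (l' (k x)) := by
    rw [← hfk.self_of_nhds]
    exact h2.to_localInverse.hasFDerivAt.differentiableAt
  exact (h6.comp x (l'.differentiableAt.comp x hk)).congr_of_eventuallyEq h5

end Inverse

section Group

variable {M : ℕ} {κ : Type} [Fintype κ] {S : Set ℂ^κ} {B : ℕ → Param (Fin M) κ}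

theorem embeddedSystem_atlas (hB : ∀ i, IsChart S (B i)) :
    EmbeddedSystem (fun i => (B i).dom) fun i => (B i).map where
  isOpen i := (hB i).isOpen_dom
  injOn i := (hB i).injOn
  contDiffOn i := contDiffOn_of_holomorphic (hB i).isOpen_dom (hB i).holomorphic
  openMap i V hV hVo := by
    obtain ⟨O, hO, hOV⟩ := (hB i).openMap V hV hVo
    exact ⟨O, hO, fun j u hu => by rw [hOV]; exact (and_iff_left ((hB j).mapsTo hu)).symm⟩

theorem chartSystem_atlas (hB : ∀ i, IsChart S (B i)) :
    ChartSystem (fun i => (B i).dom) (fun i => (B i).map)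
      (transMap (fun i => (B i).dom) fun i => (B i).map) := by
  have h := embeddedSystem_atlas hB
  refine h.chartSystem fun i j u hu => ?_
  have hj := transMap_mem hu
  refine differentiableAt_of_immersion (hB j).isOpen_dom (hB j).holomorphic hj
    ((hB j).immersion _ hj) (h.continuousAt_transMap hu)
    ((hB i).holomorphic.differentiableAt ((hB i).isOpen_dom.mem_nhds hu.1)) ?_
  exact Filter.eventually_of_mem ((h.isOpen_overlap i j).mem_nhds hu) fun y hy => apply_transMap hy

end Group

section Projective

variable {N n : ℕ} {X : Set (PSpace N)} {A : ℕ → Param (Fin n) (Fin (N + 1))}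

/-- The orthogonal projection to the line spanned by `z`. -/
def lineProj (z : ℂ^(Fin (N + 1))) : MatIdx N → ℂ := fun p =>
  z p.1 * conj (z p.2) * ((∑ i, Complex.normSq (z i) : ℝ) : ℂ)⁻¹

theorem act_lineProj (z w : ℂ^(Fin (N + 1))) :
    act (lineProj z) w = ((∑ j, conj (z j) * w j) *
      ((∑ i, Complex.normSq (z i) : ℝ) : ℂ)⁻¹) • z := by
  ext i
  simp only [act, Matrix.mulVec, dotProduct, Matrix.of_apply, lineProj, Pi.smul_apply, smul_eq_mul,
    sum_mul]
  exact sum_congr rfl fun j _ => by ring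

theorem act_lineProj_self {z : ℂ^(Fin (N + 1))} (hz : z ≠ 0) : act (lineProj z) z = z := by
  rw [act_lineProj]
  have h1 : ∑ j, conj (z j) * z j = ((∑ i, Complex.normSq (z i) : ℝ) : ℂ) := by
    push_cast
    exact sum_congr rfl fun j _ => (Complex.normSq_eq_conj_mul_self).symm
  rw [h1, mul_inv_cancel₀ (Complex.ofReal_ne_zero.mpr (sum_normSq_pos hz).ne'), one_smul]

theorem lineProj_smul {c : ℂ} (hc : c ≠ 0) (z : ℂ^(Fin (N + 1))) :
    lineProj (c • z) = lineProj z := by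
  funext p
  have h1 : ∑ i, Complex.normSq ((c • z) i) = Complex.normSq c * ∑ i, Complex.normSq (z i) := by
    rw [mul_sum]
    simp
  rw [lineProj, h1, lineProj]
  push_cast
  rw [mul_inv, Complex.normSq_eq_conj_mul_self, mul_inv]
  simp only [Pi.smul_apply, smul_eq_mul, map_mul]
  have h2 : (starRingEnd ℂ) c ≠ 0 := (map_ne_zero _).mpr hc
  field_simp

theorem contDiffOn_lineProj : SmoothOn (lineProj (N := N)) {z | z ≠ 0} := by
  refine contDiffOn_pi.mpr fun p => ?_
  have h1 : ContDiff ℝ ∞ fun z : ℂ^(Fin (N + 1)) => ((∑ i, Complex.normSq (z i) : ℝ) : ℂ) :=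
    Complex.ofRealCLM.contDiff.comp (ContDiff.sum (s := univ)
      (f := fun (i : Fin (N + 1)) (z : ℂ^(Fin (N + 1))) => Complex.normSq (z i)) fun i _ =>
        contDiff_normSq.comp (contDiff_apply ℝ ℂ i))
  exact ((contDiff_apply ℝ ℂ p.1).mul
    (Complex.conjCLE.contDiff.comp (contDiff_apply ℝ ℂ p.2))).contDiffOn.mul
      (h1.contDiffOn.inv fun z hz => Complex.ofReal_ne_zero.mpr (sum_normSq_pos hz).ne')

theorem lineProj_mem_image {T : Set ℂ^(Fin n)} {p : ℂ^(Fin n) → Fin (N + 1) → ℂ}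
    {z : ℂ^(Fin (N + 1))} (hz : z ≠ 0) :
    lineProj z ∈ (fun v => lineProj (p v)) '' T ↔ z ∈ multiples (p '' T) := by
  constructor
  · rintro ⟨v, hv, hvz⟩
    have h1 := act_lineProj (p v) z
    change lineProj (p v) = lineProj z at hvz
    rw [hvz, act_lineProj_self hz] at h1
    refine ⟨_, fun hc => hz ?_, p v, ⟨v, hv, rfl⟩, h1⟩
    rw [h1, hc, zero_smul]
  · rintro ⟨c, hc, _, ⟨v, hv, rfl⟩, rfl⟩
    exact ⟨v, hv, (lineProj_smul hc _).symm⟩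

variable (hA : ∀ i, IsProjChart X (A i))
include hA

theorem ne_zero_of_mem_dom {i : ℕ} {u : ℂ^(Fin n)} (hu : u ∈ (A i).dom) : (A i).map u ≠ 0 :=
  ((hA i).mapsTo hu).1

theorem embeddedSystem_projAtlas :
    EmbeddedSystem (fun i => (A i).dom) fun i u => lineProj ((A i).map u) where
  isOpen i := (hA i).isOpen_dom
  injOn i u hu v hv huv := by
    have h1 : lineProj ((A i).map u) ∈ (fun v => lineProj ((A i).map v)) '' {v} := ⟨v, rfl, huv.symm⟩
    rw [lineProj_mem_image (ne_zero_of_mem_dom hA hu)] at h1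
    obtain ⟨c, -, _, ⟨_, rfl, rfl⟩, hc⟩ := h1
    exact (hA i).inj u hu _ hv c hc
  contDiffOn i := contDiffOn_lineProj.comp (contDiffOn_of_holomorphic (hA i).isOpen_dom
    (hA i).holomorphic) fun u hu => ne_zero_of_mem_dom hA hu
  openMap i V hV hVo := by
    obtain ⟨O, hO, hOV⟩ := (hA i).openMap V hV hVo
    have hc : ∀ z : ℂ^(Fin (N + 1)), Continuous fun σ : ℂ^(MatIdx N) => act σ z := fun z =>
      (contDiffOn_univ.mp (contDiffOn_act contDiffOn_id contDiffOn_const)).continuous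
    refine ⟨⋃ z, {σ | act σ z ∈ O ∩ {0}ᶜ}, isOpen_iUnion fun z =>
      (hO.inter isOpen_compl_singleton).preimage (hc z), fun j u hu => ?_⟩
    have hu0 := ne_zero_of_mem_dom hA hu
    rw [lineProj_mem_image hu0]
    constructor
    · intro h
      obtain ⟨z, hz⟩ := Set.mem_iUnion.mp h
      obtain ⟨hz, hz0⟩ : act (lineProj ((A j).map u)) z ∈ O ∧ act (lineProj ((A j).map u)) z ≠ 0 := hz
      rw [act_lineProj] at hz hz0
      obtain ⟨c, hc⟩ : ∃ c : ℂ, c = (∑ j_1, conj ((A j).map u j_1) * z j_1) *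
        ((∑ i, Complex.normSq ((A j).map u i) : ℝ) : ℂ)⁻¹ := ⟨_, rfl⟩
      rw [← hc] at hz hz0
      have hc0 : c ≠ 0 := fun h => hz0 (by rw [h, zero_smul])
      obtain ⟨h1, h2⟩ := (hA j).mapsTo hu
      have h3 : c • (A j).map u ∈ O ∩ cone X := by
        refine ⟨hz, hz0, ?_⟩
        rwa [(Projectivization.mk_eq_mk_iff' ℂ _ _ hz0 h1).mpr ⟨c, rfl⟩]
      rw [← hOV] at h3
      obtain ⟨c', hc', w, hw, hcw⟩ := h3
      exact ⟨c⁻¹ * c', mul_ne_zero (inv_ne_zero hc0) hc', w, hw, by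
        rw [mul_smul, ← hcw, smul_smul, inv_mul_cancel₀ hc0, one_smul]⟩
    · intro h
      refine Set.mem_iUnion.mpr ⟨(A j).map u, ?_⟩
      change act (lineProj ((A j).map u)) ((A j).map u) ∈ O ∩ {0}ᶜ
      rw [act_lineProj_self hu0]
      rw [hOV] at h
      exact ⟨h.1, hu0⟩

/-- The quotient of two homogeneous coordinate vectors of a point. -/
def transFactor (A : ℕ → Param (Fin n) (Fin (N + 1))) (i j : ℕ) (u : ℂ^(Fin n)) : ℂ :=
  Classical.epsilon fun c => (A i).map u = c •
    (A j).map (transMap (fun i => (A i).dom) (fun i u => lineProj ((A i).map u)) i j u)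

theorem map_eq_transFactor {i j : ℕ} {u : ℂ^(Fin n)}
    (hu : u ∈ overlap (fun i => (A i).dom) (fun i u => lineProj ((A i).map u)) i j) :
    (A i).map u = transFactor A i j u •
      (A j).map (transMap (fun i => (A i).dom) (fun i u => lineProj ((A i).map u)) i j u) := by
  have h1 : lineProj ((A i).map u) ∈ (fun v => lineProj ((A j).map v)) ''
      {transMap (fun i => (A i).dom) (fun i u => lineProj ((A i).map u)) i j u} :=
    ⟨_, rfl, apply_transMap (q := fun i u => lineProj ((A i).map u)) hu⟩
  rw [lineProj_mem_image (ne_zero_of_mem_dom hA hu.1)] at h1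
  obtain ⟨c, -, _, ⟨_, rfl, rfl⟩, hc⟩ := h1
  exact Classical.epsilon_spec (p := fun c : ℂ => (A i).map u = c •
    (A j).map (transMap (fun i => (A i).dom) (fun i u => lineProj ((A i).map u)) i j u)) ⟨c, hc⟩

theorem differentiableAt_transMap {i j : ℕ} {u : ℂ^(Fin n)}
    (hu : u ∈ overlap (fun i => (A i).dom) (fun i u => lineProj ((A i).map u)) i j) :
    DifferentiableAt ℂ (fun u => (transFactor A i j u,
      transMap (fun i => (A i).dom) (fun i u => lineProj ((A i).map u)) i j u)) u := by
  have h := embeddedSystem_projAtlas hA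
  obtain ⟨τ, hτ⟩ : ∃ τ, τ = transMap (fun i => (A i).dom) (fun i u => lineProj ((A i).map u)) i j :=
    ⟨_, rfl⟩
  have hτc : ContinuousAt τ u := hτ ▸ h.continuousAt_transMap hu
  have hj : τ u ∈ (A j).dom := hτ ▸ transMap_mem hu
  have heq : ∀ᶠ y in nhds u, (A i).map y = transFactor A i j y • (A j).map (τ y) :=
    Filter.eventually_of_mem ((h.isOpen_overlap i j).mem_nhds hu) fun y hy => by
      rw [hτ]; exact map_eq_transFactor hA hy
  rw [← hτ]
  have hdj : DifferentiableAt ℂ (A j).map (τ u) :=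
    (hA j).holomorphic.differentiableAt ((hA j).isOpen_dom.mem_nhds hj)
  have hdi : DifferentiableAt ℂ (A i).map u :=
    (hA i).holomorphic.differentiableAt ((hA i).isOpen_dom.mem_nhds hu.1)
  obtain ⟨k, hk⟩ := Function.ne_iff.mp (ne_zero_of_mem_dom hA hj)
  have hp : ContinuousAt (fun y => (A j).map (τ y) k) u :=
    (continuous_apply k).continuousAt.comp (hdj.continuousAt.comp hτc)
  have hcc : ContinuousAt (transFactor A i j) u := by
    refine (((continuous_apply k).continuousAt.comp hdi.continuousAt).div hp hk).congr ?_
    filter_upwards [heq, hp.eventually_ne hk] with y hy hy'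
    change (A i).map y k / (A j).map (τ y) k = _
    rw [div_eq_iff hy', hy]
    rfl
  have hc0 : transFactor A i j u ≠ 0 := fun h0 => ne_zero_of_mem_dom hA hu.1 (by
    rw [heq.self_of_nhds, h0, zero_smul])
  refine differentiableAt_of_immersion (V := ℂ × ℂ^(Fin n)) (D := Set.univ ×ˢ (A j).dom)
    (f := fun p => p.1 • (A j).map p.2) (k := (A i).map)
    (isOpen_univ.prod (hA j).isOpen_dom) (DifferentiableOn.smul (c := Prod.fst)
      (f := fun p : ℂ × ℂ^(Fin n) => (A j).map p.2) differentiableOn_fst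
      ((hA j).holomorphic.comp differentiableOn_snd fun p hp => hp.2)) ⟨trivial, hj⟩ ?_
    (hcc.prodMk hτc) hdi (heq.mono fun y hy => hy.symm)
  have hder : HasFDerivAt (fun p : ℂ × ℂ^(Fin n) => p.1 • (A j).map p.2) _
      (transFactor A i j u, τ u) := HasFDerivAt.smul (c := Prod.fst) (f := fun p : ℂ × ℂ^(Fin n) => (A j).map p.2)
        hasFDerivAt_fst (HasFDerivAt.comp (transFactor A i j u, τ u) (g := (A j).map) hdj.hasFDerivAt hasFDerivAt_snd)
  rw [hder.fderiv]
  refine (injective_iff_map_eq_zero _).mpr fun ⟨c, w⟩ hcw => ?_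
  have h1 : transFactor A i j u • fderiv ℂ (A j).map (τ u) w + c • (A j).map (τ u) = 0 := hcw
  have hw : w = 0 := by
    refine (hA j).immersion _ hj w (-((transFactor A i j u)⁻¹ * c)) ?_
    have h2 := congrArg (fun x => (transFactor A i j u)⁻¹ • x) (eq_neg_of_add_eq_zero_left h1)
    simpa [smul_smul, hc0] using h2
  rw [hw, map_zero, smul_zero, zero_add] at h1
  exact Prod.ext ((smul_eq_zero.mp h1).resolve_right (ne_zero_of_mem_dom hA hj)) hw

theorem projSystem_projAtlas : ProjSystem X A (fun i u => lineProj ((A i).map u))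
    (transMap (fun i => (A i).dom) fun i u => lineProj ((A i).map u)) (transFactor A) where
  toChartSystem := (embeddedSystem_projAtlas hA).chartSystem fun i j u hu =>
    (differentiableAt_transMap hA hu).snd
  mem_cone i u hu := (hA i).mapsTo hu
  holomorphic_map i := (hA i).holomorphic
  holomorphic_factor i j u hu := (differentiableAt_transMap hA hu).fst.differentiableWithinAt
  factor_ne_zero i j u hu h0 := ne_zero_of_mem_dom hA hu.1 (by
    rw [map_eq_transFactor hA hu, h0, zero_smul])
  map_eq i j u hu := map_eq_transFactor hA hu

theorem isPartition_projPiece :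
    IsPartition (fun i => (A i).dom) (fun i u => lineProj ((A i).map u)) (projPiece A) := by
  have h1 : projPiece A = fun i => {u | u ∈ (A i).dom ∧ ∀ j < i, lineProj ((A i).map u) ∉
      (fun u => lineProj ((A j).map u)) '' (A j).dom} := by
    funext i
    ext u
    exact and_congr_right fun hu => forall₂_congr fun j _ => not_congr
      (lineProj_mem_image (ne_zero_of_mem_dom hA hu)).symm
  rw [h1]
  exact (projSystem_projAtlas hA).toChartSystem.isPartition_piece

omit hA

theorem isCompact_cone_inter_sphere (hX : IsProjAlgebraic X) :
    IsCompact (cone X ∩ Metric.sphere 0 1) := by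
  obtain ⟨P, hP, hXP⟩ := hX
  have h1 : cone X ∩ Metric.sphere 0 1 =
      Metric.sphere 0 1 ∩ ⋂ f ∈ P, {z | MvPolynomial.eval z f = 0} := by
    ext z
    rw [Set.inter_comm, Set.mem_inter_iff, Set.mem_inter_iff]
    refine and_congr_right fun hz => ?_
    have hz0 : z ≠ 0 := fun h => by simp [h] at hz
    have h2 : z ∈ cone X ↔ Projectivization.mk ℂ z hz0 ∈ X := exists_prop_of_true hz0
    obtain ⟨c, hc⟩ := Projectivization.exists_smul_eq_mk_rep ℂ z hz0
    rw [h2, hXP]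
    simp only [Set.mem_ofPred_eq, Set.mem_iInter]
    refine forall₂_congr fun f hf => ?_
    obtain ⟨d, hd⟩ := hP f hf
    have h3 : MvPolynomial.eval (Projectivization.mk ℂ z hz0).rep f =
        (c : ℂ) ^ d * MvPolynomial.eval z f := by
      rw [← hc, MvPolynomial.eval_eq', MvPolynomial.eval_eq', mul_sum]
      refine sum_congr rfl fun e he => ?_
      have h4 : ∑ i, e i = d := by
        rw [← Finsupp.degree_eq_sum, Finsupp.degree_eq_weight_one]
        exact hd (MvPolynomial.mem_support_iff.mp he)
      simp only [Units.smul_def, Pi.smul_apply, smul_eq_mul, mul_pow, Finset.prod_mul_distrib,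
        Finset.prod_pow_eq_pow_sum, h4]
      ring
    rw [h3, mul_eq_zero, or_iff_right (pow_ne_zero _ c.ne_zero)]
  rw [h1]
  exact (isCompact_sphere 0 1).inter_right (isClosed_biInter fun f _ =>
    isClosed_eq (MvPolynomial.continuous_eval f) continuous_const)

theorem exists_unityPartition_projAtlas (hX : IsProjAlgebraic X) (hA : IsProjAtlas X A) :
    ∃ (L : ℕ) (idx : Fin L → ℕ) (ρ : Fin L → ℕ → ℂ^(Fin n) → ℝ) (C : Fin L → Set ℂ^(Fin n)),
      UnityPartition (fun i => (A i).dom) (fun i u => lineProj ((A i).map u))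
        (transMap (fun i => (A i).dom) fun i u => lineProj ((A i).map u)) idx ρ C Set.univ := by
  have h := embeddedSystem_projAtlas hA.chart
  obtain ⟨L, idx, ρ, C, U⟩ := h.exists_unityPartition
    ((isCompact_cone_inter_sphere hX).image_of_continuousOn
      (contDiffOn_lineProj.continuousOn.mono fun z hz => hz.1.1)) (by
      rintro _ ⟨z, hz, rfl⟩
      obtain ⟨i, hi⟩ := hA.cover z hz.1
      exact ⟨i, (lineProj_mem_image hz.1.1).mpr hi⟩)
  refine ⟨L, idx, ρ, C, ⟨U.smooth, U.nonneg, U.isCompact, U.subset, U.invariant, U.support,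
    fun i u hu _ => U.sum_eq_one i u hu ?_⟩⟩
  obtain ⟨h0, hm⟩ := (hA.chart i).mapsTo hu
  have hc : ((‖(A i).map u‖⁻¹ : ℝ) : ℂ) ≠ 0 :=
    Complex.ofReal_ne_zero.mpr (inv_ne_zero (norm_ne_zero_iff.mpr h0))
  have hc0 := smul_ne_zero hc h0
  refine ⟨((‖(A i).map u‖⁻¹ : ℝ) : ℂ) • (A i).map u, ⟨⟨hc0, ?_⟩, ?_⟩, lineProj_smul hc _⟩
  · rwa [(Projectivization.mk_eq_mk_iff' ℂ _ _ hc0 h0).mpr ⟨_, rfl⟩]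
  · rw [mem_sphere_zero_iff_norm, norm_smul, Complex.norm_real, norm_inv, norm_norm,
      inv_mul_cancel₀ (norm_ne_zero_iff.mpr h0)]

end Projective

/-! ### The operators `∂` and `\bar∂` on forms -/

section Dolbeault

attribute [local instance] normedRingFrm normedAlgebraFrm

variable {ι κ : Type} [Fintype ι] [DecidableEq ι] [Fintype κ] [DecidableEq κ]

/-- `dz_a` (`b = false`) and `d\bar z_a` (`b = true`). -/
def dcov (b : Bool) (a : ι) : Cov ι := bif b then dzbar a else dz a

/-- The operators `∂` (`b = false`) and `\bar∂` (`b = true`). -/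
def dolbeault (b : Bool) (θ : ℂ^ι → Frm ι) (z : ℂ^ι) : Frm ι :=
  ∑ a, ιF ℂ (dcov b a) * wd b a θ z

theorem ι_mul_ι_neg (x y : Cov ι) : ιF ℂ x * ιF ℂ y =
    -(ιF ℂ y * ιF ℂ x) :=
  eq_neg_of_add_eq_zero_left (ι_add_mul_swap x y)

section Algebra

variable {b : Bool} {θ θ' : ℂ^ι → Frm ι} {z : ℂ^ι}

theorem dolbeault_congr_on {U : Set ℂ^ι} (hU : IsOpen U) (h : Set.EqOn θ θ' U) (b : Bool)
    (hz : z ∈ U) : dolbeault b θ z = dolbeault b θ' z :=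
  sum_congr rfl fun a _ => by rw [wd_congr_on hU h b a hz]

theorem dolbeault_sum {J : Type*} (s : Finset J) {θ : J → ℂ^ι → Frm ι}
    (h : ∀ j ∈ s, DifferentiableAt ℝ (θ j) z) :
    dolbeault b (fun y => ∑ j ∈ s, θ j y) z = ∑ j ∈ s, dolbeault b (θ j) z := by
  simp only [dolbeault, wd_sum s h, mul_sum]
  exact sum_comm

theorem dolbeault_add (h : DifferentiableAt ℝ θ z) (h' : DifferentiableAt ℝ θ' z) :
    dolbeault b (fun y => θ y + θ' y) z = dolbeault b θ z + dolbeault b θ' z := by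
  simp only [dolbeault, wd_add h h', mul_add, sum_add_distrib]

theorem dolbeault_const_smul (h : DifferentiableAt ℝ θ z) (c : ℂ) :
    dolbeault b (fun y => c • θ y) z = c • dolbeault b θ z := by
  simp only [dolbeault, wd_const_smul h, mul_smul_comm, smul_sum]

theorem dolbeault_const (v : Frm ι) : dolbeault b (fun _ => v) z = 0 :=
  sum_eq_zero fun a _ => by rw [wd_const, mul_zero]

theorem dolbeault_smul {c : ℂ^ι → ℂ} (hc : DifferentiableAt ℝ c z)
    (h : DifferentiableAt ℝ θ z) : dolbeault b (fun y => c y • θ y) z =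
      c z • dolbeault b θ z + (∑ a, wd b a c z • ιF ℂ (dcov b a)) * θ z := by
  simp only [dolbeault, wd_smul hc h, mul_add, sum_add_distrib, mul_smul_comm,
    smul_sum, sum_mul, smul_mul_assoc]

theorem dolbeault_ι_mul {γ : ℂ^ι → Cov ι}
    (hγ : DifferentiableAt ℝ (fun y => ιF ℂ (γ y)) z)
    (h : DifferentiableAt ℝ θ z) :
    dolbeault b (fun y => ιF ℂ (γ y) * θ y) z =
      dolbeault b (fun y => ιF ℂ (γ y)) z * θ z -
        ιF ℂ (γ z) * dolbeault b θ z := by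
  simp only [dolbeault]
  rw [sum_mul, mul_sum, ← Finset.sum_sub_distrib]
  refine sum_congr rfl fun a _ => ?_
  rw [wd_mul hγ h, mul_add, ← mul_assoc, ι_mul_ι_neg, ← mul_assoc]
  noncomm_ring

end Algebra

section Pullback

variable {T : ℂ^ι → ℂ^κ} {U' : Set ℂ^ι} {U : Set ℂ^κ}

theorem covPullback_dcov {z : ℂ^ι} (hT : DifferentiableAt ℂ T z) (b : Bool) (c : κ) :
    covPullback T z (dcov b c) = ∑ a, wconj b (jac T a c z) • dcov b a := by
  rw [covPullback_eq hT]
  cases b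
  · exact covComp_dz _ _
  · exact covComp_dzbar _ _

/-- The pull-backs of a form with constant coefficients are smooth and closed. -/
theorem map_covPullback_closed (hU' : IsOpen U') (hT : DifferentiableOn ℂ T U') (e : Frm κ) :
    SmoothOn (fun z => map (covPullback T z) e) U' ∧
      ∀ b, ∀ z ∈ U', dolbeault b (fun z => map (covPullback T z) e) z = 0 := by
  have hadd : ∀ e e' : Frm κ, (SmoothOn (fun z => map (covPullback T z) e) U' ∧
      ∀ b, ∀ z ∈ U', dolbeault b (fun z => map (covPullback T z) e) z = 0) →
      (SmoothOn (fun z => map (covPullback T z) e') U' ∧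
      ∀ b, ∀ z ∈ U', dolbeault b (fun z => map (covPullback T z) e') z = 0) →
      (SmoothOn (fun z => map (covPullback T z) (e + e')) U' ∧
      ∀ b, ∀ z ∈ U', dolbeault b (fun z => map (covPullback T z) (e + e')) z = 0) := by
    rintro e e' ⟨h1, h2⟩ ⟨h3, h4⟩
    simp only [map_add]
    refine ⟨h1.add h3, fun b z hz => ?_⟩
    rw [dolbeault_add (diffAt_of_contDiffOn hU' h1 hz)
      (diffAt_of_contDiffOn hU' h3 hz), h2 b z hz, h4 b z hz, add_zero]
  have hcov : ∀ m : Cov κ,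
      (SmoothOn (fun z => map (covPullback T z) (ιF ℂ m)) U' ∧
      ∀ b, ∀ z ∈ U', dolbeault b
        (fun z => map (covPullback T z) (ιF ℂ m)) z = 0) := by
    intro m
    have hm : m ∈ Submodule.span ℂ (Set.range (covBasis κ)) := by
      rw [(covBasis κ).span_eq]; trivial
    induction hm using Submodule.span_induction with
    | zero =>
      simp only [map_zero]
      exact ⟨contDiffOn_const, fun b z _ => dolbeault_const 0⟩
    | add x y _ _ hx hy => rw [map_add]; exact hadd _ _ hx hy
    | smul c x _ hx =>
      simp only [map_smul]
      exact ⟨hx.1.const_smul c, fun b z hz => by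
        rw [dolbeault_const_smul (diffAt_of_contDiffOn hU' hx.1 hz), hx.2 b z hz,
          smul_zero]⟩
    | mem x hx =>
      obtain ⟨b', c, rfl⟩ : ∃ b' c, x = dcov b' c := by
        obtain ⟨c | c, rfl⟩ := hx
        · exact ⟨false, c, covBasis_inl c⟩
        · exact ⟨true, c, covBasis_inr c⟩
      have h1 : Set.EqOn (fun z => map (covPullback T z)
          (ιF ℂ (dcov b' c))) (fun z => ∑ a, wconj b' (jac T a c z) •
            ιF ℂ (dcov b' a)) U' := fun z hz => by
        change map _ (ιF ℂ (dcov b' c)) = _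
        rw [map_apply_ι,
          covPullback_dcov (hT.differentiableAt (hU'.mem_nhds hz)), map_sum]
        simp only [map_smul]
      have h2 : ∀ a, SmoothOn (fun z => wconj b' (jac T a c z)) U' := fun a => by
        cases b'
        · exact contDiffOn_jac hU' hT a c
        · exact contDiffOn_conj (contDiffOn_jac hU' hT a c)
      have h3 : ∀ a, SmoothOn (fun z => wconj b' (jac T a c z) •
          (ιF ℂ (dcov b' a) : Frm ι)) U' := fun a => (h2 a).fun_smul contDiffOn_const
      refine ⟨(ContDiffOn.sum fun a _ => h3 a).congr h1, fun b z hz => ?_⟩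
      rw [dolbeault_congr_on hU' h1 b hz, dolbeault_sum _ fun a _ =>
        diffAt_of_contDiffOn hU' (h3 a) hz]
      have h4 : ∀ a, dolbeault b (fun z => wconj b' (jac T a c z) •
          (ιF ℂ (dcov b' a) : Frm ι)) z =
          ∑ β, wd b β (fun z => wconj b' (jac T a c z)) z •
            (ιF ℂ (dcov b β) * ιF ℂ (dcov b' a)) := fun a => by
        rw [dolbeault_smul (diffAt_of_contDiffOn hU' (h2 a) hz)
          (differentiableAt_const _), dolbeault_const, smul_zero, zero_add, sum_mul]
        simp only [smul_mul_assoc]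
      simp only [h4]
      have hj := fun a => diffAt_of_contDiffOn hU' (contDiffOn_jac hU' hT a c) hz
      by_cases hb : b = b'
      · subst hb
        have hsymm : ∀ a β, wd b β (fun z => wconj b (jac T a c z)) z =
            wd b a (fun z => wconj b (jac T β c z)) z := by
          have hs : ∀ a β, wd false β (jac T a c) z = wd false a (jac T β c) z := fun a β => by
            rw [wd_congr_on hU' (fun y hy => jac_eq hU' hT hy a c) false β hz,
              wd_congr_on hU' (fun y hy => jac_eq hU' hT hy β c) false a hz]
            exact wd_comm hU' (contDiffOn_of_holomorphic hU'
              (differentiableOn_apply hT c)) hz _ _ _ _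
          intro a β
          cases b
          · exact hs a β
          · exact (wd_conj (hj a) true β).trans (((congrArg _ (hs a β))).trans
              (wd_conj (hj β) true a).symm)
        have hS := sum_comm (s := univ) (t := univ) (f := fun a β =>
          wd b β (fun z => wconj b (jac T a c z)) z •
            ((ιF ℂ (dcov b β) : Frm ι) * ιF ℂ (dcov b a)))
        have hS' : ∑ β, ∑ a, wd b β (fun z => wconj b (jac T a c z)) z •
            ((ιF ℂ (dcov b β) : Frm ι) * ιF ℂ (dcov b a)) =
            -∑ a, ∑ β, wd b β (fun z => wconj b (jac T a c z)) z •
            ((ιF ℂ (dcov b β) : Frm ι) * ιF ℂ (dcov b a)) := by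
          simp only [← sum_neg_distrib]
          refine sum_congr rfl fun a _ => sum_congr rfl fun β _ => ?_
          rw [hsymm, ι_mul_ι_neg, smul_neg]
        rw [hS'] at hS
        have h2 := eq_neg_iff_add_eq_zero.mp hS
        rw [← two_smul ℂ] at h2
        exact (smul_eq_zero.mp h2).resolve_left two_ne_zero
      · refine sum_eq_zero fun a _ => sum_eq_zero fun β _ => ?_
        have : wd b β (fun z => wconj b' (jac T a c z)) z = 0 := by
          cases b <;> cases b'
          · exact absurd rfl hb
          · exact wd_false_conj_jac hU' hT hz a c β
          · exact wd_true_jac hU' hT hz a c β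
          · exact absurd rfl hb
        rw [this, zero_smul]
  induction e using CliffordAlgebra.left_induction with
  | algebraMap r =>
    simp only [AlgHom.commutes]
    exact ⟨contDiffOn_const, fun b z _ => dolbeault_const _⟩
  | add x y hx hy => exact hadd x y hx hy
  | ι_mul x m hx =>
    have hm := hcov m
    have heq : ∀ z, map (covPullback T z) (CliffordAlgebra.ι 0 m * x) =
        ιF ℂ (covPullback T z m) * map (covPullback T z) x := fun z => by
      rw [map_mul]
      congr 1
      exact map_apply_ι _ _
    simp only [map_apply_ι] at hm
    simp only [heq]
    refine ⟨hm.1.mul hx.1, fun b z hz => ?_⟩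
    rw [dolbeault_ι_mul (diffAt_of_contDiffOn hU' hm.1 hz)
      (diffAt_of_contDiffOn hU' hx.1 hz), hm.2 b z hz, hx.2 b z hz, zero_mul, mul_zero,
      sub_zero]

/-- A coordinate function on forms. -/
def frmCoord (κ : Type) [Fintype κ] (k : Fin (Module.finrank ℂ (Frm κ))) : Frm κ →L[ℂ] ℂ :=
  ((Module.finBasis ℂ (Frm κ)).coord k).toContinuousLinearMap

theorem sum_frmCoord (w : Frm κ) :
    ∑ k, frmCoord κ k w • Module.finBasis ℂ (Frm κ) k = w :=
  (Module.finBasis ℂ (Frm κ)).sum_repr w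

variable {θ : ℂ^κ → Frm κ}

theorem pullback_eq_sum (z : ℂ^ι) : pullback T θ z = ∑ k, frmCoord κ k (θ (T z)) •
    map (covPullback T z) (Module.finBasis ℂ (Frm κ) k) := by
  conv_lhs => rw [pullback, ← sum_frmCoord (θ (T z))]
  simp only [map_sum, map_smul]

theorem contDiffOn_pullback (hU' : IsOpen U') (hT : DifferentiableOn ℂ T U')
    (hm : Set.MapsTo T U' U) (hθ : SmoothOn θ U) : SmoothOn (pullback T θ) U' := by
  rw [funext pullback_eq_sum]
  exact ContDiffOn.sum fun k _ => ((contDiffOn_clm (frmCoord κ k) hθ).comp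
    (contDiffOn_of_holomorphic hU' hT) hm).smul (map_covPullback_closed hU' hT _).1

/-- `∂` and `\bar∂` commute with the pull-back by a holomorphic map. -/
theorem dolbeault_pullback (hU' : IsOpen U') (hU : IsOpen U) (hT : DifferentiableOn ℂ T U')
    (hm : Set.MapsTo T U' U) (hθ : SmoothOn θ U) (b : Bool) {z : ℂ^ι} (hz : z ∈ U') :
    dolbeault b (pullback T θ) z = pullback T (dolbeault b θ) z := by
  have hW := fun e : Frm κ => map_covPullback_closed hU' hT e
  have hd := diffAt_of_contDiffOn hU hθ (hm hz)
  have h1 : ∀ k, SmoothOn (fun y => frmCoord κ k (θ y)) U := fun k => contDiffOn_clm _ hθ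
  have h2 : ∀ k, DifferentiableAt ℝ (fun y => frmCoord κ k (θ (T y))) z := fun k =>
    diffAt_of_contDiffOn hU' ((h1 k).comp
      (contDiffOn_of_holomorphic hU' hT) hm) hz
  have h3 : ∀ k, DifferentiableAt ℝ (fun y => map (covPullback T y)
      (Module.finBasis ℂ (Frm κ) k)) z := fun k => diffAt_of_contDiffOn hU' (hW _).1 hz
  rw [funext pullback_eq_sum, dolbeault_sum _ fun k _ => (h2 k).fun_smul (h3 k)]
  simp only [dolbeault_smul (h2 _) (h3 _), (hW _).2 b z hz, smul_zero, zero_add]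
  rw [pullback, dolbeault, map_sum]
  have h4 : ∀ k a, wd b a (fun y => frmCoord κ k (θ (T y))) z =
      ∑ c, wconj b (jac T a c z) * frmCoord κ k (wd b c θ (T z)) := fun k a => by
    rw [wd_comp_jac (f := fun y => frmCoord κ k (θ y)) hU' hT hz
      (diffAt_of_contDiffOn hU (h1 k) (hm hz))]
    exact sum_congr rfl fun c _ => by rw [wd_clm (frmCoord κ k) hd]
  have h5 : ∀ c, map (covPullback T z)
      (ιF ℂ (dcov b c) * wd b c θ (T z)) =
      ∑ k, ∑ a, (wconj b (jac T a c z) * frmCoord κ k (wd b c θ (T z))) •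
        (ιF ℂ (dcov b a) *
          map (covPullback T z) (Module.finBasis ℂ (Frm κ) k)) := fun c => by
    rw [map_mul, map_apply_ι,
      covPullback_dcov (hT.differentiableAt (hU'.mem_nhds hz))]
    conv_lhs => rw [← sum_frmCoord (wd b c θ (T z))]
    rw [map_sum, map_sum, mul_sum]
    refine sum_congr rfl fun k _ => ?_
    rw [sum_mul]
    refine sum_congr rfl fun a _ => ?_
    rw [map_smul, map_smul, smul_mul_smul_comm]
  simp only [h4, h5, sum_smul, sum_mul, smul_mul_assoc]
  rw [Finset.sum_comm' (s' := fun _ => univ) (t' := univ) (by simp)]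
  rw [sum_congr rfl fun c _ => sum_comm]
  rw [sum_comm]
  refine sum_congr rfl fun a _ => ?_
  rw [sum_comm]

end Pullback

section DDbar

variable {θ : ℂ^ι → Frm ι} {U : Set ℂ^ι}

theorem contDiffOn_of_smoothFormOn (h : SmoothFormOn θ U) : SmoothOn θ U := by
  rw [funext fun z => (sum_frmCoord (θ z)).symm]
  exact ContDiffOn.sum fun k _ => (h ((Module.finBasis ℂ (Frm ι)).coord k)).smul contDiffOn_const

theorem ddbarForm_eq (hU : IsOpen U) (hθ : SmoothOn θ U) {z : ℂ^ι} (hz : z ∈ U) :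
    ddbarForm θ z = ∑ a, ∑ β, (dzdzbar a β : Frm ι) * wd false a (wd true β θ) z := by
  refine sum_congr rfl fun a _ => sum_congr rfl fun β _ => congrArg _ ?_
  rw [← sum_frmCoord (wd false a (wd true β θ) z)]
  refine sum_congr rfl fun k _ => congrArg (· • _) ?_
  rw [pd_eq, pdbar_eq, ← wd_clm (frmCoord ι k)
    (diffAt_of_contDiffOn hU (contDiffOn_wd hU hθ true β) hz)]
  exact wd_congr_on hU (fun y hy =>
    wd_clm (frmCoord ι k) (diffAt_of_contDiffOn hU hθ hy) true β) false a hz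

theorem contDiffOn_dolbeault (hU : IsOpen U) (hθ : SmoothOn θ U) (b : Bool) :
    SmoothOn (dolbeault b θ) U :=
  ContDiffOn.sum fun β _ => contDiffOn_const.mul (contDiffOn_wd hU hθ b β)

theorem ddbarForm_eq_dolbeault (hU : IsOpen U) (hθ : SmoothOn θ U) {z : ℂ^ι} (hz : z ∈ U) :
    ddbarForm θ z = dolbeault false (dolbeault true θ) z := by
  have hw := fun β => contDiffOn_wd hU hθ true β
  rw [ddbarForm_eq hU hθ hz]
  refine sum_congr rfl fun a _ => ?_
  have h1 : wd false a (dolbeault true θ) z =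
      ∑ β, ιF ℂ (dzbar β) * wd false a (wd true β θ) z := by
    refine (wd_sum _ (f := fun β y => ιF ℂ (dzbar β) * wd true β θ y) (fun β _ =>
      diffAt_of_contDiffOn hU (contDiffOn_const.mul (hw β)) hz) false a).trans ?_
    exact sum_congr rfl fun β _ => by
      rw [wd_mul (differentiableAt_const _) (diffAt_of_contDiffOn hU (hw β) hz), wd_const,
        zero_mul, add_zero]
  rw [h1, mul_sum]
  exact sum_congr rfl fun β _ => mul_assoc _ _ _

theorem ddbarForm_pullback {κ : Type} [Fintype κ] [DecidableEq κ] {T : ℂ^κ → ℂ^ι}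
    {U' : Set ℂ^κ} (hU' : IsOpen U') (hU : IsOpen U) (hT : DifferentiableOn ℂ T U')
    (hm : Set.MapsTo T U' U) (hθ : SmoothOn θ U) {z : ℂ^κ} (hz : z ∈ U') :
    ddbarForm (pullback T θ) z = pullback T (ddbarForm θ) z := by
  rw [ddbarForm_eq_dolbeault hU' (contDiffOn_pullback hU' hT hm hθ) hz,
    dolbeault_congr_on hU' (fun y hy => dolbeault_pullback hU' hU hT hm hθ true hy) false hz,
    dolbeault_pullback hU' hU hT hm (contDiffOn_dolbeault hU hθ _) false hz, pullback, pullback,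
    ddbarForm_eq_dolbeault hU hθ (hm hz)]

/-- `testCoeff` as a continuous functional. -/
def testCLM (a β : ι) : Frm ι →L[ℂ] ℂ :=
  ((topCoeff ι).comp (LinearMap.mulLeft ℂ (dzdzbar a β : Frm ι))).toContinuousLinearMap

theorem testCLM_apply (a β : ι) (ψ : Frm ι) : testCLM a β ψ = testCoeff false a β ψ := rfl

theorem topCoeff_ddbarForm (hU : IsOpen U) (hθ : SmoothOn θ U) {z : ℂ^ι} (hz : z ∈ U) :
    topCoeff ι (ddbarForm θ z) =
      ∑ a, ∑ β, wd false a (wd true β fun y => testCoeff false a β (θ y)) z := by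
  simp only [ddbarForm_eq hU hθ hz, map_sum]
  refine sum_congr rfl fun a _ => sum_congr rfl fun β _ => ?_
  change testCLM a β _ = _
  rw [← wd_clm (testCLM a β)
    (diffAt_of_contDiffOn hU (contDiffOn_wd hU hθ true β) hz)]
  exact (wd_congr_on hU (fun y hy =>
    wd_clm (testCLM a β) (diffAt_of_contDiffOn hU hθ hy) true β) false a hz).symm

end DDbar

end Dolbeault

/-! ### Integration by parts on a manifold -/

section Parts

variable {κ : Type} [Fintype κ] [DecidableEq κ] {r f : ℂ^κ → ℂ} {W C : Set ℂ^κ}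

theorem CompactBump.integral_mul_wd (hr : CompactBump r W C) (hf : SmoothOn f W) (b : Bool)
    (a : κ) : ∫ u in W, f u * HigherEnergy.wd b a r u = -∫ u in W, HigherEnergy.wd b a f u * r u := by
  have h1 := hr.fibreInt_wd_inr (V := (Set.univ : Set (Empty → ℂ))) (h := fun z => f (zSnd z))
    isOpen_univ (hf.comp contDiff_zSnd.contDiffOn fun z hz => hz.2) (v := Empty.elim) trivial b a
  rw [setIntegral_eq_integral_of_forall_compl_eq_zero fun u hu => by
      rw [(hr.wd b a).support u fun hc => hu (hr.subset hc), mul_zero],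
    setIntegral_eq_integral_of_forall_compl_eq_zero fun u hu => by
      rw [hr.support u fun hc => hu (hr.subset hc), mul_zero], eq_neg_iff_add_eq_zero, add_comm,
    ← eq_neg_iff_add_eq_zero]
  refine Eq.trans ?_ (h1.trans (congrArg Neg.neg ?_))
  · refine integral_congr_ae (ae_of_all _ fun u => ?_)
    change _ = r u * _
    by_cases hu : u ∈ C
    · rw [wd_inr_comp_zSnd (g := f) (z := Sum.elim Empty.elim u)
        (diffAt_of_contDiffOn hr.isOpen hf (hr.subset hu))]
      exact mul_comm _ _
    · simp only [hr.support u hu, zero_mul, mul_zero]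
  · exact integral_congr_ae (ae_of_all _ fun u => mul_comm _ _)

theorem CompactBump.integral_mul_wd_wd (hr : CompactBump r W C) (hf : SmoothOn f W)
    (b b' : Bool) (a a' : κ) :
    ∫ u in W, f u * HigherEnergy.wd b a (HigherEnergy.wd b' a' r) u =
      ∫ u in W, HigherEnergy.wd b a (HigherEnergy.wd b' a' f) u * r u := by
  rw [(hr.wd b' a').integral_mul_wd hf, hr.integral_mul_wd (contDiffOn_wd hr.isOpen hf b a), neg_neg]
  exact setIntegral_congr_fun hr.isOpen.measurableSet fun u hu => by
    simp only [wd_comm hr.isOpen hf hu b' b a' a]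

theorem CompactBump.integrableOn (hr : CompactBump r W C) : IntegrableOn r W :=
  (hr.smooth.continuousOn.mono hr.subset |>.integrableOn_compact
    hr.isCompact).of_forall_sdiff_eq_zero hr.isOpen.measurableSet fun u hu => hr.support u hu.2

theorem CompactBump.integrableOn_mul (hr : CompactBump r W C) (hf : ContinuousOn f W) :
    IntegrableOn (fun u => f u * r u) W :=
  ((hf.mul hr.smooth.continuousOn).mono hr.subset |>.integrableOn_compact
    hr.isCompact).of_forall_sdiff_eq_zero hr.isOpen.measurableSet fun u hu => by
      change f u * r u = 0
      rw [hr.support u hu.2, mul_zero]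

end Parts

section Stokes

attribute [local instance] normedRingFrm normedAlgebraFrm

variable {κ : Type} [Fintype κ] [DecidableEq κ] {S I Λ : Type} [Fintype Λ]
  {dom : I → Set ℂ^κ} {q : I → ℂ^κ → S} {τ : I → I → ℂ^κ → ℂ^κ}
  {P : I → Set ℂ^κ} {idx : Λ → I} {μ : Λ → I → ℂ^κ → ℝ} {C : Λ → Set ℂ^κ} {K : Set S}
  {Ψ : I → ℂ^κ → Frm κ} {E : I → ℂ^κ → ℂ}

theorem ddbarForm_congr_on {θ θ' : ℂ^κ → Frm κ} {U : Set ℂ^κ} (hU : IsOpen U)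
    (h : Set.EqOn θ θ' U) {z : ℂ^κ} (hz : z ∈ U) : ddbarForm θ z = ddbarForm θ' z := by
  simp only [ddbarForm, pd_eq, pdbar_eq]
  refine sum_congr rfl fun a _ => sum_congr rfl fun β _ => congrArg _ <|
    sum_congr rfl fun k _ => congrArg (· • _) ?_
  exact wd_congr_on hU (fun y hy => wd_congr_on hU (fun x hx => by simp only [h hx]) true β hy)
    false a hz

theorem ddbarForm_zero (z : ℂ^κ) : ddbarForm (fun _ => (0 : Frm κ)) z = 0 := by
  rw [ddbarForm_eq_dolbeault isOpen_univ (contDiffOn_const (c := (0 : Frm κ))) (Set.mem_univ z),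
    show dolbeault true (fun _ => (0 : Frm κ)) = fun _ => 0 from funext fun y => dolbeault_const 0,
    dolbeault_const]

theorem ddbarForm_sum {θ : Λ → ℂ^κ → Frm κ} {U : Set ℂ^κ} (hU : IsOpen U)
    (hθ : ∀ l, SmoothOn (θ l) U) {z : ℂ^κ} (hz : z ∈ U) :
    ddbarForm (fun y => ∑ l, θ l y) z = ∑ l, ddbarForm (θ l) z := by
  rw [ddbarForm_eq_dolbeault hU (ContDiffOn.sum fun l _ => hθ l) hz,
    dolbeault_congr_on hU (fun y hy => dolbeault_sum _ fun l _ =>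
      diffAt_of_contDiffOn hU (hθ l) hy) false hz,
    dolbeault_sum _ fun l _ => diffAt_of_contDiffOn hU (contDiffOn_dolbeault hU (hθ l) _) hz]
  exact sum_congr rfl fun l _ => (ddbarForm_eq_dolbeault hU (hθ l) hz).symm

theorem UnityPartition.compactBump_mul (U : UnityPartition dom q τ idx μ C K)
    (h : ChartSystem dom q τ) (l : Λ) {f : ℂ^κ → ℂ} (hf : SmoothOn f (dom (idx l))) :
    CompactBump (fun u => (μ l (idx l) u : ℂ) * f u) (dom (idx l)) (C l) where
  isOpen := h.isOpen _
  isCompact := U.isCompact l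
  subset := U.subset l
  smooth := (contDiffOn_ofReal (U.smooth l _)).mul hf
  support u hu := by rw [U.eq_zero h hu, Complex.ofReal_zero, zero_mul]

variable [TopologicalSpace S] [T2Space S] [Countable I]

/-- The integral of `E ∂\bar∂ Ψ` for a function `E` and a compactly supported form `Ψ`. -/
theorem UnityPartition.hasSum_integral_ddbarForm (U : UnityPartition dom q τ idx μ C K)
    (h : ChartSystem dom q τ) (hP : IsPartition dom q P)
    (hq : ∀ i, ContinuousOn (q i) (dom i)) (hE : ∀ i, SmoothOn (E i) (dom i))
    (hEτ : ∀ i j, ∀ u ∈ overlap dom q i j, E i u = E j (τ i j u))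
    (hΨ : ∀ i, SmoothOn (Ψ i) (dom i))
    (hΨτ : ∀ i j, ∀ u ∈ overlap dom q i j, Ψ i u = pullback (τ i j) (Ψ j) u)
    (hK : ∀ i, ∀ u ∈ dom i, q i u ∉ K → Ψ i u = 0) :
    HasSum (fun i => ∫ u in P i, E i u * topCoeff κ (ddbarForm (Ψ i) u))
      (∑ l, ∫ u in dom (idx l), (∑ a, ∑ β, wd false a (wd true β (E (idx l))) u *
        testCoeff false a β (Ψ (idx l) u)) * (μ l (idx l) u : ℂ)) := by
  obtain ⟨θ, hθ⟩ : ∃ θ : Λ → I → ℂ^κ → Frm κ, θ = fun l i u => (μ l i u : ℂ) • Ψ i u := ⟨_, rfl⟩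
  have hs : ∀ l i, SmoothOn (θ l i) (dom i) := fun l i => by
    rw [hθ]
    exact (contDiffOn_ofReal (U.smooth l i)).fun_smul (hΨ i)
  have ht : ∀ l a β, CompactBump (fun u => testCoeff false a β (θ l (idx l) u)) (dom (idx l))
      (C l) := fun l a β => by
    have : (fun u => testCoeff false a β (θ l (idx l) u)) =
        fun u => (μ l (idx l) u : ℂ) * testCLM a β (Ψ (idx l) u) := funext fun u => by
      rw [hθ, ← testCLM_apply, map_smul, smul_eq_mul]
    rw [this]
    exact U.compactBump_mul h l (contDiffOn_clm _ (hΨ _))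
  have htop : ∀ l, ∀ u ∈ dom (idx l), E (idx l) u * topCoeff κ (ddbarForm (θ l (idx l)) u) =
      ∑ a, ∑ β, E (idx l) u *
        wd false a (wd true β fun y => testCoeff false a β (θ l (idx l) y)) u := fun l u hu => by
    rw [topCoeff_ddbarForm (h.isOpen _) (hs l _) hu]
    simp only [mul_sum]
  have hint : ∀ l a β, IntegrableOn (fun u => E (idx l) u *
      wd false a (wd true β fun y => testCoeff false a β (θ l (idx l) y)) u) (dom (idx l)) :=
    fun l a β => (((ht l a β).wd true β).wd false a).integrableOn_mul (hE _).continuousOn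
  have hΨsum : ∀ i, Set.EqOn (Ψ i) (fun u => ∑ l, θ l i u) (dom i) := fun i u hu => by
    simp only [hθ, ← sum_smul]
    by_cases hq : q i u ∈ K
    · rw [← Complex.ofReal_sum, U.sum_eq_one i u hu hq, Complex.ofReal_one, one_smul]
    · rw [hK i u hu hq, smul_zero]
  have hθτ : ∀ l i j, Set.EqOn (θ l i) (pullback (τ i j) (θ l j)) (overlap dom q i j) :=
    fun l i j u hu => by
      rw [hθ, pullback]
      simp only [map_smul, U.invariant l i j u hu, hΨτ i j u hu]
      rfl
  have key := h.hasSum_integral_sum hP (idx := idx)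
    (d := fun l i u => E i u * topCoeff κ (ddbarForm (θ l i) u))
    (fun l i j u hu => by
      beta_reduce
      rw [ddbarForm_congr_on (h.isOpen_overlap i j) (hθτ l i j) hu,
        ddbarForm_pullback (h.isOpen_overlap i j) (h.isOpen j) (h.holomorphic i j) (h.mapsTo i j)
          (hs l j) hu, pullback, topCoeff_covPullback (h.differentiableAt hu), hEτ i j u hu]
      ring)
    (fun l => IntegrableOn.congr_fun (integrable_finsetSum _ fun a _ =>
        integrable_finsetSum _ fun β _ => hint l a β)
      (fun u hu => (htop l u hu).symm) (h.isOpen _).measurableSet)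
    (fun l i u hu hqu => by
      have hO : IsOpen (dom i ∩ q i ⁻¹' (q (idx l) '' C l)ᶜ) :=
        (hq i).isOpen_inter_preimage (h.isOpen i)
          ((U.isCompact l).image_of_continuousOn ((hq _).mono (U.subset l))).isClosed.isOpen_compl
      rw [ddbarForm_congr_on (θ' := fun _ => 0) hO (fun y hy => by
        have : μ l i y = 0 := by
          by_contra h0
          exact hy.2 (U.support l i y h0).2
        rw [hθ]
        simp only [this, Complex.ofReal_zero, zero_smul])
        ⟨hu, fun hc => hqu (Set.image_mono (U.subset l) hc)⟩, ddbarForm_zero, map_zero, mul_zero])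
    (D := fun i u => E i u * topCoeff κ (ddbarForm (Ψ i) u)) (fun i u hu => by
      rw [ddbarForm_congr_on (h.isOpen i) (hΨsum i) hu, ddbarForm_sum (h.isOpen i)
        (fun l => hs l i) hu, map_sum, mul_sum])
  refine (congrArg (HasSum _) (sum_congr rfl fun l _ => ?_)).mp key
  have hE' : ∀ a β, SmoothOn (wd false a (wd true β (E (idx l)))) (dom (idx l)) :=
    fun a β => contDiffOn_wd (h.isOpen _) (contDiffOn_wd (h.isOpen _) (hE _) _ _) _ _
  rw [setIntegral_congr_fun (h.isOpen _).measurableSet fun u hu => htop l u hu]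
  have e1 : ∀ u, (∑ a, ∑ β, wd false a (wd true β (E (idx l))) u *
      testCoeff false a β (Ψ (idx l) u)) * (μ l (idx l) u : ℂ) =
      ∑ a, ∑ β, wd false a (wd true β (E (idx l))) u * testCoeff false a β (θ l (idx l) u) := by
    intro u
    simp only [sum_mul]
    refine sum_congr rfl fun a _ => sum_congr rfl fun β _ => ?_
    rw [hθ, ← testCLM_apply, ← testCLM_apply, map_smul, smul_eq_mul]
    ring
  simp only [e1]
  refine (integral_finsetSum _ fun a _ => integrable_finsetSum _ fun β _ => hint l a β).trans
    (Eq.trans ?_ (integral_finsetSum _ fun a _ => integrable_finsetSum _ fun β _ =>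
      (ht l a β).integrableOn_mul (hE' a β).continuousOn).symm)
  refine sum_congr rfl fun a _ => ?_
  refine (integral_finsetSum _ fun β _ => hint l a β).trans
    (Eq.trans ?_ (integral_finsetSum _ fun β _ =>
      (ht l a β).integrableOn_mul (hE' a β).continuousOn).symm)
  exact sum_congr rfl fun β _ => (ht l a β).integral_mul_wd_wd (hE _) _ _ _ _

end Stokes

/-! ### Chern-Weil forms on the product of the group and the manifold -/

section Pullback

variable {ι κ κ' : Type} [Fintype ι] [Fintype κ] [Fintype κ']

theorem pullback_comp {q : ℂ^κ → ℂ^κ'} {T : ℂ^ι → ℂ^κ} {p : ℂ^ι → ℂ^κ'}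
    {z : ℂ^ι} (hp : p =ᶠ[nhds z] fun y => q (T y)) (hT : DifferentiableAt ℝ T z)
    (hq : DifferentiableAt ℝ q (T z)) (ψ : ℂ^κ' → Frm κ') :
    pullback p ψ z = pullback T (pullback q ψ) z := by
  have h1 : covPullback p z = (covPullback T z).comp (covPullback q (T z)) := by
    refine LinearMap.ext fun α => LinearMap.ext fun w => ?_
    change α (fderiv ℝ p z w) = α (fderiv ℝ q (T z) (fderiv ℝ T z w))
    have h2 : fderiv ℝ (fun y => q (T y)) z = _ := (hq.hasFDerivAt.comp z hT.hasFDerivAt).fderiv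
    rw [hp.fderiv_eq, h2]
    rfl
  rw [pullback, pullback, pullback, hp.self_of_nhds, h1, ← map_comp_map]
  rfl

theorem pullback_zFst [DecidableEq ι] [DecidableEq κ] (θ : ℂ^ι → Frm ι) (z : ℂ^(ι ⊕ κ)) :
    pullback zFst θ z = frmFst ι κ (θ (zFst z)) := by
  have h1 : covPullback zFst z = covFst ι κ := by
    refine LinearMap.ext fun α => LinearMap.ext fun w => ?_
    change α (fderiv ℝ zFst z w) = α (zFst w)
    rw [((hasFDerivAt_zFst z).restrictScalars ℝ).fderiv]
    rfl
  rw [pullback, h1]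

end Pullback

theorem chernForms_eq {J : Type} {r : ℕ} (c : ℕ → ℂ) (hn : 1 ≤ n)
    (R : Matrix (Fin r) (Fin r) (CFrm J)) (F : CFrm J) :
    c (n - 1) • (((1 / 8 : ℂ) • chernOne R ^ 2 - (1 / 12 : ℂ) • chTwo R) * (ci • F) ^ (n - 1)) +
      c n • ((1 / 2 : ℂ) • chernOne R * (ci • F) ^ n) + c (n + 1) • (ci • F) ^ (n + 1) =
      ci ^ (n + 1) • cwPoly c n R F := by
  have key : ∀ (A : Type) [CommRing A] [Algebra ℂ A] (t w F : A) (p : ℕ) (a b d : ℂ),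
      a • (((1 / 8 : ℂ) • (ci • t) ^ 2 - (1 / 12 : ℂ) • (1 / 2 : ℂ) • ci • ci • w) * (ci • F) ^ p) +
        b • ((1 / 2 : ℂ) • (ci • t) * (ci • F) ^ (p + 1)) + d • (ci • F) ^ (p + 1 + 1) =
      ci ^ (p + 1 + 1) • (a • (((1 / 8 : ℂ) • t ^ 2 - (1 / 24 : ℂ) • w) * F ^ p) +
        b • ((1 / 2 : ℂ) • t * F ^ (p + 1)) + d • F ^ (p + 1 + 1)) := fun A _ _ t w F p a b d => by
    rw [show (1 / 24 : ℂ) = 1 / 12 * (1 / 2) by norm_num]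
    simp only [Algebra.smul_def, map_mul, map_pow]
    ring
  obtain ⟨p, rfl⟩ := Nat.exists_eq_add_of_le' hn
  rw [chernOne, chTwo, cwPoly, pow_two (ci • R), Matrix.smul_mul, Matrix.mul_smul,
    Matrix.trace_smul, Matrix.trace_smul, Matrix.trace_smul]
  exact key _ _ _ _ _ _ _ _

section ChernWeil

attribute [local instance] normedRingFrm normedAlgebraFrm normedCommRingCFrm normedAlgebraCFrm
  normedSpaceCFrm

variable {N n M : ℕ} {X : Set (PSpace N)} {A : ℕ → Param (Fin n) (Fin (N + 1))} {S : Type}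
  {q : ℕ → ℂ^(Fin n) → S} {τ : ℕ → ℕ → ℂ^(Fin n) → ℂ^(Fin n)} {cc : ℕ → ℕ → ℂ^(Fin n) → ℂ}

theorem curvature_congr_on {J : Type} [Fintype J] [DecidableEq J] {r : ℕ}
    {g g' : ℂ^J → Matrix (Fin r) (Fin r) ℂ} {U : Set ℂ^J} (hU : IsOpen U)
    (h : Set.EqOn g g' U) {z : ℂ^J} (hz : z ∈ U) : curvature g z = curvature g' z := by
  ext1 i j
  simp only [curvature, Matrix.of_apply, pd_eq, pdbar_eq]
  refine sum_congr rfl fun a _ => sum_congr rfl fun β _ => ?_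
  refine congrArg (fun c : ℂ => (-c) • (dzdzbar a β : CFrm J)) ?_
  refine wd_congr_on hU (fun y hy => ?_) true β hz
  have h1 : (Matrix.of fun k l => wd false a (fun w => g w k l) y) =
      Matrix.of fun k l => wd false a (fun w => g' w k l) y := by
    ext1 k l
    exact wd_congr_on hU (fun x hx => by simp only [h hx]) false a hy
  simp only [h1, h hy]

variable {s : Param (Fin M) (MatIdx N)}

theorem ProjSystem.topCoeff_chernWeil (h : ProjSystem X A q τ cc) (hs : IsChart (SL N) s)
    (hΦ : IsConeFamily X A s.dom (bergmanFamily s)) (χ : Polynomial ℚ) (hn : 1 ≤ n) {j : ℕ}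
    (ψ : ℂ^(MatIdx N) → Frm (MatIdx N)) {z : ℂ^(Fin M ⊕ Fin n)} (hz : z ∈ zProd s.dom (A j).dom) :
    topCoeff (Fin M ⊕ Fin n) ((chernWeil χ s (A j) z : Frm (Fin M ⊕ Fin n)) *
      pullback (fun y : ℂ^(Fin M ⊕ Fin n) => s.map fun a => y (Sum.inl a)) ψ z) =
    ci ^ (n + 1) * wedgeCLM n (pullback s.map ψ (zFst z))
      (cwForm (hilbTerm χ n) (coneFamily A (bergmanFamily s) j) z) := by
  have h1 : curvatureG s (A j) z =
      curvature (fibreMetric (coneFamily A (bergmanFamily s) j)) z :=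
    curvature_congr_on (isOpen_zProd hs.isOpen_dom (h.isOpen j)) (fun y hy => by
      have h1 := h.fibreMetric_coneFamily hΦ hy.1 hy.2
      have hy' : Sum.elim (zFst y) (zSnd y) = y := Sum.elim_comp_inl_inr y
      rw [hy'] at h1
      exact h1.symm) hz
  have h2 : omegaG s (A j) z = ci • ddbarFun (coneFamily A (bergmanFamily s) j) z := by
    have : coneFamily A (bergmanFamily s) j = fun y => logNormSq
        (act (s.map fun a => y (Sum.inl a)) ((A j).map fun a => y (Sum.inr a))) := funext fun y =>
      add_sub_cancel _ _
    rw [this, omegaG]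
  have h3 : chernWeil χ s (A j) z =
      ci ^ (n + 1) • cwForm (hilbTerm χ n) (coneFamily A (bergmanFamily s) j) z := by
    rw [cwForm, ← chernForms_eq _ hn, ← h1, ← h2]
    rfl
  have h4 : pullback (fun y : ℂ^(Fin M ⊕ Fin n) => s.map fun a => y (Sum.inl a)) ψ z =
      frmFst (Fin M) (Fin n) (pullback s.map ψ (zFst z)) := by
    rw [← pullback_zFst]
    exact pullback_comp (q := s.map) Filter.EventuallyEq.rfl
      (contDiff_zFst.differentiable (by simp) z)
      (diffAt_of_contDiffOn hs.isOpen_dom hs.contDiffOn hz.1) ψ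
  rw [h3, h4, wedgeCLM_apply]
  have h5 : ((ci ^ (n + 1) • cwForm (hilbTerm χ n) (coneFamily A (bergmanFamily s) j) z :
      CFrm (Fin M ⊕ Fin n)) : Frm (Fin M ⊕ Fin n)) * frmFst (Fin M) (Fin n) (pullback s.map ψ (zFst z)) =
      ci ^ (n + 1) • ((cwForm (hilbTerm χ n) (coneFamily A (bergmanFamily s) j) z :
        Frm (Fin M ⊕ Fin n)) * frmFst (Fin M) (Fin n) (pullback s.map ψ (zFst z))) :=
    smul_mul_assoc _ _ _
  rw [h5, map_smul, smul_eq_mul]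

/-- The Chern-Weil form wedge a form on the base, as a density. -/
def chernDensity (c : ℕ → ℂ) (f : ℂ^(Fin M ⊕ Fin n) → ℝ) (θ : ℂ^(Fin M) → Frm (Fin M))
    (z : ℂ^(Fin M ⊕ Fin n)) : ℂ := wedgeCLM n (θ (zFst z)) (cwForm c f z)

theorem contDiffOn_chernDensity (c : ℕ → ℂ) {f : ℂ^(Fin M ⊕ Fin n) → ℝ}
    {θ : ℂ^(Fin M) → Frm (Fin M)} {V : Set ℂ^(Fin M)} {W : Set ℂ^(Fin n)}
    (hf : IsFamily f (zProd V W)) (hθ : SmoothOn θ V) :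
    SmoothOn (chernDensity c f θ) (zProd V W) := by
  have h1 : chernDensity c f θ = fun z => ∑ k, frmCoord (Fin M) k (θ (zFst z)) *
      wedgeCLM n (Module.finBasis ℂ (Frm (Fin M)) k) (cwForm c f z) := funext fun z => by
    rw [chernDensity, wedgeCLM_apply]
    conv_lhs => rw [← sum_frmCoord (θ (zFst z))]
    rw [map_sum, mul_sum, map_sum]
    refine sum_congr rfl fun k _ => ?_
    rw [map_smul, mul_smul_comm, map_smul]
    rfl
  rw [h1]
  exact ContDiffOn.sum fun k _ => ((contDiffOn_clm _ hθ).comp contDiff_zFst.contDiffOn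
    fun z hz => hz.1).mul (hf.contDiffOn_wedgeCLM_cwForm c _)

variable {B : ℕ → Param (Fin M) (MatIdx N)} {σ : ℕ → ℕ → ℂ^(Fin M) → ℂ^(Fin M)}
  (h : ProjSystem X A q τ cc)
  (hG : ChartSystem (fun i => (B i).dom) (fun i => (B i).map) σ)
  (hΦ : ∀ i, IsConeFamily X A (B i).dom (bergmanFamily (B i)))
include h hG hΦ

theorem chartChange_bergman (i i' j j' : ℕ) : ChartChange (zMap (σ i i') (τ j j'))
    (coneFamily A (bergmanFamily (B i')) j') (coneFamily A (bergmanFamily (B i)) j)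
    (fun z => Real.log (Complex.normSq (cc j j' (zSnd z)))) (zProd (B i').dom (A j').dom)
    (zProd (overlap (fun i => (B i).dom) (fun i => (B i).map) i i')
      (overlap (fun i => (A i).dom) q j j')) := by
  have F := fun i => h.potFamily (hΦ i)
  exact
  { family := h.isFamily (hΦ i') j'
    family' := (h.isFamily (hΦ i) j).mono (isOpen_zProd (hG.isOpen_overlap i i')
      (h.isOpen_overlap j j')) fun z hz => ⟨hz.1.1, hz.2.1⟩
    mapsTo := fun z hz => ⟨hG.mapsTo i i' _ hz.1, h.mapsTo j j' _ hz.2⟩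
    holomorphic := differentiableOn_zMap (hG.holomorphic i i') (h.holomorphic j j')
    surjective := fun z hz => (hG.prod h.toChartSystem).covPullback_surjective (i := (i, j))
      (j := (i', j'))
      ((Set.ext_iff.mp (overlap_prod (dom := fun i => (B i).dom) (q := fun i => (B i).map)
        (dom' := fun i => (A i).dom) (q' := q) (i, j) (i', j')) z).mpr hz)
    vertical := fun z hz a c => by
      rw [jac, fderiv_zMap (hG.differentiableAt hz.1) (h.toChartSystem.differentiableAt hz.2),
        Sum.elim_inl, zFst_single_inr, map_zero]
      rfl
    smooth := ((F i).smooth j j').comp contDiff_zSnd.contDiffOn fun z hz => hz.2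
    pluriharmonic := fun z hz a b =>
      (F i).pluriharmonic_zSnd h.toChartSystem ⟨hz.1.1, hz.2⟩ a b
    potential := fun z hz => by
      have h1 := (F i').potential j j' (zMap (σ i i') id z) (hG.mapsTo i i' _ hz.1) hz.2
      refine Eq.trans ?_ h1
      have h2 : bergmanFamily (B i) (zFst z) =
          bergmanFamily (B i') (zFst (zMap (σ i i') id z : ℂ^(Fin M ⊕ Fin n))) :=
        congrArg bergman (hG.compat i i' _ hz.1).symm
      change localPotential _ _ _ = localPotential _ _ _
      rw [h2]
      rfl }

theorem isDensity_chernDensity (c : ℕ → ℂ) {Ψ : ℕ → ℂ^(Fin M) → Frm (Fin M)}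
    (hΨ : ∀ i i', ∀ v ∈ overlap (fun i => (B i).dom) (fun i => (B i).map) i i',
      Ψ i v = pullback (σ i i') (Ψ i') v) :
    ChartSystem.IsDensity (fun p : ℕ × ℕ => zProd (B p.1).dom (A p.2).dom)
      (qProd (fun i => (B i).map) q) (fun p p' => zMap (σ p.1 p'.1) (τ p.2 p'.2))
      fun p => chernDensity c (coneFamily A (bergmanFamily (B p.1)) p.2) (Ψ p.1) := by
  rintro ⟨i, j⟩ ⟨i', j'⟩ z hz
  have hz' := hz
  rw [overlap_prod (dom := fun i => (B i).dom) (dom' := fun i => (A i).dom)] at hz'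
  have T := chartChange_bergman h hG hΦ i i' j j'
  have d1 := hG.differentiableAt hz'.1
  have d2 := h.toChartSystem.differentiableAt hz'.2
  change chernDensity c _ _ z = _ * chernDensity c _ _ _
  rw [chernDensity, wedgeCLM_apply, T.cwForm_eq c hz', coe_cmap, hΨ i i' _ hz'.1, pullback,
    ← map_zMap_frmFst d1 d2, ← map_mul, topCoeff_covPullback (differentiableAt_zMap d1 d2)]
  rfl

variable {Λ Λ' : Type} [Fintype Λ] [Fintype Λ'] {idx : Λ → ℕ} {μ : Λ → ℕ → ℂ^(Fin M) → ℝ}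
  {C : Λ → Set ℂ^(Fin M)} {K : Set ℂ^(MatIdx N)} {idx' : Λ' → ℕ}
  {ρ : Λ' → ℕ → ℂ^(Fin n) → ℝ} {C' : Λ' → Set ℂ^(Fin n)} {Q : ℕ → Set ℂ^(Fin M)}
  {Q' : ℕ → Set ℂ^(Fin n)}

/-- Fubini's theorem for the Chern-Weil forms. -/
theorem hasSum_integral_chernDensity
    (U : UnityPartition (fun i => (B i).dom) (fun i => (B i).map) σ idx μ C K)
    (U' : UnityPartition (fun i => (A i).dom) q τ idx' ρ C' Set.univ)
    (hQ : IsPartition (fun i => (B i).dom) (fun i => (B i).map) Q)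
    (hQ' : IsPartition (fun i => (A i).dom) q Q') (c : ℕ → ℂ)
    {Ψ : ℕ → ℂ^(Fin M) → Frm (Fin M)} (hs : ∀ i, SmoothOn (Ψ i) (B i).dom)
    (hΨ : ∀ i i', ∀ v ∈ overlap (fun i => (B i).dom) (fun i => (B i).map) i i',
      Ψ i v = pullback (σ i i') (Ψ i') v)
    (hK : ∀ i, ∀ v ∈ (B i).dom, (B i).map v ∉ K → Ψ i v = 0) :
    HasSum (fun p : ℕ × ℕ => ∫ z in zProd (Q p.1) (Q' p.2),
      chernDensity c (coneFamily A (bergmanFamily (B p.1)) p.2) (Ψ p.1) z)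
      (∑ k, ∫ v in (B (idx k)).dom, fibreChern idx' ρ (coneFamily A (bergmanFamily (B (idx k)))) c
        (Ψ (idx k) v) v * (μ k (idx k) v : ℂ)) := by
  have hD : ∀ i j, SmoothOn (chernDensity c (coneFamily A (bergmanFamily (B i)) j) (Ψ i))
      (zProd (B i).dom (A j).dom) := fun i j =>
    contDiffOn_chernDensity c (h.isFamily (hΦ i) j) (hs i)
  have key := (U.prod U').hasSum_integral (hG.prod h.toChartSystem) (hQ.prod hQ')
    (isDensity_chernDensity h hG hΦ c hΨ) (fun p => (hD p.1 p.2).continuousOn)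
    (fun p z hz hq => by
      have : (B p.1).map (zFst z) ∉ K := fun hc => hq ⟨hc, trivial⟩
      rw [chernDensity, hK _ _ hz.1 this, wedgeCLM_apply, map_zero, mul_zero, map_zero])
  refine (congrArg (HasSum _) ?_).mp key
  rw [Fintype.sum_prod_type]
  refine sum_congr rfl fun k _ => ?_
  have hfc : ∀ l, FibreCompact (fun z => (ρ l (idx' l) (zSnd z) : ℂ) *
      chernDensity c (coneFamily A (bergmanFamily (B (idx k))) (idx' l)) (Ψ (idx k)) z)
      (B (idx k)).dom (C' l) := fun l =>
    (U'.compactBump h.toChartSystem l).fibreCompact (hG.isOpen _) (hD _ _)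
  have hfib : ∀ v, fibreChern idx' ρ (coneFamily A (bergmanFamily (B (idx k)))) c (Ψ (idx k) v) v =
      ∑ l, fibreInt (fun z => (ρ l (idx' l) (zSnd z) : ℂ) *
        chernDensity c (coneFamily A (bergmanFamily (B (idx k))) (idx' l)) (Ψ (idx k)) z) v :=
    fun v => rfl
  simp only [hfib, sum_mul]
  refine Eq.trans ?_ (integral_finsetSum _ fun l _ => (U.compactBump hG k).integrableOn_mul
    (hfc l).contDiffOn_fibreInt.continuousOn).symm
  refine sum_congr rfl fun l _ => ?_
  have hb := (U.prod U').compactBump_mul (hG.prod h.toChartSystem) (k, l)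
    (hD (idx k) (idx' l))
  refine (integral_zProd (hb.integrableOn)).trans ?_
  refine setIntegral_congr_fun (hG.isOpen _).measurableSet fun v hv => ?_
  rw [setIntegral_eq_integral_of_forall_compl_eq_zero fun u hu => ?_, fibreInt, mul_comm,
    ← integral_const_mul]
  · refine integral_congr_ae (ae_of_all _ fun u => ?_)
    change (((μ k (idx k) v * ρ l (idx' l) u : ℝ)) : ℂ) * _ =
      (μ k (idx k) v : ℂ) * ((ρ l (idx' l) u : ℂ) * _)
    push_cast
    ring
  · have : ρ l (idx' l) u = 0 := U'.eq_zero h.toChartSystem fun hc => hu (U'.subset l hc)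
    change (((μ k (idx k) v * ρ l (idx' l) u : ℝ)) : ℂ) * _ = 0
    rw [this, mul_zero, Complex.ofReal_zero, zero_mul]

end ChernWeil

attribute [local instance] normedRingFrm normedAlgebraFrm normedCommRingCFrm normedAlgebraCFrm
  normedSpaceCFrm

/-- The complex Hessian of the energy on the group. -/
theorem integral_ddbarForm_energy {N n M : ℕ} (hn : 1 ≤ n) {X : Set (PSpace N)}
    (hX : IsProjAlgebraic X) {A : ℕ → Param (Fin n) (Fin (N + 1))} (hA : IsProjAtlas X A)
    (χ : Polynomial ℚ) {B : ℕ → Param (Fin M) (MatIdx N)} (hB : IsAtlas (SL N) B) (m : ℕ)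
    {F : ℂ^(MatIdx N) → ℂ} (hF : ∀ σ ∈ SL N, IsHigherEnergy X A χ 2 m (bergman σ) (F σ))
    {ψ : ℂ^(MatIdx N) → Frm (MatIdx N)} (hψ : IsTestForm B ψ) :
    -ci * integral B (fun i v => F ((B i).map v) • ddbarForm (pullback (B i).map ψ) v) =
      integralProd B A (fun i j z => (chernWeil χ (B i) (A j) z : Frm (Fin M ⊕ Fin n)) *
        pullback (fun y : ℂ^(Fin M ⊕ Fin n) => (B i).map fun a => y (Sum.inl a)) ψ z) := by
  obtain ⟨K, hK, hKS, hKψ⟩ := hψ.compactSupport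
  have hG := chartSystem_atlas hB.chart
  have h := projSystem_projAtlas hA.chart
  have hP := isPartition_projPiece hA.chart
  have hQ := hG.isPartition_piece
  obtain ⟨L', idx', ρ, C', U'⟩ := exists_unityPartition_projAtlas hX hA
  obtain ⟨L, idx, μ, C, U⟩ := (embeddedSystem_atlas hB.chart).exists_unityPartition hK
    fun σ hσ => hB.cover σ (hKS hσ)
  have hF' : ∀ σ ∈ SL N, ∃ φ, IsPath X A φ (bergman σ) := fun σ hσ =>
    (hF σ hσ).imp fun φ hφ => hφ.1
  have hΦ := fun i => isConeFamily_bergman h (hB.chart i) hF'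
  have hs : ∀ i, SmoothOn (pullback (B i).map ψ) (B i).dom := fun i =>
    contDiffOn_of_smoothFormOn (hψ.smooth i)
  have hΨ : ∀ i j, ∀ u ∈ overlap (fun i => (B i).dom) (fun i => (B i).map) i j,
      pullback (B i).map ψ u = pullback (transMap (fun i => (B i).dom) (fun i => (B i).map) i j)
        (pullback (B j).map ψ) u := fun i j u hu =>
    pullback_comp (Filter.eventuallyEq_of_mem ((hG.isOpen_overlap i j).mem_nhds hu)
        fun y hy => (hG.compat i j y hy).symm)
      ((hG.differentiableAt hu).restrictScalars ℝ)
      (diffAt_of_contDiffOn (hB.chart j).isOpen_dom (hB.chart j).contDiffOn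
        (hG.mapsTo i j u hu)) ψ
  have h1 := U.hasSum_integral_ddbarForm (E := fun i v => F ((B i).map v)) hG hQ
    (fun i => (hB.chart i).holomorphic.continuousOn)
    (fun i => contDiffOn_energy h (hB.chart i) hF' hP U' hn hF)
    (fun i j u hu => congrArg F (hG.compat i j u hu).symm) hs hΨ hKψ
  have h2 := hasSum_integral_chernDensity h hG hΦ U U' hQ hP (hilbTerm χ n) hs hΨ hKψ
  have h3 : integral B (fun i v => F ((B i).map v) • ddbarForm (pullback (B i).map ψ) v) =
      -(ci ^ n * ∑ k, ∫ v in (B (idx k)).dom,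
        fibreChern idx' ρ (coneFamily A (bergmanFamily (B (idx k)))) (hilbTerm χ n)
          (pullback (B (idx k)).map ψ v) v * (μ k (idx k) v : ℂ)) := by
    rw [integral]
    refine (tsum_congr fun i => integral_congr_ae (ae_of_all _ fun v => ?_)).trans
      (h1.tsum_eq.trans ?_)
    · exact map_smul _ _ _
    · rw [mul_sum, ← sum_neg_distrib]
      refine sum_congr rfl fun k _ => ?_
      rw [← integral_const_mul, ← integral_neg]
      refine setIntegral_congr_fun (hG.isOpen _).measurableSet fun v hv => ?_
      rw [sum_wd_energy h (hB.chart (idx k)) hF' hP U' hn hF _ hv]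
      ring
  have h4 : integralProd B A (fun i j z => (chernWeil χ (B i) (A j) z : Frm (Fin M ⊕ Fin n)) *
        pullback (fun y : ℂ^(Fin M ⊕ Fin n) => (B i).map fun a => y (Sum.inl a)) ψ z) =
      ci ^ (n + 1) * ∑ k, ∫ v in (B (idx k)).dom,
        fibreChern idx' ρ (coneFamily A (bergmanFamily (B (idx k)))) (hilbTerm χ n)
          (pullback (B (idx k)).map ψ v) v * (μ k (idx k) v : ℂ) := by
    rw [← h2.tsum_eq, ← tsum_mul_left, integralProd]
    refine tsum_congr fun p => ?_
    rw [← integral_const_mul]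
    refine setIntegral_congr_fun ((hQ.prod hP).measurableSet p) fun z hz => ?_
    exact h.topCoeff_chernWeil (hB.chart p.1) (hΦ p.1) χ hn ψ ⟨hz.1.1, hz.2.1⟩
  rw [h3, h4]
  ring

end HigherEnergy
end

theorem lemma2 (N n : ℕ) (hn : 1 ≤ n)
    (X : Set (HigherEnergy.PSpace N)) (hX : HigherEnergy.IsProjAlgebraic X)
    (A : ℕ → HigherEnergy.Param (Fin n) (Fin (N + 1))) (hA : HigherEnergy.IsProjAtlas X A)
    (χ : Polynomial ℚ) (hχ : HigherEnergy.IsHilbertPolynomial X χ)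
    (B : ℕ → HigherEnergy.Param (Fin ((N + 1) ^ 2 - 1)) (HigherEnergy.MatIdx N))
    (hB : HigherEnergy.IsAtlas (HigherEnergy.SL N) B)
    (m : ℕ) (F : (HigherEnergy.MatIdx N → ℂ) → ℂ)
    (hF : ∀ σ ∈ HigherEnergy.SL N,
      HigherEnergy.IsHigherEnergy X A χ 2 m (HigherEnergy.bergman σ) (F σ))
    (ψ : (HigherEnergy.MatIdx N → ℂ) → HigherEnergy.Frm (HigherEnergy.MatIdx N))
    (hψ : HigherEnergy.IsTestForm B ψ) :
    -HigherEnergy.ci * HigherEnergy.integral B (fun i v =>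
        F ((B i).map v) •
          HigherEnergy.ddbarForm (HigherEnergy.pullback (B i).map ψ) v) =
      HigherEnergy.integralProd B A (fun i j z =>
        (HigherEnergy.chernWeil χ (B i) (A j) z :
            HigherEnergy.Frm (Fin ((N + 1) ^ 2 - 1) ⊕ Fin n)) *
          HigherEnergy.pullback
            (fun y : Fin ((N + 1) ^ 2 - 1) ⊕ Fin n → ℂ => (B i).map fun a => y (Sum.inl a))
            ψ z) :=
  HigherEnergy.integral_ddbarForm_energy hn hX hA χ hB m hF hψ
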